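/- **Notation.** For $\tau\in\mathbb H$, $z\in\mathbb C$ put $q=e^{2\pi i\tau}$, $\zeta=e^{2\pi iz}$, $\tau_2=\operatorname{Im}\tau$, $z_2=\operatorname{Im}z$, $(a;q)_\infty=\prod_{n\ge0}(1-aq^n)$, $\eta(\tau)=q^{1/24}\prod_{n\ge1}(1-q^n)$, and (rational powers of $q,\zeta$ meaning $q^r=e^{2\pi ir\tau}$, $\zeta^r=e^{2\pi irz}$) $$\mathcal C^*(z;\tau)=\frac{q^{-1/24}(q;q)_\infty}{(\zeta q;q)_\infty(\zeta^{-1}q;q)_\infty},\qquad \psi(z;\tau)=i\sum_{m\in\mathbb Z+\frac12}\operatorname{sgn}\Big(m+\frac{z_2}{\tau_2}\Big)(-1)^{m-\frac12}q^{\frac{m^2}{2}}\zeta^m,$$ $$\mathcal V_1(z;\tau)=-q^{\frac1{12}}\zeta^{-\frac12}\,\frac{\mathcal C^*(z;\tau)}{\eta(\tau)}\,\psi\big(3z-\tau+\tfrac12;6\tau\big).$$ Complex powers are principal. For a matrix in $\mathrm{SL}_2(\mathbb Z)$ let, with the Kronecker symbol, $$\chi\begin{pmatrix}a&b\\c&d\end{pmatrix}=\begin{cases}\left(\frac{d}{|c|}\right)e^{\frac{\pi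 i}{12}((a+d)c-bd(c^2-1)-3c)}&c\text{ odd},\\ \left(\frac cd\right)e^{\frac{\pi i}{12}(ac(1-d^2)+d(b-c+3)-3)}&c\text{ even}.\end{cases}$$ For integers $k\ge1$ and $h$ with $\gcd(h,k)=1$ let $0\le[-h]_k<k$ with $-h[-h]_k\equiv1\pmod k$, and write $g=\gcd(k,6)$, $K=k/g$, $H=6h/g$, $\alpha=\alpha_{H,K}=\frac K2-\frac H6$, $$\chi_{h,k}=\chi\begin{pmatrix}[-h]_k&-\frac{h[-h]_k+1}{k}\\k&-h\end{pmatrix}^{2}\chi\begin{pmatrix}[-H]_K&-\frac{H[-H]_K+1}{K}\\K&-H\end{pmatrix}^{-3}.$$ With $B_n(x)$ the Bernoulli polynomials let $$\kappa(a,b,c)=\frac{(2(a+b+c))!\,(-1)^{a+c}B_{2c}(\frac12)}{a!\,(2b+1)!\,(2c)!\,\pi^a4^{a+b}},\qquad C_j(w)=\Big(\frac1{2\pi i}\frac{\partial}{\partial w}\Big)^j\cot(\pi w).$$ For $0\le\nu\le6K-1$, $0\le\varrho<g$ let $\delta_{k,\varrho,\nu}=1$ if $|6kr+g(\nu+\frac12)-\frac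 k2+\varrho|\le1$ for some $r\in\mathbb Z$ and $\delta_{k,\varrho,\nu}=0$ otherwise; if $\delta_{k,\varrho,\nu}=1$ let $\gamma_{k,\varrho,\nu}\in\{1,-1,0\}$ be determined by $g(\nu+\frac12)\equiv\frac k2-\varrho-\gamma_{k,\varrho,\nu}\pmod{6k}$ (its value is irrelevant if $\delta_{k,\varrho,\nu}=0$). Let $\varepsilon^\pm_{k,\varrho}=1$ if $\varrho\equiv\pm1\pmod{\gcd(k,3)}$ and $\gcd(k,12)\in\{1,2,3,6\}$, and $\varepsilon^\pm_{k,\varrho}=0$ otherwise. **Theorem.** Let $\ell\ge0$ be even and let $A>0$. Then there is a constant, depending only on $\ell$ and $A$, such that for all integers $k\ge1$ and $h$ with $\gcd(h,k)=1$, written as $h=g\mu+\varrho$ with $\mu\in\mathbb Z$, $0\le\varrho<g$, and all $Z\in\mathbb C$ with $\operatorname{Re}(\frac1Z)\ge\frac k2$ and $|Z|\le\frac Ak$, the following holds with that implied constant: $$\begin{aligned}\Big[\frac{\partial^\ell}{\partial z^\ell}&\mathcal V_1\Big(z;\frac hk+\frac{iZ}k\Big)\Big]_{z=0}=(2\pi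 i)^\ell\,\frac{i^{\frac12}e^{\frac{\pi i}{6k}(k-h-[-h]_k-g)}\sqrt g}{6\sqrt6\,k}\,\chi_{h,k}\sum_{\nu=0}^{6K-1}(-1)^{\nu+\mu}e^{\pi i\left(\frac{\mu-\nu}{3K}+\frac{[-H]_K}{K}(\nu-\mu+\frac12)^2\right)}\\&\times\sum_{j=0}^{\ell/2}\binom\ell{2j}\sum_{\substack{a,b,c\ge0\\a+b+c=j}}k^a\kappa(a,b,c)Z^{\frac12-a-2c}2^{2j-\ell}\int_{-1}^1e^{\frac{\pi}{6kZ}(1-x^2)}\\&\times\left(C_{\ell-2j}\Big(\tfrac1{6k}\big(x-g(\nu+\tfrac12)+\tfrac k2-\varrho\big)\Big)-\delta_{k,\varrho,\nu}(-1)^{\frac\ell2+j}\,2(\ell-2j)!\Big(\tfrac{3k}{\pi(x+\gamma_{k,\varrho,\nu})}\Big)^{\ell-2j+1}\right)dx\\&+(2\pi i)^\ell i^{-\frac12}\sum_\pm\varepsilon^\pm_{k,\varrho}(-1)^{\alpha\pm\frac1g+\frac12}e^{\pi i\left(-\frac{[-h]_k}{6k}+\frac{[-H]_K}{K}(\alpha\pm\frac1g)^2+\frac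 H{36K}\mp\frac1{3gK}\right)}\sqrt g\,\chi_{h,k}\,\Big(e^{\frac\pi{6kZ}}S_1^\pm\mp i\,S_2^\pm\int_0^1e^{\frac{\pi t^2}{6kZ}}dt\Big)\\&+O\big(\log(k+1)\,|Z|^{\frac12-\ell}\big),\end{aligned}$$ where $$S_1^\pm=\sum_{\substack{j_1,j_3\ge0,\ j_2\ge1\\2j_1+j_2+j_3=\ell}}\ \sum_{\substack{a,b,c\ge0\\a+b+c=j_1}}\ \sum_{0\le j_4\le\frac{j_2-1}2}\frac{\ell!\,3^{j_4}k^{a+\frac12+j_4}\,\kappa(a,b,c)(-1)^a(\pm i)^{j_2+1}(\mp i)^{j_3}}{(2j_1)!\,j_2\,j_3!\,j_4!\,(j_2-1-2j_4)!\,2^{\ell+a-2j_1+j_4}\pi^{j_4+1}}Z^{1-a-2c-j_2-j_3+j_4},$$ $$S_2^\pm=\sum_{\substack{j_1,j_3\ge0\\2j_1+j_3=\ell}}\binom\ell{2j_1}\sum_{\substack{a,b,c\ge0\\a+b+c=j_1}}\kappa(a,b,c)\frac{k^{a-\frac12}(-1)^{a+1}}{3\cdot2^{a+j_3}}(\pm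 i)^{j_3}Z^{-a-2c-j_3}.$$ (The integrand of the integral over $[-1,1]$ has only removable singularities.) -/

import Mathlib

open Complex

/-- `[-h]_k`: for `gcd(h, k) = 1` the integer `0 ≤ x < k` with `-h x ≡ 1 (mod k)`. -/
def negInv (h : ℤ) (k : ℕ) : ℕ := ((-(h : ZMod k))⁻¹ : ZMod k).val

theorem negInv_spec (h : ℤ) (k : ℕ) (hk : 0 < k) (hhk : Int.gcd h k = 1) :
    negInv h k < k ∧ -h * (negInv h k : ℤ) ≡ 1 [ZMOD k] := by
  have : NeZero k := ⟨hk.ne'⟩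
  refine ⟨ZMod.val_lt _, ?_⟩
  rw [← ZMod.intCast_eq_intCast_iff]
  have hu : IsUnit ((-h : ℤ) : ZMod k) := by
    rw [ZMod.coe_int_isUnit_iff_isCoprime]
    have : IsCoprime h (k : ℤ) := Int.isCoprime_iff_gcd_eq_one.mpr hhk
    exact (this.neg_left).symm
  have h1 := ZMod.mul_inv_of_unit _ hu
  push_cast at h1 ⊢
  rw [negInv, ZMod.natCast_zmod_val]
  exact h1

/-- The Kronecker symbol `(a / n)` for all integers `a`, `n`. -/
def kroneckerSymbol (a n : ℤ) : ℤ :=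
  if n = 0 then (if a.natAbs = 1 then 1 else 0)
  else (if n < 0 ∧ a < 0 then -1 else 1)
    * (ZMod.χ₈ (a : ZMod 8)) ^ (padicValNat 2 n.natAbs)
    * jacobiSym a (n.natAbs / 2 ^ (padicValNat 2 n.natAbs))

/-- The multiplier `χ` of the Dedekind eta function at the matrix with rows `(a, b)`, `(c, d)`. -/
noncomputable def etaMultiplier (a b c d : ℤ) : ℂ :=
  if Odd c then
    (kroneckerSymbol d |c| : ℂ)
      * cexp (Real.pi * I / 12 * ((a + d) * c - b * d * (c ^ 2 - 1) - 3 * c))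
  else
    (kroneckerSymbol c d : ℂ)
      * cexp (Real.pi * I / 12 * (a * c * (1 - d ^ 2) + d * (b - c + 3) - 3))

/-- `χ` at the matrix with rows `([-h]_k, -(h [-h]_k + 1) / k)`, `(k, -h)`;
the division is exact when `gcd(h, k) = 1`. -/
noncomputable def etaMultiplierAt (h : ℤ) (k : ℕ) : ℂ :=
  etaMultiplier (negInv h k) (-((h * negInv h k + 1) / k)) k (-h)

/-- `K = k / gcd(k, 6)`. -/
def bigK (k : ℕ) : ℕ := k / Nat.gcd k 6

/-- `H = 6 h / gcd(k, 6)`, an integer since `gcd(k, 6)` divides `6`. -/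
def bigH (h : ℤ) (k : ℕ) : ℤ := 6 * h / (Nat.gcd k 6 : ℤ)

/-- `α_{H,K} = K / 2 - H / 6`. -/
noncomputable def alphaHK (h : ℤ) (k : ℕ) : ℝ := (bigK k : ℝ) / 2 - (bigH h k : ℝ) / 6

/-- `χ_{h,k}`: the square of the multiplier for `(h, k)` over the cube of that for `(H, K)`. -/
noncomputable def chiHK (h : ℤ) (k : ℕ) : ℂ :=
  etaMultiplierAt h k ^ 2 / etaMultiplierAt (bigH h k) (bigK k) ^ 3

/-- `(a; q)_∞`. -/
noncomputable def qPochInf (a q : ℂ) : ℂ := ∏' n : ℕ, (1 - a * q ^ n)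

/-- The crank generating function `C(ζ; q)`. -/
noncomputable def crankGen (ζ q : ℂ) : ℂ :=
  qPochInf q q / (qPochInf (ζ * q) q * qPochInf (ζ⁻¹ * q) q)

/-- `C*(z; τ) = q^{-1/24} C(ζ; q)`, with `q = e^{2πiτ}` and `ζ = e^{2πiz}`. -/
noncomputable def crankStar (z τ : ℂ) : ℂ :=
  cexp (-(2 * Real.pi * I * τ / 24))
    * crankGen (cexp (2 * Real.pi * I * z)) (cexp (2 * Real.pi * I * τ))

/-- The false theta function `ψ(z; τ)`; the summation index `m ∈ ℤ + 1/2` is `n + 1/2`, `n ∈ ℤ`. -/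
noncomputable def falseTheta (z τ : ℂ) : ℂ :=
  I * ∑' n : ℤ, (Real.sign ((n : ℝ) + 1 / 2 + z.im / τ.im) : ℂ) * (-1 : ℂ) ^ n
    * cexp (2 * Real.pi * I * τ * ((n : ℂ) + 1 / 2) ^ 2 / 2)
    * cexp (2 * Real.pi * I * z * ((n : ℂ) + 1 / 2))

/-- `𝒱₁(z; τ) = -q^{1/12} ζ^{-1/2} C*(z; τ) / η(τ) · ψ(3z - τ + 1/2; 6τ)`. -/
noncomputable def calV1 (z τ : ℂ) : ℂ :=
  -(cexp (2 * Real.pi * I * τ / 12)) * cexp (-(2 * Real.pi * I * z / 2))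
    * (crankStar z τ / ModularForm.eta τ) * falseTheta (3 * z - τ + 1 / 2) (6 * τ)

/-- `κ(a, b, c)`, with the Bernoulli polynomial `B_{2c}` evaluated at `1/2`. -/
noncomputable def kappa (a b c : ℕ) : ℝ :=
  ((2 * (a + b + c)).factorial : ℝ) * (-1) ^ (a + c)
      * (((Polynomial.bernoulli (2 * c)).eval (1 / 2 : ℚ) : ℚ) : ℝ)
    / ((a.factorial : ℝ) * ((2 * b + 1).factorial : ℝ) * ((2 * c).factorial : ℝ)
      * Real.pi ^ a * 4 ^ (a + b))

/-- `C_j(w) = ((1 / 2πi) ∂/∂w)^j cot(πw)`. -/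
noncomputable def cotC (j : ℕ) (w : ℂ) : ℂ :=
  (1 / (2 * Real.pi * I)) ^ j * iteratedDeriv j (fun u : ℂ => Complex.cot (Real.pi * u)) w

open Classical in
/-- `γ_{k,ϱ,ν} ∈ {1, -1, 0}`, according to `gcd(k,6)(ν + 1/2)` modulo `6k`. It is only used
multiplied by `δ_{k,ϱ,ν}`, which vanishes outside these three residue classes. -/
noncomputable def gammaInd (k ϱ ν : ℕ) : ℤ :=
  if ((Nat.gcd k 6 : ℚ) * (ν + 1 / 2)) ≡ (k : ℚ) / 2 - ϱ - 1 [PMOD (6 * k : ℚ)] then 1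
  else if ((Nat.gcd k 6 : ℚ) * (ν + 1 / 2)) ≡ (k : ℚ) / 2 - ϱ + 1 [PMOD (6 * k : ℚ)] then -1
  else 0

open Classical in
/-- `δ_{k,ϱ,ν} ∈ {0, 1}`. -/
noncomputable def deltaInd (k ϱ ν : ℕ) : ℕ :=
  if ∃ r : ℤ, |6 * (k : ℚ) * r + (Nat.gcd k 6 : ℚ) * (ν + 1 / 2) - (k : ℚ) / 2 + ϱ| ≤ 1
  then 1 else 0

/-- `ε^±_{k,ϱ} ∈ {0, 1}`; the sign `±` is `s = ±1`. -/
def epsInd (s : ℤ) (k ϱ : ℕ) : ℕ :=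
  if (ϱ : ℤ) ≡ s [ZMOD (Nat.gcd k 3 : ℤ)] ∧ Nat.gcd k 12 ∈ ({1, 2, 3, 6} : Finset ℕ) then 1 else 0

/-- The part of the main term with the integral of the cotangent minus its pole correction, for
`h = gcd(k,6) μ + ϱ`. The triple `t` is `(a, b, c)` with `a + b + c = j`. -/
noncomputable def cotPart (l k : ℕ) (h μ : ℤ) (ϱ : ℕ) (Z : ℂ) : ℂ :=
  (2 * Real.pi * I) ^ l
    * (I ^ (1 / 2 : ℂ)
        * cexp (Real.pi * I / (6 * k) * ((k : ℂ) - h - negInv h k - Nat.gcd k 6))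
        * (Real.sqrt (Nat.gcd k 6) : ℂ) / (6 * (Real.sqrt 6 : ℂ) * k))
    * chiHK h k
    * ∑ ν ∈ Finset.range (6 * bigK k),
        (-1 : ℂ) ^ ((ν : ℤ) + μ)
        * cexp (Real.pi * I * (((μ : ℂ) - ν) / (3 * bigK k)
            + (negInv (bigH h k) (bigK k) : ℂ) / bigK k * ((ν : ℂ) - μ + 1 / 2) ^ 2))
        * ∑ j ∈ Finset.range (l / 2 + 1), (l.choose (2 * j) : ℂ)
          * ∑ t ∈ Finset.Nat.antidiagonalTuple 3 j,
              (k : ℂ) ^ (t 0) * (kappa (t 0) (t 1) (t 2) : ℂ)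
              * Z ^ ((1 / 2 : ℂ) - (t 0 : ℂ) - 2 * (t 2 : ℂ))
              * (2 : ℂ) ^ (2 * (j : ℤ) - (l : ℤ))
              * ∫ x in (-1 : ℝ)..1,
                  cexp (Real.pi / (6 * k * Z) * (1 - (x : ℂ) ^ 2))
                  * (cotC (l - 2 * j) (1 / (6 * (k : ℂ))
                        * ((x : ℂ) - (Nat.gcd k 6 : ℂ) * ((ν : ℂ) + 1 / 2) + (k : ℂ) / 2 - ϱ))
                      - (deltaInd k ϱ ν : ℂ) * (-1) ^ (l / 2 + j) * 2
                        * ((l - 2 * j).factorial : ℂ)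
                        * (3 * k / (Real.pi * ((x : ℂ) + gammaInd k ϱ ν))) ^ (l - 2 * j + 1))

/-- The finite sum multiplying `e^{π/(6kZ)}` in the part coming from the error function. Here
`p = (j₂, j₃)` and `t = (a, b, c)`, with `2j₁ + j₂ + j₃ = ℓ`, `j₂ ≥ 1`, `a + b + c = j₁`. -/
noncomputable def erfExpSum (s : ℤ) (l k : ℕ) (Z : ℂ) : ℂ :=
  ∑ j₁ ∈ Finset.range (l / 2 + 1),
    ∑ p ∈ (Finset.HasAntidiagonal.antidiagonal (l - 2 * j₁)).filter (fun p => 1 ≤ p.1),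
      ∑ t ∈ Finset.Nat.antidiagonalTuple 3 j₁,
        ∑ j₄ ∈ Finset.range ((p.1 - 1) / 2 + 1),
          (l.factorial : ℂ) * 3 ^ j₄ * (((k : ℝ) ^ ((t 0 : ℝ) + 1 / 2 + (j₄ : ℝ)) : ℝ) : ℂ)
            / (((2 * j₁).factorial : ℂ) * (p.1 : ℂ) * (p.2.factorial : ℂ) * (j₄.factorial : ℂ)
              * ((p.1 - 1 - 2 * j₄).factorial : ℂ)
              * (2 : ℂ) ^ ((l : ℤ) + (t 0 : ℤ) - 2 * (j₁ : ℤ) + (j₄ : ℤ))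
              * (Real.pi : ℂ) ^ (j₄ + 1))
          * (kappa (t 0) (t 1) (t 2) : ℂ) * (-1) ^ (t 0)
          * ((s : ℂ) * I) ^ (p.1 + 1) * (-(s : ℂ) * I) ^ p.2
          * Z ^ ((1 : ℤ) - (t 0 : ℤ) - 2 * (t 2 : ℤ) - (p.1 : ℤ) - (p.2 : ℤ) + (j₄ : ℤ))

/-- The finite sum multiplying `∫₀¹ e^{πt²/(6kZ)} dt` in the part coming from the error function.
Here `t = (a, b, c)` and `j₃ = ℓ - 2j₁`, with `a + b + c = j₁`. -/
noncomputable def erfIntSum (s : ℤ) (l k : ℕ) (Z : ℂ) : ℂ :=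
  ∑ j₁ ∈ Finset.range (l / 2 + 1),
    ∑ t ∈ Finset.Nat.antidiagonalTuple 3 j₁,
      (l.choose (2 * j₁) : ℂ) * (kappa (t 0) (t 1) (t 2) : ℂ)
        * ((((k : ℝ) ^ ((t 0 : ℝ) - 1 / 2) : ℝ) : ℂ) * (-1) ^ (t 0 + 1)
            / (3 * 2 ^ (t 0 + (l - 2 * j₁))))
        * ((s : ℂ) * I) ^ (l - 2 * j₁)
        * Z ^ (-(t 0 : ℤ) - 2 * (t 2 : ℤ) - ((l - 2 * j₁ : ℕ) : ℤ))

/-- The part of the main term coming from the error function, for `h ≡ ϱ (mod gcd(k,6))`. The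
exponent of `-1` is an integer whenever `ε^±_{k,ϱ} = 1`. -/
noncomputable def erfPart (l k : ℕ) (h : ℤ) (ϱ : ℕ) (Z : ℂ) : ℂ :=
  (2 * Real.pi * I) ^ l * I ^ (-(1 / 2) : ℂ)
    * ∑ s ∈ ({1, -1} : Finset ℤ), (epsInd s k ϱ : ℂ)
      * (-1 : ℂ) ^ ((alphaHK h k : ℂ) + (s : ℂ) / Nat.gcd k 6 + 1 / 2)
      * cexp (Real.pi * I * (-(negInv h k : ℂ) / (6 * k)
          + (negInv (bigH h k) (bigK k) : ℂ) / bigK k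
              * ((alphaHK h k : ℂ) + (s : ℂ) / Nat.gcd k 6) ^ 2
          + (bigH h k : ℂ) / (36 * bigK k) - (s : ℂ) / (3 * Nat.gcd k 6 * bigK k)))
      * (Real.sqrt (Nat.gcd k 6) : ℂ) * chiHK h k
      * (cexp (Real.pi / (6 * k * Z)) * erfExpSum s l k Z
          - (s : ℂ) * I * (∫ x in (0 : ℝ)..1, cexp (Real.pi * (x : ℂ) ^ 2 / (6 * k * Z)))
              * erfIntSum s l k Z)

/-! Near z = 0 the function `calV1` is q^{-1/12} / `crankDenom` times a sum over m in ℤ + 1/3 of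
sgn(m) times a Gaussian (`calV1_eventuallyEq`). The first factor is modular: sin(πz) times
`crankDenom` is a multiple of the odd Jacobi theta function (`sin_mul_crankDenom`), and a Euclidean
descent gives the exact multiplier (`IsThetaLike.transformsUnder`). At the cusp h/k this factor is
e^β, with β = π/(6kZ), times an elementary function of z and Z, times 1 + O(e^{-12 Re β})
(`crankDenom_cusp`).

The sign destroys modularity of the second factor, but two devices replace it. First, the phase
e^{6πi(h/k)m²} is a finite Fourier sum with K frequencies and coefficients of modulus K^{-1/2}; the
Gauss sums involved are read off from the theta transformation itself (`gauss_sum_theta`,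
`quadratic_phase_expansion`). Secondly, sgn(m) e^{-πam²} is m times an integral of Gaussians over a
parameter s in (0, 1) (`integral_inverse_gaussian`). Theta inversion under this integral turns the
signed sum into a lattice sum of error-function kernels `errKernel` at the points 3kz - p with p an
integer (`signedGaussSum_eq`).

Multiplied by e^β √(π/β), the kernel at a point P far from [-1, 1] is the Cauchy integral of
e^{β(1-x²)} / (P - x) over [-1, 1], plus c(β)/P, plus O(|P|^{-2})
(`exists_norm_errKernelDiff_sub_le`). Over a lattice of spacing 6k, summed in symmetric pairs, the
Cauchy kernels add up to a cotangent and the terms c(β)/P nearly cancel. Only the points p = 0, 1,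
-1 are too close to the interval. There the kernel is kept as it stands and the rest of its lattice
gives a cotangent without its pole: hence the δ-correction in the first main term. The points ±1
produce the error-function part; p = 0 drops out by parity, because ℓ is even.

Each p contributes an error O(1 / max(1, |p|)) with weight K^{-1/2}. The points p are distinct and
of size O(k), so the sum of these is logarithmic, and the error is O(log(k+1) |Z|^{1/2}) uniformly
for 0 < |z| ≤ |Z|/100 (`exists_norm_cuspFun_sub_mainFun_le`). Cauchy's estimate on a circle of
radius |Z|/200 then costs |Z|^{-ℓ}. What remains is exact algebra: the ℓ-th derivative of the main
term at 0 (`CuspRange.iteratedDeriv_mainFun`), in which κ(a, b, c) collects the Taylor coefficients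
of a Gaussian, of sin w / w and of w / sinh w. -/

/-! ### The eta multiplier under translation and inversion. -/

/-- The 24th roots of unity `e^{πin/12}`. -/
noncomputable def root24 (n : ℤ) : ℂ := cexp (Real.pi * I / 12 * n)

lemma root24_add (m n : ℤ) : root24 (m + n) = root24 m * root24 n := by
  rw [root24, root24, root24, ← Complex.exp_add]; congr 1; push_cast; ring

lemma root24_zero : root24 0 = 1 := by simp [root24]

lemma root24_mul_nat (n : ℤ) (r : ℕ) : root24 (r * n) = root24 n ^ r := by
  rw [root24, root24, ← Complex.exp_nat_mul]; congr 1; push_cast; ring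

lemma root24_of_dvd {n : ℤ} (h : 24 ∣ n) : root24 n = 1 := by
  obtain ⟨m, rfl⟩ := h
  rw [root24, Complex.exp_eq_one_iff]
  exact ⟨m, by push_cast; ring⟩

lemma root24_congr {m n : ℤ} (h : 24 ∣ m - n) : root24 m = root24 n := by
  have : m = n + (m - n) := by ring
  rw [this, root24_add, root24_of_dvd h, mul_one]

lemma root24_twelve_mul (n : ℕ) : root24 (12 * n) = (-1) ^ n := by
  have h1 : root24 12 = -1 := by
    rw [root24, ← Complex.exp_pi_mul_I]; congr 1; push_cast; ring
  rw [mul_comm, root24_mul_nat, h1]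

lemma norm_root24 (n : ℤ) : ‖root24 n‖ = 1 := by
  rw [root24, show (Real.pi * I / 12 * n : ℂ) = ((Real.pi / 12 * n : ℝ) : ℂ) * I by push_cast; ring,
    Complex.norm_exp_ofReal_mul_I]

lemma padicValNat_two_of_odd {n : ℕ} (h : Odd n) : padicValNat 2 n = 0 :=
  padicValNat.eq_zero_of_not_dvd (by rcases h with ⟨m, rfl⟩; omega)

lemma kroneckerSymbol_of_odd (a : ℤ) {n : ℤ} (h : Odd n) (hs : 0 < a ∨ 0 < n) :
    kroneckerSymbol a n = jacobiSym a n.natAbs := by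
  have hn : n ≠ 0 := by rintro rfl; simp at h
  have h2 : ¬ (n < 0 ∧ a < 0) := by omega
  rw [kroneckerSymbol, if_neg hn, if_neg h2, padicValNat_two_of_odd (Int.natAbs_odd.mpr h)]
  simp

lemma etaMultiplier_of_odd (a b d : ℤ) {c : ℤ} (hc : Odd c) (h0 : 0 < c) :
    etaMultiplier a b c d = (jacobiSym d c.natAbs : ℂ)
      * root24 ((a + d) * c - b * d * (c ^ 2 - 1) - 3 * c) := by
  rw [etaMultiplier, if_pos hc, abs_of_pos h0, kroneckerSymbol_of_odd d hc (Or.inr h0), root24]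
  push_cast; rfl

lemma etaMultiplier_of_even (a b : ℤ) {c d : ℤ} (hc : Even c) (h0 : 0 < c) (hd : Odd d) :
    etaMultiplier a b c d = (jacobiSym c d.natAbs : ℂ)
      * root24 (a * c * (1 - d ^ 2) + d * (b - c + 3) - 3) := by
  rw [etaMultiplier, if_neg (Int.not_odd_iff_even.mpr hc), kroneckerSymbol_of_odd c hd (Or.inl h0),
    root24]
  push_cast; rfl

lemma etaMultiplier_one (a b d : ℤ) : etaMultiplier a b 1 d = root24 (a + d - 3) := by
  rw [etaMultiplier_of_odd a b d odd_one one_pos]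
  simp

lemma dvd_24_cube_sub_self {c : ℤ} (hc : Odd c) : (24 : ℤ) ∣ c * (c ^ 2 - 1) := by
  obtain ⟨x, rfl⟩ := hc
  have h8 : (8 : ℤ) ∣ (2 * x + 1) * ((2 * x + 1) ^ 2 - 1) := by
    obtain ⟨y, hy⟩ := Int.even_mul_succ_self x
    exact ⟨(2 * x + 1) * y, by linear_combination 4 * (2 * x + 1) * hy⟩
  have h3 : (3 : ℤ) ∣ (2 * x + 1) * ((2 * x + 1) ^ 2 - 1) := by
    have key : ∀ x : ZMod 3, (2 * x + 1) * ((2 * x + 1) ^ 2 - 1) = 0 := by decide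
    have := key x
    exact_mod_cast (ZMod.intCast_zmod_eq_zero_iff_dvd _ 3).mp (by exact_mod_cast this)
  have := IsCoprime.mul_dvd (by norm_num [Int.isCoprime_iff_gcd_eq_one] : IsCoprime (8 : ℤ) 3) h8 h3
  simpa using this

/-- Right multiplication by `T^j`. -/
lemma etaMultiplier_translate {a b c d : ℤ} (j : ℤ) (hdet : a * d - b * c = 1) (hc : Odd c)
    (h0 : 0 < c) :
    etaMultiplier a (b + j * a) c (d + j * c) = root24 j * etaMultiplier a b c d := by
  rw [etaMultiplier_of_odd _ _ _ hc h0, etaMultiplier_of_odd _ _ _ hc h0]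
  have hJ : jacobiSym (d + j * c) c.natAbs = jacobiSym d c.natAbs := by
    apply jacobiSym.mod_left'
    have : ((c.natAbs : ℕ) : ℤ) = c := by simp [abs_of_pos h0]
    rw [this]; simp
  rw [hJ, mul_left_comm, ← root24_add]
  congr 1
  apply root24_congr
  have := Dvd.dvd.mul_left (dvd_24_cube_sub_self hc) (-(2 * j * b + j ^ 2 * a))
  refine this.trans (dvd_of_eq ?_)
  linear_combination (j * (c ^ 2 - 1)) * hdet

lemma dvd_24_of_eight_three {n : ℤ} (h8 : (n : ZMod 8) = 0) (h3 : (n : ZMod 3) = 0) : 24 ∣ n := by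
  have h8' := (ZMod.intCast_zmod_eq_zero_iff_dvd n 8).mp h8
  have h3' := (ZMod.intCast_zmod_eq_zero_iff_dvd n 3).mp h3
  have := IsCoprime.mul_dvd (by norm_num [Int.isCoprime_iff_gcd_eq_one] : IsCoprime (8 : ℤ) 3)
    h8' h3'
  simpa using this

/-- Compatibility of the exponents under inversion when both lower entries c = 2x + 1 and d = 2y + 1
are odd; 12 y(x + 1) encodes the sign from quadratic reciprocity. A polynomial congruence modulo 24
can be checked by enumeration modulo 8 and modulo 3. -/
lemma inversion_exponent_dvd (a b x y : ℤ)
    (hdet : a * (2 * y + 1) - b * (2 * x + 1) = 1) :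
    24 ∣ ((b - (2 * x + 1)) * (2 * y + 1) - a * (2 * x + 1) * ((2 * y + 1) ^ 2 - 1)
        - 3 * (2 * y + 1) + 3)
      - ((a + (2 * y + 1)) * (2 * x + 1) - b * (2 * y + 1) * ((2 * x + 1) ^ 2 - 1)
        - 3 * (2 * x + 1) + 12 * (y * (x + 1))) := by
  apply dvd_24_of_eight_three
  -- Odd squares are 1 modulo 8, so the determinant equation can be solved for a, leaving three free
  -- residues to enumerate.
  · have ha : (a : ZMod 8) = (2 * y + 1) * (1 + b * (2 * x + 1)) := by
      have h1 : ((a * (2 * y + 1) - b * (2 * x + 1) : ℤ) : ZMod 8) = 1 := by rw [hdet]; simp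
      have h2 : ∀ y : ZMod 8, (2 * y + 1) * (2 * y + 1) = 1 := by decide
      push_cast at h1
      linear_combination (2 * (y : ZMod 8) + 1) * h1 - (a : ZMod 8) * h2 y
    push_cast
    rw [ha]
    generalize (b : ZMod 8) = b
    generalize (x : ZMod 8) = x
    generalize (y : ZMod 8) = y
    revert b x y
    decide
  · have h1 : ((a * (2 * y + 1) - b * (2 * x + 1) : ℤ) : ZMod 3) = 1 := by rw [hdet]; simp
    push_cast at h1 ⊢
    generalize (b : ZMod 3) = b at *
    generalize (x : ZMod 3) = x at *
    generalize (y : ZMod 3) = y at *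
    generalize (a : ZMod 3) = a at *
    revert a b x y
    decide

/-- The supplementary law for -1 contributes (-1)^y and reciprocity contributes (-1)^{xy}. -/
lemma jacobiSym_neg_swap {x y : ℕ} :
    jacobiSym (-((2 * x + 1 : ℕ) : ℤ)) (2 * y + 1)
      = (-1) ^ (y * (x + 1)) * jacobiSym ((2 * y + 1 : ℕ) : ℤ) (2 * x + 1) := by
  have hx : Odd (2 * x + 1) := ⟨x, rfl⟩
  have hy : Odd (2 * y + 1) := ⟨y, rfl⟩
  rw [jacobiSym.neg _ hy, jacobiSym.quadratic_reciprocity hx hy, ZMod.χ₄_eq_neg_one_pow (by omega),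
    show (2 * x + 1) / 2 = x by omega, show (2 * y + 1) / 2 = y by omega, ← mul_assoc, ← pow_add]
  congr 2; ring

/-- Relation under the inversion `S`, lower right entry positive. -/
lemma etaMultiplier_inversion_pos {a b c d : ℤ} (hdet : a * d - b * c = 1) (hc : 0 < c)
    (hd : 0 < d) (hodd : Odd d) :
    etaMultiplier a b c d = root24 3 * etaMultiplier b (-a) d (-c) := by
  rw [etaMultiplier_of_odd b (-a) (-c) hodd hd]
  rcases Int.even_or_odd c with he | ho
  · rw [etaMultiplier_of_even a b he hc hodd]
    lift c to ℕ using hc.le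
    lift d to ℕ using hd.le
    have hdo : Odd d := by exact_mod_cast hodd
    simp only [Int.natAbs_natCast]
    rw [jacobiSym.neg _ hdo, ZMod.χ₄_eq_neg_one_pow (Nat.odd_iff.mp hdo)]
    push_cast
    rw [← root24_twelve_mul, show ∀ p q r s : ℂ, p * (q * r * s) = r * (p * q * s) by intros; ring,
      ← root24_add, ← root24_add]
    congr 1
    apply root24_congr
    obtain ⟨y, rfl⟩ := hdo
    rw [show (2 * y + 1) / 2 = y by omega]
    push_cast
    exact ⟨0, by ring⟩
  · rw [etaMultiplier_of_odd a b d ho hc]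
    lift c to ℕ using hc.le
    lift d to ℕ using hd.le
    have hdo : Odd d := by exact_mod_cast hodd
    have hco : Odd c := by exact_mod_cast ho
    obtain ⟨y, rfl⟩ := hdo
    obtain ⟨x, rfl⟩ := hco
    simp only [Int.natAbs_natCast]
    rw [jacobiSym_neg_swap]
    push_cast
    rw [← root24_twelve_mul, show ∀ p q r s : ℂ, p * (q * r * s) = r * (p * q * s) by intros; ring,
      ← root24_add, ← root24_add]
    congr 1
    apply root24_congr
    have := inversion_exponent_dvd a b x y (by exact_mod_cast hdet)
    rw [← dvd_neg]
    push_cast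
    -- Here the reciprocity sign stands on the opposite side from `inversion_exponent_dvd`; this is
    -- harmless as 12n ≡ -12n modulo 24.
    have h24 : (24 : ℤ) ∣ 24 * (y * (x + 1)) := ⟨_, rfl⟩
    refine (dvd_add this h24).trans (dvd_of_eq ?_)
    ring

/-- Relation under the inversion `S`, lower right entry negative. -/
lemma etaMultiplier_inversion_neg {a b c d : ℤ} (hdet : a * d - b * c = 1) (hc : 0 < c)
    (hd : d < 0) (hodd : Odd d) :
    etaMultiplier a b c d = root24 (-3) * etaMultiplier (-b) a (-d) c := by
  obtain ⟨m, rfl⟩ : ∃ m, d = -m := ⟨-d, by ring⟩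
  have hm : 0 < m := by omega
  have hmo : Odd m := by simpa using hodd
  rw [neg_neg, etaMultiplier_of_odd (-b) a c hmo hm]
  rcases Int.even_or_odd c with he | ho
  · rw [etaMultiplier_of_even a b he hc hodd, Int.natAbs_neg, mul_left_comm, ← root24_add]
    congr 2; ring
  · rw [etaMultiplier_of_odd a b (-m) ho hc]
    lift c to ℕ using hc.le
    lift m to ℕ using hm.le
    have hdo : Odd m := by exact_mod_cast hmo
    have hco : Odd c := by exact_mod_cast ho
    obtain ⟨y, rfl⟩ := hco
    obtain ⟨x, rfl⟩ := hdo
    simp only [Int.natAbs_natCast]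
    rw [jacobiSym_neg_swap]
    push_cast
    rw [← root24_twelve_mul, mul_left_comm, ← root24_add,
      show ∀ p q r : ℂ, p * q * r = q * (p * r) by intros; ring, ← root24_add]
    congr 1
    apply root24_congr
    have := inversion_exponent_dvd (-b) a x y (by push_cast at hdet ⊢; linarith)
    push_cast
    have h24 : (24 : ℤ) ∣ 24 * (y * (x + 1)) := ⟨_, rfl⟩
    refine (dvd_add this h24).trans (dvd_of_eq ?_)
    ring

/-! ### Principal square roots on the upper half-plane. -/

lemma eq_of_exp_eq_of_im {x y : ℂ} (h : cexp x = cexp y) (h1 : x.im - y.im < 2 * Real.pi)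
    (h2 : -(2 * Real.pi) < x.im - y.im) : x = y := by
  obtain ⟨n, hn⟩ := Complex.exp_eq_exp_iff_exists_int.mp h
  have him : x.im - y.im = n * (2 * Real.pi) := by rw [hn]; simp
  have hp := Real.pi_pos
  have hn0 : n = 0 := by
    rw [him] at h1 h2
    have a1 : (n : ℝ) < 1 := by nlinarith
    have a2 : (-1 : ℝ) < n := by nlinarith
    have a3 : n < 1 := by exact_mod_cast a1
    have a4 : -1 < n := by exact_mod_cast a2
    omega
  rw [hn, hn0]; simp

lemma ne_zero_of_im_pos {w : ℂ} (h : 0 < w.im) : w ≠ 0 := by rintro rfl; simp at h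

lemma cpow_half_eq {w : ℂ} (h : w ≠ 0) : w ^ (1 / 2 : ℂ) = cexp (log w / 2) := by
  rw [Complex.cpow_def_of_ne_zero h]; congr 1; ring

lemma log_im_mem {w : ℂ} (h : 0 < w.im) : 0 < (log w).im ∧ (log w).im < Real.pi := by
  rw [Complex.log_im]
  refine ⟨(Complex.arg_nonneg_iff.mpr h.le).lt_of_ne' ?_, (Complex.arg_le_pi w).lt_of_ne ?_⟩
  · intro h0; rw [Complex.arg_eq_zero_iff] at h0; linarith [h0.2]
  · intro h0; rw [Complex.arg_eq_pi_iff] at h0; linarith [h0.2]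

/-- All three arguments lie in (0, π), so arg u + arg v and arg w differ by less than 2π: the
logarithms add without a branch correction. -/
lemma cpow_half_mul {u v w : ℂ} (hu : 0 < u.im) (hv : 0 < v.im) (hw : 0 < w.im)
    (h : u * v = w) : u ^ (1 / 2 : ℂ) * v ^ (1 / 2 : ℂ) = w ^ (1 / 2 : ℂ) := by
  have hu0 := ne_zero_of_im_pos hu
  have hv0 := ne_zero_of_im_pos hv
  have hw0 := ne_zero_of_im_pos hw
  rw [cpow_half_eq hu0, cpow_half_eq hv0, cpow_half_eq hw0, ← Complex.exp_add]
  have : log u + log v = log w := by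
    apply eq_of_exp_eq_of_im
    · rw [Complex.exp_add, exp_log hu0, exp_log hv0, exp_log hw0, h]
    all_goals
      have := log_im_mem hu; have := log_im_mem hv; have := log_im_mem hw
      simp only [add_im]; linarith
  rw [← this]; congr 1; ring

/-- The product lies in the lower half-plane, so the logarithms add up to log w + πi; half of πi
gives the factor i. -/
lemma cpow_half_mul_neg {u v w : ℂ} (hu : 0 < u.im) (hv : 0 < v.im) (hw : 0 < w.im)
    (h : u * v = -w) : u ^ (1 / 2 : ℂ) * v ^ (1 / 2 : ℂ) = I * w ^ (1 / 2 : ℂ) := by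
  have hu0 := ne_zero_of_im_pos hu
  have hv0 := ne_zero_of_im_pos hv
  have hw0 := ne_zero_of_im_pos hw
  rw [cpow_half_eq hu0, cpow_half_eq hv0, cpow_half_eq hw0, ← Complex.exp_add]
  have : log u + log v = log w + Real.pi * I := by
    apply eq_of_exp_eq_of_im
    · rw [Complex.exp_add, Complex.exp_add, exp_log hu0, exp_log hv0, exp_log hw0, h, exp_pi_mul_I]
      ring
    all_goals
      have := log_im_mem hu; have := log_im_mem hv; have := log_im_mem hw
      simp; linarith [Real.pi_pos]
  rw [← add_div, this, add_div, Complex.exp_add, mul_comm]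
  congr 1
  rw [mul_div_right_comm, Complex.exp_pi_div_two_mul_I]

lemma cpow_half_neg_I_mul {w : ℂ} (hw : 0 < w.im) :
    (-I * w) ^ (1 / 2 : ℂ) = root24 (-3) * w ^ (1 / 2 : ℂ) := by
  have hw0 := ne_zero_of_im_pos hw
  have h0 : -I * w ≠ 0 := mul_ne_zero (neg_ne_zero.mpr I_ne_zero) hw0
  rw [cpow_half_eq hw0, cpow_half_eq h0, root24, ← Complex.exp_add]
  have : log (-I * w) = log w - Real.pi / 2 * I := by
    apply eq_of_exp_eq_of_im
    · rw [Complex.exp_sub, exp_log h0, exp_log hw0, Complex.exp_pi_div_two_mul_I]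
      field_simp; simp
    all_goals
      have := log_im_mem hw
      have h1 := Complex.arg_le_pi (-I * w)
      have h2 := Complex.neg_pi_lt_arg (-I * w)
      rw [← Complex.log_im] at h1 h2
      simp at *; linarith [Real.pi_pos]
  rw [this]; congr 1; push_cast; ring

lemma cpow_half_sq {w : ℂ} (hw : w ≠ 0) : (w ^ (1 / 2 : ℂ)) ^ 2 = w := by
  rw [cpow_half_eq hw, ← Complex.exp_nat_mul]; push_cast
  rw [mul_div_cancel₀ _ two_ne_zero, exp_log hw]

lemma cpow_half_ne_zero {w : ℂ} (hw : w ≠ 0) : w ^ (1 / 2 : ℂ) ≠ 0 := by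
  rw [cpow_half_eq hw]; exact Complex.exp_ne_zero _

/-! ### From the generators to all matrices with positive lower left entry. -/

/-- Behaviour under the generators of a Jacobi form of weight `1/2`, index `x/2`, whose multiplier
is the `r`-th power of the one of the eta function. -/
structure IsThetaLike (f : ℂ → ℂ → ℂ) (r : ℕ) (x e : ℂ) : Prop where
  map_translate : ∀ z τ : ℂ, 0 < τ.im → f z (τ + 1) = root24 r * f z τ
  map_inversion : ∀ z τ : ℂ, 0 < τ.im → f (z / τ) (-1 / τ)
    = root24 (-3 * r) * τ ^ (1 / 2 : ℂ) * cexp (Real.pi * I * x * z ^ 2 / τ) * f z τ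
  map_neg : ∀ z τ : ℂ, 0 < τ.im → f (-z) τ = e * f z τ
  parity : e * I = root24 (6 * r)

/-- The transformation law under the matrix with rows `(a, b)`, `(c, d)`. -/
def TransformsUnder (f : ℂ → ℂ → ℂ) (r : ℕ) (x : ℂ) (a b c d : ℤ) : Prop :=
  ∀ z τ : ℂ, 0 < τ.im → f (z / (c * τ + d)) ((a * τ + b) / (c * τ + d))
    = etaMultiplier a b c d ^ r * (c * τ + d) ^ (1 / 2 : ℂ)
      * cexp (Real.pi * I * x * c * z ^ 2 / (c * τ + d)) * f z τ

lemma im_neg_one_div {τ : ℂ} (h : 0 < τ.im) : 0 < (-1 / τ).im := by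
  have hn := Complex.normSq_pos.mpr (ne_zero_of_im_pos h)
  simp [neg_div]
  positivity

lemma im_linear {c : ℤ} (hc : 0 < c) (d : ℤ) {τ : ℂ} (h : 0 < τ.im) : 0 < (c * τ + d).im := by
  have : (0 : ℝ) < c := by exact_mod_cast hc
  simp; positivity

namespace IsThetaLike
variable {f : ℂ → ℂ → ℂ} {r : ℕ} {x e : ℂ}

lemma map_translate_int (hf : IsThetaLike f r x e) (n : ℤ) (z τ : ℂ) (h : 0 < τ.im) :
    f z (τ + n) = root24 (r * n) * f z τ := by
  have key : ∀ (m : ℕ) (τ : ℂ), 0 < τ.im → f z (τ + m) = root24 (r * m) * f z τ := by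
    intro m
    induction m with
    | zero => intro τ _; simp [root24_zero]
    | succ m ih =>
      intro τ hτ
      rw [show τ + ((m + 1 : ℕ) : ℂ) = (τ + m) + 1 by push_cast; ring,
        hf.map_translate z _ (by simpa using hτ), ih τ hτ, ← mul_assoc, ← root24_add]
      congr 2; push_cast; ring
  obtain ⟨m, rfl | rfl⟩ := n.eq_nat_or_neg
  · exact_mod_cast key m τ h
  · have := key m (τ - m) (by simpa using h)
    rw [sub_add_cancel] at this
    rw [this, ← mul_assoc, ← root24_add]
    simp [root24_zero, sub_eq_add_neg]

/-- Such a matrix is T^a S T^d, so the three generator laws compose directly. -/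
lemma transformsUnder_one (hf : IsThetaLike f r x e) {a b d : ℤ} (hdet : a * d - b * 1 = 1) :
    TransformsUnder f r x a b 1 d := by
  intro z τ h
  have hw : 0 < (τ + d).im := by simpa using h
  have hw0 := ne_zero_of_im_pos hw
  have hb : (b : ℂ) = a * d - 1 := by
    have : b = a * d - 1 := by linarith
    rw [this]; push_cast; ring
  have e1 : ((a * τ + b) / ((1 : ℤ) * τ + d) : ℂ) = -1 / (τ + d) + a := by
    push_cast; rw [hb, one_mul]; field_simp; ring
  rw [e1, hf.map_translate_int a _ _ (im_neg_one_div hw)]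
  push_cast
  simp only [one_mul, mul_one]
  rw [hf.map_inversion z _ hw, hf.map_translate_int d z τ h, etaMultiplier_one, ← root24_mul_nat,
    show (r : ℤ) * (a + d - 3) = r * a + (-3 * r + r * d) by ring, root24_add, root24_add]
  ring

lemma transformsUnder_of_translate (hf : IsThetaLike f r x e) {a b c d : ℤ} (j : ℤ)
    (hdet : a * d - b * c = 1) (hc : 0 < c) (ho : Odd c)
    (h : TransformsUnder f r x a (b + j * a) c (d + j * c)) : TransformsUnder f r x a b c d := by
  intro z τ hτ
  have := h z (τ - j) (by simpa using hτ)
  have e1 : ((c : ℂ) * (τ - j) + ((d + j * c : ℤ) : ℂ)) = c * τ + d := by push_cast; ring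
  have e2 : ((a : ℂ) * (τ - j) + ((b + j * a : ℤ) : ℂ)) = a * τ + b := by push_cast; ring
  rw [e1, e2, etaMultiplier_translate j hdet ho hc] at this
  have e3 := hf.map_translate_int j z (τ - j) (by simpa using hτ)
  rw [sub_add_cancel, root24_mul_nat] at e3
  rw [this, e3]
  ring

/-- The matrix is M'S with M' of rows (-b, a), (-d, c); the law of M' is applied at (z/τ, -1/τ). -/
lemma transformsUnder_of_neg (hf : IsThetaLike f r x e) {a b c d : ℤ}
    (hdet : a * d - b * c = 1) (hc : 0 < c) (hd : d < 0) (ho : Odd d)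
    (h : TransformsUnder f r x (-b) a (-d) c) : TransformsUnder f r x a b c d := by
  intro z τ hτ
  have hτ0 := ne_zero_of_im_pos hτ
  have hτ1 := im_neg_one_div hτ
  have hw := im_linear hc d hτ
  have hw0 := ne_zero_of_im_pos hw
  have hv := im_linear (by omega : 0 < -d) c hτ1
  have ev : (((-d : ℤ) : ℂ) * (-1 / τ) + c) = (c * τ + d) / τ := by
    push_cast; field_simp; ring
  have := h (z / τ) (-1 / τ) hτ1
  rw [ev] at hv
  have hs := cpow_half_mul hv hτ hw (div_mul_cancel₀ _ hτ0)
  rw [ev, hf.map_inversion z τ hτ] at this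
  have ez : z / τ / ((c * τ + d) / τ) = z / (c * τ + d) := by field_simp
  have eτ : (((-b : ℤ) : ℂ) * (-1 / τ) + a) / ((c * τ + d) / τ) = (a * τ + b) / (c * τ + d) := by
    push_cast; field_simp; ring
  rw [ez, eτ] at this
  rw [this, etaMultiplier_inversion_neg hdet hc hd ho, mul_pow, ← hs, ← root24_mul_nat,
    show (r : ℤ) * -3 = -3 * r by ring]
  have eexp : cexp (Real.pi * I * x * c * z ^ 2 / (c * τ + d))
      = cexp (Real.pi * I * x * ((-d : ℤ) : ℂ) * (z / τ) ^ 2 / ((c * τ + d) / τ))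
        * cexp (Real.pi * I * x * z ^ 2 / τ) := by
    rw [← Complex.exp_add]; congr 1; push_cast; field_simp; ring
  rw [eexp]
  ring

/-- For M' of rows (b, -a), (d, -c) the product M'S is minus the given matrix. The sign is absorbed
by z ↦ -z, at the cost of the factor e, while the square roots contribute i through
`cpow_half_mul_neg`. -/
lemma transformsUnder_of_pos (hf : IsThetaLike f r x e) {a b c d : ℤ}
    (hdet : a * d - b * c = 1) (hc : 0 < c) (hd : 0 < d) (ho : Odd d)
    (h : TransformsUnder f r x b (-a) d (-c)) : TransformsUnder f r x a b c d := by
  intro z τ hτ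
  have hτ0 := ne_zero_of_im_pos hτ
  have hτ1 := im_neg_one_div hτ
  have hw := im_linear hc d hτ
  have hw0 := ne_zero_of_im_pos hw
  have hv := im_linear hd (-c) hτ1
  have ev : ((d : ℂ) * (-1 / τ) + ((-c : ℤ) : ℂ)) = -(c * τ + d) / τ := by
    push_cast; field_simp; ring
  have := h (-z / τ) (-1 / τ) hτ1
  rw [ev] at hv
  have hs := cpow_half_mul_neg hv hτ hw (div_mul_cancel₀ _ hτ0)
  rw [ev, hf.map_inversion (-z) τ hτ, hf.map_neg z τ hτ] at this
  have ez : -z / τ / (-(c * τ + d) / τ) = z / (c * τ + d) := by field_simp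
  have eτ : ((b : ℂ) * (-1 / τ) + ((-a : ℤ) : ℂ)) / (-(c * τ + d) / τ)
      = (a * τ + b) / (c * τ + d) := by
    push_cast; field_simp; ring
  rw [ez, eτ] at this
  -- The field `parity` is the compatibility needed here: it turns e · i into a 24th root of unity,
  -- matching the factor of `etaMultiplier_inversion_pos`.
  have h6 : root24 (-3 * r) * (e * I) = root24 3 ^ r := by
    rw [hf.parity, ← root24_add, ← root24_mul_nat]; congr 1; ring
  have eexp : cexp (Real.pi * I * x * c * z ^ 2 / (c * τ + d))
      = cexp (Real.pi * I * x * d * (-z / τ) ^ 2 / (-(c * τ + d) / τ))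
        * cexp (Real.pi * I * x * (-z) ^ 2 / τ) := by
    rw [← Complex.exp_add]; congr 1; field_simp; ring
  rw [this, etaMultiplier_inversion_pos hdet hc hd ho, mul_pow, ← h6, eexp]
  linear_combination (etaMultiplier b (-a) d (-c) ^ r
    * cexp (Real.pi * I * x * d * (-z / τ) ^ 2 / (-(c * τ + d) / τ))
    * root24 (-3 * r) * cexp (Real.pi * I * x * (-z) ^ 2 / τ) * e * f z τ) * hs

/-- Euclidean descent on c. Since c is odd, d has an odd representative in (-c, c) modulo c; after
translating to it, an inversion makes |d| < c the new lower left entry, again odd. So the Jacobi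
symbol formula for odd c applies throughout. -/
lemma transformsUnder_of_odd (hf : IsThetaLike f r x e) (n : ℕ) : ∀ {a b c d : ℤ},
    c.natAbs = n → a * d - b * c = 1 → 0 < c → Odd c → TransformsUnder f r x a b c d := by
  induction n using Nat.strong_induction_on with
  | _ n ih =>
    intro a b c d hn hdet hc ho
    rcases eq_or_ne c 1 with rfl | h1
    · exact hf.transformsUnder_one hdet
    obtain ⟨j, hj1, hj2, hj3⟩ : ∃ j : ℤ, Odd (d + j * c) ∧ d + j * c < c ∧ -c < d + j * c := by
      have hm := Int.emod_nonneg d hc.ne'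
      have hl := Int.emod_lt_of_pos d hc
      have hdm := Int.emod_add_mul_ediv d c
      rcases Int.even_or_odd (d % c) with he | hodd
      · refine ⟨-(d / c) - 1, ?_, ?_, ?_⟩
        · have : d + (-(d / c) - 1) * c = d % c - c := by linear_combination -hdm
          rw [this]; exact he.sub_odd ho
        · linarith
        -- An even remainder is lowered by c; the result exceeds -c strictly only when the remainder
        -- is nonzero, which coprimality ensures for c ≠ 1.
        · have hne : d % c ≠ 0 := by
            intro h0
            have hdvd := Int.dvd_of_emod_eq_zero h0
            have : c ∣ 1 := by
              rw [← hdet]; exact dvd_sub (hdvd.mul_left a) (dvd_mul_left c b)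
            have := Int.eq_one_of_dvd_one hc.le this
            exact h1 this
          have : 0 < d % c := lt_of_le_of_ne hm (Ne.symm hne)
          linarith
      · refine ⟨-(d / c), ?_, ?_, ?_⟩
        · have : d + -(d / c) * c = d % c := by linear_combination -hdm
          rw [this]; exact hodd
        · linarith
        · linarith
    apply hf.transformsUnder_of_translate j hdet hc ho
    have hdet' : a * (d + j * c) - (b + j * a) * c = 1 := by linear_combination hdet
    set d' := d + j * c with hd'
    have hd0 : d' ≠ 0 := by intro h; rw [h] at hj1; simp at hj1
    rcases lt_or_gt_of_ne hd0 with hneg | hpos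
    · exact hf.transformsUnder_of_neg hdet' hc hneg hj1
        (ih d'.natAbs (by omega) (by omega) (by linear_combination hdet') (by omega)
          hj1.neg)
    · exact hf.transformsUnder_of_pos hdet' hc hpos hj1
        (ih d'.natAbs (by omega) rfl (by linear_combination hdet') hpos hj1)

/-- For even c the entry d is odd, and a single inversion leads to an odd lower left entry. -/
theorem transformsUnder (hf : IsThetaLike f r x e) {a b c d : ℤ}
    (hdet : a * d - b * c = 1) (hc : 0 < c) : TransformsUnder f r x a b c d := by
  rcases Int.even_or_odd c with he | ho
  · have hd : Odd d := by
      by_contra hd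
      rw [Int.not_odd_iff_even] at hd
      have : Even (1 : ℤ) := by rw [← hdet]; exact (hd.mul_left a).sub (he.mul_left b)
      simp at this
    have hd0 : d ≠ 0 := by rintro rfl; simp at hd
    rcases lt_or_gt_of_ne hd0 with hneg | hpos
    · exact hf.transformsUnder_of_neg hdet hc hneg hd
        (hf.transformsUnder_of_odd _ rfl (by linear_combination hdet) (by omega) hd.neg)
    · exact hf.transformsUnder_of_pos hdet hc hpos hd
        (hf.transformsUnder_of_odd _ rfl (by linear_combination hdet) hpos hd)
  · exact hf.transformsUnder_of_odd _ rfl hdet hc ho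

end IsThetaLike

/-! ### The odd theta function and the eta function are theta-like. -/

/-- The odd Jacobi theta function `∑ (-1)^n e^{πiτ(n+1/2)^2 + 2πiz(n+1/2)}`. -/
noncomputable def thetaOdd (z τ : ℂ) : ℂ :=
  cexp (Real.pi * I * τ / 4 + Real.pi * I * z) * jacobiTheta₂ (z + τ / 2 + 1 / 2) τ

lemma cexp_two_pi_int (n : ℤ) : cexp (2 * Real.pi * I * n) = 1 :=
  Complex.exp_eq_one_iff.mpr ⟨n, by ring⟩

lemma thetaOdd_isThetaLike : IsThetaLike thetaOdd 3 1 (-1) where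
  map_translate z τ h := by
    rw [thetaOdd, thetaOdd, root24, ← mul_assoc, ← Complex.exp_add]
    congr 1
    · congr 1; push_cast; ring
    · unfold jacobiTheta₂
      refine tsum_congr fun n => ?_
      obtain ⟨m, hm⟩ := Int.even_mul_succ_self n
      have hm' : (n : ℂ) * (n + 1) = m + m := by exact_mod_cast hm
      rw [jacobiTheta₂_term, jacobiTheta₂_term, Complex.exp_eq_exp_iff_exists_int]
      exact ⟨m, by linear_combination Real.pi * I * hm'⟩
  map_inversion z τ h := by
    have hτ := ne_zero_of_im_pos h
    -- The argument is first moved by the period 1: dividing z + τ/2 - 1/2 by τ gives z/τ + (-1/τ)/2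
    -- + 1/2, the shifted argument belonging to -1/τ.
    have h1 := jacobiTheta₂_functional_equation (z + τ / 2 - 1 / 2) τ
    have h2 : jacobiTheta₂ (z + τ / 2 - 1 / 2) τ = jacobiTheta₂ (z + τ / 2 + 1 / 2) τ := by
      rw [← jacobiTheta₂_add_left]; congr 1; ring
    have h3 : (z + τ / 2 - 1 / 2) / τ = z / τ + -1 / τ / 2 + 1 / 2 := by field_simp; ring
    have h0 : -I * τ ≠ 0 := mul_ne_zero (neg_ne_zero.mpr I_ne_zero) hτ
    have hs := cpow_half_ne_zero h0
    rw [h3, h2] at h1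
    rw [thetaOdd, thetaOdd, h1, cpow_half_neg_I_mul h]
    rw [cpow_half_neg_I_mul h] at hs
    have hr : root24 (-3 * (3 : ℕ)) = root24 (-3) * root24 (-6) := by
      rw [← root24_add]; norm_num
    have hx : cexp (Real.pi * I * (-1 / τ) / 4 + Real.pi * I * (z / τ))
        = root24 (-6) * cexp (Real.pi * I * 1 * z ^ 2 / τ)
          * cexp (Real.pi * I * τ / 4 + Real.pi * I * z)
          * cexp (-Real.pi * I * (z + τ / 2 - 1 / 2) ^ 2 / τ) := by
      rw [root24, ← Complex.exp_add, ← Complex.exp_add, ← Complex.exp_add]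
      congr 1
      push_cast
      field_simp
      ring
    rw [hr, hx]
    generalize jacobiTheta₂ (z / τ + -1 / τ / 2 + 1 / 2) (-1 / τ) = J
    have hs' := mul_one_div_cancel hs
    generalize cexp (-Real.pi * I * (z + τ / 2 - 1 / 2) ^ 2 / τ) = E
    generalize cexp (Real.pi * I * τ / 4 + Real.pi * I * z) = E'
    generalize cexp (Real.pi * I * 1 * z ^ 2 / τ) = E''
    linear_combination (-(root24 (-6) * E'' * E' * E * J)) * hs'
  map_neg z τ h := by
    have h1 : jacobiTheta₂ (-z + τ / 2 + 1 / 2) τ = jacobiTheta₂ (z - τ / 2 - 1 / 2) τ := by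
      rw [← jacobiTheta₂_neg_left]; congr 1; ring
    have h2 := jacobiTheta₂_add_left' (z - τ / 2 - 1 / 2) τ
    have h3 : jacobiTheta₂ (z - τ / 2 - 1 / 2 + τ) τ = jacobiTheta₂ (z + τ / 2 + 1 / 2) τ := by
      rw [← jacobiTheta₂_add_left (z - τ / 2 - 1 / 2 + τ)]; congr 1; ring
    rw [h3] at h2
    rw [thetaOdd, thetaOdd, h1, h2, ← mul_assoc, ← mul_assoc]
    congr 1
    rw [← Complex.exp_pi_mul_I, ← Complex.exp_add, ← Complex.exp_add,
      Complex.exp_eq_exp_iff_exists_int]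
    exact ⟨-1, by push_cast; ring⟩
  parity := by
    have : root24 (6 * (3 : ℕ)) = root24 12 * root24 6 := by rw [← root24_add]; norm_num
    have h1 := root24_twelve_mul 1
    norm_num at h1
    have h6 : I = root24 6 := by
      rw [root24]; conv_lhs => rw [← Complex.exp_pi_div_two_mul_I]
      congr 1; push_cast; ring
    rw [this, h1, ← h6]

lemma eta_isThetaLike : IsThetaLike (fun _ τ => ModularForm.eta τ) 1 0 1 where
  map_translate z τ h := by
    simp only [ModularForm.eta, ModularForm.eta_q_eq_cexp]
    rw [← mul_assoc]
    congr 1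
    · rw [Function.Periodic.qParam, Function.Periodic.qParam, root24, ← Complex.exp_add]
      congr 1; push_cast; ring
    · refine tprod_congr fun n => ?_
      rw [mul_add, Complex.exp_add, mul_one]
      have := cexp_two_pi_int (n + 1)
      push_cast at this
      rw [this, mul_one]
  map_inversion z τ h := by
    have := ModularForm.eta_comp_eq_csqrt_I_inv (x := τ) h
    have hI : (I ^ (2⁻¹ : ℂ))⁻¹ = root24 (-3) := by
      rw [root24, ← one_div 2, cpow_half_eq I_ne_zero, ← Complex.exp_neg, Complex.log_I]
      congr 1; push_cast; ring
    simp only [Function.comp_apply, Pi.smul_apply, Pi.mul_apply, smul_eq_mul, Complex.sqrt] at this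
    rw [this, hI]
    simp [mul_assoc]
  map_neg z τ h := by simp
  parity := by
    rw [one_mul, root24]
    conv_lhs => rw [← Complex.exp_pi_div_two_mul_I]
    congr 1; push_cast; ring

/-! ### The crank denominator as a theta quotient. -/

/-- `(ζq; q)_∞ (ζ⁻¹q; q)_∞`. -/
noncomputable def crankDenom (z τ : ℂ) : ℂ :=
  qPochInf (cexp (2 * Real.pi * I * z) * cexp (2 * Real.pi * I * τ)) (cexp (2 * Real.pi * I * τ))
  * qPochInf ((cexp (2 * Real.pi * I * z))⁻¹ * cexp (2 * Real.pi * I * τ))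
      (cexp (2 * Real.pi * I * τ))

lemma norm_nome_lt_one {τ : ℂ} (h : 0 < τ.im) : ‖cexp (2 * Real.pi * I * τ)‖ < 1 := by
  rw [Complex.norm_exp]
  simp
  positivity

lemma qPochInf_multipliable (a : ℂ) {q : ℂ} (hq : ‖q‖ < 1) :
    Multipliable fun n : ℕ => 1 - a * q ^ n := by
  have : Summable fun n : ℕ => ‖-(a * q ^ n)‖ := by
    simp only [norm_neg, norm_mul, norm_pow]
    exact (summable_geometric_of_lt_one (norm_nonneg _) hq).mul_left _
  simpa [sub_eq_add_neg] using multipliable_one_add_of_summable this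

lemma qPochInf_succ (a : ℂ) {q : ℂ} (hq : ‖q‖ < 1) :
    qPochInf a q = (1 - a) * qPochInf (a * q) q := by
  have h1 : (fun n : ℕ => 1 - a * q ^ (n + 1)) = fun n => 1 - a * q * q ^ n := by
    ext n; ring
  rw [qPochInf, tprod_eq_zero_mul' (by rw [h1]; exact qPochInf_multipliable _ hq), h1]
  simp [qPochInf]

lemma differentiable_qPochInf {q : ℂ} (hq : ‖q‖ < 1) : Differentiable ℂ fun a => qPochInf a q := by
  have key : HasProdLocallyUniformlyOn (fun (n : ℕ) a => 1 + -(a * q ^ n))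
      (fun a => ∏' n : ℕ, (1 + -(a * q ^ n))) Set.univ := by
    apply hasProdLocallyUniformlyOn_of_forall_compact isOpen_univ
    intro K _ hK
    obtain ⟨R, hR⟩ := hK.isBounded.exists_norm_le
    refine ((summable_geometric_of_lt_one (norm_nonneg _) hq).mul_left R).hasProdUniformlyOn_nat_one_add
      hK (.of_forall fun n x hx ↦ ?_) (fun _ ↦ by fun_prop)
    rw [norm_neg, norm_mul, norm_pow]
    exact mul_le_mul_of_nonneg_right (hR x hx) (by positivity)
  rw [← differentiableOn_univ]
  have := key.differentiableOn (.of_forall fun _ ↦ by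
    simpa [Finset.prod_fn] using! DifferentiableOn.finsetProd (fun _ _ ↦ by fun_prop)) isOpen_univ
  simpa [qPochInf, sub_eq_add_neg] using this

/-- With a primitive Γ of G the left side is Γ(1 + τ) - Γ(τ), whose derivative in τ vanishes by
periodicity. -/
lemma fourier_quasiperiodic_step {G : ℂ → ℂ} (hG : Differentiable ℂ G)
    (hper : ∀ z, G (z + 1) = G z) (τ : ℂ) :
    ∫ x in (0 : ℝ)..1, G (x + τ) = ∫ x in (0 : ℝ)..1, G x := by
  obtain ⟨Γ, hΓ⟩ : ∃ Γ : ℂ → ℂ, ∀ z, HasDerivAt Γ (G z) z := by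
    obtain ⟨Γ, hΓ⟩ := hG.isExactOn_univ
    exact ⟨Γ, fun z => hΓ z (Set.mem_univ z)⟩
  have key : ∀ w : ℂ, ∫ x in (0 : ℝ)..1, G (x + w) = Γ (1 + w) - Γ w := by
    intro w
    have h1 : ∀ x ∈ Set.uIcc (0 : ℝ) 1, HasDerivAt (fun x : ℝ => Γ (x + w)) (G (x + w)) x := by
      intro x _
      have := (hΓ (x + w)).comp_add_const (x : ℂ) w
      exact this.comp_ofReal
    rw [intervalIntegral.integral_eq_sub_of_hasDerivAt h1]
    · simp
    · exact (hG.continuous.comp (by fun_prop)).intervalIntegrable _ _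
  have hconst : ∀ w : ℂ, Γ (1 + w) - Γ w = Γ (1 + 0) - Γ 0 := by
    intro w
    apply is_const_of_deriv_eq_zero (f := fun w => Γ (1 + w) - Γ w)
    · intro w
      exact (((hΓ (1 + w)).comp_const_add 1 w).sub (hΓ w)).differentiableAt
    · intro w
      refine (((hΓ (1 + w)).comp_const_add 1 w).sub (hΓ w)).deriv.trans ?_
      rw [add_comm, hper, sub_self]
  have h0 := key 0
  simp only [add_zero] at h0
  rw [key τ, hconst τ, h0]
  simp

/-- An entire function with the quasi-periods of the odd theta function is a multiple of it. -/
lemma eq_const_mul_theta_of_quasiperiodic {f : ℂ → ℂ} (hf : Differentiable ℂ f) {τ : ℂ}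
    (hτ : 0 < τ.im) (h1 : ∀ z, f (z + 1) = f z)
    (h2 : ∀ z, f (z + τ) = -cexp (-(2 * Real.pi * I * (z + τ))) * f z) :
    ∃ c : ℂ, ∀ z, f z = c * jacobiTheta₂ (z + τ / 2 + 1 / 2) τ := by
  let a : ℤ → ℂ := fun n => ∫ x in (0 : ℝ)..1, cexp (-(2 * Real.pi * I * n * x)) * f x
  -- Moving the segment of integration by τ and using the quasi-period gives a two-term recursion
  -- for the Fourier coefficients. The theta coefficients satisfy the same one, so a(0) determines
  -- everything.
  have hrec : ∀ n : ℤ, a n = -cexp (-(2 * Real.pi * I * (n + 1) * τ)) * a (n + 1) := by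
    intro n
    have hG : Differentiable ℂ fun z : ℂ => cexp (-(2 * Real.pi * I * n * z)) * f z := by fun_prop
    have := fourier_quasiperiodic_step hG (fun z => by
      rw [h1]; congr 1
      rw [Complex.exp_eq_exp_iff_exists_int]
      exact ⟨-n, by push_cast; ring⟩) τ
    simp only [a]
    rw [← this, ← intervalIntegral.integral_const_mul]
    refine intervalIntegral.integral_congr fun x _ => ?_
    rw [h2, show ∀ p q r s t : ℂ, p * (-q * r) = -s * (t * r) ↔ -(p * q) * r = -(s * t) * r by
      intros; constructor <;> intro h <;> linear_combination h, ← Complex.exp_add, ← Complex.exp_add]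
    congr 3
    push_cast; ring
  have hsol : ∀ n : ℤ, a n = a 0 * jacobiTheta₂_term n (τ / 2 + 1 / 2) τ := by
    have hterm : ∀ n : ℤ, jacobiTheta₂_term (n + 1) (τ / 2 + 1 / 2) τ
        = -cexp (2 * Real.pi * I * (n + 1) * τ) * jacobiTheta₂_term n (τ / 2 + 1 / 2) τ := by
      intro n
      rw [jacobiTheta₂_term, jacobiTheta₂_term, ← neg_one_mul, ← Complex.exp_pi_mul_I,
        ← Complex.exp_add, ← Complex.exp_add]
      congr 1; push_cast; ring
    have hstep : ∀ n : ℤ, a (n + 1) = -cexp (2 * Real.pi * I * (n + 1) * τ) * a n := by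
      intro n
      rw [hrec n, ← mul_assoc, neg_mul_neg, ← Complex.exp_add]
      simp
    intro n
    induction n using Int.induction_on with
    | zero => simp [jacobiTheta₂_term]
    | succ n ih => rw [hstep, hterm, ih]; ring
    | pred n ih =>
      have e1 := hstep (-(n : ℤ) - 1)
      have e2 := hterm (-(n : ℤ) - 1)
      rw [sub_add_cancel] at e1 e2
      rw [ih, e2] at e1
      have hne : -cexp (2 * Real.pi * I * (((-(n : ℤ) - 1 : ℤ) : ℂ) + 1) * τ) ≠ 0 :=
        neg_ne_zero.mpr (Complex.exp_ne_zero _)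
      apply mul_left_cancel₀ hne
      rw [← e1]; ring
  refine ⟨a 0, ?_⟩
  have hreal : ∀ x : ℝ, f x = a 0 * jacobiTheta₂ (x + τ / 2 + 1 / 2) τ := by
    have : Fact ((0 : ℝ) < 1) := ⟨one_pos⟩
    have hper : Function.Periodic (fun x : ℝ => f x) 1 := fun x => by simpa using h1 x
    let F : C(AddCircle (1 : ℝ), ℂ) := ⟨hper.lift, by
      apply continuous_coinduced_dom.mpr
      exact hf.continuous.comp Complex.continuous_ofReal⟩
    have hF : ∀ x : ℝ, F (x : AddCircle (1 : ℝ)) = f x := fun x => rfl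
    have hcoef : ∀ n, fourierCoeff F n = a n := by
      intro n
      rw [fourierCoeff_eq_intervalIntegral _ _ 0]
      simp only [zero_add, div_one, one_smul, a]
      refine intervalIntegral.integral_congr fun x _ => ?_
      simp only [hF, fourier_coe_apply, smul_eq_mul]
      congr 2
      push_cast; simp
    have hsum : Summable (fourierCoeff F) := by
      have : fourierCoeff F = fun n => a 0 * jacobiTheta₂_term n (τ / 2 + 1 / 2) τ := by
        ext n; rw [hcoef, hsol]
      rw [this]
      exact ((summable_jacobiTheta₂_term_iff _ _).mpr hτ).mul_left _
    intro x
    have := has_pointwise_sum_fourier_series_of_summable hsum (x : AddCircle (1 : ℝ))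
    rw [hF] at this
    rw [← this.tsum_eq, jacobiTheta₂, ← tsum_mul_left]
    refine tsum_congr fun n => ?_
    rw [hcoef, hsol, fourier_coe_apply, smul_eq_mul, mul_assoc]
    congr 1
    rw [jacobiTheta₂_term, jacobiTheta₂_term, ← Complex.exp_add]
    congr 1; push_cast; ring
  have hfa : AnalyticOnNhd ℂ f Set.univ := fun z _ => hf.analyticAt z
  have hga : AnalyticOnNhd ℂ (fun z => a 0 * jacobiTheta₂ (z + τ / 2 + 1 / 2) τ) Set.univ := by
    have : Differentiable ℂ (fun z => a 0 * jacobiTheta₂ (z + τ / 2 + 1 / 2) τ) := by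
      intro z
      apply DifferentiableAt.const_mul
      exact (differentiableAt_jacobiTheta₂_fst _ hτ).comp z (by fun_prop)
    exact fun z _ => this.analyticAt z
  -- The real points accumulate at 0, so equality on the real line extends to ℂ by the identity
  -- theorem.
  have hfreq : ∃ᶠ z in nhdsWithin (0 : ℂ) {0}ᶜ, f z = a 0 * jacobiTheta₂ (z + τ / 2 + 1 / 2) τ := by
    have ht : Filter.Tendsto (fun x : ℝ => (x : ℂ)) (nhdsWithin 0 {0}ᶜ) (nhdsWithin 0 {0}ᶜ) := by
      apply tendsto_nhdsWithin_of_tendsto_nhds_of_eventually_within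
      · exact (Complex.continuous_ofReal.tendsto' 0 0 (by simp)).mono_left nhdsWithin_le_nhds
      · filter_upwards [self_mem_nhdsWithin] with x hx
        simpa using hx
    exact ht.frequently (Filter.Eventually.of_forall hreal).frequently
  have := hfa.eq_of_frequently_eq hga hfreq
  exact fun z => congrFun this z

/-- The factor 1 - ζ⁻¹ completes the product to (ζq; q)_∞ (ζ⁻¹; q)_∞, which is quasi-periodic under
z ↦ z + τ. -/
lemma crankDenom_eq (z : ℂ) {τ : ℂ} (hτ : 0 < τ.im) :
    (1 - cexp (-(2 * Real.pi * I * z))) * crankDenom z τ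
      = qPochInf (cexp (2 * Real.pi * I * z) * cexp (2 * Real.pi * I * τ)) (cexp (2 * Real.pi * I * τ))
        * qPochInf (cexp (-(2 * Real.pi * I * z))) (cexp (2 * Real.pi * I * τ)) := by
  rw [qPochInf_succ (cexp (-(2 * Real.pi * I * z))) (norm_nome_lt_one hτ), crankDenom,
    Complex.exp_neg]
  ring

lemma differentiable_crankDenom {τ : ℂ} (hτ : 0 < τ.im) :
    Differentiable ℂ fun z => crankDenom z τ := by
  have h := differentiable_qPochInf (norm_nome_lt_one hτ)
  unfold crankDenom
  refine Differentiable.mul (h.comp (by fun_prop)) (h.comp ?_)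
  simp_rw [← Complex.exp_neg]
  fun_prop

lemma crankDenom_zero (τ : ℂ) :
    crankDenom 0 τ = cexp (-(2 * Real.pi * I * τ / 12)) * ModularForm.eta τ ^ 2 := by
  have h : qPochInf (cexp (2 * Real.pi * I * τ)) (cexp (2 * Real.pi * I * τ))
      = ∏' n, (1 - ModularForm.eta_q n τ) := by
    refine tprod_congr fun n => ?_
    rw [ModularForm.eta_q_eq_pow, pow_succ']
  rw [crankDenom]
  simp only [mul_zero, Complex.exp_zero, inv_one, one_mul]
  rw [h, ModularForm.eta, mul_pow, ← mul_assoc, Function.Periodic.qParam, ← Complex.exp_nat_mul,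
    ← Complex.exp_add]
  have : -(2 * Real.pi * I * τ / 12) + (2 : ℕ) * (2 * Real.pi * I * τ / ((24 : ℝ) : ℂ)) = 0 := by
    push_cast; ring
  rw [this, Complex.exp_zero]; ring

lemma crankDenom_zero_ne_zero {τ : ℂ} (hτ : 0 < τ.im) : crankDenom 0 τ ≠ 0 := by
  rw [crankDenom_zero]
  exact mul_ne_zero (Complex.exp_ne_zero _) (pow_ne_zero _ (ModularForm.eta_ne_zero hτ))

/-- The triple product identity with an unspecified constant: the completed product is entire with
the quasi-periods that characterise the theta function. The constant is nonzero because the left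
side has derivative π · `crankDenom 0 τ` ≠ 0 at z = 0. -/
lemma sin_mul_crankDenom {τ : ℂ} (hτ : 0 < τ.im) :
    ∃ C : ℂ, C ≠ 0 ∧ ∀ z, Complex.sin (Real.pi * z) * crankDenom z τ = C * thetaOdd z τ := by
  have hq := norm_nome_lt_one hτ
  let f : ℂ → ℂ := fun z => (1 - cexp (-(2 * Real.pi * I * z))) * crankDenom z τ
  have hf : Differentiable ℂ f := by
    have := differentiable_crankDenom hτ
    fun_prop
  obtain ⟨c, hc⟩ := eq_const_mul_theta_of_quasiperiodic hf hτ
    (fun z => by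
      have h1 : cexp (2 * Real.pi * I * (z + 1)) = cexp (2 * Real.pi * I * z) := by
        rw [Complex.exp_eq_exp_iff_exists_int]; exact ⟨1, by push_cast; ring⟩
      simp only [f, crankDenom, h1, Complex.exp_neg])
    (fun z => by
      simp only [f, crankDenom_eq _ hτ]
      have h1 := qPochInf_succ (cexp (2 * Real.pi * I * z) * cexp (2 * Real.pi * I * τ)) hq
      have h2 := qPochInf_succ (cexp (-(2 * Real.pi * I * (z + τ)))) hq
      have h3 : cexp (-(2 * Real.pi * I * (z + τ))) * cexp (2 * Real.pi * I * τ)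
          = cexp (-(2 * Real.pi * I * z)) := by
        rw [← Complex.exp_add]; congr 1; ring
      have h4 : cexp (2 * Real.pi * I * (z + τ))
          = cexp (2 * Real.pi * I * z) * cexp (2 * Real.pi * I * τ) := by
        rw [← Complex.exp_add]; congr 1; ring
      rw [h3] at h2
      rw [h4, h2, h1]
      have h5 : cexp (-(2 * Real.pi * I * (z + τ)))
          * (cexp (2 * Real.pi * I * z) * cexp (2 * Real.pi * I * τ)) = 1 := by
        rw [← h4, ← Complex.exp_add]; simp
      linear_combination (qPochInf (cexp (2 * Real.pi * I * z) * cexp (2 * Real.pi * I * τ)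
        * cexp (2 * Real.pi * I * τ)) (cexp (2 * Real.pi * I * τ))
        * qPochInf (cexp (-(2 * Real.pi * I * z))) (cexp (2 * Real.pi * I * τ))) * (-h5))
  have hsin : ∀ z, Complex.sin (Real.pi * z) * (2 * I)
      = cexp (Real.pi * I * z) * (1 - cexp (-(2 * Real.pi * I * z))) := by
    intro z
    rw [Complex.sin, mul_sub, ← Complex.exp_add, mul_one,
      show Real.pi * I * z + -(2 * Real.pi * I * z) = -(Real.pi * z) * I by ring,
      show Real.pi * I * z = Real.pi * z * I by ring]
    linear_combination (cexp (-(Real.pi * z) * I) - cexp (Real.pi * z * I)) * I_mul_I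
  have hform : ∀ z, Complex.sin (Real.pi * z) * crankDenom z τ
      = c / (2 * I) * cexp (-(Real.pi * I * τ / 4)) * thetaOdd z τ := by
    intro z
    have h1 := hc z
    simp only [f] at h1
    have h2 : cexp (-(Real.pi * I * τ / 4)) * cexp (Real.pi * I * τ / 4 + Real.pi * I * z)
        = cexp (Real.pi * I * z) := by rw [← Complex.exp_add]; congr 1; ring
    have hI : (2 * I) ≠ 0 := by simp
    rw [thetaOdd]
    apply mul_left_cancel₀ hI
    have h3 : 2 * I * (c / (2 * I)) = c := mul_div_cancel₀ _ hI
    linear_combination crankDenom z τ * hsin z + cexp (Real.pi * I * z) * h1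
      - c * jacobiTheta₂ (z + τ / 2 + 1 / 2) τ * h2
      - cexp (-(Real.pi * I * τ / 4)) * cexp (Real.pi * I * τ / 4 + Real.pi * I * z)
        * jacobiTheta₂ (z + τ / 2 + 1 / 2) τ * h3
  refine ⟨_, ?_, hform⟩
  intro h0
  have hder : HasDerivAt (fun z => Complex.sin (Real.pi * z) * crankDenom z τ)
      (Real.pi * crankDenom 0 τ) 0 := by
    have h1 : HasDerivAt (fun z : ℂ => Complex.sin (Real.pi * z)) Real.pi 0 := by
      have := ((hasDerivAt_id (0 : ℂ)).const_mul (Real.pi : ℂ)).csin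
      simpa using this
    have := h1.fun_mul (differentiable_crankDenom hτ 0).hasDerivAt
    simpa using this
  have hz : (fun z => Complex.sin (Real.pi * z) * crankDenom z τ) = fun _ => 0 := by
    ext z; rw [hform, h0, zero_mul]
  rw [hz] at hder
  have := hder.unique (hasDerivAt_const 0 0)
  have hpi : (Real.pi : ℂ) ≠ 0 := by exact_mod_cast Real.pi_ne_zero
  exact mul_ne_zero hpi (crankDenom_zero_ne_zero hτ) this

/-- Modular transformation of the crank denominator under a matrix with rows `(a, b)`, `(c, d)`. -/
theorem crankDenom_transform {a b c d : ℤ} (hdet : a * d - b * c = 1) (hc : 0 < c) {τ : ℂ}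
    (hτ : 0 < τ.im) (hτ' : 0 < ((a * τ + b) / (c * τ + d)).im) (z : ℂ) :
    (c * τ + d) * Complex.sin (Real.pi * (z / (c * τ + d)))
        * crankDenom (z / (c * τ + d)) ((a * τ + b) / (c * τ + d))
      = (c * τ + d) * etaMultiplier a b c d ^ 2
        * cexp (-(2 * Real.pi * I * ((a * τ + b) / (c * τ + d)) / 12) + 2 * Real.pi * I * τ / 12)
        * cexp (Real.pi * I * c * z ^ 2 / (c * τ + d))
        * (Complex.sin (Real.pi * z) * crankDenom z τ) := by
  set w : ℂ := c * τ + d with hw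
  set τ' : ℂ := (a * τ + b) / w with hτ'd
  have hw0 : w ≠ 0 := ne_zero_of_im_pos (im_linear hc d hτ)
  obtain ⟨C, hC0, hC⟩ := sin_mul_crankDenom hτ
  obtain ⟨C', hC0', hC'⟩ := sin_mul_crankDenom hτ'
  have htheta := thetaOdd_isThetaLike.transformsUnder hdet hc
  have heta := eta_isThetaLike.transformsUnder hdet hc 0 τ hτ
  -- The theta law fixes the ratio of the two sides up to a factor R independent of z. Comparing
  -- derivatives at z = 0, where `crankDenom` is an exponential times η², evaluates R, so C and C'
  -- need not be computed.
  obtain ⟨R, hR⟩ : ∃ R : ℂ, ∀ z, Complex.sin (Real.pi * (z / w)) * crankDenom (z / w) τ'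
      = R * cexp (Real.pi * I * c * z ^ 2 / w) * (Complex.sin (Real.pi * z) * crankDenom z τ) := by
    refine ⟨C' * etaMultiplier a b c d ^ 3 * w ^ (1 / 2 : ℂ) / C, fun z => ?_⟩
    have := htheta z τ hτ
    rw [← hw, ← hτ'd, mul_one] at this
    rw [hC', hC, this]
    field_simp
  have hder1 : HasDerivAt (fun z => Complex.sin (Real.pi * (z / w)) * crankDenom (z / w) τ')
      (Real.pi / w * crankDenom 0 τ') 0 := by
    have h1 : HasDerivAt (fun z : ℂ => Complex.sin (Real.pi * (z / w))) (Real.pi / w) 0 := by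
      have := (((hasDerivAt_id (0 : ℂ)).div_const w).const_mul (Real.pi : ℂ)).csin
      simpa [div_eq_mul_inv] using this
    have h2 : DifferentiableAt ℂ (fun z => crankDenom (z / w) τ') 0 :=
      ((differentiable_crankDenom hτ').comp (by fun_prop : Differentiable ℂ fun z => z / w)) 0
    have := h1.fun_mul h2.hasDerivAt
    simpa using this
  have hder2 : HasDerivAt (fun z => R * cexp (Real.pi * I * c * z ^ 2 / w)
      * (Complex.sin (Real.pi * z) * crankDenom z τ)) (R * (Real.pi * crankDenom 0 τ)) 0 := by
    have h1 : HasDerivAt (fun z : ℂ => Complex.sin (Real.pi * z)) Real.pi 0 := by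
      have := ((hasDerivAt_id (0 : ℂ)).const_mul (Real.pi : ℂ)).csin
      simpa using this
    have h2 := h1.fun_mul (differentiable_crankDenom hτ 0).hasDerivAt
    have h3 : DifferentiableAt ℂ (fun z => R * cexp (Real.pi * I * c * z ^ 2 / w)) 0 := by fun_prop
    have := h3.hasDerivAt.fun_mul h2
    simpa using this
  have hRval : Real.pi / w * crankDenom 0 τ' = R * (Real.pi * crankDenom 0 τ) := by
    rw [funext hR] at hder1
    exact hder1.unique hder2
  have hpi : (Real.pi : ℂ) ≠ 0 := by exact_mod_cast Real.pi_ne_zero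
  have heta' : ModularForm.eta τ' ^ 2 = etaMultiplier a b c d ^ 2 * w * ModularForm.eta τ ^ 2 := by
    rw [← hw, ← hτ'd] at heta
    beta_reduce at heta
    rw [heta, mul_pow, mul_pow, mul_pow, cpow_half_sq hw0]
    simp
  have hη : ModularForm.eta τ ≠ 0 := ModularForm.eta_ne_zero hτ
  have hRe : R = etaMultiplier a b c d ^ 2
      * cexp (-(2 * Real.pi * I * τ' / 12) + 2 * Real.pi * I * τ / 12) := by
    rw [crankDenom_zero, crankDenom_zero, heta'] at hRval
    have h5 : cexp (-(2 * Real.pi * I * τ' / 12) + 2 * Real.pi * I * τ / 12)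
        * cexp (-(2 * Real.pi * I * τ / 12)) = cexp (-(2 * Real.pi * I * τ' / 12)) := by
      rw [← Complex.exp_add]; congr 1; ring
    have hne : Real.pi * (cexp (-(2 * Real.pi * I * τ / 12)) * ModularForm.eta τ ^ 2) ≠ 0 :=
      mul_ne_zero hpi (mul_ne_zero (Complex.exp_ne_zero _) (pow_ne_zero _ hη))
    apply mul_right_cancel₀ hne
    rw [← hRval, ← h5]
    field_simp
  rw [mul_assoc, hR, hRe]
  ring

/-! ### Gauss sums from the theta transformation. -/

lemma tsum_int_eq_sum_residues {f : ℤ → ℂ} (hf : Summable f) (c : ℕ) (hc : 0 < c) :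
    ∑' n, f n = ∑ s ∈ Finset.range c, ∑' j : ℤ, f (s + c * j) := by
  have : NeZero c := ⟨hc.ne'⟩
  let e := (Equiv.prodComm (Fin c) ℤ).trans (Int.divModEquiv c).symm
  have he : ∀ p : Fin c × ℤ, e p = (p.1 : ℕ) + c * p.2 := by
    intro p
    simp only [e, Equiv.trans_apply, Equiv.prodComm_apply, Int.divModEquiv_symm_apply, Prod.fst_swap,
      Prod.snd_swap]
    ring
  have h1 : Summable fun p : Fin c × ℤ => f (e p) := (Equiv.summable_iff _).mpr hf
  rw [← e.tsum_eq f, h1.tsum_prod' (fun b => h1.prod_factor b), tsum_fintype, Finset.sum_range]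
  simp_rw [he]

lemma fourier_series_unique {A B : ℤ → ℂ} (hA : Summable A) (hB : Summable B)
    (h : ∀ x : ℝ, ∑' n : ℤ, A n * cexp (2 * Real.pi * I * n * x)
      = ∑' n : ℤ, B n * cexp (2 * Real.pi * I * n * x)) : A = B := by
  have hint : ∀ k : ℤ, ∫ x in (0 : ℝ)..1, cexp (2 * Real.pi * I * k * x) = if k = 0 then 1 else 0 := by
    intro k
    split_ifs with hk
    · simp [hk]
    · have hne : 2 * Real.pi * I * k ≠ 0 := by
        simp [Real.pi_ne_zero, hk]
      rw [integral_exp_mul_complex hne]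
      simp only [ofReal_one, mul_one, ofReal_zero, mul_zero, Complex.exp_zero]
      rw [cexp_two_pi_int, sub_self, zero_div]
  have hnorm : ∀ (k : ℤ) (x : ℝ), ‖cexp (2 * Real.pi * I * k * x)‖ = 1 := by
    intro k x
    rw [show 2 * Real.pi * I * k * x = ((2 * Real.pi * k * x : ℝ) : ℂ) * I by push_cast; ring,
      Complex.norm_exp_ofReal_mul_I]
  have key : ∀ {A : ℤ → ℂ}, Summable A → ∀ m : ℤ, ∫ x in (0 : ℝ)..1,
      (∑' n : ℤ, A n * cexp (2 * Real.pi * I * n * x)) * cexp (2 * Real.pi * I * (-m : ℤ) * x)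
        = A m := by
    intro A hA m
    have h1 : ∀ x : ℝ, (∑' n : ℤ, A n * cexp (2 * Real.pi * I * n * x))
        * cexp (2 * Real.pi * I * (-m : ℤ) * x)
        = ∑' n : ℤ, A n * cexp (2 * Real.pi * I * (n - m : ℤ) * x) := by
      intro x
      rw [← tsum_mul_right]
      refine tsum_congr fun n => ?_
      rw [mul_assoc, ← Complex.exp_add]; congr 2; push_cast; ring
    simp_rw [h1]
    let F : ℤ → C(ℝ, ℂ) := fun n => ⟨fun x => A n * cexp (2 * Real.pi * I * (n - m : ℤ) * x),
      by fun_prop⟩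
    have hF := intervalIntegral.tsum_intervalIntegral_eq_of_summable_norm (a := 0) (b := 1)
      (f := F) (by
        refine Summable.of_nonneg_of_le (fun _ => norm_nonneg _) (fun n => ?_) hA.norm
        rw [ContinuousMap.norm_le _ (norm_nonneg _)]
        intro x
        simp only [F, ContinuousMap.restrict_apply, ContinuousMap.coe_mk, norm_mul, hnorm, mul_one, le_refl])
    simp only [F, ContinuousMap.coe_mk] at hF
    rw [← hF]
    simp_rw [intervalIntegral.integral_const_mul, hint]
    rw [tsum_eq_single m]
    · simp
    · intro n hn; simp [sub_eq_zero, hn]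
  ext m
  rw [← key hA m, ← key hB m]
  exact intervalIntegral.integral_congr fun x _ => by simp only [h x]

lemma thetaOdd_eq_tsum (z τ : ℂ) : thetaOdd z τ = ∑' n : ℤ,
    (-1 : ℂ) ^ n * cexp (Real.pi * I * τ * (n + 1 / 2) ^ 2 + 2 * Real.pi * I * (n + 1 / 2) * z) := by
  rw [thetaOdd, jacobiTheta₂, ← tsum_mul_left]
  refine tsum_congr fun n => ?_
  rw [jacobiTheta₂_term, ← Complex.exp_pi_mul_I, ← Complex.exp_int_mul, ← Complex.exp_add,
    ← Complex.exp_add]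
  congr 1; ring

lemma summable_thetaOdd (z : ℂ) {τ : ℂ} (h : 0 < τ.im) : Summable fun n : ℤ =>
    (-1 : ℂ) ^ n * cexp (Real.pi * I * τ * (n + 1 / 2) ^ 2 + 2 * Real.pi * I * (n + 1 / 2) * z) := by
  have := ((summable_jacobiTheta₂_term_iff (z + τ / 2 + 1 / 2) τ).mpr h).mul_left
    (cexp (Real.pi * I * τ / 4 + Real.pi * I * z))
  refine this.congr fun n => ?_
  rw [jacobiTheta₂_term, ← Complex.exp_pi_mul_I, ← Complex.exp_int_mul, ← Complex.exp_add,
    ← Complex.exp_add]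
  congr 1; ring

/-- Poisson summation; the alternating sign moves the dual lattice to ℤ + 1/2. -/
lemma tsum_alternating_gaussian {c : ℝ} (hc : 0 < c) (t : ℂ) :
    ∑' j : ℤ, (-1 : ℂ) ^ j * cexp (-Real.pi * c * (j + t) ^ 2)
      = 1 / (c : ℂ) ^ (1 / 2 : ℂ) * ∑' n : ℤ, cexp (-Real.pi / c * (n + 1 / 2) ^ 2
        - 2 * Real.pi * I * t * (n + 1 / 2)) := by
  have hc' : (c : ℂ) ≠ 0 := by exact_mod_cast hc.ne'
  have h := Complex.tsum_exp_neg_quadratic (a := c) (by simpa using hc) (-c * t + I / 2)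
  rw [← (Equiv.neg ℤ).tsum_eq (fun n : ℤ => cexp (-Real.pi / c * (n + I * (-c * t + I / 2)) ^ 2))] at h
  have h1 : ∀ j : ℤ, (-1 : ℂ) ^ j * cexp (-Real.pi * c * (j + t) ^ 2) = cexp (-Real.pi * c * t ^ 2)
      * cexp (-Real.pi * c * j ^ 2 + 2 * Real.pi * (-c * t + I / 2) * j) := by
    intro j
    rw [← Complex.exp_pi_mul_I, ← Complex.exp_int_mul, ← Complex.exp_add, ← Complex.exp_add]
    congr 1; ring
  have h2 : ∀ n : ℤ, cexp (-Real.pi * c * t ^ 2)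
      * cexp (-Real.pi / c * (((Equiv.neg ℤ) n : ℤ) + I * (-c * t + I / 2)) ^ 2)
      = cexp (-Real.pi / c * (n + 1 / 2) ^ 2 - 2 * Real.pi * I * t * (n + 1 / 2)) := by
    intro n
    rw [← Complex.exp_add]
    congr 1
    simp only [Equiv.neg_apply]; push_cast
    field_simp
    ring_nf
    simp only [I_sq, show I ^ 3 = -I by rw [pow_succ, I_sq]; ring, I_pow_four]
    ring
  simp_rw [h1, ← h2]
  rw [tsum_mul_left, tsum_mul_left, h]
  ring

/-- Modulo 2 the total exponent of -1 is j(a + c + ac) = j((1 + a)(1 + c) - 1), and (1 + a)(1 + c)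
is even because a and c are not both even. -/
lemma phase_add_mul {a b c d : ℤ} (hdet : a * d - b * c = 1) (hc : 0 < c) (s j : ℤ) :
    (-1 : ℂ) ^ (s + c * j) * cexp (Real.pi * I * (a / c) * ((s + c * j : ℤ) + 1 / 2) ^ 2)
      = (-1) ^ j * ((-1) ^ s * cexp (Real.pi * I * (a / c) * (s + 1 / 2) ^ 2)) := by
  have hc' : (c : ℂ) ≠ 0 := by exact_mod_cast hc.ne'
  have hpar : Even ((1 + a) * (1 + c)) := by
    rcases Int.even_or_odd a with ha | ha
    · rcases Int.even_or_odd c with hcc | hcc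
      · exfalso
        have : Even (1 : ℤ) := by
          rw [← hdet]; exact (ha.mul_right d).sub (hcc.mul_left b)
        exact absurd this (by decide)
      · exact (odd_one.add_odd hcc).mul_left _
    · exact (odd_one.add_odd ha).mul_right _
  obtain ⟨m, hm⟩ := hpar
  have e1 : Real.pi * I * (a / c) * ((s + c * j : ℤ) + 1 / 2) ^ 2
      = ((a * (j * (2 * s + 1) + c * j ^ 2) : ℤ) : ℂ) * (Real.pi * I)
        + Real.pi * I * (a / c) * (s + 1 / 2) ^ 2 := by
    push_cast; field_simp; ring
  rw [e1, Complex.exp_add, Complex.exp_int_mul, Complex.exp_pi_mul_I, ← mul_assoc, ← mul_assoc,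
    ← zpow_add₀ (by norm_num), ← zpow_add₀ (by norm_num)]
  congr 1
  have e2 : ∀ x y : ℤ, Even (x - y) → (-1 : ℂ) ^ x = (-1) ^ y := by
    intro x y h
    rw [show x = (x - y) + y by ring, zpow_add₀ (by norm_num), h.neg_one_zpow, one_mul]
  apply e2
  rcases Int.even_or_odd' (j * (j - 1)) with ⟨p, hp⟩
  rcases hp with hp | hp
  · refine ⟨m * j - j + a * j * s + a * c * p, ?_⟩
    linear_combination hm * j + a * c * hp
  · exact absurd (Int.even_mul_pred_self j) (by rw [hp]; simp)

/-- The quadratic Gauss sum produced by the theta transformation, with its multiplier. -/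
theorem gauss_sum_theta {a b c d : ℤ} (hdet : a * d - b * c = 1) (hc : 0 < c) (n : ℤ) :
    etaMultiplier a b c d ^ 3 * I ^ (1 / 2 : ℂ) * (c : ℂ) ^ (1 / 2 : ℂ) * ((-1) ^ n
        * cexp (-(Real.pi * I * (d / c) * (n + 1 / 2) ^ 2)))
      = ∑ s ∈ Finset.range c.toNat, (-1 : ℂ) ^ s * cexp (Real.pi * I * (a / c) * (s + 1 / 2) ^ 2)
        * cexp (-(2 * Real.pi * I * (n + 1 / 2) * (s + 1 / 2) / c)) := by
  have hc' : (c : ℂ) ≠ 0 := by exact_mod_cast hc.ne'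
  have hcR : (0 : ℝ) < c := by exact_mod_cast hc
  obtain ⟨C, rfl⟩ : ∃ C : ℕ, c = C := ⟨c.toNat, by omega⟩
  have hC : 0 < C := by omega
  set χ := etaMultiplier a b C d
  -- This point satisfies Cτ + d = i and is mapped to (a + i)/C, so both sides of the theta law
  -- carry Gaussians of the same width.
  set τ : ℂ := -(d / (C : ℤ)) + I / (C : ℤ) with hτdef
  have hτ : 0 < τ.im := by
    have : τ = ((-(d / C) : ℝ) : ℂ) + ((1 / C : ℝ) : ℂ) * I := by rw [hτdef]; push_cast; ring
    rw [this]; simp; exact_mod_cast hC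
  have hden : (C : ℤ) * τ + d = I := by rw [hτdef]; field_simp; ring
  have hM : (a * τ + b) / ((C : ℤ) * τ + d) = a / (C : ℤ) + I / (C : ℤ) := by
    rw [hden, hτdef]
    have hd : (a * d - b * (C : ℤ) : ℂ) = 1 := by exact_mod_cast hdet
    field_simp
    linear_combination (-1 : ℂ) * hd - I_sq
  have hM' : 0 < ((a : ℂ) / (C : ℤ) + I / (C : ℤ)).im := by
    have : (a : ℂ) / (C : ℤ) + I / (C : ℤ) = ((a / C : ℝ) : ℂ) + ((1 / C : ℝ) : ℂ) * I := by
      push_cast; ring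
    rw [this]; simp; exact_mod_cast hC
  set G : ℤ → ℂ := fun n => cexp (-(Real.pi * (n + 1 / 2) ^ 2 / (C : ℤ)))
  set α : ℤ → ℂ := fun s => (-1) ^ s * cexp (Real.pi * I * (a / (C : ℤ)) * (s + 1 / 2) ^ 2)
  set β : ℤ → ℂ := fun n => (-1) ^ n * cexp (-(Real.pi * I * (d / (C : ℤ)) * (n + 1 / 2) ^ 2))
  set σ : ℤ → ℂ := fun n => ∑ s ∈ Finset.range C,
    α s * cexp (-(2 * Real.pi * I * (n + 1 / 2) * (s + 1 / 2) / (C : ℤ)))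
  have hGsum : Summable fun n => ‖G n‖ := by
    have := (summable_thetaOdd 0 (τ := I / (C : ℤ)) (by
      rw [show I / ((C : ℤ) : ℂ) = ((1 / C : ℝ) : ℂ) * I by push_cast; ring]
      simp; exact_mod_cast hC)).norm
    refine this.congr fun n => ?_
    rw [norm_mul, norm_zpow, norm_neg, norm_one, one_zpow, one_mul]
    simp only [G]
    congr 2
    linear_combination (Real.pi : ℂ) * (n + 1 / 2) ^ 2 / (C : ℤ) * I_sq
  have hβ : ∀ n, ‖β n‖ = 1 := by
    intro n
    simp only [β]
    rw [norm_mul, norm_zpow, norm_neg, norm_one, one_zpow, one_mul,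
      show -(Real.pi * I * (d / (C : ℤ)) * ((n : ℂ) + 1 / 2) ^ 2)
        = ((-(Real.pi * (d / C) * (n + 1 / 2) ^ 2) : ℝ) : ℂ) * I by push_cast; ring,
      Complex.norm_exp_ofReal_mul_I]
  have hα : ∀ n, ‖α n‖ = 1 := by
    intro n
    simp only [α]
    rw [norm_mul, norm_zpow, norm_neg, norm_one, one_zpow, one_mul,
      show (Real.pi * I * (a / (C : ℤ)) * ((n : ℂ) + 1 / 2) ^ 2)
        = (((Real.pi * (a / C) * (n + 1 / 2) ^ 2) : ℝ) : ℂ) * I by push_cast; ring,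
      Complex.norm_exp_ofReal_mul_I]
  have hσ : ∀ n, ‖σ n‖ ≤ C := by
    intro n
    refine (norm_sum_le _ _).trans ?_
    refine (Finset.sum_le_sum fun s _ => ?_).trans (b := ∑ s ∈ Finset.range C, (1 : ℝ)) (by simp)
    rw [norm_mul, hα, show -(2 * Real.pi * I * ((n : ℂ) + 1 / 2) * (s + 1 / 2) / (C : ℤ))
        = ((-(2 * Real.pi * (n + 1 / 2) * (s + 1 / 2) / C) : ℝ) : ℂ) * I by push_cast; ring,
      Complex.norm_exp_ofReal_mul_I, one_mul]
  -- Both sides of the theta law are Fourier series in the real variable x with the common weight G.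
  -- Poisson summation in each residue class modulo C produces the finite sum σ on one side; the
  -- other has the single phase β. Equating coefficients evaluates σ.
  have key : ∀ x : ℝ, ∑' n : ℤ, (1 / ((C : ℤ) : ℂ) ^ (1 / 2 : ℂ) * G n * σ n)
        * cexp (2 * Real.pi * I * n * x)
      = ∑' n : ℤ, (χ ^ 3 * I ^ (1 / 2 : ℂ) * G n * β n) * cexp (2 * Real.pi * I * n * x) := by
    intro x
    have htr := thetaOdd_isThetaLike.transformsUnder hdet hc x τ hτ
    rw [hM, hden, thetaOdd_eq_tsum, thetaOdd_eq_tsum, tsum_int_eq_sum_residues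
      (summable_thetaOdd _ hM') C hC] at htr
    have hx : cexp (Real.pi * I * 1 * (C : ℤ) * x ^ 2 / I) ≠ 0 := Complex.exp_ne_zero _
    have hR : ∑' n : ℤ, (χ ^ 3 * I ^ (1 / 2 : ℂ) * G n * β n) * cexp (2 * Real.pi * I * n * x)
        = cexp (-(Real.pi * I * x)) * (χ ^ 3 * I ^ (1 / 2 : ℂ)
          * ∑' n : ℤ, (-1 : ℂ) ^ n * cexp (Real.pi * I * τ * (n + 1 / 2) ^ 2
            + 2 * Real.pi * I * (n + 1 / 2) * x)) := by
      rw [← tsum_mul_left, ← tsum_mul_left]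
      refine tsum_congr fun n => ?_
      have : cexp (-(Real.pi * I * x)) * cexp (Real.pi * I * τ * (n + 1 / 2) ^ 2
            + 2 * Real.pi * I * (n + 1 / 2) * x) = G n
            * cexp (-(Real.pi * I * (d / (C : ℤ)) * (n + 1 / 2) ^ 2))
            * cexp (2 * Real.pi * I * n * x) := by
        simp only [G]
        rw [← Complex.exp_add, ← Complex.exp_add, ← Complex.exp_add]
        congr 1
        rw [hτdef]
        linear_combination (Real.pi : ℂ) * (n + 1 / 2) ^ 2 / (C : ℤ) * I_sq
      simp only [β]
      linear_combination (-(χ ^ 3 * I ^ (1 / 2 : ℂ) * (-1) ^ n)) * this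
    have hL : ∑' n : ℤ, (1 / ((C : ℤ) : ℂ) ^ (1 / 2 : ℂ) * G n * σ n)
        * cexp (2 * Real.pi * I * n * x)
        = cexp (-(Real.pi * I * x)) * (cexp (-(Real.pi * (C : ℤ) * x ^ 2))
          * ∑ s ∈ Finset.range C, ∑' j : ℤ, (-1 : ℂ) ^ ((s : ℤ) + (C : ℤ) * j)
            * cexp (Real.pi * I * (a / (C : ℤ) + I / (C : ℤ))
                * ((((s : ℤ) + (C : ℤ) * j : ℤ) : ℂ) + 1 / 2) ^ 2
              + 2 * Real.pi * I * ((((s : ℤ) + (C : ℤ) * j : ℤ) : ℂ) + 1 / 2) * (x / I))) := by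
      have hcls : ∀ s : ℕ, cexp (-(Real.pi * (C : ℤ) * x ^ 2)) *
          ∑' j : ℤ, (-1 : ℂ) ^ ((s : ℤ) + (C : ℤ) * j)
            * cexp (Real.pi * I * (a / (C : ℤ) + I / (C : ℤ))
                * ((((s : ℤ) + (C : ℤ) * j : ℤ) : ℂ) + 1 / 2) ^ 2
              + 2 * Real.pi * I * ((((s : ℤ) + (C : ℤ) * j : ℤ) : ℂ) + 1 / 2) * (x / I))
          = α s * (1 / ((C : ℤ) : ℂ) ^ (1 / 2 : ℂ) * ∑' n : ℤ,
            cexp (-Real.pi / (C : ℤ) * (n + 1 / 2) ^ 2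
              - 2 * Real.pi * I * (((s : ℤ) + 1 / 2) / (C : ℤ) - x) * (n + 1 / 2))) := by
        intro s
        have hg := tsum_alternating_gaussian hcR (((s : ℤ) + 1 / 2) / (C : ℤ) - x)
        rw [show (((C : ℤ) : ℝ) : ℂ) = ((C : ℤ) : ℂ) by push_cast; ring] at hg
        rw [← hg, ← tsum_mul_left, ← tsum_mul_left]
        refine tsum_congr fun j => ?_
        have hp := phase_add_mul hdet hc (s : ℤ) j
        rw [show Real.pi * I * (a / (C : ℤ) + I / (C : ℤ))
                * ((((s : ℤ) + (C : ℤ) * j : ℤ) : ℂ) + 1 / 2) ^ 2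
              + 2 * Real.pi * I * ((((s : ℤ) + (C : ℤ) * j : ℤ) : ℂ) + 1 / 2) * (x / I)
            = Real.pi * I * (a / (C : ℤ)) * ((((s : ℤ) + (C : ℤ) * j : ℤ) : ℂ) + 1 / 2) ^ 2
              + (-Real.pi * (C : ℤ) * (j + (((s : ℤ) + 1 / 2) / (C : ℤ) - x)) ^ 2
                + Real.pi * (C : ℤ) * x ^ 2) by
            have hcn : (C : ℂ) ≠ 0 := by exact_mod_cast hc'
            push_cast
            field_simp
            linear_combination (2 * ((s : ℂ) + C * j) + 1) ^ 2 * I_sq,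
          Complex.exp_add, Complex.exp_add]
        have hx1 : cexp (-(Real.pi * (C : ℤ) * x ^ 2)) * cexp (Real.pi * (C : ℤ) * x ^ 2) = 1 := by
          rw [← Complex.exp_add]; simp
        simp only [α]
        linear_combination cexp (-Real.pi * (C : ℤ) * (j + (((s : ℤ) + 1 / 2) / (C : ℤ) - x)) ^ 2)
          * (hp + (-1 : ℂ) ^ ((s : ℤ) + (C : ℤ) * j)
            * cexp (Real.pi * I * (a / (C : ℤ)) * ((((s : ℤ) + (C : ℤ) * j : ℤ) : ℂ) + 1 / 2) ^ 2)
            * hx1)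
      rw [Finset.mul_sum, Finset.sum_congr rfl fun s _ => hcls s]
      have hterm : ∀ (s : ℕ) (n : ℤ), cexp (-(Real.pi * I * x)) * (α s
          * (1 / ((C : ℤ) : ℂ) ^ (1 / 2 : ℂ) * cexp (-Real.pi / (C : ℤ) * (n + 1 / 2) ^ 2
              - 2 * Real.pi * I * (((s : ℤ) + 1 / 2) / (C : ℤ) - x) * (n + 1 / 2))))
          = 1 / ((C : ℤ) : ℂ) ^ (1 / 2 : ℂ) * G n
            * (α s * cexp (-(2 * Real.pi * I * (n + 1 / 2) * (s + 1 / 2) / (C : ℤ))))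
            * cexp (2 * Real.pi * I * n * x) := by
        intro s n
        have : cexp (-(Real.pi * I * x)) * cexp (-Real.pi / (C : ℤ) * (n + 1 / 2) ^ 2
              - 2 * Real.pi * I * (((s : ℤ) + 1 / 2) / (C : ℤ) - x) * (n + 1 / 2))
            = G n * cexp (-(2 * Real.pi * I * (n + 1 / 2) * (s + 1 / 2) / (C : ℤ)))
              * cexp (2 * Real.pi * I * n * x) := by
          simp only [G]
          rw [← Complex.exp_add, ← Complex.exp_add, ← Complex.exp_add]
          congr 1
          push_cast
          ring
        linear_combination (α s * (1 / ((C : ℤ) : ℂ) ^ (1 / 2 : ℂ))) * this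
      have hsum : ∀ s ∈ Finset.range C, Summable fun n : ℤ =>
          1 / ((C : ℤ) : ℂ) ^ (1 / 2 : ℂ) * G n
            * (α s * cexp (-(2 * Real.pi * I * (n + 1 / 2) * (s + 1 / 2) / (C : ℤ))))
            * cexp (2 * Real.pi * I * n * x) := by
        intro s _
        refine Summable.of_norm ((hGsum.mul_left ‖1 / ((C : ℤ) : ℂ) ^ (1 / 2 : ℂ)‖).congr
          fun n => ?_)
        rw [norm_mul _ (cexp (2 * Real.pi * I * n * x)), norm_mul _ (α s * _), norm_mul (α s), hα,
          show 2 * Real.pi * I * n * x = ((2 * Real.pi * n * x : ℝ) : ℂ) * I by push_cast; ring,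
          show -(2 * Real.pi * I * ((n : ℂ) + 1 / 2) * (s + 1 / 2) / (C : ℤ))
            = ((-(2 * Real.pi * (n + 1 / 2) * (s + 1 / 2) / C) : ℝ) : ℂ) * I by push_cast; ring,
          Complex.norm_exp_ofReal_mul_I, Complex.norm_exp_ofReal_mul_I, mul_one, mul_one, mul_one,
          norm_mul]
      rw [Finset.mul_sum]
      refine Eq.trans ?_ ((Summable.tsum_finsetSum hsum).trans (Finset.sum_congr rfl fun s _ => ?_))
      · refine tsum_congr fun n => ?_
        simp only [σ]
        rw [Finset.mul_sum, Finset.sum_mul]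
      · rw [← tsum_mul_left, ← tsum_mul_left, ← tsum_mul_left]
        exact (tsum_congr fun n => hterm s n).symm
    rw [hL, hR, htr]
    have hx1 : cexp (-(Real.pi * (C : ℤ) * x ^ 2)) * cexp (Real.pi * I * 1 * (C : ℤ) * x ^ 2 / I)
        = 1 := by
      rw [← Complex.exp_add, show -(Real.pi * (C : ℤ) * x ^ 2)
        + Real.pi * I * 1 * (C : ℤ) * x ^ 2 / I = (0 : ℂ) by field_simp; ring, Complex.exp_zero]
    linear_combination cexp (-(Real.pi * I * x)) * (χ ^ 3 * I ^ (1 / 2 : ℂ)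
          * ∑' n : ℤ, (-1 : ℂ) ^ n * cexp (Real.pi * I * τ * (n + 1 / 2) ^ 2
            + 2 * Real.pi * I * (n + 1 / 2) * x)) * hx1
  have hAB := fourier_series_unique ?_ ?_ key
  · have hn := congrFun hAB n
    have hG : G n ≠ 0 := Complex.exp_ne_zero _
    have hs : ((C : ℤ) : ℂ) ^ (1 / 2 : ℂ) ≠ 0 := cpow_half_ne_zero hc'
    have : σ n = χ ^ 3 * I ^ (1 / 2 : ℂ) * ((C : ℤ) : ℂ) ^ (1 / 2 : ℂ) * β n := by
      have h2 : G n * σ n = G n * (χ ^ 3 * I ^ (1 / 2 : ℂ) * ((C : ℤ) : ℂ) ^ (1 / 2 : ℂ) * β n) := by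
        field_simp at hn
        linear_combination G n * hn
      exact mul_left_cancel₀ hG h2
    simp only [σ, β] at this
    rw [Int.toNat_natCast, ← this]
    simp only [α]
    refine Finset.sum_congr rfl fun s _ => ?_
    push_cast
    rw [zpow_natCast]
  · refine Summable.of_norm ?_
    refine Summable.of_nonneg_of_le (fun _ => norm_nonneg _) (fun n => ?_)
      (hGsum.mul_left (‖1 / ((C : ℤ) : ℂ) ^ (1 / 2 : ℂ)‖ * C))
    rw [norm_mul, norm_mul]
    nlinarith [mul_le_mul_of_nonneg_left (hσ n)
      (mul_nonneg (norm_nonneg (1 / ((C : ℤ) : ℂ) ^ (1 / 2 : ℂ))) (norm_nonneg (G n)))]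
  · refine Summable.of_norm ?_
    refine (hGsum.mul_left (‖χ ^ 3 * I ^ (1 / 2 : ℂ)‖)).congr fun n => ?_
    rw [norm_mul _ (β n), hβ, mul_one, norm_mul _ (G n)]

/-! ### Reduction of `calV1` to a signed Gaussian sum. -/

/-- This is the false theta function after completing the square. The indices n + 1/3 never vanish,
so the sign is always ±1; the parameter y carries the elliptic variable. -/
noncomputable def signedGaussSum (a y : ℂ) : ℂ :=
  ∑' n : ℤ, (Real.sign ((n : ℝ) + 1 / 3) : ℂ)
    * cexp (-Real.pi * a * (n + 1 / 3) ^ 2 + 2 * Real.pi * I * (n + 1 / 3) * y)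

lemma norm_sign_le_one (x : ℝ) : ‖(Real.sign x : ℂ)‖ ≤ 1 := by
  rcases Real.sign_apply_eq x with h | h | h <;> rw [h] <;> simp

lemma signedGauss_term_eq (a y : ℂ) (n : ℤ) :
    cexp (-Real.pi * a * (n + 1 / 3) ^ 2 + 2 * Real.pi * I * (n + 1 / 3) * y)
      = cexp (-Real.pi * a / 9 + 2 * Real.pi * I * y / 3)
        * jacobiTheta₂_term n (y + I * a / 3) (I * a) := by
  rw [jacobiTheta₂_term, ← Complex.exp_add]
  congr 1
  linear_combination (-(Real.pi : ℂ) * a * n ^ 2 - 2 * Real.pi * n * a / 3) * I_sq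

lemma summable_signedGauss {a : ℂ} (ha : 0 < a.re) (y : ℂ) : Summable fun n : ℤ =>
    (Real.sign ((n : ℝ) + 1 / 3) : ℂ)
      * cexp (-Real.pi * a * (n + 1 / 3) ^ 2 + 2 * Real.pi * I * (n + 1 / 3) * y) := by
  have h := ((summable_jacobiTheta₂_term_iff (y + I * a / 3) (I * a)).mpr (by simpa using ha)).norm
  refine Summable.of_norm (Summable.of_nonneg_of_le (fun _ => norm_nonneg _) (fun n => ?_)
    (h.mul_left ‖cexp (-Real.pi * a / 9 + 2 * Real.pi * I * y / 3)‖))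
  rw [signedGauss_term_eq, norm_mul, norm_mul]
  exact mul_le_of_le_one_left (by positivity) (norm_sign_le_one _)

lemma differentiable_signedGaussSum {a : ℂ} (ha : 0 < a.re) :
    Differentiable ℂ (signedGaussSum a) := by
  intro y₀
  set w : ℂ → ℂ := fun y => y + I * a / 3
  have h1 : DifferentiableOn ℂ (fun y => ∑' n : ℤ, (Real.sign ((n : ℝ) + 1 / 3) : ℂ)
      * jacobiTheta₂_term n (w y) (I * a)) (w ⁻¹' {z : ℂ | |z.im| < |(w y₀).im| + 1}) := by
    refine Complex.differentiableOn_tsum_of_summable_norm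
      (u := fun n : ℤ => Real.exp (-Real.pi * (a.re * n ^ 2 - 2 * (|(w y₀).im| + 1) * |n|)))
      ?_ ?_ ?_ ?_
    · simpa using! summable_pow_mul_jacobiTheta₂_term_bound (|(w y₀).im| + 1) ha 0
    · intro n
      simp only [w, jacobiTheta₂_term]
      fun_prop
    · refine IsOpen.preimage (by fun_prop) ?_
      exact isOpen_lt (by fun_prop) continuous_const
    · intro n y hy
      rw [norm_mul]
      refine (mul_le_of_le_one_left (norm_nonneg _) (norm_sign_le_one _)).trans ?_
      exact norm_jacobiTheta₂_term_le ha (le_of_lt hy) (by simp) n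
  have h2 : DifferentiableAt ℂ (fun y => ∑' n : ℤ, (Real.sign ((n : ℝ) + 1 / 3) : ℂ)
      * jacobiTheta₂_term n (w y) (I * a)) y₀ := by
    refine h1.differentiableAt (IsOpen.mem_nhds ?_ ?_)
    · refine IsOpen.preimage (by fun_prop) ?_
      exact isOpen_lt (by fun_prop) continuous_const
    · simp
  have h3 : signedGaussSum a = fun y => cexp (-Real.pi * a / 9 + 2 * Real.pi * I * y / 3)
      * ∑' n : ℤ, (Real.sign ((n : ℝ) + 1 / 3) : ℂ) * jacobiTheta₂_term n (w y) (I * a) := by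
    ext y
    rw [signedGaussSum, ← tsum_mul_left]
    refine tsum_congr fun n => ?_
    rw [signedGauss_term_eq]; ring
  rw [h3]
  fun_prop

/-- The point of ℤ + 1/3 nearest to 0 is 1/3. -/
lemma sign_shift {t : ℝ} (h : |t| < 1 / 3) (n : ℤ) :
    Real.sign ((n : ℝ) + 1 / 3 + t) = Real.sign ((n : ℝ) + 1 / 3) := by
  rw [abs_lt] at h
  rcases le_or_gt 0 n with hn | hn
  · have : (0 : ℝ) ≤ n := by exact_mod_cast hn
    rw [Real.sign_of_pos (by linarith), Real.sign_of_pos (by linarith)]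
  · have : (n : ℝ) ≤ -1 := by exact_mod_cast (by omega : n ≤ -1)
    rw [Real.sign_of_neg (by linarith), Real.sign_of_neg (by linarith)]

lemma crankStar_div_eta (z : ℂ) {τ : ℂ} (hτ : 0 < τ.im) :
    crankStar z τ / ModularForm.eta τ = cexp (-(2 * Real.pi * I * τ / 12)) / crankDenom z τ := by
  have h1 : ModularForm.eta τ = cexp (2 * Real.pi * I * τ / 24)
      * qPochInf (cexp (2 * Real.pi * I * τ)) (cexp (2 * Real.pi * I * τ)) := by
    have e1 : Function.Periodic.qParam 24 τ = cexp (2 * Real.pi * I * τ / 24) := by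
      rw [Function.Periodic.qParam]; push_cast; rfl
    have e2 : ∏' n, (1 - ModularForm.eta_q n τ)
        = qPochInf (cexp (2 * Real.pi * I * τ)) (cexp (2 * Real.pi * I * τ)) := by
      refine tprod_congr fun n => ?_
      rw [ModularForm.eta_q_eq_cexp, ← Complex.exp_nat_mul, ← Complex.exp_add]
      congr 2; ring
    rw [ModularForm.eta, e1, e2]
  have h2 := ModularForm.eta_ne_zero hτ
  have h3 : qPochInf (cexp (2 * Real.pi * I * τ)) (cexp (2 * Real.pi * I * τ)) ≠ 0 := by
    intro h; rw [h1, h, mul_zero] at h2; exact h2 rfl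
  rw [h1, crankStar, crankGen, show -(2 * Real.pi * I * τ / 12)
    = -(2 * Real.pi * I * τ / 24) - 2 * Real.pi * I * τ / 24 by ring, Complex.exp_sub]
  change _ * (_ / crankDenom z τ) / _ = _
  have := Complex.exp_ne_zero (2 * Real.pi * I * τ / 24)
  field_simp

/-- Completing the square: 3τ m² - τ m = 3τ((m - 1/6)² - 1/36), so the half-integers m become
elements of ℤ + 1/3. The bound on Im z keeps the argument of the sign within 1/3 of n + 1/3. -/
lemma falseTheta_eq {z τ : ℂ} (hτ : 0 < τ.im) (hz : |z.im| < 2 / 3 * τ.im) :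
    falseTheta (3 * z - τ + 1 / 2) (6 * τ) = -(cexp (-(2 * Real.pi * I * τ / 12))
      * cexp (Real.pi * I * z) * signedGaussSum (-(6 * I * τ)) (3 * z)) := by
  rw [falseTheta, signedGaussSum, ← tsum_mul_left, ← tsum_mul_left, ← tsum_neg]
  refine tsum_congr fun n => ?_
  have him : (3 * z - τ + 1 / 2).im / (6 * τ).im = -(1 / 6) + z.im / (2 * τ.im) := by
    simp
    field_simp
    ring
  have hs : Real.sign ((n : ℝ) + 1 / 2 + (3 * z - τ + 1 / 2).im / (6 * τ).im)
      = Real.sign ((n : ℝ) + 1 / 3) := by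
    rw [him, ← sign_shift (t := z.im / (2 * τ.im)) _ n]
    · congr 1; ring
    · rw [abs_div, abs_of_pos (by linarith : 0 < 2 * τ.im), div_lt_iff₀ (by linarith)]
      linarith
  rw [hs]
  have e1 : cexp (2 * Real.pi * I * (6 * τ) * ((n : ℂ) + 1 / 2) ^ 2 / 2)
      * cexp (2 * Real.pi * I * (3 * z - τ + 1 / 2) * ((n : ℂ) + 1 / 2))
      = cexp (-(2 * Real.pi * I * τ / 12)) * cexp (Real.pi * I * z)
        * cexp (-Real.pi * -(6 * I * τ) * (n + 1 / 3) ^ 2 + 2 * Real.pi * I * (n + 1 / 3) * (3 * z))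
        * ((-1) ^ n * I) := by
    rw [← Complex.exp_pi_mul_I, ← Complex.exp_int_mul]
    nth_rw 8 [← Complex.exp_pi_div_two_mul_I]
    simp only [← Complex.exp_add]
    congr 1
    ring
  have e2 : ((-1 : ℂ) ^ n) ^ 2 = 1 := by
    rw [← zpow_natCast, ← zpow_mul, mul_comm, zpow_mul]; norm_num
  linear_combination ((Real.sign ((n : ℝ) + 1 / 3) : ℝ) : ℂ) * I * (-1) ^ n * e1
    + ((Real.sign ((n : ℝ) + 1 / 3) : ℝ) : ℂ) * cexp (-(2 * Real.pi * I * τ / 12)) * cexp (Real.pi * I * z)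
        * cexp (-Real.pi * -(6 * I * τ) * (n + 1 / 3) ^ 2 + 2 * Real.pi * I * (n + 1 / 3) * (3 * z))
        * (I ^ 2 * e2 + I_sq)

/-- The sign in the false theta function depends on Im z but is constant near z = 0, so the
derivatives at 0 are those of a holomorphic function. -/
lemma calV1_eventuallyEq {τ : ℂ} (hτ : 0 < τ.im) :
    (fun z => calV1 z τ) =ᶠ[nhds 0] fun z => cexp (-(2 * Real.pi * I * τ / 12)) / crankDenom z τ
      * signedGaussSum (-(6 * I * τ)) (3 * z) := by
  have : ∀ᶠ z : ℂ in nhds 0, |z.im| < 2 / 3 * τ.im := by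
    refine IsOpen.mem_nhds (isOpen_lt (by fun_prop) continuous_const) ?_
    simpa using hτ
  filter_upwards [this] with z hz
  rw [calV1, crankStar_div_eta z hτ, falseTheta_eq hτ hz]
  have e1 : cexp (2 * Real.pi * I * τ / 12) * cexp (-(2 * Real.pi * I * τ / 12)) = 1 := by
    rw [← Complex.exp_add]; simp
  have e2 : cexp (-(2 * Real.pi * I * z / 2)) * cexp (Real.pi * I * z) = 1 := by
    rw [← Complex.exp_add, ← Complex.exp_zero]; congr 1; ring
  linear_combination cexp (-(2 * Real.pi * I * τ / 12)) / crankDenom z τ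
      * signedGaussSum (-(6 * I * τ)) (3 * z) * (cexp (-(2 * Real.pi * I * z / 2))
        * cexp (Real.pi * I * z) * e1 + e2)

/-! ### Unimodularity of the multiplier, and the matrices attached to a cusp. -/

lemma norm_kroneckerSymbol {a n : ℤ} (hn : n ≠ 0) (h : Int.gcd a n = 1) :
    ‖(kroneckerSymbol a n : ℂ)‖ = 1 := by
  have hpm : ∀ {x : ℤ}, x = 1 ∨ x = -1 → ‖(x : ℂ)‖ = 1 := by
    rintro x (rfl | rfl) <;> simp
  rw [kroneckerSymbol, if_neg hn]
  push_cast
  rw [norm_mul, norm_mul, norm_pow]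
  have h1 : ‖(if n < 0 ∧ a < 0 then (-1 : ℂ) else 1)‖ = 1 := by split_ifs <;> simp
  have h2 : ‖((jacobiSym a (n.natAbs / 2 ^ padicValNat 2 n.natAbs) : ℤ) : ℂ)‖ = 1 := by
    refine hpm (jacobiSym.eq_one_or_neg_one ?_)
    have hd : n.natAbs / 2 ^ padicValNat 2 n.natAbs ∣ n.natAbs :=
      Nat.div_dvd_of_dvd pow_padicValNat_dvd
    rw [Int.gcd_eq_natAbs] at h ⊢
    exact Nat.Coprime.coprime_dvd_right (by rw [Int.natAbs_natCast]; exact hd) h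
  have h3 : ‖((ZMod.χ₈ (a : ZMod 8) : ℤ) : ℂ)‖ ^ padicValNat 2 n.natAbs = 1 := by
    rcases Nat.eq_zero_or_pos (padicValNat 2 n.natAbs) with h0 | h0
    · rw [h0, pow_zero]
    · have h2n : 2 ∣ n.natAbs := dvd_of_one_le_padicValNat h0
      have hodd : a % 2 ≠ 0 := by
        intro ha
        have : 2 ∣ Int.gcd a n := Int.dvd_gcd (by omega) (by omega)
        omega
      rw [hpm, one_pow]
      rw [ZMod.χ₈_int_eq_if_mod_eight, if_neg hodd]
      split_ifs <;> simp
  rw [h1, h2, h3, one_mul, one_mul]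

lemma norm_etaMultiplier {a b c d : ℤ} (hdet : a * d - b * c = 1) (hc : 0 < c) :
    ‖etaMultiplier a b c d‖ = 1 := by
  have hg : Int.gcd d c = 1 := by
    rw [← Int.isCoprime_iff_gcd_eq_one]
    exact ⟨a, -b, by linarith⟩
  have hexp : ∀ n : ℤ, ‖cexp (Real.pi * I / 12 * n)‖ = 1 := fun n => norm_root24 n
  rw [etaMultiplier]
  split_ifs with ho
  · rw [norm_mul, norm_kroneckerSymbol (by positivity) (by rwa [abs_of_pos hc]), one_mul,
      ← hexp ((a + d) * c - b * d * (c ^ 2 - 1) - 3 * c)]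
    push_cast; rfl
  · have hd : d ≠ 0 := by
      rintro rfl
      rw [Int.gcd_zero_left] at hg
      exact ho ⟨0, by omega⟩
    rw [norm_mul, norm_kroneckerSymbol hd (by rwa [Int.gcd_comm]), one_mul,
      ← hexp (a * c * (1 - d ^ 2) + d * (b - c + 3) - 3)]
    push_cast; rfl

section matrix

lemma dvd_mul_negInv_add_one {h : ℤ} {k : ℕ} (hk : 0 < k) (hhk : Int.gcd h k = 1) :
    (k : ℤ) ∣ h * negInv h k + 1 := by
  have := (negInv_spec h k hk hhk).2.dvd
  rwa [show (1 : ℤ) - -h * negInv h k = h * negInv h k + 1 by ring] at this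

lemma det_negInv {h : ℤ} {k : ℕ} (hk : 0 < k) (hhk : Int.gcd h k = 1) :
    (negInv h k : ℤ) * (-h) - (-((h * negInv h k + 1) / k)) * k = 1 := by
  have := Int.ediv_mul_cancel (dvd_mul_negInv_add_one hk hhk)
  linarith

lemma norm_etaMultiplierAt {h : ℤ} {k : ℕ} (hk : 0 < k) (hhk : Int.gcd h k = 1) :
    ‖etaMultiplierAt h k‖ = 1 :=
  norm_etaMultiplier (det_negInv hk hhk) (by exact_mod_cast hk)

lemma etaMultiplierAt_ne_zero {h : ℤ} {k : ℕ} (hk : 0 < k) (hhk : Int.gcd h k = 1) :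
    etaMultiplierAt h k ≠ 0 := by
  rw [← norm_ne_zero_iff, norm_etaMultiplierAt hk hhk]; norm_num

lemma bigK_mul_gcd (k : ℕ) : bigK k * Nat.gcd k 6 = k :=
  Nat.div_mul_cancel (Nat.gcd_dvd_left k 6)

lemma bigH_mul_gcd (h : ℤ) (k : ℕ) : bigH h k * (Nat.gcd k 6 : ℤ) = 6 * h :=
  Int.ediv_mul_cancel (Dvd.dvd.mul_right (by exact_mod_cast Nat.gcd_dvd_right k 6) h)

lemma gcd_six_pos (k : ℕ) : 0 < Nat.gcd k 6 := Nat.gcd_pos_of_pos_right k (by norm_num)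

lemma bigK_pos {k : ℕ} (hk : 0 < k) : 0 < bigK k := by
  have := bigK_mul_gcd k
  exact Nat.pos_of_ne_zero fun h => by rw [h] at this; omega

lemma gcd_bigH_bigK {h : ℤ} {k : ℕ} (hhk : Int.gcd h k = 1) :
    Int.gcd (bigH h k) (bigK k) = 1 := by
  have hg := gcd_six_pos k
  obtain ⟨m, hm⟩ := Nat.gcd_dvd_right k 6
  have hH : bigH h k = m * h := by
    have h1 := bigH_mul_gcd h k
    have h2 : (6 : ℤ) = Nat.gcd k 6 * m := by exact_mod_cast hm
    have h3 : (Nat.gcd k 6 : ℤ) ≠ 0 := by exact_mod_cast hg.ne'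
    apply mul_right_cancel₀ h3
    linear_combination h1 + h * h2
  have hcop := Nat.coprime_div_gcd_div_gcd hg
  have hm' : 6 / Nat.gcd k 6 = m := Nat.div_eq_of_eq_mul_right hg hm
  rw [hm'] at hcop
  rw [hH, ← Int.isCoprime_iff_gcd_eq_one]
  refine IsCoprime.mul_left (Nat.isCoprime_iff_coprime.mpr hcop.symm) ?_
  have h4 : IsCoprime h (k : ℤ) := Int.isCoprime_iff_gcd_eq_one.mpr hhk
  exact h4.of_isCoprime_of_dvd_right (Dvd.intro (Nat.gcd k 6 : ℤ) (by exact_mod_cast bigK_mul_gcd k))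

end matrix

/-! ### Finite Fourier expansion at the cusp. -/

/-- The frequencies of the finite Fourier expansion of `m ↦ e^{6πi(h/k)m²}`, `m ∈ ℤ + 1/3`. -/
noncomputable def frequency (h : ℤ) (k : ℕ) (s : ℤ) : ℂ :=
  ((s : ℂ) + 1 / 2) / bigK k + (bigH h k : ℂ) / (6 * bigK k) - 1 / 2

/-- The coefficients of the finite Fourier expansion of `m ↦ e^{6πi(h/k)m²}`, `m ∈ ℤ + 1/3`. -/
noncomputable def fourierCoefficient (h : ℤ) (k : ℕ) (s : ℤ) : ℂ :=
  -I / (etaMultiplierAt (bigH h k) (bigK k) ^ 3 * I ^ (1 / 2 : ℂ) * (bigK k : ℂ) ^ (1 / 2 : ℂ))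
    * ((-1) ^ s * cexp (Real.pi * I * (negInv (bigH h k) (bigK k) / bigK k) * (s + 1 / 2) ^ 2))
    * cexp (Real.pi * I * bigH h k / (36 * bigK k)) * cexp (-(Real.pi * I * frequency h k s / 3))

/-- Since 6h/k = H/K, this is `gauss_sum_theta` for the matrix with lower row (K, -H), which expands
e^{πi(H/K)(n+1/2)²}. Passing from n + 1/2 to n + 1/3 only adds a linear phase, which is absorbed
into the frequencies. -/
lemma quadratic_phase_expansion {h : ℤ} {k : ℕ} (hk : 0 < k) (hhk : Int.gcd h k = 1) (n : ℤ) :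
    cexp (6 * Real.pi * I * (h / k) * (n + 1 / 3) ^ 2) = ∑ s ∈ Finset.range (bigK k),
      fourierCoefficient h k s * cexp (-(2 * Real.pi * I * (n + 1 / 3) * frequency h k s)) := by
  have hK := bigK_pos hk
  have hHK := gcd_bigH_bigK (h := h) (k := k) hhk
  have hg := gauss_sum_theta (det_negInv hK hHK) (by exact_mod_cast hK) n
  change etaMultiplierAt (bigH h k) (bigK k) ^ 3 * _ * _ * _ = _ at hg
  rw [Int.toNat_natCast] at hg
  set χ := etaMultiplierAt (bigH h k) (bigK k)
  have hχ : χ ≠ 0 := etaMultiplierAt_ne_zero hK hHK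
  have hK0 : (bigK k : ℂ) ≠ 0 := by exact_mod_cast hK.ne'
  have hk0 : (k : ℂ) ≠ 0 := by exact_mod_cast hk.ne'
  have h1 : I ^ (1 / 2 : ℂ) ≠ 0 := cpow_half_ne_zero I_ne_zero
  have h2 : (bigK k : ℂ) ^ (1 / 2 : ℂ) ≠ 0 := cpow_half_ne_zero hK0
  have hrat : (6 * h / k : ℂ) = bigH h k / bigK k := by
    have e1 : (bigH h k : ℂ) * Nat.gcd k 6 = 6 * h := by exact_mod_cast bigH_mul_gcd h k
    have e2 : (bigK k : ℂ) * Nat.gcd k 6 = k := by exact_mod_cast bigK_mul_gcd k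
    rw [div_eq_div_iff hk0 hK0, ← e1, ← e2]; ring
  have e2 : ((-1 : ℂ) ^ n) ^ 2 = 1 := by
    rw [← zpow_natCast, ← zpow_mul, mul_comm, zpow_mul]; norm_num
  set D := χ ^ 3 * I ^ (1 / 2 : ℂ) * (bigK k : ℂ) ^ (1 / 2 : ℂ) with hD
  have hD0 : D ≠ 0 := by positivity
  -- (n + 1/3)² = (n + 1/2)² - (n + 1/2)/3 + 1/36.
  have h3 : cexp (6 * Real.pi * I * (h / k) * (n + 1 / 3) ^ 2)
      = cexp (-(Real.pi * I * ((-bigH h k : ℤ) / (bigK k : ℤ)) * (n + 1 / 2) ^ 2))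
        * cexp (-(Real.pi * I * (bigH h k / bigK k) * (n + 1 / 2) / 3)
          + Real.pi * I * bigH h k / (36 * bigK k)) := by
    rw [← Complex.exp_add, show 6 * Real.pi * I * (h / k) * ((n : ℂ) + 1 / 3) ^ 2
      = Real.pi * I * (6 * h / k) * (n + 1 / 3) ^ 2 by ring, hrat]
    congr 1
    push_cast
    field_simp
    ring
  have h4 : D * cexp (6 * Real.pi * I * (h / k) * (n + 1 / 3) ^ 2)
      = ∑ s ∈ Finset.range (bigK k), D * (fourierCoefficient h k s
        * cexp (-(2 * Real.pi * I * (n + 1 / 3) * frequency h k s))) := by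
    rw [h3, ← mul_assoc]
    have : D * cexp (-(Real.pi * I * ((-bigH h k : ℤ) / (bigK k : ℤ)) * (n + 1 / 2) ^ 2))
        = (-1) ^ n * ∑ s ∈ Finset.range (bigK k), (-1 : ℂ) ^ s
          * cexp (Real.pi * I * (negInv (bigH h k) (bigK k) / bigK k) * (s + 1 / 2) ^ 2)
          * cexp (-(2 * Real.pi * I * (n + 1 / 2) * (s + 1 / 2) / bigK k)) := by
      have hg' := congrArg (fun x => (-1 : ℂ) ^ n * x) hg
      simp only [Int.cast_natCast] at hg' ⊢
      rw [← hg', hD]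
      linear_combination (-(χ ^ 3 * I ^ (1 / 2 : ℂ) * (bigK k : ℂ) ^ (1 / 2 : ℂ)) *
        cexp (-(Real.pi * I * ((-bigH h k : ℤ) / (bigK k : ℂ)) * (n + 1 / 2) ^ 2))) * e2
    rw [this, Finset.mul_sum, Finset.sum_mul]
    refine Finset.sum_congr rfl fun s _ => ?_
    have e3 : cexp (-(Real.pi * I * frequency h k s / 3))
        * cexp (-(2 * Real.pi * I * (n + 1 / 3) * frequency h k s))
        = cexp (-(2 * Real.pi * I * (n + 1 / 2) * (s + 1 / 2) / bigK k))
          * cexp (-(Real.pi * I * (bigH h k / bigK k) * (n + 1 / 2) / 3)) * ((-1) ^ n * I) := by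
      rw [show ((-1) ^ n * I : ℂ) = cexp (n * (Real.pi * I) + Real.pi / 2 * I) by
        rw [Complex.exp_add, Complex.exp_int_mul, Complex.exp_pi_mul_I,
          Complex.exp_pi_div_two_mul_I]]
      simp only [← Complex.exp_add, frequency]
      congr 1
      push_cast
      field_simp
      ring
    rw [Complex.exp_add, fourierCoefficient, ← hD, zpow_natCast]
    have e4 : D * (-I / D) = -I := by field_simp
    push_cast at e3 ⊢
    linear_combination (-((-1) ^ s
      * cexp (Real.pi * I * (negInv (bigH h k) (bigK k) / bigK k) * (s + 1 / 2) ^ 2)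
      * cexp (Real.pi * I * bigH h k / (36 * bigK k)))) * (-I * e3
      + cexp (-(Real.pi * I * frequency h k s / 3))
        * cexp (-(2 * Real.pi * I * (n + 1 / 3) * frequency h k s)) * e4)
      + ((-1) ^ s
      * cexp (Real.pi * I * (negInv (bigH h k) (bigK k) / bigK k) * (s + 1 / 2) ^ 2)
      * cexp (Real.pi * I * bigH h k / (36 * bigK k))
      * cexp (-(2 * Real.pi * I * (n + 1 / 2) * (s + 1 / 2) / bigK k))
          * cexp (-(Real.pi * I * (bigH h k / bigK k) * (n + 1 / 2) / 3)) * (-1) ^ n) * I_sq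
  rw [← Finset.mul_sum] at h4
  exact mul_left_cancel₀ hD0 h4

lemma norm_fourierCoefficient {h : ℤ} {k : ℕ} (hk : 0 < k) (hhk : Int.gcd h k = 1) (s : ℤ) :
    ‖fourierCoefficient h k s‖ = 1 / Real.sqrt (bigK k) := by
  have hK := bigK_pos hk
  have hsq : ‖(bigK k : ℂ) ^ (1 / 2 : ℂ)‖ = Real.sqrt (bigK k) := by
    rw [Real.sqrt_eq_rpow, ← ofReal_natCast, Complex.norm_cpow_eq_rpow_re_of_pos (by exact_mod_cast hK)]
    norm_num
  have hI : ‖I ^ (1 / 2 : ℂ)‖ = 1 := by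
    rw [cpow_half_eq I_ne_zero, Complex.log_I, Complex.norm_exp]
    simp
  have hre : frequency h k s = ((((s : ℝ) + 1 / 2) / bigK k + (bigH h k : ℝ) / (6 * bigK k) - 1 / 2 : ℝ) : ℂ) := by
    rw [frequency]; push_cast; rfl
  rw [fourierCoefficient, hre]
  have e1 : Real.pi * I * (negInv (bigH h k) (bigK k) / bigK k) * ((s : ℂ) + 1 / 2) ^ 2
    = ((Real.pi * (negInv (bigH h k) (bigK k) / bigK k) * (s + 1 / 2) ^ 2 : ℝ) : ℂ) * I := by
    push_cast; ring
  have e2 : Real.pi * I * bigH h k / (36 * bigK k)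
    = ((Real.pi * bigH h k / (36 * bigK k) : ℝ) : ℂ) * I := by push_cast; ring
  have e3 : ∀ x : ℝ, -(Real.pi * I * (x : ℂ) / 3) = ((-(Real.pi * x / 3) : ℝ) : ℂ) * I := by
    intro x; push_cast; ring
  rw [e1, e2, e3]
  simp only [norm_mul, norm_div, norm_pow, Complex.norm_exp_ofReal_mul_I, hsq, hI,
    norm_etaMultiplierAt hK (gcd_bigH_bigK hhk), norm_zpow, norm_neg, norm_one, one_zpow, norm_I]
  simp

lemma frequency_add (h : ℤ) {k : ℕ} (hk : 0 < k) (s : ℤ) :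
    frequency h k (s + bigK k) = frequency h k s + 1 := by
  have hK0 : (bigK k : ℂ) ≠ 0 := by exact_mod_cast (bigK_pos hk).ne'
  rw [frequency, frequency]; push_cast; field_simp; ring

/-- The coefficients alone are only quasi-periodic. Their cube root of unity is compensated by
`signedGaussSum_sub_one`, since the frequency moves by 1 and the indices lie in ℤ + 1/3. -/
lemma fourierCoefficient_add {h : ℤ} {k : ℕ} (hk : 0 < k) (hhk : Int.gcd h k = 1) (s : ℤ) :
    fourierCoefficient h k (s + bigK k) = cexp (2 * Real.pi * I / 3) * fourierCoefficient h k s := by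
  have hK := bigK_pos hk
  have hp := phase_add_mul (det_negInv hK (gcd_bigH_bigK (h := h) (k := k) hhk))
    (by exact_mod_cast hK) s 1
  rw [mul_one, zpow_one] at hp
  rw [fourierCoefficient, frequency_add h hk]
  simp only [Int.cast_natCast] at hp
  rw [hp, fourierCoefficient]
  have e1 : cexp (-(Real.pi * I * (frequency h k s + 1) / 3))
      = -(cexp (2 * Real.pi * I / 3) * cexp (-(Real.pi * I * frequency h k s / 3))) := by
    rw [neg_eq_neg_one_mul (cexp _ * _), ← Complex.exp_pi_mul_I, ← Complex.exp_add,
      ← Complex.exp_add, Complex.exp_eq_exp_iff_exists_int]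
    exact ⟨-1, by push_cast; ring⟩
  rw [e1]
  ring

lemma signedGaussSum_sub_one (a y : ℂ) :
    cexp (2 * Real.pi * I / 3) * signedGaussSum a (y - 1) = signedGaussSum a y := by
  rw [signedGaussSum, signedGaussSum, ← tsum_mul_left]
  refine tsum_congr fun n => ?_
  rw [mul_left_comm, ← Complex.exp_add]
  congr 1
  rw [Complex.exp_eq_exp_iff_exists_int]
  exact ⟨-n, by push_cast; ring⟩

lemma sum_range_int_periodic {M : Type*} [AddCommMonoid M] {F : ℤ → M} {n : ℕ}
    (hF : ∀ s, F (s + n) = F s) (j : ℤ) :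
    ∑ i ∈ Finset.range n, F (i - j) = ∑ i ∈ Finset.range n, F i := by
  have step : ∀ G : ℤ → M, (∀ s, G (s + n) = G s) →
      ∑ i ∈ Finset.range n, G (i + 1) = ∑ i ∈ Finset.range n, G i := by
    intro G hG
    rcases n with _ | n
    · simp
    rw [Finset.sum_range_succ, Finset.sum_range_succ']
    congr 1
    simpa using hG 0
  induction j using Int.induction_on with
  | zero => simp
  | succ j ih =>
    rw [← ih, ← step (fun i => F (i - (j + 1)))]
    · refine Finset.sum_congr rfl fun i _ => ?_
      congr 1; ring
    · intro s; rw [← hF (s - (j + 1))]; congr 1; ring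
  | pred j ih =>
    rw [← ih, ← step (fun i => F (i - -j))]
    · refine Finset.sum_congr rfl fun i _ => ?_
      congr 1; ring
    · intro s; rw [← hF (s - -j)]; congr 1; ring

/-- The false theta function near the cusp `h/k` as a finite combination of Gaussian sums. -/
lemma signedGaussSum_cusp {h : ℤ} {k : ℕ} (hk : 0 < k) (hhk : Int.gcd h k = 1) (μ : ℤ) {Z : ℂ}
    (hZ : 0 < Z.re) (y : ℂ) :
    signedGaussSum (-(6 * I * ((h : ℂ) / k + I * Z / k))) y
      = ∑ ν ∈ Finset.range (bigK k), fourierCoefficient h k (ν - μ)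
          * signedGaussSum (6 * Z / k) (y - frequency h k (ν - μ)) := by
  have ha : 0 < (6 * Z / k).re := by
    rw [show 6 * Z / k = ((6 / k : ℝ) : ℂ) * Z by push_cast; ring, re_ofReal_mul]
    positivity
  rw [sum_range_int_periodic (F := fun s => fourierCoefficient h k s
          * signedGaussSum (6 * Z / k) (y - frequency h k s))]
  · simp only [signedGaussSum, ← tsum_mul_left]
    rw [← Summable.tsum_finsetSum]
    · refine tsum_congr fun n => ?_
      have : cexp (-Real.pi * -(6 * I * ((h : ℂ) / k + I * Z / k)) * (n + 1 / 3) ^ 2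
          + 2 * Real.pi * I * (n + 1 / 3) * y) = cexp (6 * Real.pi * I * (h / k) * (n + 1 / 3) ^ 2)
          * cexp (-Real.pi * (6 * Z / k) * (n + 1 / 3) ^ 2 + 2 * Real.pi * I * (n + 1 / 3) * y) := by
        rw [← Complex.exp_add]
        congr 1
        linear_combination (6 * Real.pi * (Z / k) * ((n : ℂ) + 1 / 3) ^ 2) * I_sq
      rw [this, quadratic_phase_expansion hk hhk, Finset.sum_mul, Finset.mul_sum]
      refine Finset.sum_congr rfl fun s _ => ?_
      have e : cexp (-(2 * Real.pi * I * (n + 1 / 3) * frequency h k s))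
          * cexp (-Real.pi * (6 * Z / k) * (n + 1 / 3) ^ 2 + 2 * Real.pi * I * (n + 1 / 3) * y)
          = cexp (-Real.pi * (6 * Z / k) * (n + 1 / 3) ^ 2
            + 2 * Real.pi * I * (n + 1 / 3) * (y - frequency h k s)) := by
        rw [← Complex.exp_add]; congr 1; ring
      rw [mul_assoc, e]; ring
    · intro s _
      exact (summable_signedGauss ha _).mul_left _
  · intro s
    rw [fourierCoefficient_add hk hhk, frequency_add h hk, mul_assoc, mul_left_comm,
      show y - (frequency h k s + 1) = y - frequency h k s - 1 by ring, signedGaussSum_sub_one]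

/-! ### Poisson-type formula for the signed Gaussian sum. -/

/-- Theta inversion for the derivative in the elliptic variable. It treats the weight m instead of
sgn(m); the sign is recovered afterwards by integrating over a parameter. -/
lemma hasSum_gaussian_moment {a : ℂ} (ha : 0 < a.re) (y : ℂ) :
    (Summable fun n : ℤ => cexp (2 * Real.pi * I / 3) ^ n * ((y - n)
      * cexp (-(Real.pi / a * (y - n) ^ 2)))) ∧
    HasSum (fun n : ℤ => ((n : ℂ) + 1 / 3)
        * cexp (-Real.pi * a * (n + 1 / 3) ^ 2 + 2 * Real.pi * I * (n + 1 / 3) * y))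
      (I / (a ^ (1 / 2 : ℂ) * a) * ∑' n : ℤ, cexp (2 * Real.pi * I / 3) ^ n * ((y - n)
        * cexp (-(Real.pi / a * (y - n) ^ 2)))) := by
  have ha0 : a ≠ 0 := by rintro rfl; simp at ha
  have hpi : (Real.pi : ℂ) ≠ 0 := by exact_mod_cast Real.pi_ne_zero
  set z := y + I * a / 3 with hz
  set τ := I * a with hτd
  have hτ : 0 < τ.im := by simpa [hτd] using ha
  have hτ0 : τ ≠ 0 := ne_zero_of_im_pos hτ
  have hτ' : 0 < (-1 / τ).im := im_neg_one_div hτ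
  have e1 : -I * τ = a := by rw [hτd]; linear_combination (-a) * I_sq
  have f1 := jacobiTheta₂'_functional_equation z τ
  have f2 := jacobiTheta₂_functional_equation z τ
  rw [e1] at f1 f2
  set X := cexp (-Real.pi * I * z ^ 2 / τ) with hX
  set P := cexp (-Real.pi * a / 9 + 2 * Real.pi * I * y / 3) with hP
  have hPX : ∀ n : ℤ, P * X * jacobiTheta₂_term n (z / τ) (-1 / τ)
      = cexp (2 * Real.pi * I / 3) ^ n * cexp (-(Real.pi / a * (y - n) ^ 2)) := by
    intro n
    rw [hP, hX, jacobiTheta₂_term, ← Complex.exp_int_mul, ← Complex.exp_add, ← Complex.exp_add,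
      ← Complex.exp_add]
    congr 1
    rw [hτd, hz]
    field_simp
    linear_combination (-9 * a ^ 2) * I_sq
  have h1 := hasSum_jacobiTheta₂'_term (z / τ) hτ'
  have h2 := hasSum_jacobiTheta₂_term (z / τ) hτ'
  have h3 : HasSum (fun n : ℤ => cexp (2 * Real.pi * I / 3) ^ n * ((y - n)
      * cexp (-(Real.pi / a * (y - n) ^ 2)))) (P * X * (y * jacobiTheta₂ (z / τ) (-1 / τ)
        - 1 / (2 * Real.pi * I) * jacobiTheta₂' (z / τ) (-1 / τ))) := by
    refine ((h2.mul_left y).sub (h1.mul_left (1 / (2 * Real.pi * I)))).mul_left (P * X)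
      |>.congr_fun fun n => ?_
    rw [jacobiTheta₂'_term]
    have := hPX n
    generalize jacobiTheta₂_term n (z / τ) (-1 / τ) = T at this ⊢
    rw [show 1 / (2 * Real.pi * I) * (2 * Real.pi * I * n * T) = n * T by
      have hI := I_ne_zero
      field_simp]
    linear_combination (-(y - n)) * this
  refine ⟨h3.summable, ?_⟩
  rw [h3.tsum_eq]
  have g1 := hasSum_jacobiTheta₂'_term z hτ
  have g2 := hasSum_jacobiTheta₂_term z hτ
  have h4 := ((g1.mul_left (1 / (2 * Real.pi * I))).add (g2.mul_left (1 / 3))).mul_left P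
  have h5 : P * (1 / (2 * Real.pi * I) * jacobiTheta₂' z τ + 1 / 3 * jacobiTheta₂ z τ)
      = I / (a ^ (1 / 2 : ℂ) * a) * (P * X * (y * jacobiTheta₂ (z / τ) (-1 / τ)
        - 1 / (2 * Real.pi * I) * jacobiTheta₂' (z / τ) (-1 / τ))) := by
    rw [f1, f2]
    generalize jacobiTheta₂ (z / τ) (-1 / τ) = T
    generalize jacobiTheta₂' (z / τ) (-1 / τ) = T'
    have := cpow_half_ne_zero ha0
    have hI := I_ne_zero
    have hzy : z - τ / 3 = y := by rw [hz]; ring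
    have hτi : I * τ = -a := by rw [hτd]; linear_combination a * I_sq
    rw [← hzy]
    field_simp
    linear_combination (P * X * (3 * T' - 2 * Real.pi * I * (3 * z - τ) * T)) * hτi
  rw [← h5]
  refine h4.congr_fun fun n => ?_
  rw [signedGauss_term_eq, ← hP, jacobiTheta₂'_term]
  change _ = P * (_ * (_ * jacobiTheta₂_term n z τ) + _) at *
  change (n + 1 / 3) * (P * jacobiTheta₂_term n z τ) = _
  have hI := I_ne_zero
  field_simp

/-- The substitution σ = s/√(1 - s²) has dσ = (1 - s²)^{-3/2} ds and 1/(1 - s²) = 1 + σ², which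
leaves a Gaussian integral over (0, ∞). The resulting factor 1/|m|, multiplied by m, is the sign of
m. -/
lemma integral_inverse_gaussian {a : ℂ} (ha : 0 < a.re) {m : ℝ} (hm : m ≠ 0) :
    MeasureTheory.IntegrableOn (fun s : ℝ => (((1 - s ^ 2) * Real.sqrt (1 - s ^ 2))⁻¹ : ℝ)
      * cexp (-Real.pi * (a / ((1 - s ^ 2 : ℝ) : ℂ)) * m ^ 2)) (Set.Ioo 0 1) ∧
    ∫ s in Set.Ioo (0 : ℝ) 1, (((1 - s ^ 2) * Real.sqrt (1 - s ^ 2))⁻¹ : ℝ)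
      * cexp (-Real.pi * (a / ((1 - s ^ 2 : ℝ) : ℂ)) * m ^ 2)
      = cexp (-Real.pi * a * m ^ 2) / (2 * a ^ (1 / 2 : ℂ) * |m|) := by
  have ha0 : a ≠ 0 := by rintro rfl; simp at ha
  have hm2 : 0 < m ^ 2 := by positivity
  set f : ℝ → ℝ := fun s => s / Real.sqrt (1 - s ^ 2)
  set f' : ℝ → ℝ := fun s => ((1 - s ^ 2) * Real.sqrt (1 - s ^ 2))⁻¹
  set g : ℝ → ℂ := fun σ => cexp (-Real.pi * a * m ^ 2) * cexp (-(Real.pi * a * m ^ 2) * σ ^ 2)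
  have hq : ∀ s ∈ Set.Ioo (0 : ℝ) 1, 0 < 1 - s ^ 2 := fun s hs => by nlinarith [hs.1, hs.2]
  have hder : ∀ s ∈ Set.Ioo (0 : ℝ) 1, HasDerivWithinAt f (f' s) (Set.Ioo 0 1) s := by
    intro s hs
    have h0 := hq s hs
    have h1 : HasDerivAt (fun s : ℝ => 1 - s ^ 2) (-(2 * s)) s := by
      simpa using ((hasDerivAt_id s).fun_pow 2).const_sub 1
    have h2 := (hasDerivAt_id s).fun_div (h1.sqrt h0.ne') (Real.sqrt_pos.mpr h0).ne'
    refine (h2.congr_deriv ?_).hasDerivWithinAt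
    have h3 := Real.sq_sqrt h0.le
    have h4 := Real.sqrt_pos.mpr h0
    simp only [id, f']
    field_simp
    linear_combination (-s ^ 2) * h3
  have hinj : Set.InjOn f (Set.Ioo 0 1) := by
    intro s hs t ht hst
    have h0 := hq s hs
    have h1 := hq t ht
    have h2 : s ^ 2 / (1 - s ^ 2) = t ^ 2 / (1 - t ^ 2) := by
      have := congrArg (fun x => x ^ 2) hst
      simpa only [f, div_pow, Real.sq_sqrt h0.le, Real.sq_sqrt h1.le] using this
    rw [div_eq_div_iff h0.ne' h1.ne'] at h2
    exact (pow_left_inj₀ hs.1.le ht.1.le two_ne_zero).mp (by linarith)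
  have himg : f '' Set.Ioo 0 1 = Set.Ioi 0 := by
    ext σ
    constructor
    · rintro ⟨s, hs, rfl⟩
      exact div_pos hs.1 (Real.sqrt_pos.mpr (hq s hs))
    · intro hσ
      have hσ' : (0 : ℝ) < σ := hσ
      have h0 : 0 < 1 + σ ^ 2 := by positivity
      have h1 := Real.sqrt_pos.mpr h0
      have h2 := Real.sq_sqrt h0.le
      refine ⟨σ / Real.sqrt (1 + σ ^ 2), ⟨by positivity, ?_⟩, ?_⟩
      · rw [div_lt_one h1]
        exact Real.lt_sqrt_of_sq_lt (by linarith)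
      · have h3 : 1 - (σ / Real.sqrt (1 + σ ^ 2)) ^ 2 = 1 / (1 + σ ^ 2) := by
          rw [div_pow, h2]; field_simp; ring
        simp only [f]
        rw [h3, Real.sqrt_div zero_le_one, Real.sqrt_one]
        field_simp
  have hcongr : ∀ s ∈ Set.Ioo (0 : ℝ) 1, |f' s| • g (f s)
      = (((1 - s ^ 2) * Real.sqrt (1 - s ^ 2))⁻¹ : ℝ)
        * cexp (-Real.pi * (a / ((1 - s ^ 2 : ℝ) : ℂ)) * m ^ 2) := by
    intro s hs
    have h0 := hq s hs
    have h4 := Real.sqrt_pos.mpr h0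
    have hpos : 0 < f' s := by positivity
    rw [abs_of_pos hpos, real_smul]
    congr 1
    simp only [g, f]
    rw [← Complex.exp_add]
    congr 1
    have h5 : ((s / Real.sqrt (1 - s ^ 2) : ℝ) : ℂ) ^ 2 = ((s ^ 2 / (1 - s ^ 2) : ℝ) : ℂ) := by
      rw [← ofReal_pow, div_pow, Real.sq_sqrt h0.le]
    rw [h5]
    have h6 : ((1 - s ^ 2 : ℝ) : ℂ) ≠ 0 := by exact_mod_cast h0.ne'
    push_cast at h6 ⊢
    field_simp
    ring
  have hb : 0 < (Real.pi * a * m ^ 2 : ℂ).re := by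
    rw [show (Real.pi * a * m ^ 2 : ℂ) = ((Real.pi * m ^ 2 : ℝ) : ℂ) * a by push_cast; ring,
      re_ofReal_mul]
    positivity
  have hint : MeasureTheory.IntegrableOn g (Set.Ioi 0) :=
    ((integrable_cexp_neg_mul_sq hb).const_mul _).integrableOn
  have hval : ∫ σ in Set.Ioi (0 : ℝ), g σ = cexp (-Real.pi * a * m ^ 2) / (2 * a ^ (1 / 2 : ℂ) * |m|) := by
    simp only [g]
    rw [MeasureTheory.integral_const_mul, integral_gaussian_complex_Ioi hb]
    have h7 : (Real.pi / (Real.pi * a * m ^ 2) : ℂ) = (((m ^ 2)⁻¹ : ℝ) : ℂ) * a⁻¹ := by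
      have : (Real.pi : ℂ) ≠ 0 := by exact_mod_cast Real.pi_ne_zero
      have : (m : ℂ) ≠ 0 := by exact_mod_cast hm
      push_cast; field_simp
    have h8 : (Real.pi / (Real.pi * a * m ^ 2) : ℂ) ^ (1 / 2 : ℂ) = 1 / (a ^ (1 / 2 : ℂ) * |m|) := by
      have harg : a.arg ≠ Real.pi := by
        have := Complex.abs_arg_lt_pi_div_two_iff.mpr (Or.inl ha)
        intro h
        rw [h, abs_of_pos Real.pi_pos] at this
        linarith [Real.pi_pos]
      rw [h7, cpow_half_eq (mul_ne_zero (by exact_mod_cast (inv_pos.mpr hm2).ne') (inv_ne_zero ha0)),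
        cpow_half_eq ha0, Complex.log_ofReal_mul (inv_pos.mpr hm2) (inv_ne_zero ha0),
        Complex.log_inv _ harg, Real.log_inv, Real.log_pow, ← Real.log_abs]
      have h9 : ((|m| : ℝ) : ℂ) = cexp (Real.log |m|) := by
        rw [← ofReal_exp, Real.exp_log (abs_pos.mpr hm)]
      rw [h9, one_div, ← Complex.exp_add, ← Complex.exp_neg]
      congr 1
      push_cast; ring
    rw [h8]
    ring
  have hchg := MeasureTheory.integral_image_eq_integral_abs_deriv_smul measurableSet_Ioo hder hinj g
  have hchi := (MeasureTheory.integrableOn_image_iff_integrableOn_abs_deriv_smul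
    measurableSet_Ioo hder hinj g).mp (by rwa [himg])
  rw [himg, hval] at hchg
  refine ⟨(MeasureTheory.integrableOn_congr_fun hcongr measurableSet_Ioo).mp hchi, ?_⟩
  rw [hchg]
  exact (MeasureTheory.setIntegral_congr_fun measurableSet_Ioo hcongr).symm

/-- A single term is of size N e^{-cN²q}; with q = 1 - s², integrating over s leaves 1/N, which is
not summable. In the symmetric pair a common Gaussian splits off and 2(η cosh w - N sinh w) with w =
2bqηN remains. As |sinh w| ≤ |w| e^{|w|}, the factor N becomes qN², which the Gaussian absorbs. -/
lemma norm_gaussian_pair_le {b : ℂ} (hb : 0 < b.re) (η : ℂ) : ∃ C c : ℝ, 0 < c ∧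
    ∀ N q : ℝ, 0 ≤ N → 0 ≤ q → q ≤ 1 →
      ‖(η - N) * cexp (-(b * (η - N) ^ 2 * q)) + (η + N) * cexp (-(b * (η + N) ^ 2 * q))‖
        ≤ C * Real.exp (-(c * N ^ 2 * q)) := by
  refine ⟨2 * Real.exp (2 * ‖b‖ * ‖η‖ ^ 2 + 4 * ‖b‖ ^ 2 * ‖η‖ ^ 2 / b.re)
    * (‖η‖ + 8 * ‖b‖ * ‖η‖ / b.re), b.re / 2, by positivity, fun N q hN hq hq1 => ?_⟩
  set w := 2 * b * q * η * N with hw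
  have e1 : (η - N) * cexp (-(b * (η - N) ^ 2 * q)) + (η + N) * cexp (-(b * (η + N) ^ 2 * q))
      = cexp (-(b * q * (η ^ 2 + N ^ 2))) * (2 * (η * Complex.cosh w - N * Complex.sinh w)) := by
    rw [Complex.cosh, Complex.sinh, show -(b * (η - N) ^ 2 * q) = -(b * q * (η ^ 2 + N ^ 2)) + w by
      rw [hw]; ring, show -(b * (η + N) ^ 2 * q) = -(b * q * (η ^ 2 + N ^ 2)) + -w by
      rw [hw]; ring, Complex.exp_add, Complex.exp_add]
    ring
  have hcosh : ‖Complex.cosh w‖ ≤ Real.exp ‖w‖ := by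
    rw [Complex.cosh, norm_div]
    have h1 := Complex.norm_exp_le_exp_norm w
    have h2 := Complex.norm_exp_le_exp_norm (-w)
    rw [norm_neg] at h2
    have := norm_add_le (cexp w) (cexp (-w))
    norm_num
    linarith
  have hsinh : ‖Complex.sinh w‖ ≤ ‖w‖ * Real.exp ‖w‖ := by
    have h1 : ∀ x : ℂ, ‖cexp x - 1‖ ≤ ‖x‖ * Real.exp ‖x‖ := fun x => by
      simpa using Complex.norm_exp_sub_sum_le_norm_mul_exp x 1
    rw [Complex.sinh, norm_div, show cexp w - cexp (-w) = (cexp w - 1) - (cexp (-w) - 1) by ring]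
    have h2 := h1 w
    have h3 := h1 (-w)
    rw [norm_neg] at h3
    have := norm_sub_le (cexp w - 1) (cexp (-w) - 1)
    rw [norm_ofNat, div_le_iff₀ two_pos]
    linarith
  have hwn : ‖w‖ = 2 * ‖b‖ * q * ‖η‖ * N := by
    rw [hw]; simp [abs_of_nonneg hN, abs_of_nonneg hq]
  have hexp : ‖cexp (-(b * q * (η ^ 2 + N ^ 2)))‖ ≤ Real.exp (‖b‖ * ‖η‖ ^ 2 - b.re * q * N ^ 2) := by
    rw [Complex.norm_exp]
    gcongr
    have h1 : (-(b * q * (η ^ 2 + N ^ 2))).re = -(b * q * η ^ 2).re - b.re * q * N ^ 2 := by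
      rw [show -(b * q * (η ^ 2 + N ^ 2)) = -(b * q * η ^ 2) - b * ((q * N ^ 2 : ℝ) : ℂ) by
        push_cast; ring, sub_re, neg_re, re_mul_ofReal]
      ring
    rw [h1]
    have h2 : -(b * q * η ^ 2).re ≤ ‖b‖ * ‖η‖ ^ 2 := by
      have := (abs_le.mp (Complex.abs_re_le_norm (b * q * η ^ 2))).1
      have h3 : ‖b * q * η ^ 2‖ ≤ ‖b‖ * ‖η‖ ^ 2 := by
        rw [norm_mul, norm_mul, norm_pow]
        simp only [norm_real, Real.norm_eq_abs, abs_of_nonneg hq]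
        have := mul_nonneg (norm_nonneg b) (sq_nonneg ‖η‖)
        nlinarith
      linarith
    linarith
  rw [e1, norm_mul, norm_mul, norm_ofNat]
  have h2 : ‖η * Complex.cosh w - N * Complex.sinh w‖
      ≤ (‖η‖ + 2 * ‖b‖ * ‖η‖ * (q * N ^ 2)) * Real.exp ‖w‖ := by
    refine (norm_sub_le _ _).trans ?_
    rw [norm_mul, norm_mul, norm_real, Real.norm_eq_abs, abs_of_nonneg hN]
    have h3 := mul_le_mul_of_nonneg_left hcosh (norm_nonneg η)
    have h4 := mul_le_mul_of_nonneg_left hsinh hN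
    rw [hwn] at h4 h3 ⊢
    linarith
  have hx : 0 ≤ q * N ^ 2 := by positivity
  have h5 : ‖η‖ + 2 * ‖b‖ * ‖η‖ * (q * N ^ 2)
      ≤ (‖η‖ + 8 * ‖b‖ * ‖η‖ / b.re) * Real.exp (b.re / 4 * (q * N ^ 2)) := by
    have h6 := Real.add_one_le_exp (b.re / 4 * (q * N ^ 2))
    have h7 : 1 ≤ Real.exp (b.re / 4 * (q * N ^ 2)) := Real.one_le_exp (by positivity)
    have h8 : 2 * ‖b‖ * ‖η‖ * (q * N ^ 2) = 8 * ‖b‖ * ‖η‖ / b.re * (b.re / 4 * (q * N ^ 2)) := by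
      field_simp; ring
    have h9 : 0 ≤ 8 * ‖b‖ * ‖η‖ / b.re := by positivity
    rw [h8]
    nlinarith [norm_nonneg η, mul_le_mul_of_nonneg_left h6 h9, mul_le_mul_of_nonneg_left h7 (norm_nonneg η)]
  have h10 : ‖w‖ ≤ b.re / 4 * (q * N ^ 2) + 4 * ‖b‖ ^ 2 * ‖η‖ ^ 2 / b.re := by
    rw [hwn]
    have h11 : 2 * ‖b‖ * ‖η‖ * N ≤ b.re / 4 * N ^ 2 + 4 * ‖b‖ ^ 2 * ‖η‖ ^ 2 / b.re := by
      have : b.re / 4 * N ^ 2 + 4 * ‖b‖ ^ 2 * ‖η‖ ^ 2 / b.re - 2 * ‖b‖ * ‖η‖ * N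
          = (b.re * N / 2 - 2 * ‖b‖ * ‖η‖) ^ 2 / b.re := by field_simp; ring
      have : 0 ≤ (b.re * N / 2 - 2 * ‖b‖ * ‖η‖) ^ 2 / b.re := by positivity
      linarith
    have h12 : 0 ≤ 4 * ‖b‖ ^ 2 * ‖η‖ ^ 2 / b.re := by positivity
    nlinarith [mul_le_mul_of_nonneg_left h11 hq]
  calc ‖cexp (-(b * q * (η ^ 2 + N ^ 2)))‖ * (2 * ‖η * Complex.cosh w - N * Complex.sinh w‖)
      ≤ Real.exp (‖b‖ * ‖η‖ ^ 2 - b.re * q * N ^ 2) * (2 * (((‖η‖ + 8 * ‖b‖ * ‖η‖ / b.re)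
        * Real.exp (b.re / 4 * (q * N ^ 2))) * Real.exp (b.re / 4 * (q * N ^ 2)
          + 4 * ‖b‖ ^ 2 * ‖η‖ ^ 2 / b.re))) := by
        gcongr
        exact h2.trans (by gcongr)
    _ = 2 * (Real.exp (‖b‖ * ‖η‖ ^ 2 - b.re * q * N ^ 2) * Real.exp (b.re / 4 * (q * N ^ 2))
        * Real.exp (b.re / 4 * (q * N ^ 2) + 4 * ‖b‖ ^ 2 * ‖η‖ ^ 2 / b.re))
        * (‖η‖ + 8 * ‖b‖ * ‖η‖ / b.re) := by ring
    _ ≤ _ := by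
        rw [← Real.exp_add, ← Real.exp_add, mul_right_comm _ (‖η‖ + _), mul_assoc 2 (Real.exp (2 * _ * _ + _)),
          ← Real.exp_add]
        refine mul_le_mul_of_nonneg_right (mul_le_mul_of_nonneg_left (Real.exp_le_exp.mpr ?_)
          zero_le_two) (by positivity)
        have := mul_nonneg (norm_nonneg b) (sq_nonneg ‖η‖)
        linarith

/-- The error-function type kernel `2bξ ∫₀¹ e^{-bξ²(1-s²)} ds`. -/
noncomputable def errKernel (b ξ : ℂ) : ℂ :=
  2 * b * ξ * ∫ s in (0 : ℝ)..1, cexp (-(b * ξ ^ 2 * ((1 - s ^ 2 : ℝ) : ℂ)))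

lemma hasSum_int_pairs {f : ℤ → ℂ} (hf : Summable f) :
    ∑' n, f n = f 0 + ∑' n : ℕ, (f (n + 1) + f (-(n + 1))) := by
  have h1 : Summable fun n : ℕ => f (n + 1) :=
    hf.comp_injective (i := fun n : ℕ => (n : ℤ) + 1) fun a b h => by simpa using h
  have h2 : Summable fun n : ℕ => f (-(n + 1)) :=
    hf.comp_injective (i := fun n : ℕ => -((n : ℤ) + 1)) fun a b h => by simpa using h
  rw [tsum_of_add_one_of_neg_add_one h1 h2, h1.tsum_add h2]
  ring

lemma cpow_half_ofReal_mul {r : ℝ} (hr : 0 < r) {a : ℂ} (ha : a ≠ 0) :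
    ((r : ℂ) * a) ^ (1 / 2 : ℂ) = Real.sqrt r * a ^ (1 / 2 : ℂ) := by
  have h : ((Real.sqrt r : ℝ) : ℂ) = cexp (Real.log r / 2) := by
    rw [← Real.exp_log (Real.sqrt_pos.mpr hr), Real.log_sqrt hr.le]; push_cast; rfl
  rw [cpow_half_eq (mul_ne_zero (by exact_mod_cast hr.ne') ha), cpow_half_eq ha,
    Complex.log_ofReal_mul hr ha, h, ← Complex.exp_add]
  congr 1; ring

lemma integral_exp_neg_mul_one_sub_le {d : ℝ} (hd : 0 < d) :
    ∫ s in Set.Ioo (0 : ℝ) 1, Real.exp (-(d * (1 - s))) ≤ 1 / d := by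
  rw [← MeasureTheory.integral_Ioc_eq_integral_Ioo, ← intervalIntegral.integral_of_le zero_le_one,
    intervalIntegral.integral_eq_sub_of_hasDerivAt (f := fun s => Real.exp (-(d * (1 - s))) / d)]
  · simp only [sub_self, mul_zero, neg_zero, Real.exp_zero]
    have : 0 ≤ Real.exp (-(d * (1 - 0))) / d := by positivity
    linarith
  · intro x _
    have h1 : HasDerivAt (fun s : ℝ => -(d * (1 - s))) d x := by
      simpa using! (((hasDerivAt_id x).const_sub 1).const_mul d).neg
    refine (h1.exp.div_const d).congr_deriv ?_
    field_simp
  · exact (by fun_prop : Continuous fun s : ℝ => Real.exp (-(d * (1 - s)))).intervalIntegrable _ _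

/-- The false theta function as a Poisson-type series of error-function kernels. -/
theorem signedGaussSum_eq {a : ℂ} (ha : 0 < a.re) (y : ℂ) :
    signedGaussSum a y = I / Real.pi * ∑ r ∈ Finset.range 6, cexp (2 * Real.pi * I / 3) ^ r
      * (errKernel (Real.pi / a) (y - r)
        + ∑' n : ℕ, (errKernel (Real.pi / a) (y - r - 6 * (n + 1))
          + errKernel (Real.pi / a) (y - r + 6 * (n + 1)))) := by
  have ha0 : a ≠ 0 := by rintro rfl; simp at ha
  have hpi : (Real.pi : ℂ) ≠ 0 := by exact_mod_cast Real.pi_ne_zero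
  set b : ℂ := Real.pi / a with hb
  have hb0 : 0 < b.re := by
    rw [hb, div_re, ofReal_re, ofReal_im]
    have := Complex.normSq_pos.mpr ha0
    have := Real.pi_pos
    simp; positivity
  set ω := cexp (2 * Real.pi * I / 3)
  have hq : ∀ s ∈ Set.Ioo (0 : ℝ) 1, 0 < 1 - s ^ 2 := fun s hs => by nlinarith [hs.1, hs.2]
  -- the kernel and its sum over the lattice
  set f : ℂ → ℝ → ℂ := fun x s => x * cexp (-(b * x ^ 2 * ((1 - s ^ 2 : ℝ) : ℂ))) with hf
  set G : ℝ → ℂ := fun s => ∑' n : ℤ, ω ^ n * f (y - n) s with hG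
  -- With A = a/(1 - s²) in place of a, the inversion factor A^{-3/2} cancels the weight (1 -
  -- s²)^{-3/2} of `integral_inverse_gaussian`, so the transformed sum G(s) has no singular weight.
  have hmom : ∀ s ∈ Set.Ioo (0 : ℝ) 1, (Summable fun n : ℤ => ω ^ n * f (y - n) s) ∧
      ∑' n : ℤ, (((1 - s ^ 2) * Real.sqrt (1 - s ^ 2))⁻¹ : ℝ) * (((n : ℂ) + 1 / 3)
        * cexp (-Real.pi * (a / ((1 - s ^ 2 : ℝ) : ℂ)) * (n + 1 / 3) ^ 2
          + 2 * Real.pi * I * (n + 1 / 3) * y)) = I / (a ^ (1 / 2 : ℂ) * a) * G s := by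
    intro s hs
    have h0 := hq s hs
    have hA : a / ((1 - s ^ 2 : ℝ) : ℂ) = (((1 - s ^ 2)⁻¹ : ℝ) : ℂ) * a := by
      push_cast; rw [div_eq_inv_mul]
    have hA0 : 0 < (a / ((1 - s ^ 2 : ℝ) : ℂ)).re := by
      rw [hA, re_ofReal_mul]; positivity
    obtain ⟨h1, h2⟩ := hasSum_gaussian_moment hA0 y
    have hqc : ((1 - s ^ 2 : ℝ) : ℂ) ≠ 0 := by exact_mod_cast h0.ne'
    have h3 : ∀ n : ℤ, (y - n) * cexp (-(Real.pi / (a / ((1 - s ^ 2 : ℝ) : ℂ)) * (y - n) ^ 2))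
        = f (y - n) s := by
      intro n
      simp only [hf, hb]
      congr 2
      field_simp
    simp only [h3] at h1 h2
    change HasSum _ (_ * ∑' n : ℤ, ω ^ n * f (y - n) s) at h2
    refine ⟨h1, ?_⟩
    rw [tsum_mul_left, h2.tsum_eq, hA, cpow_half_ofReal_mul (inv_pos.mpr h0) ha0, Real.sqrt_inv]
    have h5 := (Real.sqrt_pos.mpr h0).ne'
    have h6 : ((Real.sqrt (1 - s ^ 2) : ℝ) : ℂ) ≠ 0 := by exact_mod_cast h5
    have h7 := cpow_half_ne_zero ha0
    rw [ofReal_inv, ofReal_inv, ofReal_inv, ofReal_mul]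
    simp only [hG]
    field_simp
  -- On this side the interchange is absolute: the integral of ‖F n‖ is a constant times ‖T n‖, by
  -- the same Gaussian integral with a replaced by its real part.
  have hleft : ∫ s in Set.Ioo (0 : ℝ) 1, I / (a ^ (1 / 2 : ℂ) * a) * G s
      = signedGaussSum a y / (2 * a ^ (1 / 2 : ℂ)) := by
    set c : ℝ → ℝ := fun s => ((1 - s ^ 2) * Real.sqrt (1 - s ^ 2))⁻¹
    have hm0 : ∀ n : ℤ, ((n : ℝ) + 1 / 3) ≠ 0 := by
      intro n h
      have h1 : (3 * n + 1 : ℝ) = 0 := by linarith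
      have h2 : 3 * n + 1 = 0 := by exact_mod_cast h1
      omega
    set T : ℤ → ℂ := fun n =>
      cexp (-Real.pi * a * (n + 1 / 3) ^ 2 + 2 * Real.pi * I * (n + 1 / 3) * y)
    set F : ℤ → ℝ → ℂ := fun n s => (c s : ℝ) * (((n : ℂ) + 1 / 3)
        * cexp (-Real.pi * (a / ((1 - s ^ 2 : ℝ) : ℂ)) * (n + 1 / 3) ^ 2
          + 2 * Real.pi * I * (n + 1 / 3) * y)) with hF
    set κ : ℤ → ℂ := fun n => (((n : ℝ) + 1 / 3 : ℝ) : ℂ) * cexp (2 * Real.pi * I * (n + 1 / 3) * y)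
    have hFκ : ∀ n s, F n s = κ n * ((c s : ℝ)
        * cexp (-Real.pi * (a / ((1 - s ^ 2 : ℝ) : ℂ)) * ((n + 1 / 3 : ℝ) : ℂ) ^ 2)) := by
      intro n s
      simp only [hF, κ]
      rw [Complex.exp_add]
      push_cast
      ring
    have hTκ : ∀ n, κ n * cexp (-Real.pi * a * ((n + 1 / 3 : ℝ) : ℂ) ^ 2)
        = (((n : ℝ) + 1 / 3 : ℝ) : ℂ) * T n := by
      intro n
      simp only [κ, T]
      rw [Complex.exp_add]
      push_cast
      ring
    have hint : ∀ n, MeasureTheory.Integrable (F n)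
        (MeasureTheory.volume.restrict (Set.Ioo 0 1)) := by
      intro n
      simp_rw [funext (hFκ n)]
      exact (integral_inverse_gaussian ha (hm0 n)).1.const_mul _
    have hnorm : ∀ n, ∫ s in Set.Ioo (0 : ℝ) 1, ‖F n s‖
        = ‖(a.re : ℂ) ^ (1 / 2 : ℂ)‖⁻¹ / 2 * ‖T n‖ := by
      intro n
      have h1 := (integral_inverse_gaussian (a := (a.re : ℂ)) (by simpa using ha) (hm0 n)).2
      have h2 : ∀ s ∈ Set.Ioo (0 : ℝ) 1, ((‖F n s‖ : ℝ) : ℂ) = ‖κ n‖ * ((c s : ℝ)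
          * cexp (-Real.pi * ((a.re : ℂ) / ((1 - s ^ 2 : ℝ) : ℂ)) * ((n + 1 / 3 : ℝ) : ℂ) ^ 2)) := by
        intro s hs
        have h0 := hq s hs
        have h4 := Real.sqrt_pos.mpr h0
        have hc : 0 < c s := by positivity
        rw [hFκ, norm_mul (κ n), norm_mul ((c s : ℝ) : ℂ), norm_real, Real.norm_eq_abs, abs_of_pos hc,
          Complex.norm_exp]
        push_cast
        congr 4
        rw [show -Real.pi * (a / (1 - (s : ℂ) ^ 2)) * ((n : ℂ) + 1 / 3) ^ 2
          = ((-Real.pi / (1 - s ^ 2) * (n + 1 / 3) ^ 2 : ℝ) : ℂ) * a by push_cast; ring, re_ofReal_mul]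
        push_cast; ring
      have h3 : ((∫ s in Set.Ioo (0 : ℝ) 1, ‖F n s‖ : ℝ) : ℂ) = ‖κ n‖
          * (cexp (-Real.pi * a.re * ((n + 1 / 3 : ℝ) : ℂ) ^ 2)
            / (2 * (a.re : ℂ) ^ (1 / 2 : ℂ) * |(n : ℝ) + 1 / 3|)) := by
        rw [← integral_complex_ofReal, MeasureTheory.setIntegral_congr_fun measurableSet_Ioo h2,
          MeasureTheory.integral_const_mul, ← h1]
      have h4 := congrArg norm h3
      rw [norm_real, Real.norm_eq_abs, abs_of_nonneg
        (MeasureTheory.integral_nonneg fun s => norm_nonneg _)] at h4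
      rw [h4]
      have h5 := congrArg norm (hTκ n)
      rw [norm_mul (κ n), norm_mul _ (T n), norm_real, Real.norm_eq_abs] at h5
      have h6 : ‖cexp (-Real.pi * a * ((n + 1 / 3 : ℝ) : ℂ) ^ 2)‖
          = ‖cexp (-Real.pi * a.re * ((n + 1 / 3 : ℝ) : ℂ) ^ 2)‖ := by
        rw [Complex.norm_exp, Complex.norm_exp]
        congr 1
        rw [show -Real.pi * a * ((n + 1 / 3 : ℝ) : ℂ) ^ 2
          = ((-Real.pi * (n + 1 / 3) ^ 2 : ℝ) : ℂ) * a by push_cast; ring,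
          show -Real.pi * (a.re : ℂ) * ((n + 1 / 3 : ℝ) : ℂ) ^ 2
          = ((-Real.pi * (n + 1 / 3) ^ 2 : ℝ) : ℂ) * a.re by push_cast; ring,
          re_ofReal_mul, re_ofReal_mul, ofReal_re]
      rw [h6] at h5
      have h7 : |(n : ℝ) + 1 / 3| ≠ 0 := abs_ne_zero.mpr (hm0 n)
      simp only [norm_mul, norm_div, norm_real, Real.norm_eq_abs, abs_abs, norm_ofNat, abs_norm]
      rw [← mul_div_assoc, h5]
      generalize |(n : ℝ) + 1 / 3| = v at h7 ⊢
      field_simp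
    have hTs : Summable fun n => ‖T n‖ := by
      refine (summable_signedGauss ha y).norm.congr fun n => ?_
      rw [norm_mul]
      have : ‖(Real.sign ((n : ℝ) + 1 / 3) : ℂ)‖ = 1 := by
        rcases lt_or_gt_of_ne (hm0 n) with h | h
        · rw [Real.sign_of_neg h]; simp
        · rw [Real.sign_of_pos h]; simp
      rw [this, one_mul]
    have hs := MeasureTheory.hasSum_integral_of_summable_integral_norm hint
      (by simp_rw [hnorm]; exact hTs.mul_left _)
    rw [MeasureTheory.setIntegral_congr_fun measurableSet_Ioo fun s hs => ((hmom s hs).2).symm,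
      ← hs.tsum_eq, signedGaussSum, div_eq_inv_mul, ← tsum_mul_left]
    refine tsum_congr fun n => ?_
    simp_rw [hFκ]
    rw [MeasureTheory.integral_const_mul, (integral_inverse_gaussian ha (hm0 n)).2,
      ← mul_div_assoc, hTκ]
    have h7 : |(n : ℝ) + 1 / 3| ≠ 0 := abs_ne_zero.mpr (hm0 n)
    have h8 : (((n : ℝ) + 1 / 3 : ℝ) : ℂ) = (Real.sign ((n : ℝ) + 1 / 3) : ℂ) * |(n : ℝ) + 1 / 3| := by
      rcases lt_or_gt_of_ne (hm0 n) with h | h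
      · rw [Real.sign_of_neg h, abs_of_neg h]; push_cast; ring
      · rw [Real.sign_of_pos h, abs_of_pos h]; push_cast; ring
    have h9 : ((|(n : ℝ) + 1 / 3| : ℝ) : ℂ) ≠ 0 := by exact_mod_cast h7
    have h10 := cpow_half_ne_zero ha0
    rw [h8]
    change _ = (2 * a ^ (1 / 2 : ℂ))⁻¹ * (_ * T n)
    generalize T n = t
    generalize ((|(n : ℝ) + 1 / 3| : ℝ) : ℂ) = v at h9 ⊢
    field_simp
  -- The lattice is split modulo 6, where ω⁶ = 1, and each class is summed in symmetric pairs. After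
  -- scaling by k these classes have the spacing 6k of the cotangent in the result.
  have hright : ∫ s in Set.Ioo (0 : ℝ) 1, G s = ∑ r ∈ Finset.range 6, ω ^ r
      * ((∫ s in Set.Ioo (0 : ℝ) 1, f (y - r) s)
        + ∑' n : ℕ, ((∫ s in Set.Ioo (0 : ℝ) 1, f (y - r - 6 * (n + 1)) s)
          + ∫ s in Set.Ioo (0 : ℝ) 1, f (y - r + 6 * (n + 1)) s)) := by
    have hω : ω ^ (6 : ℤ) = 1 := by
      rw [← Complex.exp_int_mul, Complex.exp_eq_one_iff]
      exact ⟨2, by push_cast; ring⟩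
    set p : ℕ → ℕ → ℝ → ℂ := fun r n s =>
      f (y - r - 6 * (n + 1)) s + f (y - r + 6 * (n + 1)) s with hp
    have hfc : ∀ x, Continuous (f x) := by intro x; simp only [hf]; fun_prop
    have hfi : ∀ x, MeasureTheory.IntegrableOn (f x) (Set.Ioo 0 1) := fun x =>
      (((hfc x).integrableOn_Icc (a := 0) (b := 1)).mono_set Set.Ioo_subset_Icc_self)
    have hpi' : ∀ r n, MeasureTheory.IntegrableOn (p r n) (Set.Ioo 0 1) := fun r n =>
      (hfi _).add (hfi _)
    -- As 1 - s² ≥ 1 - s, the pair bound integrates to O(1/(n + 1)²).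
    have hpn : ∀ r, Summable fun n : ℕ => ∫ s in Set.Ioo (0 : ℝ) 1, ‖p r n s‖ := by
      intro r
      obtain ⟨C, c, hc, hCc⟩ := norm_gaussian_pair_le hb0 (y - r)
      have hC : 0 ≤ C := by
        have := (norm_nonneg _).trans (hCc 0 0 le_rfl le_rfl zero_le_one)
        simpa using this
      have hz : Summable fun n : ℕ => C / (36 * c) * (1 / ((n + 1 : ℕ) : ℝ) ^ 2) :=
        ((summable_nat_add_iff 1).mpr (Real.summable_one_div_nat_pow.mpr (by norm_num))).mul_left _
      refine Summable.of_nonneg_of_le (fun n => MeasureTheory.integral_nonneg fun s => norm_nonneg _)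
        (fun n => ?_) hz
      have hd : 0 < c * (6 * ((n : ℝ) + 1)) ^ 2 := by positivity
      calc ∫ s in Set.Ioo (0 : ℝ) 1, ‖p r n s‖
          ≤ ∫ s in Set.Ioo (0 : ℝ) 1, C * Real.exp (-(c * (6 * ((n : ℝ) + 1)) ^ 2 * (1 - s))) := by
            refine MeasureTheory.setIntegral_mono_on (hpi' r n).norm
              ((by fun_prop : Continuous fun s : ℝ => C * Real.exp (-(c * (6 * ((n : ℝ) + 1)) ^ 2
                * (1 - s)))).integrableOn_Icc.mono_set Set.Ioo_subset_Icc_self)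
              measurableSet_Ioo fun s hs => ?_
            have h0 := hq s hs
            have := hCc (6 * ((n : ℝ) + 1)) (1 - s ^ 2) (by positivity) h0.le (by nlinarith [hs.1])
            simp only [hp, hf]
            push_cast at this ⊢
            refine this.trans ?_
            gcongr
            nlinarith [hs.1, hs.2]
        _ ≤ C * (1 / (c * (6 * ((n : ℝ) + 1)) ^ 2)) := by
            rw [MeasureTheory.integral_const_mul]
            exact mul_le_mul_of_nonneg_left (integral_exp_neg_mul_one_sub_le hd) hC
        _ = _ := by push_cast; field_simp; norm_num
    have hpint : ∀ r n, ∫ s in Set.Ioo (0 : ℝ) 1, p r n s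
        = (∫ s in Set.Ioo (0 : ℝ) 1, f (y - r - 6 * (n + 1)) s)
          + ∫ s in Set.Ioo (0 : ℝ) 1, f (y - r + 6 * (n + 1)) s := fun r n =>
      MeasureTheory.integral_add (hfi _) (hfi _)
    simp_rw [← hpint]
    have hps : ∀ r, Summable fun n : ℕ => ∫ s in Set.Ioo (0 : ℝ) 1, p r n s := fun r =>
      Summable.of_norm (Summable.of_nonneg_of_le (fun _ => norm_nonneg _)
        (fun n => MeasureTheory.norm_integral_le_integral_norm _) (hpn r))
    set F : ℕ → ℝ → ℂ := fun n s => ∑ r ∈ Finset.range 6, ω ^ r * p r n s with hF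
    have hpw : ∀ s ∈ Set.Ioo (0 : ℝ) 1, (Summable fun n => F n s) ∧
        G s = ∑ r ∈ Finset.range 6, ω ^ r * f (y - r) s + ∑' n, F n s := by
      intro s hs
      obtain ⟨h1, -⟩ := hmom s hs
      have hcls : ∀ (r : ℕ) (j : ℤ), ω ^ ((r : ℤ) + (6 : ℕ) * j) * f (y - ((r + (6 : ℕ) * j : ℤ) : ℂ)) s
          = ω ^ r * f (y - r - 6 * j) s := by
        intro r j
        have hω0 : ω ≠ 0 := Complex.exp_ne_zero _
        rw [zpow_add₀ hω0, zpow_mul, Nat.cast_ofNat, hω, one_zpow, mul_one, zpow_natCast]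
        congr 2
        push_cast; ring
      have hsm : ∀ r : ℕ, Summable fun j : ℤ => ω ^ r * f (y - r - 6 * j) s := fun r =>
        (h1.comp_injective (i := fun j : ℤ => (r : ℤ) + (6 : ℕ) * j) fun a b h => by
          simpa using h).congr fun j => hcls r j
      have hsp : ∀ r ∈ Finset.range 6, Summable fun n : ℕ => ω ^ r * p r n s := by
        intro r _
        refine Summable.congr (((hsm r).comp_injective (i := fun n : ℕ => (n : ℤ) + 1)
          fun a b h => by simpa using h).add ((hsm r).comp_injective
            (i := fun n : ℕ => -((n : ℤ) + 1)) fun a b h => by simpa using h)) fun n => ?_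
        simp only [hp, Function.comp]
        push_cast
        rw [mul_add]
        ring_nf
      simp only [hG, hF]
      refine ⟨summable_sum hsp, ?_⟩
      rw [tsum_int_eq_sum_residues h1 6 (by norm_num), Summable.tsum_finsetSum hsp,
        ← Finset.sum_add_distrib]
      refine Finset.sum_congr rfl fun r _ => ?_
      rw [tsum_congr (hcls r), hasSum_int_pairs (hsm r)]
      simp only [Int.cast_zero, mul_zero, sub_zero, hp]
      congr 1
      refine tsum_congr fun n => ?_
      push_cast
      rw [mul_add]
      ring_nf
    have hFi : ∀ n, MeasureTheory.IntegrableOn (F n) (Set.Ioo 0 1) := fun n =>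
      MeasureTheory.integrable_finsetSum _ fun r _ => (hpi' r n).const_mul _
    have hFn : Summable fun n => ∫ s in Set.Ioo (0 : ℝ) 1, ‖F n s‖ := by
      refine Summable.of_nonneg_of_le (fun n => MeasureTheory.integral_nonneg fun s => norm_nonneg _)
        (fun n => ?_) (summable_sum fun r (_ : r ∈ Finset.range 6) => hpn r)
      rw [← MeasureTheory.integral_finsetSum _ fun r _ => (hpi' r n).norm]
      refine MeasureTheory.integral_mono (hFi n).norm
        (MeasureTheory.integrable_finsetSum _ fun r _ => (hpi' r n).norm) fun s => ?_
      refine (norm_sum_le _ _).trans (Finset.sum_le_sum fun r _ => ?_)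
      rw [norm_mul, norm_pow, Complex.norm_exp]
      simp
    -- The unpaired central terms become the entry of index 0, so one termwise integration covers
    -- everything.
    set H : ℕ → ℝ → ℂ := fun n => if n = 0 then
      fun s => ∑ r ∈ Finset.range 6, ω ^ r * f (y - r) s else F (n - 1) with hH
    have hH0 : H 0 = fun s => ∑ r ∈ Finset.range 6, ω ^ r * f (y - r) s := by simp [hH]
    have hH1 : ∀ n, H (n + 1) = F n := by intro n; simp [hH]
    have hHi : ∀ n, MeasureTheory.IntegrableOn (H n) (Set.Ioo 0 1) := by
      intro n
      rcases n with _ | n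
      · rw [hH0]
        exact MeasureTheory.integrable_finsetSum _ fun r _ => (hfi _).const_mul _
      · rw [hH1]; exact hFi n
    have hHs := MeasureTheory.hasSum_integral_of_summable_integral_norm hHi (by
      rw [← summable_nat_add_iff 1]
      simpa only [hH1] using hFn)
    have hGH : ∀ s ∈ Set.Ioo (0 : ℝ) 1, G s = ∑' n, H n s := by
      intro s hs
      obtain ⟨hFs, hGs⟩ := hpw s hs
      rw [hGs]
      rw [((summable_nat_add_iff 1).mp (by simpa only [hH1] using hFs) :
        Summable fun n => H n s).tsum_eq_zero_add]
      simp only [hH1, hH0]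
    rw [MeasureTheory.setIntegral_congr_fun measurableSet_Ioo hGH, ← hHs.tsum_eq,
      hHs.summable.tsum_eq_zero_add]
    simp only [hH1, hH0]
    have hFint : ∀ n, ∫ s in Set.Ioo (0 : ℝ) 1, F n s
        = ∑ r ∈ Finset.range 6, ω ^ r * ∫ s in Set.Ioo (0 : ℝ) 1, p r n s := by
      intro n
      simp only [hF]
      rw [MeasureTheory.integral_finsetSum _ fun r _ => (hpi' r n).const_mul _]
      simp_rw [MeasureTheory.integral_const_mul]
    rw [tsum_congr hFint, Summable.tsum_finsetSum fun r _ => (hps r).mul_left _,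
      MeasureTheory.integral_finsetSum _ fun r _ => (hfi _).const_mul _, ← Finset.sum_add_distrib]
    refine Finset.sum_congr rfl fun r _ => ?_
    rw [MeasureTheory.integral_const_mul, tsum_mul_left, mul_add]
  have hker : ∀ x, errKernel b x = 2 * b * ∫ s in Set.Ioo (0 : ℝ) 1, f x s := by
    intro x
    rw [errKernel, intervalIntegral.integral_of_le zero_le_one, ← MeasureTheory.integral_Ioc_eq_integral_Ioo]
    simp only [hf]
    rw [MeasureTheory.integral_const_mul]
    ring
  simp_rw [hker, ← mul_add, tsum_mul_left, ← mul_add]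
  rw [MeasureTheory.integral_const_mul, hright] at hleft
  have hs0 := cpow_half_ne_zero ha0
  have h1 : ∑ r ∈ Finset.range 6, ω ^ r
      * (2 * b * ((∫ s in Set.Ioo (0 : ℝ) 1, f (y - r) s)
        + ∑' n : ℕ, ((∫ s in Set.Ioo (0 : ℝ) 1, f (y - r - 6 * (n + 1)) s)
          + ∫ s in Set.Ioo (0 : ℝ) 1, f (y - r + 6 * (n + 1)) s)))
      = 2 * b * ∑ r ∈ Finset.range 6, ω ^ r
      * ((∫ s in Set.Ioo (0 : ℝ) 1, f (y - r) s)
        + ∑' n : ℕ, ((∫ s in Set.Ioo (0 : ℝ) 1, f (y - r - 6 * (n + 1)) s)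
          + ∫ s in Set.Ioo (0 : ℝ) 1, f (y - r + 6 * (n + 1)) s)) := by
    rw [Finset.mul_sum]
    exact Finset.sum_congr rfl fun r _ => by ring
  rw [h1]
  generalize (∑ r ∈ Finset.range 6, ω ^ r
      * ((∫ s in Set.Ioo (0 : ℝ) 1, f (y - r) s)
        + ∑' n : ℕ, ((∫ s in Set.Ioo (0 : ℝ) 1, f (y - r - 6 * (n + 1)) s)
          + ∫ s in Set.Ioo (0 : ℝ) 1, f (y - r + 6 * (n + 1)) s))) = W at hleft ⊢
  rw [hb]
  field_simp at hleft ⊢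
  linear_combination -hleft

/-! ### Gaussian tails. -/

/-- The Gaussian tail `2 ∫_a^∞ e^{-βy²} dy`. -/
noncomputable def gaussTail (β : ℂ) (a : ℝ) : ℂ :=
  (Real.pi / β) ^ (1 / 2 : ℂ) - 2 * ∫ y in (0 : ℝ)..a, cexp (-(β * (y : ℂ) ^ 2))

lemma norm_cexp_neg_mul_ofReal_sq (β : ℂ) (y : ℝ) :
    ‖cexp (-(β * (y : ℂ) ^ 2))‖ = Real.exp (-(β.re * y ^ 2)) := by
  rw [Complex.norm_exp, ← ofReal_pow, neg_re, re_mul_ofReal]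

section tail

variable {β : ℂ} {a : ℝ}

lemma integrable_gauss (hβ : 0 < β.re) : MeasureTheory.Integrable fun y : ℝ => cexp (-(β * (y : ℂ) ^ 2)) := by
  simpa only [neg_mul] using integrable_cexp_neg_mul_sq hβ

lemma gaussTail_eq (hβ : 0 < β.re) :
    gaussTail β a = 2 * ∫ y in Set.Ioi a, cexp (-(β * (y : ℂ) ^ 2)) := by
  have h1 := integral_gaussian_complex_Ioi hβ
  simp only [neg_mul] at h1
  have h2 := intervalIntegral.integral_interval_add_Ioi (a := 0) (b := a)
    (integrable_gauss hβ).integrableOn (integrable_gauss hβ).integrableOn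
  rw [gaussTail]
  linear_combination (-2) * h1 - 2 * h2

lemma norm_gauss_div_pow_le (hβ : 0 < β.re) (ha : 0 < a) (n : ℕ) {y : ℝ} (hy : a < y) :
    ‖cexp (-(β * (y : ℂ) ^ 2)) / (y : ℂ) ^ n‖ ≤ Real.exp (-(β.re * a ^ 2)) * (y ^ n)⁻¹ := by
  have hy0 := ha.trans hy
  rw [norm_div, norm_cexp_neg_mul_ofReal_sq, norm_pow, norm_real, Real.norm_eq_abs, abs_of_pos hy0,
    div_eq_mul_inv]
  gcongr

lemma integrableOn_gauss_div_pow (hβ : 0 < β.re) (ha : 0 < a) (n : ℕ) :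
    MeasureTheory.IntegrableOn (fun y : ℝ => cexp (-(β * (y : ℂ) ^ 2)) / (y : ℂ) ^ n)
      (Set.Ioi a) := by
  refine MeasureTheory.Integrable.mono' (((integrable_gauss hβ).norm.mul_const (a ^ n)⁻¹).integrableOn)
    ?_ ?_
  · refine ContinuousOn.aestronglyMeasurable ?_ measurableSet_Ioi
    refine ContinuousOn.div (by fun_prop) (by fun_prop) fun y hy => ?_
    have : (y : ℂ) ≠ 0 := by exact_mod_cast (ha.trans hy).ne'
    exact pow_ne_zero _ this
  · refine (MeasureTheory.ae_restrict_iff' measurableSet_Ioi).mpr (Filter.Eventually.of_forall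
      fun y hy => ?_)
    have hy0 : 0 < y := ha.trans hy
    have hy1 : a ≤ y := le_of_lt hy
    rw [norm_div, norm_pow, norm_real, Real.norm_eq_abs, abs_of_pos hy0, div_eq_mul_inv]
    gcongr

lemma norm_integral_gauss_div_pow_le (hβ : 0 < β.re) (ha : 0 < a) (n : ℕ) :
    ‖∫ y in Set.Ioi a, cexp (-(β * (y : ℂ) ^ 2)) / (y : ℂ) ^ (n + 2)‖
      ≤ Real.exp (-(β.re * a ^ 2)) / ((n + 1) * a ^ (n + 1)) := by
  have hlt : (-((n + 2 : ℕ) : ℝ)) < -1 := by push_cast; linarith [(Nat.cast_nonneg n : (0 : ℝ) ≤ n)]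
  have hcongr : ∀ y ∈ Set.Ioi a, y ^ (-((n + 2 : ℕ) : ℝ)) = (y ^ (n + 2))⁻¹ := fun y hy => by
    rw [Real.rpow_neg (ha.trans hy).le, Real.rpow_natCast]
  have h1 := integrableOn_Ioi_rpow_of_lt hlt ha
  have h2 := integral_Ioi_rpow_of_lt hlt ha
  rw [MeasureTheory.integrableOn_congr_fun hcongr measurableSet_Ioi] at h1
  rw [MeasureTheory.setIntegral_congr_fun measurableSet_Ioi hcongr] at h2
  refine (MeasureTheory.norm_integral_le_of_norm_le (h1.const_mul (Real.exp (-(β.re * a ^ 2))))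
    ((MeasureTheory.ae_restrict_iff' measurableSet_Ioi).mpr (Filter.Eventually.of_forall
      fun y hy => norm_gauss_div_pow_le hβ ha (n + 2) hy))).trans ?_
  rw [MeasureTheory.integral_const_mul, h2]
  have e1 : a ^ (-((n + 2 : ℕ) : ℝ) + 1) = (a ^ (n + 1))⁻¹ := by
    rw [← Real.rpow_natCast, ← Real.rpow_neg ha.le]
    congr 1; push_cast; ring
  rw [e1]
  have : (0 : ℝ) < n + 1 := by positivity
  have h3 : (-((n + 2 : ℕ) : ℝ) + 1) = -(n + 1) := by push_cast; ring
  rw [h3]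
  apply le_of_eq
  field_simp

/-- Integration by parts, that is, integration of the derivative of e^{-βy²}/y^{n+1}. -/
lemma gauss_div_pow_recursion (hβ : 0 < β.re) (ha : 0 < a) (n : ℕ) :
    2 * β * (∫ y in Set.Ioi a, cexp (-(β * (y : ℂ) ^ 2)) / (y : ℂ) ^ n)
      + (n + 1) * (∫ y in Set.Ioi a, cexp (-(β * (y : ℂ) ^ 2)) / (y : ℂ) ^ (n + 2))
      = cexp (-(β * (a : ℂ) ^ 2)) / (a : ℂ) ^ (n + 1) := by
  have hi := ((integrableOn_gauss_div_pow hβ ha n).const_mul (-(2 * β))).add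
    ((integrableOn_gauss_div_pow hβ ha (n + 2)).const_mul (-((n : ℂ) + 1)))
  have hd : ∀ x : ℝ, 0 < x → HasDerivAt
      (fun y : ℝ => cexp (-(β * (y : ℂ) ^ 2)) / (y : ℂ) ^ (n + 1))
      (-(2 * β) * (cexp (-(β * (x : ℂ) ^ 2)) / (x : ℂ) ^ n)
        + -((n : ℂ) + 1) * (cexp (-(β * (x : ℂ) ^ 2)) / (x : ℂ) ^ (n + 2))) x := by
    intro x hx
    have hx0 : (x : ℂ) ≠ 0 := by exact_mod_cast hx.ne'
    have h1 : HasDerivAt (fun w : ℂ => cexp (-(β * w ^ 2)) / w ^ (n + 1))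
      (-(2 * β) * (cexp (-(β * (x : ℂ) ^ 2)) / (x : ℂ) ^ n)
        + -((n : ℂ) + 1) * (cexp (-(β * (x : ℂ) ^ 2)) / (x : ℂ) ^ (n + 2))) (x : ℂ) := by
      have h2 : HasDerivAt (fun w : ℂ => -(β * w ^ 2)) (-(β * (2 * x))) (x : ℂ) := by
        simpa using ((hasDerivAt_pow 2 (x : ℂ)).const_mul β).fun_neg
      refine (h2.cexp.fun_div (hasDerivAt_pow (n + 1) (x : ℂ)) (pow_ne_zero _ hx0)).congr_deriv ?_
      push_cast
      field_simp
      ring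
    exact h1.comp_ofReal
  have ht : Filter.Tendsto (fun y : ℝ => cexp (-(β * (y : ℂ) ^ 2)) / (y : ℂ) ^ (n + 1))
      Filter.atTop (nhds 0) := by
    have h1 : Filter.Tendsto (fun y : ℝ => (y ^ (n + 1))⁻¹) Filter.atTop (nhds 0) :=
      (Filter.tendsto_pow_atTop (by omega)).inv_tendsto_atTop
    refine squeeze_zero_norm' ?_ h1
    filter_upwards [Filter.eventually_gt_atTop a] with y hy
    refine (norm_gauss_div_pow_le hβ ha (n + 1) hy).trans ?_
    have : 0 < y := ha.trans hy
    refine mul_le_of_le_one_left (by positivity) (Real.exp_le_one_iff.mpr ?_)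
    have := mul_pos hβ (pow_pos ha 2)
    linarith
  have h := MeasureTheory.integral_Ioi_of_hasDerivAt_of_tendsto
    (hd a ha).continuousAt.continuousWithinAt (fun x hx => hd x (ha.trans hx)) hi ht
  rw [MeasureTheory.integral_add ((integrableOn_gauss_div_pow hβ ha n).const_mul _)
    ((integrableOn_gauss_div_pow hβ ha (n + 2)).const_mul _), MeasureTheory.integral_const_mul,
    MeasureTheory.integral_const_mul] at h
  linear_combination -h

lemma norm_gaussTail_le (hβ : 0 < β.re) (ha : 0 < a) :
    ‖gaussTail β a‖ ≤ 2 * Real.exp (-(β.re * a ^ 2)) / (‖β‖ * a) := by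
  have hβ0 : β ≠ 0 := by rintro rfl; simp at hβ
  have hn : 0 < ‖β‖ := norm_pos_iff.mpr hβ0
  have h1 := gauss_div_pow_recursion hβ ha 0
  simp only [pow_zero, div_one, zero_add, pow_one, Nat.cast_zero, one_mul] at h1
  have h2 := norm_integral_gauss_div_pow_le hβ ha 0
  simp only [zero_add, Nat.cast_zero, one_mul, pow_one] at h2
  have h3 : β * gaussTail β a = cexp (-(β * (a : ℂ) ^ 2)) / a
      - ∫ y in Set.Ioi a, cexp (-(β * (y : ℂ) ^ 2)) / (y : ℂ) ^ 2 := by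
    rw [gaussTail_eq hβ]; linear_combination h1
  have h4 : ‖β * gaussTail β a‖ ≤ 2 * Real.exp (-(β.re * a ^ 2)) / a := by
    rw [h3]
    refine (norm_sub_le _ _).trans ?_
    rw [norm_div, norm_cexp_neg_mul_ofReal_sq, norm_real, Real.norm_eq_abs, abs_of_pos ha]
    calc _ ≤ Real.exp (-(β.re * a ^ 2)) / a + Real.exp (-(β.re * a ^ 2)) / a := by gcongr
      _ = _ := by ring
  rw [norm_mul] at h4
  rw [le_div_iff₀ (by positivity)]
  rw [le_div_iff₀ ha] at h4
  linarith

/-- This combination is the derivative of `errPrimitive` up to an explicit factor. The first two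
terms cancel to leading order: their difference is the integral of e^{-βy²}/y², and another
integration by parts brings it to the order of the third term. -/
lemma norm_gaussTail_remainder_le (hβ : 0 < β.re) (ha : 0 < a) :
    ‖cexp (-(β * (a : ℂ) ^ 2)) / a - β * gaussTail β a + gaussTail β a / (2 * a ^ 2)‖
      ≤ 2 * Real.exp (-(β.re * a ^ 2)) / (‖β‖ * a ^ 3) := by
  have hβ0 : β ≠ 0 := by rintro rfl; simp at hβ
  have hn : 0 < ‖β‖ := norm_pos_iff.mpr hβ0
  have h1 := gauss_div_pow_recursion hβ ha 0
  have h1' := gauss_div_pow_recursion hβ ha 2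
  simp only [pow_zero, div_one, zero_add, pow_one, Nat.cast_zero, one_mul] at h1
  have h2 := norm_integral_gauss_div_pow_le hβ ha 2
  set J2 := ∫ y in Set.Ioi a, cexp (-(β * (y : ℂ) ^ 2)) / (y : ℂ) ^ 2
  have h3 : β * gaussTail β a = cexp (-(β * (a : ℂ) ^ 2)) / a - J2 := by
    rw [gaussTail_eq hβ]; linear_combination h1
  set E := Real.exp (-(β.re * a ^ 2))
  have hJ2 : ‖J2‖ ≤ E / (‖β‖ * a ^ 3) := by
    have h5 : 2 * β * J2 = cexp (-(β * (a : ℂ) ^ 2)) / (a : ℂ) ^ 3 - ((2 : ℕ) + 1) *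
        ∫ y in Set.Ioi a, cexp (-(β * (y : ℂ) ^ 2)) / (y : ℂ) ^ (2 + 2) := by
      linear_combination h1'
    have h6 : ‖2 * β * J2‖ ≤ 2 * E / a ^ 3 := by
      rw [h5]
      refine (norm_sub_le _ _).trans ?_
      rw [norm_div, norm_cexp_neg_mul_ofReal_sq, norm_pow, norm_real, Real.norm_eq_abs, abs_of_pos ha,
        norm_mul]
      have h7 : ‖(((2 : ℕ) : ℂ) + 1)‖ = 3 := by norm_num
      rw [h7]
      calc _ ≤ E / a ^ 3 + 3 * (E / (((2 : ℕ) + 1) * a ^ (2 + 1))) := by gcongr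
        _ = _ := by push_cast; field_simp; norm_num; ring
    rw [norm_mul, norm_mul, norm_ofNat] at h6
    rw [le_div_iff₀ (by positivity)]
    rw [le_div_iff₀ (by positivity)] at h6
    linarith
  rw [h3, sub_sub_cancel]
  refine (norm_add_le _ _).trans ?_
  have h8 : ‖gaussTail β a / (2 * (a : ℂ) ^ 2)‖ ≤ E / (‖β‖ * a ^ 3) := by
    rw [norm_div, norm_mul, norm_pow, norm_real, Real.norm_eq_abs, abs_of_pos ha, norm_ofNat]
    refine (div_le_div_of_nonneg_right (norm_gaussTail_le hβ ha) (by positivity)).trans (le_of_eq ?_)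
    change 2 * E / _ / _ = _
    field_simp
  calc _ ≤ E / (‖β‖ * a ^ 3) + E / (‖β‖ * a ^ 3) := add_le_add hJ2 h8
    _ = _ := by ring

end tail

/-! ### Differentiation under the integral and uniform bounds for the error kernel. -/

lemma hasDerivAt_intervalIntegral_of_continuousOn {𝕜 : Type*} [RCLike 𝕜] [NormedSpace 𝕜 ℂ]
    {F F' : 𝕜 → ℝ → ℂ} {c d : ℝ} {x₀ : 𝕜} {s : Set 𝕜} (hs : IsCompact s) (hs0 : s ∈ nhds x₀)
    (hF : ∀ x ∈ s, ContinuousOn (F x) (Set.uIcc c d))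
    (hF' : ContinuousOn (Function.uncurry F') (s ×ˢ Set.uIcc c d))
    (hd : ∀ x ∈ s, ∀ t ∈ Set.uIcc c d, HasDerivAt (fun x => F x t) (F' x t) x) :
    HasDerivAt (fun x => ∫ t in c..d, F x t) (∫ t in c..d, F' x₀ t) x₀ := by
  obtain ⟨C, hC⟩ := (hs.prod isCompact_uIcc).exists_bound_of_continuousOn hF'
  have hx0 : x₀ ∈ s := mem_of_mem_nhds hs0
  have hFx : ContinuousOn (F' x₀) (Set.uIcc c d) :=
    hF'.comp (f := fun t => (x₀, t)) (by fun_prop) fun t ht => ⟨hx0, ht⟩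
  refine (intervalIntegral.hasDerivAt_integral_of_dominated_loc_of_deriv_le (bound := fun _ => C)
    (F' := F') hs0 ?_ (hF x₀ hx0).intervalIntegrable ?_ ?_ ?_ ?_).2
  · filter_upwards [hs0] with x hx
    exact ((hF x hx).mono Set.uIoc_subset_uIcc).aestronglyMeasurable measurableSet_uIoc
  · exact (hFx.mono Set.uIoc_subset_uIcc).aestronglyMeasurable measurableSet_uIoc
  · exact Filter.Eventually.of_forall fun t ht x hx => hC (x, t) ⟨hx, Set.uIoc_subset_uIcc ht⟩
  · exact intervalIntegrable_const
  · exact Filter.Eventually.of_forall fun t ht x hx => hd x hx t (Set.uIoc_subset_uIcc ht)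

lemma norm_gaussConst (β : ℂ) : ‖(Real.pi / β : ℂ) ^ (1 / 2 : ℂ)‖ = Real.sqrt (Real.pi / ‖β‖) := by
  rcases eq_or_ne β 0 with rfl | hβ
  · simp
  have h : (Real.pi / β : ℂ) ≠ 0 := div_ne_zero (by exact_mod_cast Real.pi_ne_zero) hβ
  have h2 := congrArg norm (cpow_half_sq h)
  rw [norm_pow, norm_div, norm_real, Real.norm_eq_abs, abs_of_pos Real.pi_pos] at h2
  rw [← h2, Real.sqrt_sq (norm_nonneg _)]

/-- The condition on Re B bounds the integrand by e. That suffices on [0, |B|^{-1/2}]; on the rest,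
e^{-B(1-s²)} is integrated by parts against 2Bs, which gains 1/|B|. -/
lemma norm_oscillatory_le {B : ℂ} (hB : -1 ≤ B.re) :
    Real.sqrt ‖B‖ * ‖∫ s in (0 : ℝ)..1, cexp (-(B * ((1 - s ^ 2 : ℝ) : ℂ)))‖ ≤ 3 * Real.exp 1 := by
  set f : ℝ → ℂ := fun s => cexp (-(B * ((1 - s ^ 2 : ℝ) : ℂ))) with hf
  have hfc : Continuous f := by simp only [hf]; fun_prop
  have hfn : ∀ s : ℝ, 0 ≤ s → s ≤ 1 → ‖f s‖ ≤ Real.exp 1 := by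
    intro s h0 h1
    simp only [hf]
    rw [Complex.norm_exp, neg_re, re_mul_ofReal]
    have h2 : 0 ≤ 1 - s ^ 2 := by nlinarith
    have h3 := mul_nonneg (by linarith : 0 ≤ B.re + 1) h2
    exact Real.exp_le_exp.mpr (by nlinarith [sq_nonneg s])
  rcases le_or_gt ‖B‖ 1 with h1 | h1
  · have h2 : ‖∫ s in (0 : ℝ)..1, f s‖ ≤ Real.exp 1 * |1 - 0| :=
      intervalIntegral.norm_integral_le_of_norm_le_const fun s hs => by
        rw [Set.uIoc_of_le zero_le_one] at hs
        exact hfn s hs.1.le hs.2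
    have h3 : Real.sqrt ‖B‖ ≤ 1 := Real.sqrt_le_one.mpr h1
    have h4 := mul_le_mul h3 h2 (norm_nonneg _) zero_le_one
    have := Real.exp_pos 1
    refine h4.trans ?_
    rw [sub_zero, abs_one]
    linarith
  have hB0 : B ≠ 0 := by rintro rfl; rw [norm_zero] at h1; linarith
  have hbp : 0 < ‖B‖ := by linarith
  set r := Real.sqrt ‖B‖ with hr
  have hrr : r ^ 2 = ‖B‖ := Real.sq_sqrt hbp.le
  have hr1 : 1 < r := by rw [hr]; exact Real.lt_sqrt_of_sq_lt (by simpa using h1)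
  set δ := r⁻¹ with hδ
  have hδ0 : 0 < δ := by positivity
  have hδ1 : δ ≤ 1 := inv_le_one_of_one_le₀ hr1.le
  have hI1 : ‖∫ s in (0 : ℝ)..δ, f s‖ ≤ Real.exp 1 * δ := by
    have := intervalIntegral.norm_integral_le_of_norm_le_const (a := 0) (b := δ) (f := f)
      (C := Real.exp 1) fun s hs => by
        rw [Set.uIoc_of_le hδ0.le] at hs
        exact hfn s hs.1.le (hs.2.trans hδ1)
    rwa [sub_zero, abs_of_pos hδ0] at this
  have hint2 : IntervalIntegrable (fun s : ℝ => f s / (2 * B * (s : ℂ) ^ 2)) MeasureTheory.volume δ 1 := by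
    refine ContinuousOn.intervalIntegrable ?_
    rw [Set.uIcc_of_le hδ1]
    refine hfc.continuousOn.div (by fun_prop) fun s hs => ?_
    have : (s : ℂ) ≠ 0 := by exact_mod_cast (hδ0.trans_le hs.1).ne'
    simp [hB0, this]
  have hI2 : ∫ s in δ..1, (f s - f s / (2 * B * (s : ℂ) ^ 2))
      = f 1 / (2 * B * (1 : ℝ)) - f δ / (2 * B * δ) := by
    refine intervalIntegral.integral_eq_sub_of_hasDerivAt (f := fun s : ℝ => f s / (2 * B * s))
      (fun x hx => ?_) ((hfc.intervalIntegrable _ _).sub hint2)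
    rw [Set.uIcc_of_le hδ1] at hx
    have hx0 : (x : ℂ) ≠ 0 := by exact_mod_cast (hδ0.trans_le hx.1).ne'
    have h2 : HasDerivAt (fun w : ℂ => -(B * (1 - w ^ 2))) (B * (2 * x)) (x : ℂ) := by
      simpa using (((hasDerivAt_pow 2 (x : ℂ)).const_sub 1).const_mul B).fun_neg
    have h3 := (h2.cexp.fun_div ((hasDerivAt_id (x : ℂ)).const_mul (2 * B))
      (by simp [hB0, hx0])).comp_ofReal
    simp only [hf]
    push_cast
    refine h3.congr_deriv ?_
    simp only [id]
    field_simp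
  have hI3 : ‖∫ s in δ..1, f s / (2 * B * (s : ℂ) ^ 2)‖ ≤ Real.exp 1 / (2 * ‖B‖) * (δ⁻¹ - 1) := by
    have hc : ContinuousOn (fun s : ℝ => (s ^ 2)⁻¹) (Set.uIcc δ 1) := by
      rw [Set.uIcc_of_le hδ1]
      exact (by fun_prop : Continuous fun s : ℝ => s ^ 2).continuousOn.inv₀ fun s hs =>
        (pow_pos (hδ0.trans_le hs.1) 2).ne'
    have h4 : ∫ s in δ..1, (s ^ 2)⁻¹ = -(1 : ℝ)⁻¹ - -δ⁻¹ := by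
      refine intervalIntegral.integral_eq_sub_of_hasDerivAt (f := fun s : ℝ => -s⁻¹) (fun x hx => ?_)
        hc.intervalIntegrable
      rw [Set.uIcc_of_le hδ1] at hx
      simpa using (hasDerivAt_inv (hδ0.trans_le hx.1).ne').fun_neg
    have h5 := intervalIntegral.norm_integral_le_of_norm_le hδ1 (f := fun s : ℝ => f s / (2 * B * (s : ℂ) ^ 2))
      (g := fun s => Real.exp 1 / (2 * ‖B‖) * (s ^ 2)⁻¹)
      (Filter.Eventually.of_forall fun s hs => by
        have hs0 : 0 < s := hδ0.trans hs.1
        rw [norm_div, norm_mul, norm_mul, norm_pow, norm_ofNat, norm_real, Real.norm_eq_abs,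
          abs_of_pos hs0, div_mul_eq_mul_div, ← div_eq_mul_inv, div_div, mul_comm (s ^ 2)]
        gcongr
        exact hfn s hs0.le hs.2) (hc.intervalIntegrable (μ := MeasureTheory.volume) |>.const_mul _)
    rw [intervalIntegral.integral_const_mul, h4] at h5
    refine h5.trans (le_of_eq ?_)
    rw [inv_one]
    ring
  rw [intervalIntegral.integral_sub (hfc.intervalIntegrable _ _) hint2] at hI2
  have hsplit := intervalIntegral.integral_add_adjacent_intervals
    (hfc.intervalIntegrable (μ := MeasureTheory.volume) 0 δ) (hfc.intervalIntegrable δ 1)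
  have e1 : ‖f 1 / (2 * B * (1 : ℝ))‖ ≤ Real.exp 1 / (2 * ‖B‖) := by
    rw [norm_div, norm_mul, norm_mul, norm_ofNat, norm_real, norm_one, mul_one]
    gcongr
    exact hfn 1 zero_le_one le_rfl
  have e2 : ‖f δ / (2 * B * δ)‖ ≤ Real.exp 1 / (2 * ‖B‖) * δ⁻¹ := by
    rw [norm_div, norm_mul, norm_mul, norm_ofNat, norm_real, Real.norm_eq_abs, abs_of_pos hδ0,
      ← div_div, div_eq_mul_inv _ δ]
    gcongr
    exact hfn δ hδ0.le hδ1
  have htot : ‖∫ s in (0 : ℝ)..1, f s‖ ≤ Real.exp 1 * δ + Real.exp 1 / ‖B‖ * δ⁻¹ := by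
    rw [← hsplit]
    have h6 : ∫ s in δ..1, f s = f 1 / (2 * B * (1 : ℝ)) - f δ / (2 * B * δ)
        + ∫ s in δ..1, f s / (2 * B * (s : ℂ) ^ 2) := by linear_combination hI2
    rw [h6]
    have h7 := norm_add_le (∫ s in (0 : ℝ)..δ, f s) (f 1 / (2 * B * (1 : ℝ)) - f δ / (2 * B * δ)
        + ∫ s in δ..1, f s / (2 * B * (s : ℂ) ^ 2))
    have h8 := norm_add_le (f 1 / (2 * B * (1 : ℝ)) - f δ / (2 * B * δ))
      (∫ s in δ..1, f s / (2 * B * (s : ℂ) ^ 2))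
    have h9 := norm_sub_le (f 1 / (2 * B * (1 : ℝ))) (f δ / (2 * B * δ))
    have h10 : Real.exp 1 / ‖B‖ * δ⁻¹ = Real.exp 1 / (2 * ‖B‖) * δ⁻¹ + Real.exp 1 / (2 * ‖B‖) * δ⁻¹ := by
      field_simp; norm_num
    linarith
  calc r * ‖∫ s in (0 : ℝ)..1, f s‖ ≤ r * (Real.exp 1 * δ + Real.exp 1 / ‖B‖ * δ⁻¹) := by gcongr
    _ = 2 * Real.exp 1 := by rw [hδ, ← hrr]; field_simp; norm_num
    _ ≤ _ := by have := Real.exp_pos 1; linarith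

/-- With B = βP² the prefactor has modulus 2√π |B|^{1/2}, so the bound is uniform in β. It covers
the lattice points |p| ≤ 1, where no asymptotic expansion is available. -/
lemma norm_gaussConst_mul_errKernel_le {β P : ℂ} (hP : -1 ≤ (β * P ^ 2).re) :
    ‖(Real.pi / β : ℂ) ^ (1 / 2 : ℂ) * errKernel β P‖ ≤ 6 * Real.sqrt Real.pi * Real.exp 1 := by
  rcases eq_or_ne β 0 with rfl | hβ
  · simp [errKernel]; positivity
  have hb : 0 < ‖β‖ := norm_pos_iff.mpr hβ
  have h := norm_oscillatory_le hP
  rw [norm_mul, norm_pow, Real.sqrt_mul (norm_nonneg _), Real.sqrt_sq (norm_nonneg _)] at h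
  rw [norm_mul, norm_gaussConst, errKernel, norm_mul, norm_mul, norm_mul, norm_ofNat,
    Real.sqrt_div Real.pi_pos.le]
  have h2 : ‖β‖ = Real.sqrt ‖β‖ ^ 2 := (Real.sq_sqrt hb.le).symm
  have h3 := Real.sqrt_pos.mpr hb
  calc _ = 2 * Real.sqrt Real.pi * (Real.sqrt ‖β‖ * ‖P‖
      * ‖∫ s in (0 : ℝ)..1, cexp (-(β * P ^ 2 * ((1 - s ^ 2 : ℝ) : ℂ)))‖) := by
        generalize ‖∫ s in (0 : ℝ)..1, cexp (-(β * P ^ 2 * ((1 - s ^ 2 : ℝ) : ℂ)))‖ = J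
        nth_rw 2 [h2]
        field_simp
    _ ≤ 2 * Real.sqrt Real.pi * (3 * Real.exp 1) := by gcongr
    _ = _ := by ring

/-! ### Comparison of the error kernel with a truncated Cauchy integral. -/

/-- The difference between the error-function kernel and its truncated Cauchy integral. -/
noncomputable def errKernelDiff (β P : ℂ) : ℂ :=
  cexp β * (Real.pi / β) ^ (1 / 2 : ℂ) * errKernel β P
    - ∫ x in (-1 : ℝ)..1, cexp (β * (1 - (x : ℂ) ^ 2)) / (P - x)

/-- The leading coefficient of `errKernelDiff β P` as `P → ∞`. -/
noncomputable def errKernelLead (β : ℂ) : ℂ := cexp β * gaussTail β 1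

lemma norm_errKernelLead_le {β : ℂ} (hβ : 0 < β.re) : ‖errKernelLead β‖ ≤ 2 / ‖β‖ := by
  rw [errKernelLead, norm_mul, Complex.norm_exp]
  have h := norm_gaussTail_le hβ one_pos
  rw [one_pow, mul_one, mul_one] at h
  calc _ ≤ Real.exp β.re * (2 * Real.exp (-β.re) / ‖β‖) := by gcongr
    _ = 2 * (Real.exp β.re * Real.exp (-β.re)) / ‖β‖ := by ring
    _ = _ := by rw [← Real.exp_add]; simp

lemma integral_symm_linear (g : ℝ → ℂ) (hg : Continuous g) (hev : ∀ x, g (-x) = g x) (p : ℂ) :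
    ∫ x in (-1 : ℝ)..1, (p + x) * g x = 2 * p * ∫ x in (0 : ℝ)..1, g x := by
  have hc : Continuous fun x : ℝ => (p + x) * g x := by fun_prop
  have h1 := intervalIntegral.integral_add_adjacent_intervals
    (hc.intervalIntegrable (μ := MeasureTheory.volume) (-1) 0) (hc.intervalIntegrable 0 1)
  have h2 := intervalIntegral.integral_comp_neg (a := 0) (b := 1) (fun x : ℝ => (p + x) * g x)
  rw [neg_zero] at h2
  have hc2 : Continuous fun x : ℝ => (p + ((-x : ℝ) : ℂ)) * g (-x) := by fun_prop
  rw [← h1, ← h2, ← intervalIntegral.integral_add (hc2.intervalIntegrable _ _)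
    (hc.intervalIntegrable _ _), ← intervalIntegral.integral_const_mul]
  refine intervalIntegral.integral_congr fun x _ => ?_
  simp only [hev]
  push_cast
  ring

/-- The interpolating function whose increments control `errKernelDiff`. -/
noncomputable def errPrimitive (β P : ℂ) (a : ℝ) : ℂ :=
  2 * (Real.pi / β) ^ (1 / 2 : ℂ) * β * P * (∫ y in (0 : ℝ)..a, cexp (β * P ^ 2 * (y : ℂ) ^ 2))
    - (∫ x in (-1 : ℝ)..1, cexp ((a : ℂ) ^ 2 * β * (P ^ 2 - (x : ℂ) ^ 2)) / (P - x))
    - P / (P ^ 2 - 1) * (cexp ((a : ℂ) ^ 2 * β * P ^ 2) * gaussTail β a / a)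

lemma hasDerivAt_gaussTail (β : ℂ) (a : ℝ) :
    HasDerivAt (gaussTail β) (-(2 * cexp (-(β * (a : ℂ) ^ 2)))) a := by
  have hc : Continuous fun y : ℝ => cexp (-(β * (y : ℂ) ^ 2)) := by fun_prop
  exact ((hc.integral_hasStrictDerivAt 0 a).hasDerivAt.const_mul 2).const_sub _

/-- At a = 1, `errPrimitive` is e^{β(P²-1)} times `errKernelDiff` minus a multiple of its leading
coefficient (`errKernelDiff_eq`). Differentiating the first two terms in a leaves 2βP e^{a²βP²}
times the Gaussian tail; the third term is chosen to cancel the leading part of this. -/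
lemma hasDerivAt_errPrimitive {β P : ℂ} (hA : P ^ 2 - 1 ≠ 0)
    (hP : ∀ x ∈ Set.Icc (-1 : ℝ) 1, P - x ≠ 0) {a : ℝ} (ha : 0 < a) :
    HasDerivAt (errPrimitive β P) (2 * P / (P ^ 2 - 1) * cexp ((a : ℂ) ^ 2 * β * P ^ 2)
      * (cexp (-(β * (a : ℂ) ^ 2)) / a - β * gaussTail β a + gaussTail β a / (2 * a ^ 2))) a := by
  have ha0 : (a : ℂ) ≠ 0 := by exact_mod_cast ha.ne'
  have h1 : HasDerivAt (fun a : ℝ => ∫ y in (0 : ℝ)..a, cexp (β * P ^ 2 * (y : ℂ) ^ 2))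
      (cexp (β * P ^ 2 * (a : ℂ) ^ 2)) a :=
    ((by fun_prop : Continuous fun y : ℝ => cexp (β * P ^ 2 * (y : ℂ) ^ 2)).integral_hasStrictDerivAt
      0 a).hasDerivAt
  have h2 : HasDerivAt (fun a : ℝ => ∫ x in (-1 : ℝ)..1,
      cexp ((a : ℂ) ^ 2 * β * (P ^ 2 - (x : ℂ) ^ 2)) / (P - x))
      (∫ x in (-1 : ℝ)..1, (P + x) * (2 * a * β * cexp ((a : ℂ) ^ 2 * β * (P ^ 2 - (x : ℂ) ^ 2)))) a := by
    have hu : Set.uIcc (-1 : ℝ) 1 = Set.Icc (-1) 1 := Set.uIcc_of_le (by norm_num)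
    refine hasDerivAt_intervalIntegral_of_continuousOn (𝕜 := ℝ)
      (F' := fun a x => (P + x) * (2 * a * β * cexp ((a : ℂ) ^ 2 * β * (P ^ 2 - (x : ℂ) ^ 2))))
      (isCompact_closedBall a 1)
      (Metric.closedBall_mem_nhds a one_pos) (fun b _ => ?_) ?_ (fun b _ x hx => ?_)
    · rw [hu]
      exact ContinuousOn.div (by fun_prop) (by fun_prop) hP
    · exact Continuous.continuousOn (by unfold Function.uncurry; fun_prop)
    · rw [hu] at hx
      have h3 : HasDerivAt (fun w : ℂ => w ^ 2 * β * (P ^ 2 - (x : ℂ) ^ 2))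
          (2 * b * β * (P ^ 2 - (x : ℂ) ^ 2)) (b : ℂ) := by
        simpa using ((hasDerivAt_pow 2 (b : ℂ)).mul_const β).mul_const (P ^ 2 - (x : ℂ) ^ 2)
      refine (h3.cexp.div_const (P - x)).comp_ofReal.congr_deriv ?_
      have := hP x hx
      field_simp
      ring
  have h3 : HasDerivAt (fun a : ℝ => cexp ((a : ℂ) ^ 2 * β * P ^ 2) * gaussTail β a / a)
      (cexp ((a : ℂ) ^ 2 * β * P ^ 2) * (2 * β * P ^ 2 * gaussTail β a
        - 2 * cexp (-(β * (a : ℂ) ^ 2)) / a - gaussTail β a / a ^ 2)) a := by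
    have h4 : HasDerivAt (fun w : ℂ => w ^ 2 * β * P ^ 2) (2 * a * β * P ^ 2) (a : ℂ) := by
      simpa using ((hasDerivAt_pow 2 (a : ℂ)).mul_const β).mul_const (P ^ 2)
    refine ((h4.cexp.comp_ofReal.fun_mul (hasDerivAt_gaussTail β a)).fun_div
      (hasDerivAt_id (a : ℂ)).comp_ofReal ha0).congr_deriv ?_
    simp only [id]
    field_simp
    ring
  have h5 : ∫ x in (-1 : ℝ)..1, (P + x) * (2 * a * β * cexp ((a : ℂ) ^ 2 * β * (P ^ 2 - (x : ℂ) ^ 2)))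
      = 4 * β * P * cexp ((a : ℂ) ^ 2 * β * P ^ 2) * ∫ y in (0 : ℝ)..a, cexp (-(β * (y : ℂ) ^ 2)) := by
    rw [integral_symm_linear (fun x : ℝ => 2 * a * β * cexp ((a : ℂ) ^ 2 * β * (P ^ 2 - (x : ℂ) ^ 2)))
      (by fun_prop) (fun x => by push_cast; rw [neg_sq])]
    have h6 := intervalIntegral.integral_comp_mul_left (a := 0) (b := 1)
      (fun y : ℝ => cexp (-(β * (y : ℂ) ^ 2))) ha.ne'
    rw [mul_zero, mul_one, real_smul] at h6
    have h7 : ∀ x : ℝ, 2 * a * β * cexp ((a : ℂ) ^ 2 * β * (P ^ 2 - (x : ℂ) ^ 2))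
        = 2 * a * β * cexp ((a : ℂ) ^ 2 * β * P ^ 2) * cexp (-(β * ((a * x : ℝ) : ℂ) ^ 2)) := by
      intro x
      rw [mul_assoc (2 * a * β) (cexp _), ← Complex.exp_add]
      congr 2
      push_cast; ring
    simp_rw [h7]
    rw [intervalIntegral.integral_const_mul, h6]
    push_cast
    field_simp
    ring
  refine ((h1.const_mul _).fun_sub h2 |>.fun_sub (h3.const_mul (P / (P ^ 2 - 1)))).congr_deriv ?_
  rw [h5]
  have hg : (Real.pi / β : ℂ) ^ (1 / 2 : ℂ)
      = gaussTail β a + 2 * ∫ y in (0 : ℝ)..a, cexp (-(β * (y : ℂ) ^ 2)) := by rw [gaussTail]; ring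
  rw [hg, show β * P ^ 2 * (a : ℂ) ^ 2 = (a : ℂ) ^ 2 * β * P ^ 2 by ring]
  generalize (∫ y in (0 : ℝ)..a, cexp (-(β * (y : ℂ) ^ 2))) = J
  field_simp
  ring

lemma errKernelDiff_eq {β P : ℂ} :
    errKernelDiff β P - P / (P ^ 2 - 1) * errKernelLead β
      = cexp (-(β * (P ^ 2 - 1))) * errPrimitive β P 1 := by
  have h1 : cexp (-(β * (P ^ 2 - 1))) * ∫ y in (0 : ℝ)..1, cexp (β * P ^ 2 * (y : ℂ) ^ 2)
      = cexp β * ∫ s in (0 : ℝ)..1, cexp (-(β * P ^ 2 * ((1 - s ^ 2 : ℝ) : ℂ))) := by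
    rw [← intervalIntegral.integral_const_mul, ← intervalIntegral.integral_const_mul]
    refine intervalIntegral.integral_congr fun x _ => ?_
    rw [← Complex.exp_add, ← Complex.exp_add]
    congr 1; push_cast; ring
  have h2 : cexp (-(β * (P ^ 2 - 1)))
        * ∫ x in (-1 : ℝ)..1, cexp (((1 : ℝ) : ℂ) ^ 2 * β * (P ^ 2 - (x : ℂ) ^ 2)) / (P - x)
      = ∫ x in (-1 : ℝ)..1, cexp (β * (1 - (x : ℂ) ^ 2)) / (P - x) := by
    rw [← intervalIntegral.integral_const_mul]
    refine intervalIntegral.integral_congr fun x _ => ?_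
    rw [← mul_div_assoc, ← Complex.exp_add]
    congr 2; push_cast; ring
  have h3 : cexp (-(β * (P ^ 2 - 1))) * cexp (((1 : ℝ) : ℂ) ^ 2 * β * P ^ 2) = cexp β := by
    rw [← Complex.exp_add]; congr 1; push_cast; ring
  rw [errKernelDiff, errPrimitive, errKernel, errKernelLead]
  have h4 : (((1 : ℝ) : ℝ) : ℂ) = 1 := ofReal_one
  simp only [h4, div_one] at h2 h3 ⊢
  linear_combination (-(2 * (Real.pi / β : ℂ) ^ (1 / 2 : ℂ) * β * P)) * h1 + h2
    + P / (P ^ 2 - 1) * gaussTail β 1 * h3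

lemma exp_neg_le_two_div_sq {x : ℝ} (hx : 0 < x) : Real.exp (-x) ≤ 2 / x ^ 2 := by
  rw [Real.exp_neg, inv_eq_one_div, div_le_div_iff₀ (Real.exp_pos x) (by positivity)]
  have := Real.quadratic_le_exp_of_nonneg hx.le
  nlinarith

/-- Conditions saying that `P` has size `q` and lies far from the interval `[-1, 1]`, in the sector
in which `e^{-βP²}` decays. -/
structure IsFar (β P : ℂ) (q : ℝ) : Prop where
  two_le : 2 ≤ q
  quarter_le : 1 / 4 ≤ β.re
  norm_le : ‖P‖ ≤ 2 * q
  le_norm : q / 2 ≤ ‖P‖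
  le_norm_sq_sub : q ^ 2 / 4 ≤ ‖P ^ 2 - 1‖
  le_re : q ^ 2 / 10 ≤ (β * (P ^ 2 - 1)).re
  le_norm_sub : ∀ x ∈ Set.Icc (-1 : ℝ) 1, 1 / 2 ≤ ‖P - x‖

/-- The derivative of `errPrimitive` is controlled only by 1/a³ near a = 0, so the integration
starts where a²|β(P² - 1)| = 1/4. There a²|β| ≤ 1/q², all exponents are bounded, and each term can
be estimated crudely. -/
lemma IsFar.norm_errPrimitive_start_le {β P : ℂ} {q : ℝ} (h : IsFar β P q) {a : ℝ} (ha : 0 < a)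
    (ha2 : a ^ 2 * (4 * ‖β * (P ^ 2 - 1)‖) = 1) :
    ‖errPrimitive β P a‖ ≤ (4 * Real.sqrt Real.pi * Real.exp 4 + 4 * Real.exp 5 + 16 * Real.exp 4) * q := by
  have hq := h.two_le
  have hβ : 0 < β.re := by linarith [h.quarter_le]
  have hβ0 : β ≠ 0 := by rintro rfl; simp at hβ
  have hb : 0 < ‖β‖ := norm_pos_iff.mpr hβ0
  have hA : 0 < ‖P ^ 2 - 1‖ := lt_of_lt_of_le (by positivity) h.le_norm_sq_sub
  have hbA : ‖β‖ * a ^ 2 = 1 / (4 * ‖P ^ 2 - 1‖) := by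
    rw [norm_mul] at ha2
    rw [eq_div_iff (by positivity)]; linarith
  have hP2 : ‖P‖ ^ 2 ≤ 4 * q ^ 2 := by nlinarith [h.norm_le, norm_nonneg P]
  have hbq : ‖β‖ * a ^ 2 ≤ 1 / q ^ 2 := by
    rw [hbA]
    apply one_div_le_one_div_of_le (by positivity)
    linarith [h.le_norm_sq_sub]
  have hexp : ∀ (y : ℝ) (w : ℂ) (c : ℝ), 0 ≤ y → y ≤ a → ‖w‖ ≤ c * q ^ 2 → 0 ≤ c →
      ‖cexp ((y : ℂ) ^ 2 * β * w)‖ ≤ Real.exp c := by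
    intro y w c hy0 hya hw hc
    refine (Complex.norm_exp_le_exp_norm _).trans (Real.exp_le_exp.mpr ?_)
    rw [norm_mul, norm_mul, norm_pow, norm_real, Real.norm_eq_abs, abs_of_nonneg hy0]
    calc y ^ 2 * ‖β‖ * ‖w‖ ≤ a ^ 2 * ‖β‖ * (c * q ^ 2) := by gcongr
      _ = ‖β‖ * a ^ 2 * (c * q ^ 2) := by ring
      _ ≤ 1 / q ^ 2 * (c * q ^ 2) := by gcongr
      _ = c := by field_simp
  have t1 : ‖2 * (Real.pi / β) ^ (1 / 2 : ℂ) * β * P * (∫ y in (0 : ℝ)..a, cexp (β * P ^ 2 * (y : ℂ) ^ 2))‖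
      ≤ 4 * Real.sqrt Real.pi * Real.exp 4 := by
    have hI : ‖∫ y in (0 : ℝ)..a, cexp (β * P ^ 2 * (y : ℂ) ^ 2)‖ ≤ Real.exp 4 * |a - 0| := by
      refine intervalIntegral.norm_integral_le_of_norm_le_const fun y hy => ?_
      rw [Set.uIoc_of_le ha.le] at hy
      rw [show β * P ^ 2 * (y : ℂ) ^ 2 = (y : ℂ) ^ 2 * β * P ^ 2 by ring]
      exact hexp y _ 4 hy.1.le hy.2 (by rw [norm_pow]; exact hP2) (by norm_num)
    rw [sub_zero, abs_of_pos ha] at hI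
    rw [norm_mul, norm_mul, norm_mul, norm_mul, norm_gaussConst, norm_ofNat,
      Real.sqrt_div Real.pi_pos.le]
    have h2 : ‖β‖ = Real.sqrt ‖β‖ ^ 2 := (Real.sq_sqrt hb.le).symm
    have h3 := Real.sqrt_pos.mpr hb
    have h4 : Real.sqrt ‖β‖ * a ≤ 1 / q := by
      refine abs_le_of_sq_le_sq' ?_ (by positivity) |>.2
      rw [mul_pow, ← h2, div_pow, one_pow]
      exact hbq
    calc 2 * (Real.sqrt Real.pi / Real.sqrt ‖β‖) * ‖β‖ * ‖P‖
          * ‖∫ y in (0 : ℝ)..a, cexp (β * P ^ 2 * (y : ℂ) ^ 2)‖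
        ≤ 2 * (Real.sqrt Real.pi / Real.sqrt ‖β‖) * ‖β‖ * (2 * q) * (Real.exp 4 * a) := by
          gcongr; exact h.norm_le
      _ = 4 * Real.sqrt Real.pi * Real.exp 4 * q * (Real.sqrt ‖β‖ * a) := by
          nth_rw 2 [h2]; field_simp; norm_num
      _ ≤ 4 * Real.sqrt Real.pi * Real.exp 4 * q * (1 / q) := by gcongr
      _ = _ := by field_simp
  have t2 : ‖∫ x in (-1 : ℝ)..1, cexp ((a : ℂ) ^ 2 * β * (P ^ 2 - (x : ℂ) ^ 2)) / (P - x)‖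
      ≤ 4 * Real.exp 5 := by
    have := intervalIntegral.norm_integral_le_of_norm_le_const (a := -1) (b := 1)
      (f := fun x : ℝ => cexp ((a : ℂ) ^ 2 * β * (P ^ 2 - (x : ℂ) ^ 2)) / (P - x))
      (C := Real.exp 5 * 2) fun x hx => by
        rw [Set.uIoc_of_le (by norm_num)] at hx
        have hx' : x ∈ Set.Icc (-1 : ℝ) 1 := ⟨hx.1.le, hx.2⟩
        have h5 := h.le_norm_sub x hx'
        have h6 : ‖P ^ 2 - (x : ℂ) ^ 2‖ ≤ 5 * q ^ 2 := by
          refine (norm_sub_le _ _).trans ?_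
          rw [norm_pow, norm_pow, norm_real, Real.norm_eq_abs, sq_abs]
          nlinarith [hx'.1, hx'.2]
        rw [norm_div, div_eq_mul_inv]
        gcongr
        · exact hexp a _ 5 ha.le le_rfl h6 (by norm_num)
        · rw [inv_le_comm₀ (by linarith) two_pos]; linarith
    refine this.trans (le_of_eq ?_)
    norm_num; ring
  have t3 : ‖P / (P ^ 2 - 1) * (cexp ((a : ℂ) ^ 2 * β * P ^ 2) * gaussTail β a / a)‖
      ≤ 16 * Real.exp 4 * q := by
    have h7 := norm_gaussTail_le hβ ha
    have h8 : Real.exp (-(β.re * a ^ 2)) ≤ 1 := Real.exp_le_one_iff.mpr (by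
      have := mul_pos hβ (pow_pos ha 2); linarith)
    rw [norm_mul, norm_div, norm_div, norm_mul, norm_real, Real.norm_eq_abs, abs_of_pos ha]
    calc _ ≤ 2 * q / ‖P ^ 2 - 1‖ * (Real.exp 4 * (2 * 1 / (‖β‖ * a)) / a) := by
          gcongr
          · exact h.norm_le
          · exact hexp a _ 4 ha.le le_rfl (by rw [norm_pow]; exact hP2) (by norm_num)
          · exact h7.trans (by gcongr)
      _ = 4 * q * Real.exp 4 / (‖P ^ 2 - 1‖ * (‖β‖ * a ^ 2)) := by field_simp; norm_num
      _ = _ := by rw [hbA]; field_simp; norm_num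
  rw [errPrimitive]
  refine (norm_sub_le _ _).trans ((add_le_add ((norm_sub_le _ _).trans (add_le_add t1 t2)) t3).trans ?_)
  have : 0 ≤ 4 * Real.sqrt Real.pi * Real.exp 4 + 4 * Real.exp 5 := by positivity
  nlinarith

/-- The derivative at x is at most a constant times e^{x²ρ}/x³, with ρ = Re β(P² - 1). A majorant
with an explicit primitive is integrated from a to 1. -/
lemma IsFar.norm_errPrimitive_le {β P : ℂ} {q : ℝ} (h : IsFar β P q) {a : ℝ} (ha : 0 < a) (ha1 : a ≤ 1) :
    ‖errPrimitive β P 1‖ ≤ ‖errPrimitive β P a‖ + 4 * ‖P‖ / ‖β * (P ^ 2 - 1)‖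
      * (Real.exp ((β * (P ^ 2 - 1)).re / 4) / 2 * (1 / a ^ 2 - 1)
        + 8 / (β * (P ^ 2 - 1)).re * (Real.exp (β * (P ^ 2 - 1)).re
          - Real.exp (a ^ 2 * (β * (P ^ 2 - 1)).re))) := by
  have hq := h.two_le
  have hβ : 0 < β.re := by linarith [h.quarter_le]
  have hβ0 : β ≠ 0 := by rintro rfl; simp at hβ
  have hb : 0 < ‖β‖ := norm_pos_iff.mpr hβ0
  have hA : 0 < ‖P ^ 2 - 1‖ := lt_of_lt_of_le (by positivity) h.le_norm_sq_sub
  have hPx : ∀ x ∈ Set.Icc (-1 : ℝ) 1, P - x ≠ 0 := fun x hx h0 => by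
    have := h.le_norm_sub x hx
    rw [h0, norm_zero] at this; norm_num at this
  set ρ := (β * (P ^ 2 - 1)).re with hρ
  have hρ0 : 0 < ρ := lt_of_lt_of_le (by positivity) h.le_re
  have hder := fun (x : ℝ) (hx : 0 < x) => hasDerivAt_errPrimitive (β := β) (norm_pos_iff.mp hA) hPx hx
  set c := 4 * ‖P‖ / ‖β * (P ^ 2 - 1)‖ with hc
  have hB : ∀ x : ℝ, 0 < x → HasDerivAt (fun x : ℝ => ‖errPrimitive β P a‖
      + c * (Real.exp (ρ / 4) / 2 * (1 / a ^ 2 - 1 / x ^ 2)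
        + 8 / ρ * (Real.exp (x ^ 2 * ρ) - Real.exp (a ^ 2 * ρ))))
      (c * (Real.exp (ρ / 4) / x ^ 3 + 16 * x * Real.exp (x ^ 2 * ρ))) x := by
    intro x hx
    have h1 : HasDerivAt (fun x : ℝ => 1 / a ^ 2 - 1 / x ^ 2) (2 / x ^ 3) x := by
      have := ((hasDerivAt_const x (1 : ℝ)).fun_div (hasDerivAt_pow 2 x) (by positivity)).const_sub
        (1 / a ^ 2)
      refine this.congr_deriv ?_
      push_cast
      field_simp
      ring
    have h2 : HasDerivAt (fun x : ℝ => x ^ 2 * ρ) (2 * x * ρ) x := by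
      simpa using (hasDerivAt_pow 2 x).mul_const ρ
    refine (((h1.const_mul _).fun_add ((h2.exp.sub_const _).const_mul (8 / ρ))).const_mul c
      |>.const_add _).congr_deriv ?_
    field_simp
    ring
  have key := image_norm_le_of_norm_deriv_right_le_deriv_boundary'
    (f := errPrimitive β P) (a := a) (b := 1)
    (fun x hx => (hder x (ha.trans_le hx.1)).continuousAt.continuousWithinAt)
    (fun x hx => (hder x (ha.trans_le hx.1)).hasDerivWithinAt)
    (B := fun x : ℝ => ‖errPrimitive β P a‖
      + c * (Real.exp (ρ / 4) / 2 * (1 / a ^ 2 - 1 / x ^ 2)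
        + 8 / ρ * (Real.exp (x ^ 2 * ρ) - Real.exp (a ^ 2 * ρ))))
    (B' := fun x => c * (Real.exp (ρ / 4) / x ^ 3 + 16 * x * Real.exp (x ^ 2 * ρ)))
    (by simp)
    (fun x hx => (hB x (ha.trans_le hx.1)).continuousAt.continuousWithinAt)
    (fun x hx => (hB x (ha.trans_le hx.1)).hasDerivWithinAt)
    (fun x hx => ?_) (x := 1) ⟨ha1, le_rfl⟩
  · simpa using key
  · have hx0 : 0 < x := ha.trans_le hx.1
    have h3 : ‖cexp ((x : ℂ) ^ 2 * β * P ^ 2)‖ = Real.exp (x ^ 2 * ρ) * Real.exp (β.re * x ^ 2) := by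
      rw [Complex.norm_exp, ← Real.exp_add, mul_assoc, ← ofReal_pow, re_ofReal_mul, hρ,
        mul_sub, sub_re, mul_one]
      congr 1; ring
    rw [norm_mul, norm_mul, norm_div, norm_mul, h3, norm_ofNat]
    calc _ ≤ 2 * ‖P‖ / ‖P ^ 2 - 1‖ * (Real.exp (x ^ 2 * ρ) * Real.exp (β.re * x ^ 2))
          * (2 * Real.exp (-(β.re * x ^ 2)) / (‖β‖ * x ^ 3)) := by
          gcongr
          exact norm_gaussTail_remainder_le hβ hx0
      _ = c * (Real.exp (x ^ 2 * ρ) / x ^ 3) * (Real.exp (β.re * x ^ 2) * Real.exp (-(β.re * x ^ 2))) := by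
          rw [hc, norm_mul]; field_simp; ring
      _ = c * (Real.exp (x ^ 2 * ρ) / x ^ 3) := by rw [← Real.exp_add]; simp
      _ ≤ _ := by
          have hc0 : 0 ≤ c := by positivity
          refine mul_le_mul_of_nonneg_left ?_ hc0
          -- For x ≤ 1/2 the exponential is at most e^{ρ/4}; for x ≥ 1/2 one has 1/x³ ≤ 16x, and 2xρ
          -- e^{x²ρ} is an exact derivative.
          rcases le_total x (1 / 2) with hh | hh
          · have h7 : x ^ 2 ≤ 1 / 4 := by nlinarith
            have h4 : Real.exp (x ^ 2 * ρ) ≤ Real.exp (ρ / 4) :=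
              Real.exp_le_exp.mpr (by nlinarith)
            have h5 : Real.exp (x ^ 2 * ρ) / x ^ 3 ≤ Real.exp (ρ / 4) / x ^ 3 := by gcongr
            have h6 : 0 ≤ 16 * x * Real.exp (x ^ 2 * ρ) := by positivity
            linarith
          · have h4 : (1 : ℝ) ≤ 16 * x * x ^ 3 := by
              have : (1 / 2 : ℝ) ^ 4 ≤ x ^ 4 := by gcongr
              calc (1 : ℝ) = 16 * (1 / 2) ^ 4 := by norm_num
                _ ≤ 16 * x ^ 4 := by gcongr
                _ = _ := by ring
            have h5 : Real.exp (x ^ 2 * ρ) / x ^ 3 ≤ 16 * x * Real.exp (x ^ 2 * ρ) := by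
              rw [div_le_iff₀ (by positivity)]
              nlinarith [Real.exp_pos (x ^ 2 * ρ)]
            have h6 : 0 ≤ Real.exp (ρ / 4) / x ^ 3 := by positivity
            linarith

/-- Multiplication by e^{-β(P²-1)} suppresses the starting value and the range x ≤ 1/2, since ρ ≥
q²/10; the part near x = 1 leaves O(q/(|b|ρ)) = O(q^{-3}), where b = β(P² - 1). Replacing P/(P² - 1)
by 1/P is of the same order. -/
theorem exists_norm_errKernelDiff_sub_le : ∃ C : ℝ, 0 ≤ C ∧ ∀ (β P : ℂ) (q : ℝ), IsFar β P q →
    ‖errKernelDiff β P - errKernelLead β / P‖ ≤ C / q ^ 2 := by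
  set K := 4 * Real.sqrt Real.pi * Real.exp 4 + 4 * Real.exp 5 + 16 * Real.exp 4 with hK
  have hK0 : 0 ≤ K := by positivity
  refine ⟨200 * K + 100000, by positivity, fun β P q h => ?_⟩
  have hq := h.two_le
  have hq0 : 0 < q := by linarith
  have hβ : 0 < β.re := by linarith [h.quarter_le]
  have hβ0 : β ≠ 0 := by rintro rfl; simp at hβ
  have hb : 0 < ‖β‖ := norm_pos_iff.mpr hβ0
  have hA : 0 < ‖P ^ 2 - 1‖ := lt_of_lt_of_le (by positivity) h.le_norm_sq_sub
  have hPn : 0 < ‖P‖ := lt_of_lt_of_le (by positivity) h.le_norm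
  have hP0 : P ≠ 0 := norm_pos_iff.mp hPn
  have hA0 : P ^ 2 - 1 ≠ 0 := norm_pos_iff.mp hA
  have hρq := h.le_re
  have hstart := fun a ha => h.norm_errPrimitive_start_le (a := a) ha
  have hprim := fun a ha ha1 => h.norm_errPrimitive_le (a := a) ha ha1
  have hdiff := errKernelDiff_eq (β := β) (P := P)
  generalize hbdef : β * (P ^ 2 - 1) = b at *
  generalize hρ : b.re = ρ at *
  have hρ0 : 0 < ρ := lt_of_lt_of_le (by positivity) hρq
  have hbn : ρ ≤ ‖b‖ := hρ ▸ Complex.re_le_norm b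
  have hbn0 : 0 < ‖b‖ := by linarith
  have hb1 : (2 / 5 : ℝ) ≤ ‖b‖ := by nlinarith
  have hbq : q ^ 2 / 16 ≤ ‖b‖ := by
    rw [← hbdef, norm_mul]
    have h1 : (1 / 4 : ℝ) ≤ ‖β‖ := h.quarter_le.trans (Complex.re_le_norm β)
    have := mul_le_mul h1 h.le_norm_sq_sub (by positivity) (norm_nonneg β)
    linarith
  have hsq : Real.sqrt ‖b‖ ^ 2 = ‖b‖ := Real.sq_sqrt hbn0.le
  have hsq0 : 0 < Real.sqrt ‖b‖ := Real.sqrt_pos.mpr hbn0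
  have ha0 : 0 < 1 / (2 * Real.sqrt ‖b‖) := by positivity
  have ha2 : (1 / (2 * Real.sqrt ‖b‖)) ^ 2 * (4 * ‖b‖) = 1 := by
    rw [div_pow, mul_pow, hsq]; field_simp; norm_num
  have ha1 : 1 / (2 * Real.sqrt ‖b‖) ≤ 1 := by
    rw [div_le_one (by positivity)]
    nlinarith
  have hs := hstart _ ha0 ha2
  have hp := hprim _ ha0 ha1
  have hinv : 1 / (1 / (2 * Real.sqrt ‖b‖)) ^ 2 = 4 * ‖b‖ := by
    rw [div_eq_iff (by positivity)]; linarith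
  rw [hinv] at hp
  have hmain : ‖cexp (-b) * errPrimitive β P 1‖ ≤ (200 * K + 20000) / q ^ 2 := by
    -- From e^{-x} ≤ 2/x² and ρ ≥ q²/10; in the next line the exponent is 3ρ/4.
    have e1 : Real.exp (-ρ) ≤ 200 / q ^ 4 := by
      refine (exp_neg_le_two_div_sq hρ0).trans ?_
      rw [div_le_div_iff₀ (by positivity) (by positivity)]
      nlinarith [mul_self_le_mul_self (by positivity) hρq]
    have e2 : Real.exp (-ρ) * Real.exp (ρ / 4) ≤ 360 / q ^ 4 := by
      rw [← Real.exp_add, show -ρ + ρ / 4 = -(3 / 4 * ρ) by ring]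
      refine (exp_neg_le_two_div_sq (by positivity)).trans ?_
      rw [div_le_div_iff₀ (by positivity) (by positivity)]
      nlinarith [mul_self_le_mul_self (by positivity) hρq]
    have e3 : Real.exp (-ρ) * Real.exp ρ = 1 := by rw [← Real.exp_add]; simp
    rw [norm_mul, Complex.norm_exp, neg_re, hρ]
    have hd : 0 ≤ 4 * ‖P‖ / ‖b‖ := by positivity
    have f1 : Real.exp (ρ / 4) / 2 * (4 * ‖b‖ - 1) ≤ Real.exp (ρ / 4) * (2 * ‖b‖) := by
      have := Real.exp_pos (ρ / 4)
      linarith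
    have f2 : 8 / ρ * (Real.exp ρ - Real.exp ((1 / (2 * Real.sqrt ‖b‖)) ^ 2 * ρ))
        ≤ 8 / ρ * Real.exp ρ := by
      gcongr
      have := Real.exp_pos ((1 / (2 * Real.sqrt ‖b‖)) ^ 2 * ρ)
      linarith
    have f3 : ‖errPrimitive β P 1‖ ≤ K * q + 4 * ‖P‖ / ‖b‖
        * (Real.exp (ρ / 4) * (2 * ‖b‖) + 8 / ρ * Real.exp ρ) :=
      hp.trans (add_le_add hs (mul_le_mul_of_nonneg_left (add_le_add f1 f2) hd))
    calc Real.exp (-ρ) * ‖errPrimitive β P 1‖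
        ≤ Real.exp (-ρ) * (K * q + 4 * ‖P‖ / ‖b‖
          * (Real.exp (ρ / 4) * (2 * ‖b‖) + 8 / ρ * Real.exp ρ)) := by gcongr
      _ = K * q * Real.exp (-ρ) + 8 * ‖P‖ * (Real.exp (-ρ) * Real.exp (ρ / 4))
          + 32 * ‖P‖ / (‖b‖ * ρ) * (Real.exp (-ρ) * Real.exp ρ) := by field_simp; ring
      _ ≤ K * q * (200 / q ^ 4) + 8 * (2 * q) * (360 / q ^ 4)
          + 32 * (2 * q) / (q ^ 2 / 16 * (q ^ 2 / 10)) * 1 := by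
          rw [e3]
          gcongr
          · exact h.norm_le
          · exact h.norm_le
      _ = (200 * K + 16000) / q ^ 3 := by field_simp; ring
      _ ≤ (200 * K + 20000) / q ^ 2 := by
          rw [div_le_div_iff₀ (by positivity) (by positivity)]
          nlinarith [mul_nonneg hK0 (by positivity : 0 ≤ q ^ 2), pow_pos hq0 2,
            mul_nonneg (mul_nonneg hK0 (by positivity : 0 ≤ q ^ 2)) (by linarith : 0 ≤ q - 1)]
  have hlead : ‖(P / (P ^ 2 - 1) - 1 / P) * errKernelLead β‖ ≤ 64 / q ^ 2 := by
    have h1 : P / (P ^ 2 - 1) - 1 / P = 1 / ((P ^ 2 - 1) * P) := by field_simp; ring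
    have h2 : ‖errKernelLead β‖ ≤ 8 := by
      refine (norm_errKernelLead_le hβ).trans ?_
      rw [div_le_iff₀ hb]
      linarith [h.quarter_le.trans (Complex.re_le_norm β)]
    rw [h1, norm_mul, norm_div, norm_one, norm_mul]
    calc _ ≤ 1 / (q ^ 2 / 4 * (q / 2)) * 8 := by
          gcongr
          · exact h.le_norm_sq_sub
          · exact h.le_norm
      _ = 64 / q ^ 2 * (1 / q) := by field_simp; norm_num
      _ ≤ 64 / q ^ 2 * 1 := by
          gcongr
          rw [div_le_one hq0]; linarith
      _ = _ := mul_one _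
  have hfin : errKernelDiff β P - errKernelLead β / P
      = cexp (-b) * errPrimitive β P 1 + (P / (P ^ 2 - 1) - 1 / P) * errKernelLead β := by
    rw [← hdiff]; ring
  rw [hfin]
  refine (norm_add_le _ _).trans ((add_le_add hmain hlead).trans ?_)
  rw [← add_div]
  exact div_le_div_of_nonneg_right (by linarith) (by positivity)

/-! ### Lattice sums of the error kernel and the cotangent. -/

/-- The difference of `π cot(πv)` and its pole at the origin, as a partial fraction series. -/
noncomputable def cotReg (v : ℂ) : ℂ := ∑' n : ℕ, (1 / (v - (n + 1)) + 1 / (v + (n + 1)))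

lemma norm_cotReg_term_le {v : ℂ} (hv : ‖v‖ ≤ 4 / 5) (n : ℕ) :
    ‖1 / (v - (n + 1)) + 1 / (v + (n + 1))‖ ≤ 5 * (1 / ((n : ℝ) + 1) ^ 2) := by
  have hN : (1 : ℝ) ≤ (n : ℝ) + 1 := by linarith [(Nat.cast_nonneg n : (0 : ℝ) ≤ n)]
  have hNn : ‖((n : ℂ) + 1)‖ = (n : ℝ) + 1 := by
    rw [show (n : ℂ) + 1 = ((n + 1 : ℝ) : ℂ) by push_cast; ring, norm_real, Real.norm_of_nonneg (by linarith)]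
  have h1 : v - (n + 1) ≠ 0 := fun h => by
    rw [sub_eq_zero.mp h, hNn] at hv; linarith
  have h2 : v + (n + 1) ≠ 0 := fun h => by
    rw [eq_neg_of_add_eq_zero_left h, norm_neg, hNn] at hv; linarith
  rw [show 1 / (v - (n + 1)) + 1 / (v + (n + 1)) = 2 * v / (v ^ 2 - (n + 1) ^ 2) by
    rw [show v ^ 2 - ((n : ℂ) + 1) ^ 2 = (v - (n + 1)) * (v + (n + 1)) by ring]; field_simp; ring]
  have h3 : (9 / 25) * ((n : ℝ) + 1) ^ 2 ≤ ‖v ^ 2 - (n + 1) ^ 2‖ := by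
    have h4 := norm_sub_norm_le ((n + 1 : ℂ) ^ 2) (v ^ 2)
    rw [norm_pow, norm_pow, hNn, norm_sub_rev] at h4
    have : ‖v‖ ^ 2 ≤ (4 / 5) ^ 2 := by gcongr
    nlinarith
  rw [norm_div, norm_mul, norm_ofNat]
  calc 2 * ‖v‖ / ‖v ^ 2 - (n + 1) ^ 2‖ ≤ 2 * (4 / 5) / ((9 / 25) * ((n : ℝ) + 1) ^ 2) := by gcongr
    _ = 40 / 9 * (1 / ((n : ℝ) + 1) ^ 2) := by field_simp; norm_num
    _ ≤ _ := by gcongr; norm_num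

lemma summable_one_div_succ_sq : Summable fun n : ℕ => 1 / ((n : ℝ) + 1) ^ 2 := by
  have := (summable_nat_add_iff 1).mpr (Real.summable_one_div_nat_pow.mpr (one_lt_two))
  simpa using this

lemma tsum_one_div_succ_sq_nonneg : 0 ≤ ∑' n : ℕ, 1 / ((n : ℝ) + 1) ^ 2 :=
  tsum_nonneg fun n => by positivity

lemma summable_cotReg {v : ℂ} (hv : ‖v‖ ≤ 4 / 5) :
    Summable fun n : ℕ => 1 / (v - (n + 1)) + 1 / (v + (n + 1)) :=
  Summable.of_norm_bounded (summable_one_div_succ_sq.mul_left 5) (norm_cotReg_term_le hv)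

lemma norm_cotReg_le {v : ℂ} (hv : ‖v‖ ≤ 4 / 5) :
    ‖cotReg v‖ ≤ 5 * ∑' n : ℕ, 1 / ((n : ℝ) + 1) ^ 2 := by
  rw [← tsum_mul_left]
  exact tsum_of_norm_bounded (summable_one_div_succ_sq.mul_left 5).hasSum (norm_cotReg_term_le hv)

lemma differentiableOn_cotReg : DifferentiableOn ℂ cotReg (Metric.ball 0 (4 / 5)) := by
  refine Complex.differentiableOn_tsum_of_summable_norm (summable_one_div_succ_sq.mul_left 5)
    (fun n => ?_) Metric.isOpen_ball fun n w hw => norm_cotReg_term_le (by simpa using (le_of_lt (by simpa using hw))) n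
  intro v hv
  have hv' : ‖v‖ < 4 / 5 := by simpa using hv
  have hN : (1 : ℝ) ≤ (n : ℝ) + 1 := by linarith [(Nat.cast_nonneg n : (0 : ℝ) ≤ n)]
  have hNn : ‖((n : ℂ) + 1)‖ = (n : ℝ) + 1 := by
    rw [show (n : ℂ) + 1 = ((n + 1 : ℝ) : ℂ) by push_cast; ring, norm_real, Real.norm_of_nonneg (by linarith)]
  have h1 : v - (n + 1) ≠ 0 := fun h => by
    rw [sub_eq_zero.mp h, hNn] at hv'; linarith
  have h2 : v + (n + 1) ≠ 0 := fun h => by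
    rw [eq_neg_of_add_eq_zero_left h, norm_neg, hNn] at hv'; linarith
  refine (DifferentiableAt.add ?_ ?_).differentiableWithinAt
  · exact (differentiableAt_const _).fun_div (by fun_prop) h1
  · exact (differentiableAt_const _).fun_div (by fun_prop) h2

lemma cotReg_eq {v : ℂ} (hv : ‖v‖ ≤ 4 / 5) :
    cotReg v = Real.pi * Complex.cot (Real.pi * v) - 1 / v := by
  rcases eq_or_ne v 0 with rfl | h0
  · have h1 : ∀ n : ℕ, 1 / ((0 : ℂ) - (n + 1)) + 1 / (0 + (n + 1)) = 0 := fun n => by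
      rw [zero_sub, zero_add, div_neg, neg_add_cancel]
    rw [cotReg, tsum_congr h1, tsum_zero]
    simp [Complex.cot]
  · have hm : v ∈ Complex.integerComplement := by
      rintro ⟨n, hn⟩
      rw [← hn, norm_intCast] at hv
      have : n ≠ 0 := by rintro rfl; simp at hn; exact h0 hn.symm
      have h1 : (1 : ℝ) ≤ |(n : ℝ)| := by exact_mod_cast Int.one_le_abs this
      linarith
    rw [cot_series_rep' hm]
    rfl

/-- The range of the parameters `β` and `u` in which the lattice sums are estimated. -/
structure IsNear (β u : ℂ) : Prop where
  quarter_le : 1 / 4 ≤ β.re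
  norm_le : ‖u‖ ≤ 3 / 50
  norm_mul_le : ‖β * u‖ ≤ 1 / 60

/-- Here β((u - n)² - 1) = (n² - 1)β + βu(u - 2n). Only βu is assumed small, so the second term is
harmless even though Im β may be large. -/
lemma IsNear.isFar {β u : ℂ} (h : IsNear β u) {n : ℤ} (hn : 2 ≤ |n|) :
    IsFar β (u - n) |(n : ℝ)| := by
  have hq : (2 : ℝ) ≤ |(n : ℝ)| := by exact_mod_cast hn
  have hu := h.norm_le
  have hnn : ‖(n : ℂ)‖ = |(n : ℝ)| := norm_intCast n
  have h1 := norm_sub_norm_le (n : ℂ) u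
  have h2 := norm_sub_le u (n : ℂ)
  rw [norm_sub_rev] at h1
  rw [hnn] at h1 h2
  have hsq : |(n : ℝ)| ^ 2 = (n : ℝ) ^ 2 := sq_abs _
  refine ⟨hq, h.quarter_le, by linarith, by linarith, ?_, ?_, fun x hx => ?_⟩
  · have h3 := norm_sub_norm_le ((u - n) ^ 2) 1
    rw [norm_pow, norm_one] at h3
    nlinarith
  · have h3 : β * ((u - n) ^ 2 - 1) = ((n ^ 2 - 1 : ℝ) : ℂ) * β + β * u * (u - 2 * n) := by
      push_cast; ring
    have h4 : ‖β * u * (u - 2 * n)‖ ≤ 1 / 60 * (3 / 50 + 2 * |(n : ℝ)|) := by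
      rw [norm_mul]
      refine mul_le_mul h.norm_mul_le ?_ (norm_nonneg _) (by norm_num)
      refine (norm_sub_le _ _).trans ?_
      rw [norm_mul, norm_ofNat, hnn]
      linarith
    have h5 := (abs_le.mp ((Complex.abs_re_le_norm _).trans h4)).1
    rw [h3, add_re, re_ofReal_mul, hsq]
    have h6 : (n : ℝ) ^ 2 ≥ 4 := by rw [← hsq]; nlinarith
    have h7 := mul_le_mul_of_nonneg_left h.quarter_le (by linarith : 0 ≤ (n : ℝ) ^ 2 - 1)
    rw [← hsq] at h6 h7 ⊢
    nlinarith
  · have hx1 : ‖(x : ℂ)‖ ≤ 1 := by rw [norm_real]; exact abs_le.mpr hx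
    have h3 := norm_sub_norm_le (u - n) (x : ℂ)
    linarith

lemma IsNear.re_ge {β u : ℂ} (h : IsNear β u) {n : ℤ} (hn : |n| ≤ 1) :
    -1 ≤ (β * (u - n) ^ 2).re := by
  have hq : |(n : ℝ)| ≤ 1 := by exact_mod_cast hn
  have h3 : β * (u - n) ^ 2 = ((n ^ 2 : ℝ) : ℂ) * β + β * u * (u - 2 * n) := by
    push_cast; ring
  have h4 : ‖β * u * (u - 2 * n)‖ ≤ 1 / 60 * (3 / 50 + 2 * 1) := by
    rw [norm_mul]
    refine mul_le_mul h.norm_mul_le ?_ (norm_nonneg _) (by norm_num)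
    refine (norm_sub_le _ _).trans ?_
    rw [norm_mul, norm_ofNat, norm_intCast]
    linarith [h.norm_le]
  have h5 := (abs_le.mp ((Complex.abs_re_le_norm _).trans h4)).1
  rw [h3, add_re, re_ofReal_mul]
  have := mul_nonneg (sq_nonneg (n : ℝ)) (by linarith [h.quarter_le] : 0 ≤ β.re)
  linarith

lemma norm_cexp_mul_one_sub_sq_le {β : ℂ} (hβ : 0 ≤ β.re) (x : ℝ) :
    ‖cexp (β * (1 - (x : ℂ) ^ 2))‖ ≤ Real.exp β.re := by
  rw [show β * (1 - (x : ℂ) ^ 2) = ((1 - x ^ 2 : ℝ) : ℂ) * β by push_cast; ring, Complex.norm_exp,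
    re_ofReal_mul]
  exact Real.exp_le_exp.mpr (by nlinarith [mul_nonneg (sq_nonneg x) hβ])

lemma gaussConst_mul_errKernel_eq (β P : ℂ) :
    cexp β * (Real.pi / β : ℂ) ^ (1 / 2 : ℂ) * errKernel β P
      = (∫ x in (-1 : ℝ)..1, cexp (β * (1 - (x : ℂ) ^ 2)) / (x + P)) + errKernelDiff β P := by
  have h := intervalIntegral.integral_comp_neg (a := -1) (b := 1)
    (fun x : ℝ => cexp (β * (1 - (x : ℂ) ^ 2)) / (x + P))
  rw [neg_neg] at h
  rw [← h, errKernelDiff]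
  simp only [ofReal_neg, neg_sq, neg_add_eq_sub]
  ring

/-- The sum of `errKernel` over the nonzero points of a lattice translate, in symmetric order. -/
noncomputable def latticeTail (β : ℂ) (k : ℕ) (w : ℂ) : ℂ :=
  ∑' n : ℕ, (errKernel β (w - 6 * k * (n + 1)) + errKernel β (w + 6 * k * (n + 1)))

lemma IsNear.beta_ne_zero {β u : ℂ} (h : IsNear β u) : β ≠ 0 := by
  rintro rfl
  have := h.quarter_le
  norm_num at this

lemma IsNear.norm_errKernelLead_le {β u : ℂ} (h : IsNear β u) : ‖errKernelLead β‖ ≤ 8 := by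
  refine (_root_.norm_errKernelLead_le (by linarith [h.quarter_le])).trans ?_
  rw [div_le_iff₀ (norm_pos_iff.mpr h.beta_ne_zero)]
  linarith [h.quarter_le.trans (Complex.re_le_norm β)]

/-- The worst case is (1 + 3/50 + 7/2)/6 = 0.76, at k = 1; this is the reason for the radius 4/5 in
the estimates of `cotReg`. -/
lemma IsNear.norm_scaled_le {β u : ℂ} (h : IsNear β u) {k : ℕ} (hk : 0 < k) {p : ℤ}
    (hp : 2 * |p| ≤ 7 * k) {x : ℝ} (hx : x ∈ Set.Icc (-1 : ℝ) 1) :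
    ‖((x : ℂ) + u - p) / (6 * k)‖ < 4 / 5 := by
  have hk1 : (1 : ℝ) ≤ k := by exact_mod_cast hk
  have hp' : 2 * |(p : ℝ)| ≤ 7 * k := by exact_mod_cast hp
  have hx1 : ‖(x : ℂ)‖ ≤ 1 := by rw [norm_real]; exact abs_le.mpr hx
  have hpn : ‖(p : ℂ)‖ = |(p : ℝ)| := norm_intCast p
  rw [norm_div, norm_mul, norm_ofNat, norm_natCast, div_lt_iff₀ (by positivity)]
  have h1 := norm_sub_le ((x : ℂ) + u) p
  have h2 := norm_add_le (x : ℂ) u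
  linarith [h.norm_le]

/-- All translates of u - p by nonzero multiples of 6k are far, so each kernel is a Cauchy integral
plus a leading term plus a remainder. The Cauchy integrals sum to `cotReg`; the rest, taken in
pairs, is O(1/(k(n + 1)²)). -/
theorem exists_norm_latticeTail_sub_le : ∃ C : ℝ, 0 ≤ C ∧ ∀ (β u : ℂ), IsNear β u → ∀ (k : ℕ), 0 < k →
    ∀ p : ℤ, 2 * |p| ≤ 7 * k →
    ‖cexp β * (Real.pi / β : ℂ) ^ (1 / 2 : ℂ) * latticeTail β k (u - p)
      - ∫ x in (-1 : ℝ)..1, cexp (β * (1 - (x : ℂ) ^ 2)) * (1 / (6 * k) * cotReg ((x + u - p) / (6 * k)))‖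
      ≤ C / k := by
  obtain ⟨C, hC, hdiff⟩ := exists_norm_errKernelDiff_sub_le
  set S := ∑' n : ℕ, 1 / ((n : ℝ) + 1) ^ 2 with hS
  have hS0 : 0 ≤ S := tsum_one_div_succ_sq_nonneg
  refine ⟨(2 * C + 8) * S, by positivity, fun β u h k hk p hp => ?_⟩
  have hk1 : (1 : ℝ) ≤ k := by exact_mod_cast hk
  have hk0 : (k : ℂ) ≠ 0 := by exact_mod_cast hk.ne'
  have hp' : 2 * |(p : ℝ)| ≤ 7 * k := by exact_mod_cast hp
  set E := cexp β * (Real.pi / β : ℂ) ^ (1 / 2 : ℂ) with hE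
  -- The constant is 6 - 7/2 = 5/2.
  have hbig : ∀ n : ℕ, ∀ s : ℤ, s = 1 ∨ s = -1 → 5 / 2 * (k * ((n : ℝ) + 1)) ≤ |((p + s * (6 * k * (n + 1)) : ℤ) : ℝ)| := by
    intro n s hs
    have hn : (0 : ℝ) ≤ n := Nat.cast_nonneg n
    have hkn : (k : ℝ) ≤ k * (n + 1) := by nlinarith
    have h1 := abs_le.mp (le_refl |(p : ℝ)|)
    rcases hs with rfl | rfl
    · refine le_trans ?_ (le_abs_self _)
      push_cast
      linarith
    · refine le_trans ?_ (neg_le_abs _)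
      push_cast
      linarith
  have htwo : ∀ n : ℕ, ∀ s : ℤ, s = 1 ∨ s = -1 → 2 ≤ |p + s * (6 * k * (n + 1))| := by
    intro n s hs
    have h1 := hbig n s hs
    have hn : (0 : ℝ) ≤ n := Nat.cast_nonneg n
    have hkn : (k : ℝ) ≤ k * (n + 1) := by nlinarith
    have : (2 : ℝ) ≤ |((p + s * (6 * k * (n + 1)) : ℤ) : ℝ)| := by linarith
    exact_mod_cast this
  have hD : ∀ n : ℕ, ‖errKernelDiff β (u - p - 6 * k * (n + 1))
      + errKernelDiff β (u - p + 6 * k * (n + 1))‖ ≤ (2 * C + 8) / k * (1 / ((n : ℝ) + 1) ^ 2) := by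
    intro n
    have hn1 : (1 : ℝ) ≤ (n : ℝ) + 1 := by linarith [(Nat.cast_nonneg n : (0 : ℝ) ≤ n)]
    have e1 : u - p - 6 * k * (n + 1) = u - ((p + 1 * (6 * k * (n + 1)) : ℤ) : ℂ) := by push_cast; ring
    have e2 : u - p + 6 * k * (n + 1) = u - ((p + (-1) * (6 * k * (n + 1)) : ℤ) : ℂ) := by push_cast; ring
    have f1 := h.isFar (htwo n 1 (.inl rfl))
    have f2 := h.isFar (htwo n (-1) (.inr rfl))
    have b1 := hdiff _ _ _ f1
    have b2 := hdiff _ _ _ f2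
    have g : ∀ s : ℤ, s = 1 ∨ s = -1 → C / |((p + s * (6 * k * (n + 1)) : ℤ) : ℝ)| ^ 2 ≤ C / k * (1 / ((n : ℝ) + 1) ^ 2) := by
      intro s hs
      have h1 := hbig n s hs
      calc _ ≤ C / (5 / 2 * (k * ((n : ℝ) + 1))) ^ 2 := by gcongr
        _ = (4 / 25) * (1 / k) * (C / k * (1 / ((n : ℝ) + 1) ^ 2)) := by field_simp; ring
        _ ≤ 1 * (C / k * (1 / ((n : ℝ) + 1) ^ 2)) := by
            gcongr
            have : 1 / (k : ℝ) ≤ 1 := by rw [div_le_one (by linarith)]; exact hk1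
            linarith
        _ = _ := one_mul _
    have b1' := b1.trans (g 1 (.inl rfl))
    have b2' := b2.trans (g (-1) (.inr rfl))
    rw [← e1] at b1' f1
    rw [← e2] at b2' f2
    have n1 : u - p - 6 * k * (n + 1) ≠ 0 := norm_pos_iff.mp (lt_of_lt_of_le (by have := f1.two_le; positivity) f1.le_norm)
    have n2 : u - p + 6 * k * (n + 1) ≠ 0 := norm_pos_iff.mp (lt_of_lt_of_le (by have := f2.two_le; positivity) f2.le_norm)
    -- Individually the leading terms decay only like 1/n; a symmetric pair cancels to O(1/(k(n +
    -- 1)²)).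
    have b3 : ‖errKernelLead β / (u - p - 6 * k * (n + 1)) + errKernelLead β / (u - p + 6 * k * (n + 1))‖
        ≤ 8 / k * (1 / ((n : ℝ) + 1) ^ 2) := by
      have e3 : errKernelLead β / (u - p - 6 * k * (n + 1)) + errKernelLead β / (u - p + 6 * k * (n + 1))
          = errKernelLead β * (1 / (6 * k)) *
            (1 / ((u - p) / (6 * k) - (n + 1)) + 1 / ((u - p) / (6 * k) + (n + 1))) := by
        rw [show (u - p) / (6 * k) - (n + 1) = (u - p - 6 * k * (n + 1)) / (6 * k) by field_simp,
          show (u - p) / (6 * k) + (n + 1) = (u - p + 6 * k * (n + 1)) / (6 * k) by field_simp]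
        field_simp
      have hv : ‖(u - p) / (6 * k)‖ ≤ 4 / 5 := by
        have := h.norm_scaled_le hk hp (x := 0) (by norm_num)
        rw [ofReal_zero, zero_add] at this
        exact this.le
      rw [e3, norm_mul, norm_mul, norm_div, norm_one, norm_mul, norm_ofNat, Complex.norm_natCast]
      calc _ ≤ 8 * (1 / (6 * (k : ℝ))) * (5 * (1 / ((n : ℝ) + 1) ^ 2)) := by
            gcongr
            · exact h.norm_errKernelLead_le
            · exact norm_cotReg_term_le hv n
        _ = (5 / 6) * (8 / k * (1 / ((n : ℝ) + 1) ^ 2)) := by field_simp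
        _ ≤ 1 * (8 / k * (1 / ((n : ℝ) + 1) ^ 2)) := by gcongr; norm_num
        _ = _ := one_mul _
    generalize errKernelDiff β (u - p - 6 * k * (n + 1)) = D1 at *
    generalize errKernelDiff β (u - p + 6 * k * (n + 1)) = D2 at *
    calc ‖D1 + D2‖ = ‖(D1 - errKernelLead β / (u - p - 6 * k * (n + 1)))
          + (D2 - errKernelLead β / (u - p + 6 * k * (n + 1)))
          + (errKernelLead β / (u - p - 6 * k * (n + 1)) + errKernelLead β / (u - p + 6 * k * (n + 1)))‖ := by
            congr 1; ring
      _ ≤ C / k * (1 / ((n : ℝ) + 1) ^ 2) + C / k * (1 / ((n : ℝ) + 1) ^ 2)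
          + 8 / k * (1 / ((n : ℝ) + 1) ^ 2) := norm_add₃_le.trans (add_le_add (add_le_add b1' b2') b3)
      _ = _ := by ring
  have hDs : HasSum (fun n : ℕ => (2 * C + 8) / k * (1 / ((n : ℝ) + 1) ^ 2)) ((2 * C + 8) / k * S) :=
    summable_one_div_succ_sq.hasSum.mul_left _
  have hDsum := Summable.of_norm_bounded hDs.summable hD
  have hDle := tsum_of_norm_bounded hDs hD
  have hI : HasSum (fun n : ℕ => ∫ x in (-1 : ℝ)..1, cexp (β * (1 - (x : ℂ) ^ 2)) *
      (1 / (6 * k) * (1 / ((x + u - p) / (6 * k) - (n + 1)) + 1 / ((x + u - p) / (6 * k) + (n + 1)))))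
      (∫ x in (-1 : ℝ)..1, cexp (β * (1 - (x : ℂ) ^ 2)) * (1 / (6 * k) * cotReg ((x + u - p) / (6 * k)))) := by
    refine intervalIntegral.hasSum_integral_of_dominated_convergence
      (fun n _ => Real.exp β.re * (1 / (6 * k) * (5 * (1 / ((n : ℝ) + 1) ^ 2)))) (fun n => ?_) (fun n => ?_) ?_ ?_ ?_
    · exact (Measurable.aestronglyMeasurable (by fun_prop))
    · refine Filter.Eventually.of_forall fun x hx => ?_
      rw [Set.uIoc_of_le (by norm_num)] at hx
      rw [norm_mul, norm_mul, norm_div, norm_one, norm_mul, norm_ofNat, Complex.norm_natCast]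
      gcongr
      · exact norm_cexp_mul_one_sub_sq_le (by linarith [h.quarter_le]) x
      · exact norm_cotReg_term_le (h.norm_scaled_le hk hp ⟨hx.1.le, hx.2⟩).le n
    · exact Filter.Eventually.of_forall fun x _ =>
        ((summable_one_div_succ_sq.mul_left 5).mul_left _).mul_left _
    · exact intervalIntegrable_const
    · refine Filter.Eventually.of_forall fun x hx => ?_
      rw [Set.uIoc_of_le (by norm_num)] at hx
      exact ((summable_cotReg (h.norm_scaled_le hk hp ⟨hx.1.le, hx.2⟩).le).hasSum.mul_left _).mul_left _
  have hterm : ∀ n : ℕ, E * (errKernel β (u - p - 6 * k * (n + 1)) + errKernel β (u - p + 6 * k * (n + 1)))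
      = (∫ x in (-1 : ℝ)..1, cexp (β * (1 - (x : ℂ) ^ 2)) *
      (1 / (6 * k) * (1 / ((x + u - p) / (6 * k) - (n + 1)) + 1 / ((x + u - p) / (6 * k) + (n + 1)))))
      + (errKernelDiff β (u - p - 6 * k * (n + 1)) + errKernelDiff β (u - p + 6 * k * (n + 1))) := by
    intro n
    have hint : ∀ s : ℤ, s = 1 ∨ s = -1 → IntervalIntegrable (fun x : ℝ => cexp (β * (1 - (x : ℂ) ^ 2))
        / (x + (u - ((p + s * (6 * k * (n + 1)) : ℤ) : ℂ)))) MeasureTheory.volume (-1) 1 := by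
      intro s hs
      refine (ContinuousOn.div (by fun_prop) (by fun_prop) fun x hx => ?_).intervalIntegrable
      rw [Set.uIcc_of_le (by norm_num)] at hx
      have := (h.isFar (htwo n s hs)).le_norm_sub (-x) ⟨by linarith [hx.2], by linarith [hx.1]⟩
      rw [ofReal_neg, sub_neg_eq_add, add_comm] at this
      exact norm_pos_iff.mp (by linarith)
    have e1 : u - p - 6 * k * (n + 1) = u - ((p + 1 * (6 * k * (n + 1)) : ℤ) : ℂ) := by push_cast; ring
    have e2 : u - p + 6 * k * (n + 1) = u - ((p + (-1) * (6 * k * (n + 1)) : ℤ) : ℂ) := by push_cast; ring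
    have i1 := hint 1 (.inl rfl)
    have i2 := hint (-1) (.inr rfl)
    rw [← e1] at i1
    rw [← e2] at i2
    rw [mul_add, hE, gaussConst_mul_errKernel_eq, gaussConst_mul_errKernel_eq, add_add_add_comm,
      ← intervalIntegral.integral_add i1 i2]
    congr 1
    refine intervalIntegral.integral_congr fun x _ => ?_
    rw [show (x + u - p) / (6 * k) - (n + 1) = (x + (u - p - 6 * k * (n + 1))) / (6 * k) by field_simp; ring,
          show (x + u - p) / (6 * k) + (n + 1) = (x + (u - p + 6 * k * (n + 1))) / (6 * k) by field_simp; ring,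
          one_div_div, one_div_div]
    have : (6 * (k : ℂ)) ≠ 0 := by simp [hk0]
    generalize (x : ℂ) + (u - p - 6 * k * (n + 1)) = A
    generalize (x : ℂ) + (u - p + 6 * k * (n + 1)) = B
    generalize cexp (β * (1 - (x : ℂ) ^ 2)) = e
    have h2 := mul_inv_cancel₀ this
    simp only [div_eq_mul_inv, one_mul]
    linear_combination -(e * (A⁻¹ + B⁻¹)) * h2
  have hsum := (hI.summable.tsum_add hDsum).symm.trans (tsum_congr hterm).symm
  rw [tsum_mul_left] at hsum
  rw [latticeTail, ← hsum, hI.tsum_eq, add_sub_cancel_left]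
  refine hDle.trans (le_of_eq ?_)
  ring

/-- The part of the lattice sum of `errKernel` at `u - p` that is not negligible. -/
noncomputable def nearKernel (β : ℂ) (k : ℕ) (p : ℤ) (u : ℂ) : ℂ :=
  if 2 ≤ |p| then
    ∫ x in (-1 : ℝ)..1, cexp (β * (1 - (x : ℂ) ^ 2))
      * (1 / (6 * k) * (Real.pi * Complex.cot (Real.pi * ((x + u - p) / (6 * k)))))
  else cexp β * (Real.pi / β : ℂ) ^ (1 / 2 : ℂ) * errKernel β (u - p)
    + ∫ x in (-1 : ℝ)..1, cexp (β * (1 - (x : ℂ) ^ 2)) * (1 / (6 * k) * cotReg ((x + u - p) / (6 * k)))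

lemma IsNear.norm_add_sub_ge {β u : ℂ} (h : IsNear β u) {p : ℤ} (hp : 2 ≤ |p|) {x : ℝ}
    (hx : x ∈ Set.Icc (-1 : ℝ) 1) : |(p : ℝ)| / 3 ≤ ‖(x : ℂ) + u - p‖ := by
  have hp' : (2 : ℝ) ≤ |(p : ℝ)| := by exact_mod_cast hp
  have hx1 : ‖(x : ℂ)‖ ≤ 1 := by rw [norm_real]; exact abs_le.mpr hx
  have h1 := norm_sub_norm_le (p : ℂ) (x + u)
  have h2 := norm_add_le (x : ℂ) u
  rw [norm_sub_rev, norm_intCast] at h1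
  linarith [h.norm_le]

lemma IsNear.continuousOn_cotReg {β u : ℂ} (h : IsNear β u) {k : ℕ} (hk : 0 < k) {p : ℤ}
    (hp : 2 * |p| ≤ 7 * k) :
    ContinuousOn (fun x : ℝ => cotReg (((x : ℂ) + u - p) / (6 * k))) (Set.uIcc (-1) 1) := by
  refine differentiableOn_cotReg.continuousOn.comp (by fun_prop) fun x hx => ?_
  rw [Set.uIcc_of_le (by norm_num)] at hx
  simpa using h.norm_scaled_le hk hp hx

lemma IsNear.nearKernel_of_two_le {β u : ℂ} (h : IsNear β u) {k : ℕ} (hk : 0 < k) {p : ℤ}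
    (hp : 2 * |p| ≤ 7 * k) (h2 : 2 ≤ |p|) :
    nearKernel β k p u = (∫ x in (-1 : ℝ)..1, cexp (β * (1 - (x : ℂ) ^ 2)) / (x + (u - p)))
      + ∫ x in (-1 : ℝ)..1, cexp (β * (1 - (x : ℂ) ^ 2)) * (1 / (6 * k) * cotReg ((x + u - p) / (6 * k))) := by
  have hk0 : (6 * (k : ℂ)) ≠ 0 := by simp [hk.ne']
  have hne : ∀ x ∈ Set.uIcc (-1 : ℝ) 1, (x : ℂ) + (u - p) ≠ 0 := fun x hx => by
    rw [Set.uIcc_of_le (by norm_num)] at hx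
    have h2' : (2 : ℝ) ≤ |(p : ℝ)| := by exact_mod_cast h2
    have := h.norm_add_sub_ge h2 hx
    rw [add_sub_assoc] at this
    exact norm_pos_iff.mp (by linarith)
  rw [nearKernel, if_pos h2, ← intervalIntegral.integral_add]
  · refine intervalIntegral.integral_congr fun x hx => ?_
    have h1 := hne x hx
    rw [Set.uIcc_of_le (by norm_num)] at hx
    change cexp (β * (1 - (x : ℂ) ^ 2)) * (1 / (6 * k) * (Real.pi * Complex.cot (Real.pi * ((x + u - p) / (6 * k)))))
      = cexp (β * (1 - (x : ℂ) ^ 2)) / (x + (u - p))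
        + cexp (β * (1 - (x : ℂ) ^ 2)) * (1 / (6 * k) * cotReg ((x + u - p) / (6 * k)))
    rw [cotReg_eq (h.norm_scaled_le hk hp hx).le, add_sub_assoc]
    generalize Complex.cot (Real.pi * (((x : ℂ) + (u - p)) / (6 * k))) = c
    generalize (x : ℂ) + (u - p) = A at *
    have hk' : (k : ℂ) ≠ 0 := by exact_mod_cast hk.ne'
    rw [one_div_div]
    field_simp
    ring
  · exact (ContinuousOn.div (by fun_prop) (by fun_prop) hne).intervalIntegrable
  · have := h.continuousOn_cotReg hk hp
    exact ContinuousOn.intervalIntegrable (by fun_prop)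

/-- For |p| ≥ 2 the central kernel is expanded as well, and its Cauchy kernel restores the pole of
the cotangent; for |p| ≤ 1 it is kept exactly. The condition |p| ≤ 7k/2 turns errors O(1/k) into
O(1/max(1, |p|)), the form that sums to a logarithm. -/
theorem exists_nearKernel_bounds : ∃ C : ℝ, 0 ≤ C ∧ ∀ (β u : ℂ), IsNear β u → ∀ (k : ℕ), 0 < k →
    ∀ p : ℤ, 2 * |p| ≤ 7 * k →
    ‖cexp β * (Real.pi / β : ℂ) ^ (1 / 2 : ℂ) * (errKernel β (u - p) + latticeTail β k (u - p))
      - nearKernel β k p u‖ ≤ C / max 1 |(p : ℝ)|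
    ∧ ‖nearKernel β k p u‖ ≤ C * Real.exp β.re / max 1 |(p : ℝ)| := by
  obtain ⟨C, hC, hdiff⟩ := exists_norm_errKernelDiff_sub_le
  obtain ⟨C', hC', htail⟩ := exists_norm_latticeTail_sub_le
  set S := ∑' n : ℕ, 1 / ((n : ℝ) + 1) ^ 2 with hS
  have hS0 : 0 ≤ S := tsum_one_div_succ_sq_nonneg
  refine ⟨C + 16 + 4 * C' + 6 + 8 * S + 6 * Real.sqrt Real.pi * Real.exp 1, by positivity,
    fun β u h k hk p hp => ?_⟩
  have hk1 : (1 : ℝ) ≤ k := by exact_mod_cast hk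
  have hp' : 2 * |(p : ℝ)| ≤ 7 * k := by exact_mod_cast hp
  have hβ : 0 ≤ β.re := by linarith [h.quarter_le]
  set M := max 1 |(p : ℝ)| with hM
  have hM1 : 1 ≤ M := le_max_left _ _
  have hMk : M ≤ 7 / 2 * k := max_le (by linarith) (by linarith)
  have hkM : 1 / (k : ℝ) ≤ 7 / 2 / M := by
    rw [div_le_div_iff₀ (by linarith) (by linarith)]; linarith
  have ht := htail β u h k hk p hp
  have hreg : ‖∫ x in (-1 : ℝ)..1, cexp (β * (1 - (x : ℂ) ^ 2)) * (1 / (6 * k) * cotReg ((x + u - p) / (6 * k)))‖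
      ≤ 8 * S * Real.exp β.re / M := by
    have := intervalIntegral.norm_integral_le_of_norm_le_const (a := -1) (b := 1)
      (f := fun x : ℝ => cexp (β * (1 - (x : ℂ) ^ 2)) * (1 / (6 * k) * cotReg ((x + u - p) / (6 * k))))
      (C := Real.exp β.re * (1 / (6 * k) * (5 * S))) (fun x hx => by
        rw [Set.uIoc_of_le (by norm_num)] at hx
        rw [norm_mul, norm_mul, norm_div, norm_one, norm_mul, norm_ofNat, Complex.norm_natCast]
        gcongr
        · exact norm_cexp_mul_one_sub_sq_le hβ x
        · exact norm_cotReg_le (h.norm_scaled_le hk hp ⟨hx.1.le, hx.2⟩).le)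
    refine this.trans ?_
    rw [show |(1 : ℝ) - -1| = 2 by norm_num]
    calc _ = Real.exp β.re * S * (5 / 3) * (1 / k) := by field_simp; ring
      _ ≤ Real.exp β.re * S * (5 / 3) * (7 / 2 / M) := by gcongr
      _ = 35 / 6 * (Real.exp β.re * S / M) := by ring
      _ ≤ 8 * (Real.exp β.re * S / M) := by gcongr; norm_num
      _ = _ := by ring
  have ht' : C' / k ≤ 4 * C' / M := by
    calc C' / k = C' * (1 / k) := by ring
      _ ≤ C' * (7 / 2 / M) := by gcongr
      _ = 7 / 2 * (C' / M) := by ring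
      _ ≤ 4 * (C' / M) := by gcongr; norm_num
      _ = _ := by ring
  have ht2 := ht.trans ht'
  rcases le_or_gt 2 |p| with h2 | h2
  · have h2' : (2 : ℝ) ≤ |(p : ℝ)| := by exact_mod_cast h2
    have hMp : M = |(p : ℝ)| := max_eq_right (by linarith)
    have hf := h.isFar h2
    have hD : ‖errKernelDiff β (u - p)‖ ≤ (C + 16) / M := by
      have h3 := hdiff _ _ _ hf
      have h4 : ‖errKernelLead β / (u - p)‖ ≤ 8 / (|(p : ℝ)| / 2) := by
        rw [norm_div]
        exact div_le_div₀ (by norm_num) h.norm_errKernelLead_le (by positivity) hf.le_norm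
      have h5 := norm_le_norm_sub_add (errKernelDiff β (u - p)) (errKernelLead β / (u - p))
      refine h5.trans ((add_le_add h3 h4).trans ?_)
      rw [hMp, add_div]
      refine add_le_add ?_ (le_of_eq (by field_simp; norm_num))
      exact div_le_div_of_nonneg_left hC (by positivity) (by nlinarith)
    constructor
    · rw [h.nearKernel_of_two_le hk hp h2, mul_add, gaussConst_mul_errKernel_eq]
      calc _ = ‖errKernelDiff β (u - p) + (cexp β * (Real.pi / β : ℂ) ^ (1 / 2 : ℂ) * latticeTail β k (u - p)
          - ∫ x in (-1 : ℝ)..1, cexp (β * (1 - (x : ℂ) ^ 2)) * (1 / (6 * k) * cotReg ((x + u - p) / (6 * k))))‖ := by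
            congr 1; ring
        _ ≤ (C + 16) / M + 4 * C' / M := (norm_add_le _ _).trans (add_le_add hD ht2)
        _ = (C + 16 + 4 * C') / M := by ring
        _ ≤ _ := div_le_div_of_nonneg_right (by have : 0 ≤ 6 * Real.sqrt Real.pi * Real.exp 1 := by positivity
                                                linarith) (by linarith)
    · rw [h.nearKernel_of_two_le hk hp h2]
      have := intervalIntegral.norm_integral_le_of_norm_le_const (a := -1) (b := 1)
        (f := fun x : ℝ => cexp (β * (1 - (x : ℂ) ^ 2)) / (x + (u - p)))
        (C := Real.exp β.re / (|(p : ℝ)| / 3)) (fun x hx => by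
          rw [Set.uIoc_of_le (by norm_num)] at hx
          rw [norm_div]
          have h6 := h.norm_add_sub_ge h2 ⟨hx.1.le, hx.2⟩
          rw [add_sub_assoc] at h6
          exact div_le_div₀ (Real.exp_pos _).le (norm_cexp_mul_one_sub_sq_le hβ x) (by positivity) h6)
      rw [show |(1 : ℝ) - -1| = 2 by norm_num, ← hMp] at this
      refine (norm_add_le _ _).trans ((add_le_add this hreg).trans ?_)
      rw [show Real.exp β.re / (M / 3) * 2 + 8 * S * Real.exp β.re / M = (6 + 8 * S) * Real.exp β.re / M by
        field_simp; ring]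
      refine div_le_div_of_nonneg_right (mul_le_mul_of_nonneg_right ?_ (Real.exp_pos _).le) (by linarith)
      have : 0 ≤ 6 * Real.sqrt Real.pi * Real.exp 1 := by positivity
      linarith
  · have h1 : |p| ≤ 1 := by omega
    have h1' : |(p : ℝ)| ≤ 1 := by exact_mod_cast h1
    have hM' : M = 1 := max_eq_left h1'
    rw [nearKernel, if_neg (by omega)]
    constructor
    · calc _ = ‖cexp β * (Real.pi / β : ℂ) ^ (1 / 2 : ℂ) * latticeTail β k (u - p)
          - ∫ x in (-1 : ℝ)..1, cexp (β * (1 - (x : ℂ) ^ 2)) * (1 / (6 * k) * cotReg ((x + u - p) / (6 * k)))‖ := by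
            congr 1; ring
        _ ≤ 4 * C' / M := ht2
        _ ≤ _ := div_le_div_of_nonneg_right (by have : 0 ≤ 6 * Real.sqrt Real.pi * Real.exp 1 := by positivity
                                                linarith) (by linarith)
    · have h7 := norm_gaussConst_mul_errKernel_le (h.re_ge h1)
      have h8 : ‖cexp β * (Real.pi / β : ℂ) ^ (1 / 2 : ℂ) * errKernel β (u - p)‖
          ≤ Real.exp β.re * (6 * Real.sqrt Real.pi * Real.exp 1) := by
        rw [mul_assoc, norm_mul, Complex.norm_exp]
        gcongr
      refine (norm_add_le _ _).trans ((add_le_add h8 hreg).trans ?_)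
      rw [hM', div_one, div_one, mul_comm (Real.exp β.re), ← add_mul]
      exact mul_le_mul_of_nonneg_right (by linarith) (Real.exp_pos _).le

/-! ### The crank denominator near the cusp. -/

lemma norm_qPochInf_sub_one_le {a q : ℂ} (ha : ‖a‖ ≤ 1 / 12) (hq : ‖q‖ ≤ 1 / 20) :
    ‖qPochInf a q - 1‖ ≤ 3 * ‖a‖ := by
  have hq1 : ‖q‖ < 1 := by linarith
  have hlim := ((qPochInf_multipliable a hq1).hasProd.tendsto_prod_nat.sub_const 1).norm
  refine le_of_tendsto' hlim fun N => ?_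
  have h1 := (Finset.range N).norm_prod_one_add_sub_one_le (fun n => -(a * q ^ n))
  have h2 : ∑ n ∈ Finset.range N, ‖-(a * q ^ n)‖ ≤ ‖a‖ * (20 / 19) := by
    simp only [norm_neg, norm_mul, norm_pow]
    rw [← Finset.mul_sum]
    gcongr
    have h3 := (summable_geometric_of_lt_one (norm_nonneg q) hq1).sum_le_tsum (Finset.range N)
      (fun n _ => by positivity)
    rw [tsum_geometric_of_lt_one (norm_nonneg q) hq1] at h3
    refine h3.trans ?_
    rw [inv_le_comm₀ (by linarith) (by norm_num)]
    norm_num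
    linarith
  simp only [← sub_eq_add_neg] at h1
  have h0 : 0 ≤ ∑ n ∈ Finset.range N, ‖-(a * q ^ n)‖ := Finset.sum_nonneg fun _ _ => norm_nonneg _
  have h4 := Real.abs_exp_sub_one_le (x := ∑ n ∈ Finset.range N, ‖-(a * q ^ n)‖)
    (by rw [abs_of_nonneg h0]; linarith)
  rw [abs_of_nonneg h0] at h4
  have := norm_nonneg a
  linarith [le_abs_self (Real.exp (∑ n ∈ Finset.range N, ‖-(a * q ^ n)‖) - 1)]

lemma norm_inv_crankDenom_sub_one_le {z τ : ℂ} (hτ : ‖cexp (2 * Real.pi * I * τ)‖ ≤ 1 / 20)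
    (hz : ‖2 * Real.pi * I * z‖ ≤ 7 / 100) :
    crankDenom z τ ≠ 0 ∧ ‖(crankDenom z τ)⁻¹ - 1‖ ≤ 12 * ‖cexp (2 * Real.pi * I * τ)‖ := by
  have key : ∀ w : ℂ, ‖w‖ ≤ 7 / 100 → ‖cexp w * cexp (2 * Real.pi * I * τ)‖
      ≤ 8 / 7 * ‖cexp (2 * Real.pi * I * τ)‖ := by
    intro w hw
    rw [norm_mul]
    gcongr
    rw [Complex.norm_exp]
    have h1 : w.re ≤ 7 / 100 := (Complex.re_le_norm w).trans hw
    refine (Real.exp_le_exp.mpr h1).trans ?_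
    have h2 := Real.abs_exp_sub_one_le (x := 7 / 100) (by norm_num)
    have h3 := le_abs_self (Real.exp (7 / 100) - 1)
    rw [abs_of_nonneg (by norm_num : (0 : ℝ) ≤ 7 / 100)] at h2
    linarith
  unfold crankDenom
  rw [← Complex.exp_neg (2 * Real.pi * I * z)]
  have k1 := key _ hz
  have k2 := key (-(2 * Real.pi * I * z)) (by rwa [norm_neg])
  have h1 := norm_qPochInf_sub_one_le (by linarith) hτ (a := cexp (2 * Real.pi * I * z) * cexp (2 * Real.pi * I * τ))
  have h2 := norm_qPochInf_sub_one_le (by linarith) hτ (a := cexp (-(2 * Real.pi * I * z)) * cexp (2 * Real.pi * I * τ))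
  generalize ‖cexp (2 * Real.pi * I * τ)‖ = r at *
  generalize qPochInf _ (cexp (2 * Real.pi * I * τ)) = A at *
  generalize qPochInf _ (cexp (2 * Real.pi * I * τ)) = B at *
  have hr : 0 ≤ r := by linarith [norm_nonneg (cexp (2 * Real.pi * I * z) * cexp (2 * Real.pi * I * τ))]
  have a1 : ‖A - 1‖ ≤ 24 / 7 * r := by linarith
  have b1 : ‖B - 1‖ ≤ 24 / 7 * r := by linarith
  have a2 : 14 / 17 ≤ ‖A‖ := by
    have := norm_sub_norm_le (1 : ℂ) A
    rw [norm_one, norm_sub_rev] at this; linarith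
  have b2 : 14 / 17 ≤ ‖B‖ := by
    have := norm_sub_norm_le (1 : ℂ) B
    rw [norm_one, norm_sub_rev] at this; linarith
  have b3 : ‖B‖ ≤ 6 / 5 := by
    have := norm_sub_norm_le B (1 : ℂ)
    rw [norm_one] at this; linarith
  have hA : A ≠ 0 := norm_pos_iff.mp (by linarith)
  have hB : B ≠ 0 := norm_pos_iff.mp (by linarith)
  refine ⟨mul_ne_zero hA hB, ?_⟩
  rw [show (A * B)⁻¹ - 1 = -(((A - 1) * B + (B - 1)) / (A * B)) by field_simp; ring, norm_neg, norm_div,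
    norm_mul, div_le_iff₀ (by positivity)]
  have h3 : ‖(A - 1) * B + (B - 1)‖ ≤ 24 / 7 * r * (6 / 5) + 24 / 7 * r := by
    refine (norm_add_le _ _).trans (add_le_add ?_ b1)
    rw [norm_mul]
    gcongr
  have h4 : (14 / 17) * (14 / 17) ≤ ‖A‖ * ‖B‖ := by gcongr
  nlinarith

/-- The entire function `sinh w / w`. -/
noncomputable def sinhc (w : ℂ) : ℂ := dslope Complex.sinh 0 w

lemma mul_sinhc (w : ℂ) : w * sinhc w = Complex.sinh w := by
  have := sub_smul_dslope Complex.sinh 0 w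
  simpa [sinhc] using this

lemma sinhc_zero : sinhc 0 = 1 := by
  rw [sinhc, dslope_same, Complex.deriv_sinh, Complex.cosh_zero]

lemma differentiable_sinhc : Differentiable ℂ sinhc := by
  rw [← differentiableOn_univ]
  exact (Complex.differentiableOn_dslope Filter.univ_mem).mpr Complex.differentiable_sinh.differentiableOn

lemma mul_sinhc_I_mul (w : ℂ) : w * sinhc (I * w) = Complex.sin w := by
  have := mul_sinhc (I * w)
  rw [mul_comm I w, Complex.sinh_mul_I] at this
  rw [mul_comm I w]
  apply mul_right_cancel₀ I_ne_zero
  linear_combination this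

lemma norm_sinhc_sub_one_le {w : ℂ} (hw : ‖w‖ ≤ 1) : ‖sinhc w - 1‖ ≤ ‖w‖ := by
  rcases eq_or_ne w 0 with rfl | h0
  · simp [sinhc_zero]
  have h1 := Complex.norm_exp_sub_one_sub_id_le hw
  have h2 := Complex.norm_exp_sub_one_sub_id_le (x := -w) (by rwa [norm_neg])
  have h3 : w * (sinhc w - 1) = ((cexp w - 1 - w) - (cexp (-w) - 1 - -w)) / 2 := by
    rw [mul_sub, mul_sinhc, Complex.sinh]; ring
  have h4 : ‖w * (sinhc w - 1)‖ ≤ ‖w‖ ^ 2 := by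
    rw [h3, norm_div, norm_ofNat]
    have := norm_sub_le (cexp w - 1 - w) (cexp (-w) - 1 - -w)
    rw [norm_neg] at h2
    linarith
  rw [norm_mul, sq] at h4
  exact le_of_mul_le_mul_left h4 (norm_pos_iff.mpr h0)

/-- The elementary factor of the crank generating function near a cusp. -/
noncomputable def cuspFactor (k : ℕ) (Z z : ℂ) : ℂ :=
  cexp (Real.pi * k * z ^ 2 / Z) * Z * sinhc (I * (Real.pi * z)) / sinhc (Real.pi * z / Z)

/-- `π / (6kZ)`. -/
noncomputable def cuspBeta (k : ℕ) (Z : ℂ) : ℂ := Real.pi / (6 * k * Z)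

/-- The range of `k` and `Z` in the asymptotic expansion. -/
structure CuspRange (k : ℕ) (Z : ℂ) : Prop where
  pos : 0 < k
  half_le : (k : ℝ) / 2 ≤ (1 / Z).re

lemma CuspRange.cast_ne_zero {k : ℕ} {Z : ℂ} (h : CuspRange k Z) : (k : ℂ) ≠ 0 := by exact_mod_cast h.pos.ne'

lemma CuspRange.one_le {k : ℕ} {Z : ℂ} (h : CuspRange k Z) : (1 : ℝ) ≤ k := by exact_mod_cast h.pos

lemma CuspRange.ne_zero {k : ℕ} {Z : ℂ} (h : CuspRange k Z) : Z ≠ 0 := by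
  rintro rfl
  have := h.half_le
  have := h.one_le
  rw [div_zero, zero_re] at *
  linarith

lemma CuspRange.norm_pos {k : ℕ} {Z : ℂ} (h : CuspRange k Z) : 0 < ‖Z‖ := _root_.norm_pos_iff.mpr h.ne_zero

lemma CuspRange.norm_le {k : ℕ} {Z : ℂ} (h : CuspRange k Z) : ‖Z‖ ≤ 2 / k := by
  have h1 := h.half_le.trans (Complex.re_le_norm _)
  have h2 := h.one_le
  rw [norm_div, norm_one, div_le_div_iff₀ (by norm_num) h.norm_pos] at h1
  rw [le_div_iff₀ (by linarith)]
  linarith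

lemma CuspRange.re_pos {k : ℕ} {Z : ℂ} (h : CuspRange k Z) : 0 < Z.re := by
  have h1 : 0 < (1 / Z).re := lt_of_lt_of_le (by have := h.one_le; linarith) h.half_le
  rw [one_div, Complex.inv_re] at h1
  by_contra hc
  exact absurd h1 (not_lt.mpr (div_nonpos_of_nonpos_of_nonneg (not_lt.mp hc) (Complex.normSq_nonneg _)))

lemma cuspBeta_re (k : ℕ) (Z : ℂ) : (cuspBeta k Z).re = Real.pi / (6 * k) * (1 / Z).re := by
  rw [cuspBeta, show (Real.pi / (6 * k * Z) : ℂ) = ((Real.pi / (6 * k) : ℝ) : ℂ) * (1 / Z) by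
    push_cast; field_simp, re_ofReal_mul]

lemma CuspRange.pi_div_le_beta_re {k : ℕ} {Z : ℂ} (h : CuspRange k Z) : Real.pi / 12 ≤ (cuspBeta k Z).re := by
  rw [cuspBeta_re]
  have := h.one_le
  calc Real.pi / 12 = Real.pi / (6 * k) * (k / 2) := by field_simp; norm_num
    _ ≤ _ := by gcongr; exact h.half_le

lemma CuspRange.beta_ne_zero {k : ℕ} {Z : ℂ} (h : CuspRange k Z) : cuspBeta k Z ≠ 0 := by
  have := h.ne_zero
  have := h.cast_ne_zero
  rw [cuspBeta]
  simp [*, Real.pi_ne_zero]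

lemma CuspRange.isNear {k : ℕ} {Z : ℂ} (h : CuspRange k Z) {z : ℂ} (hz : ‖z‖ ≤ ‖Z‖ / 100) : IsNear (cuspBeta k Z) (3 * k * z) := by
  have hk := h.one_le
  have hZ := h.norm_pos
  -- The constants of `IsNear` come from here: |Z| ≤ 2/k gives |3kz| ≤ 6/100, and βu = (π/2)(z/Z)
  -- has modulus at most π/200 < 1/60.
  refine ⟨by linarith [h.pi_div_le_beta_re, Real.pi_gt_three], ?_, ?_⟩
  · rw [norm_mul, norm_mul, norm_ofNat, Complex.norm_natCast]
    have := h.norm_le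
    rw [le_div_iff₀ (by linarith)] at this
    nlinarith
  · rw [cuspBeta, show (Real.pi / (6 * k * Z) : ℂ) * (3 * k * z) = ((Real.pi / 2 : ℝ) : ℂ) * (z / Z) by
      have := h.ne_zero
      have := h.cast_ne_zero
      push_cast; field_simp; ring, norm_mul, norm_real, Real.norm_of_nonneg (by positivity), norm_div]
    have h1 : ‖z‖ / ‖Z‖ ≤ 1 / 100 := by rw [div_le_iff₀ hZ]; linarith
    have h2 := Real.pi_lt_d2
    calc _ ≤ (3.15 / 2) * (1 / 100 : ℝ) := mul_le_mul (by linarith) h1 (by positivity) (by norm_num)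
      _ ≤ _ := by norm_num

lemma CuspRange.norm_pi_mul_div_le {k : ℕ} {Z : ℂ} (h : CuspRange k Z) {z : ℂ} (hz : ‖z‖ ≤ ‖Z‖ / 100) : ‖(Real.pi * z / Z : ℂ)‖ ≤ 1 / 25 := by
  rw [norm_div, norm_mul, norm_real, Real.norm_of_nonneg Real.pi_pos.le, div_le_iff₀ h.norm_pos]
  have := Real.pi_lt_d2
  nlinarith [h.norm_pos, norm_nonneg z]

lemma CuspRange.norm_I_mul_pi_mul_le {k : ℕ} {Z : ℂ} (h : CuspRange k Z) {z : ℂ} (hz : ‖z‖ ≤ ‖Z‖ / 100) : ‖I * (Real.pi * z)‖ ≤ 2 / 25 := by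
  rw [norm_mul, norm_I, one_mul, norm_mul, norm_real, Real.norm_of_nonneg Real.pi_pos.le]
  have h1 : ‖Z‖ ≤ 2 := h.norm_le.trans (by rw [div_le_iff₀ (by linarith [h.one_le])]; linarith [h.one_le])
  have := Real.pi_lt_d2
  nlinarith [norm_nonneg z]

lemma CuspRange.sinhc_ne_zero {k : ℕ} {Z : ℂ} (h : CuspRange k Z) {z : ℂ} (hz : ‖z‖ ≤ ‖Z‖ / 100) :
    sinhc (Real.pi * z / Z) ≠ 0 ∧ 1 / 2 ≤ ‖sinhc (Real.pi * z / Z)‖ := by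
  have h1 := h.norm_pi_mul_div_le hz
  have h2 := norm_sinhc_sub_one_le (h1.trans (by norm_num))
  have h3 := norm_sub_norm_le 1 (sinhc (Real.pi * z / Z))
  rw [norm_one, norm_sub_rev] at h3
  exact ⟨norm_pos_iff.mp (by linarith), by linarith⟩

lemma CuspRange.norm_cuspFactor_le {k : ℕ} {Z : ℂ} (h : CuspRange k Z) {z : ℂ} (hz : ‖z‖ ≤ ‖Z‖ / 100) : ‖cuspFactor k Z z‖ ≤ 8 * ‖Z‖ := by
  have hk := h.one_le
  have h1 := (h.sinhc_ne_zero hz).2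
  have h2 := norm_sinhc_sub_one_le ((h.norm_I_mul_pi_mul_le hz).trans (by norm_num))
  have h3 := norm_sub_norm_le (sinhc (I * (Real.pi * z))) 1
  have h4 := h.norm_I_mul_pi_mul_le hz
  rw [norm_one] at h3
  have h5 : ‖cexp (Real.pi * k * z ^ 2 / Z)‖ ≤ 3 := by
    rw [Complex.norm_exp]
    have h6 : ‖(Real.pi * k * z ^ 2 / Z : ℂ)‖ ≤ 1 := by
      have h7 := h.norm_pi_mul_div_le hz
      have h8 : ‖(k * z : ℂ)‖ ≤ 1 := by
        rw [norm_mul, Complex.norm_natCast]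
        have := h.norm_le
        rw [le_div_iff₀ (by linarith)] at this
        nlinarith
      rw [show (Real.pi * k * z ^ 2 / Z : ℂ) = Real.pi * z / Z * (k * z) by ring, norm_mul]
      nlinarith [norm_nonneg (Real.pi * z / Z : ℂ), norm_nonneg (k * z : ℂ)]
    refine (Real.exp_le_exp.mpr ((Complex.re_le_norm _).trans h6)).trans ?_
    linarith [Real.exp_one_lt_d9]
  rw [cuspFactor, norm_div, norm_mul, norm_mul]
  calc _ ≤ 3 * ‖Z‖ * (27 / 25) / (1 / 2) := by gcongr; linarith
    _ ≤ 8 * ‖Z‖ := by nlinarith [h.norm_pos]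

/-- The transformed point has nome of modulus e^{-12 Re β}, because 2π/k is twelve times π/(6k). So
replacing the transformed product by 1 loses e^{-12 Re β}, which outweighs the growth e^{Re β} of
the main term. -/
lemma CuspRange.nome_le {k : ℕ} {Z : ℂ} (h : CuspRange k Z) (N : ℤ) : ‖cexp (2 * Real.pi * I * (N / k + I / (k * Z)))‖ = Real.exp (-12 * (cuspBeta k Z).re) := by
  have hk := h.cast_ne_zero
  have hk' : (k : ℝ) ≠ 0 := by exact_mod_cast h.pos.ne'
  have hZ := h.ne_zero
  rw [Complex.norm_exp, cuspBeta_re]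
  congr 1
  have : (2 * Real.pi * I * (N / k + I / (k * Z)) : ℂ)
      = ((2 * Real.pi * N / k : ℝ) : ℂ) * I + ((-(2 * Real.pi / k) : ℝ) : ℂ) * (1 / Z) := by
    push_cast; field_simp; linear_combination I_sq
  rw [this, add_re, re_ofReal_mul, re_ofReal_mul, I_re]
  field_simp
  ring

lemma CuspRange.exp_neg_le {k : ℕ} {Z : ℂ} (h : CuspRange k Z) : Real.exp (-12 * (cuspBeta k Z).re) ≤ 1 / 20 := by
  have h1 : Real.exp (-12 * (cuspBeta k Z).re) ≤ Real.exp (-3) :=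
    Real.exp_le_exp.mpr (by linarith [h.pi_div_le_beta_re, Real.pi_gt_three])
  refine h1.trans ?_
  rw [Real.exp_neg, inv_le_comm₀ (Real.exp_pos _) (by norm_num)]
  have : Real.exp 3 = Real.exp 1 ^ 3 := by rw [← Real.exp_nat_mul]; norm_num
  rw [this]
  calc ((1 : ℝ) / 20)⁻¹ ≤ 2.7182818283 ^ 3 := by norm_num
    _ ≤ _ := by gcongr; exact Real.exp_one_gt_d9.le

/-- Transformation of the crank generating function at the cusp `h / k`. -/
theorem crankDenom_cusp {k : ℕ} {Z z : ℂ} (h : CuspRange k Z) {d : ℤ} (hd : Int.gcd d k = 1)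
    (hz : ‖z‖ ≤ ‖Z‖ / 100) :
    crankDenom z (d / k + I * Z / k) ≠ 0 ∧
    crankDenom (z / (I * Z)) (negInv d k / k + I / (k * Z)) ≠ 0 ∧
    ‖(crankDenom (z / (I * Z)) (negInv d k / k + I / (k * Z)))⁻¹ - 1‖ ≤ 12 * Real.exp (-12 * (cuspBeta k Z).re) ∧
    (z ≠ 0 → cexp (-(2 * Real.pi * I * (d / k + I * Z / k) / 12)) / crankDenom z (d / k + I * Z / k)
      = I * etaMultiplierAt d k ^ 2 * cexp (-(Real.pi * I * negInv d k / (6 * k))) * cexp (cuspBeta k Z)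
        * cuspFactor k Z z * (crankDenom (z / (I * Z)) (negInv d k / k + I / (k * Z)))⁻¹) := by
  have hk := h.pos
  have hk0 := h.cast_ne_zero
  have hZ := h.ne_zero
  have hdet := det_negInv hk hd
  have hdvd := dvd_mul_negInv_add_one hk hd
  set N := negInv d k with hN
  have hkR : (0 : ℝ) < k := by exact_mod_cast hk
  have hτ1 : 0 < ((N : ℂ) / k + I / (k * Z)).im := by
    rw [show (N : ℂ) / k + I / (k * Z) = ((N / k : ℝ) : ℂ) + ((1 / k : ℝ) : ℂ) * (I * (1 / Z)) by
      push_cast; field_simp, add_im, ofReal_im, im_ofReal_mul, I_mul_im, zero_add]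
    exact mul_pos (by positivity) (lt_of_lt_of_le (by positivity) h.half_le)
  have hτ : 0 < ((d : ℂ) / k + I * Z / k).im := by
    rw [show (d : ℂ) / k + I * Z / k = ((d / k : ℝ) : ℂ) + ((1 / k : ℝ) : ℂ) * (I * Z) by
      push_cast; field_simp, add_im, ofReal_im, im_ofReal_mul, I_mul_im, zero_add]
    exact mul_pos (by positivity) h.re_pos
  have hden : (((k : ℤ) : ℂ) * (d / k + I * Z / k) + ((-d : ℤ) : ℂ)) = I * Z := by
    push_cast; field_simp; ring
  have hIZ : I * Z ≠ 0 := mul_ne_zero I_ne_zero hZ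
  have hmap : (((N : ℤ) : ℂ) * (d / k + I * Z / k) + ((-((d * N + 1) / k) : ℤ) : ℂ)) / (I * Z)
      = N / k + I / (k * Z) := by
    obtain ⟨m, hm⟩ := hdvd
    have hkz : (k : ℤ) ≠ 0 := by exact_mod_cast hk.ne'
    rw [hm, Int.mul_ediv_cancel_left _ hkz, div_eq_iff hIZ]
    have hm' : (m : ℂ) = (d * N + 1) / k := by
      rw [eq_div_iff hk0, mul_comm]; exact_mod_cast hm.symm
    push_cast
    rw [hm']
    field_simp
    linear_combination -I_sq
  have htr := crankDenom_transform (a := N) (b := -((d * N + 1) / k)) (c := k) (d := -d)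
    hdet (by exact_mod_cast hk) hτ (by rw [hden, hmap]; exact hτ1) z
  rw [hden, hmap] at htr
  have hn := h.nome_le N
  rw [Int.cast_natCast] at hn
  have hb := norm_inv_crankDenom_sub_one_le (z := z / (I * Z)) (τ := N / k + I / (k * Z))
    (by rw [hn]; exact h.exp_neg_le) (by
      have h1 := h.norm_pi_mul_div_le hz
      rw [show 2 * Real.pi * I * (z / (I * Z)) = 2 * (Real.pi * z / Z) by field_simp, norm_mul, norm_ofNat]
      have h2 : ‖(Real.pi * z / Z : ℂ)‖ ≤ 7 / 200 := by
        rw [norm_div, norm_mul, norm_real, Real.norm_of_nonneg Real.pi_pos.le, div_le_iff₀ h.norm_pos]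
        have := Real.pi_lt_d2
        nlinarith [h.norm_pos, norm_nonneg z]
      linarith)
  rw [hn] at hb
  obtain ⟨hP, hPb⟩ := hb
  -- Writing both sines through `sinhc` exposes a common factor πz, which is cancelled; hence the
  -- restriction to z ≠ 0.
  have hmain : z ≠ 0 → sinhc (Real.pi * z / Z) * crankDenom (z / (I * Z)) (N / k + I / (k * Z))
      = I * Z * etaMultiplierAt d k ^ 2
        * cexp (-(2 * Real.pi * I * (N / k + I / (k * Z)) / 12) + 2 * Real.pi * I * (d / k + I * Z / k) / 12)
        * cexp (Real.pi * k * z ^ 2 / Z) * sinhc (I * (Real.pi * z)) * crankDenom z (d / k + I * Z / k) := by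
    intro hz0
    have e1 : Complex.sin (Real.pi * (z / (I * Z))) = -(Real.pi * z / Z * sinhc (Real.pi * z / Z) * I) := by
      rw [mul_sinhc, ← Complex.sin_mul_I, ← Complex.sin_neg]
      congr 1
      field_simp
      linear_combination I_sq
    have e2 : Real.pi * I * ((k : ℤ) : ℂ) * z ^ 2 / (I * Z) = Real.pi * k * z ^ 2 / Z := by
      push_cast; field_simp
    rw [e1, e2, ← mul_sinhc_I_mul] at htr
    have hpz : (Real.pi * z : ℂ) ≠ 0 := mul_ne_zero (by exact_mod_cast Real.pi_ne_zero) hz0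
    apply mul_left_cancel₀ hpz
    rw [etaMultiplierAt]
    have e3 : I * Z * -(Real.pi * z / Z * sinhc (Real.pi * z / Z) * I)
        = Real.pi * z * sinhc (Real.pi * z / Z) := by
      field_simp
      linear_combination -sinhc (Real.pi * z / Z) * I_sq
    rw [e3] at htr
    linear_combination htr
  obtain ⟨hs, -⟩ := h.sinhc_ne_zero hz
  -- For z ≠ 0 a zero would force the nonzero left side of `hmain` to vanish; at z = 0 the value is
  -- an exponential times η².
  have hD : crankDenom z (d / k + I * Z / k) ≠ 0 := by
    rcases eq_or_ne z 0 with rfl | hz0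
    · exact crankDenom_zero_ne_zero hτ
    · intro h0
      have := hmain hz0
      rw [h0, mul_zero] at this
      exact mul_ne_zero hs hP this
  refine ⟨hD, hP, hPb, fun hz0 => ?_⟩
  have hm := hmain hz0
  have e4 : cexp (-(2 * Real.pi * I * (d / k + I * Z / k) / 12))
      * cexp (-(2 * Real.pi * I * (N / k + I / (k * Z)) / 12) + 2 * Real.pi * I * (d / k + I * Z / k) / 12)
      = cexp (-(Real.pi * I * N / (6 * k))) * cexp (cuspBeta k Z) := by
    rw [← Complex.exp_add, ← Complex.exp_add, cuspBeta]
    congr 1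
    field_simp
    linear_combination -12 * I_sq
  rw [div_eq_iff hD, cuspFactor]
  generalize sinhc (Real.pi * z / Z) = s1 at *
  generalize crankDenom (z / (I * Z)) (N / k + I / (k * Z)) = P at *
  generalize cexp (-(2 * Real.pi * I * (d / k + I * Z / k) / 12)) = X at *
  rw [show I * etaMultiplierAt d k ^ 2 * cexp (-(Real.pi * I * N / (6 * k))) * cexp (cuspBeta k Z)
      * (cexp (Real.pi * k * z ^ 2 / Z) * Z * sinhc (I * (Real.pi * z)) / s1) * P⁻¹
      * crankDenom z (d / k + I * Z / k)
    = (cexp (-(Real.pi * I * N / (6 * k))) * cexp (cuspBeta k Z)) * (I * Z * etaMultiplierAt d k ^ 2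
      * cexp (Real.pi * k * z ^ 2 / Z) * sinhc (I * (Real.pi * z)) * crankDenom z (d / k + I * Z / k)) / (s1 * P) by
    ring, ← e4, eq_div_iff (mul_ne_zero hs hP)]
  linear_combination X * hm

lemma CuspRange.differentiableOn_cuspFactor {k : ℕ} {Z : ℂ} (h : CuspRange k Z) :
    DifferentiableOn ℂ (cuspFactor k Z) (Metric.ball 0 (‖Z‖ / 100)) := by
  intro z hz
  have hs := (h.sinhc_ne_zero (by simpa using (le_of_lt (by simpa using hz)) : ‖z‖ ≤ ‖Z‖ / 100)).1
  have hd := differentiable_sinhc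
  refine DifferentiableAt.differentiableWithinAt ?_
  unfold cuspFactor
  exact (by fun_prop : DifferentiableAt ℂ (fun z => cexp (Real.pi * k * z ^ 2 / Z) * Z * sinhc (I * (Real.pi * z))) z).fun_div
    (by fun_prop) hs

/-! ### Lattice points and the expansion at the cusp. -/

lemma sum_range_mul_eq {M : Type*} [AddCommMonoid M] (f : ℕ → M) (K R : ℕ) :
    ∑ i ∈ Finset.range (R * K), f i = ∑ r ∈ Finset.range R, ∑ ν ∈ Finset.range K, f (ν + K * r) := by
  induction R with
  | zero => simp
  | succ R ih =>
    rw [add_mul, one_mul, Finset.sum_range_add, ih, Finset.sum_range_succ]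
    congr 1
    exact Finset.sum_congr rfl fun ν _ => by rw [add_comm, mul_comm]

/-- This makes the halving in `latticePoint` exact: if gcd(k, 6) is odd, then k is odd, hence so is
K. -/
lemma gcd_mul_bigK_sub_one_even (k : ℕ) : 2 ∣ (Nat.gcd k 6 : ℤ) * (bigK k - 1) := by
  have hg := bigK_mul_gcd k
  rcases Nat.even_or_odd (Nat.gcd k 6) with he | ho
  · exact Dvd.dvd.mul_right (by exact_mod_cast he.two_dvd) _
  · have : Odd (bigK k) := by
      by_contra hc
      rw [Nat.not_odd_iff_even] at hc
      have h2 : 2 ∣ k := hg ▸ Dvd.dvd.mul_right hc.two_dvd _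
      have h3 : 2 ∣ Nat.gcd k 6 := Nat.dvd_gcd h2 (by norm_num)
      exact (Nat.not_even_iff_odd.mpr ho) (even_iff_two_dvd.mpr h3)
    obtain ⟨m, hm⟩ := this
    have h2 : (2 : ℤ) ∣ bigK k - 1 := ⟨m, by rw [hm]; push_cast; ring⟩
    exact Dvd.dvd.mul_left h2 _

/-- `k` times the frequency with index `s`, an integer. -/
def latticePoint (h : ℤ) (k : ℕ) (s : ℤ) : ℤ :=
  Nat.gcd k 6 * s + h - Nat.gcd k 6 * (bigK k - 1) / 2

lemma two_mul_latticePoint (h : ℤ) (k : ℕ) (s : ℤ) :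
    2 * latticePoint h k s = Nat.gcd k 6 * (2 * s + 1) + 2 * h - k := by
  have h1 := Int.mul_ediv_cancel' (gcd_mul_bigK_sub_one_even k)
  have h2 : (bigK k : ℤ) * Nat.gcd k 6 = k := by exact_mod_cast bigK_mul_gcd k
  rw [latticePoint]
  linarith

lemma latticePoint_eq_mul_frequency {h : ℤ} {k : ℕ} (hk : 0 < k) (s : ℤ) :
    (latticePoint h k s : ℂ) = k * frequency h k s := by
  have h1 : (2 : ℂ) * latticePoint h k s = Nat.gcd k 6 * (2 * s + 1) + 2 * h - k := by
    exact_mod_cast two_mul_latticePoint h k s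
  have h2 : (bigK k : ℂ) * Nat.gcd k 6 = k := by exact_mod_cast bigK_mul_gcd k
  have h3 : (bigH h k : ℂ) * Nat.gcd k 6 = 6 * h := by exact_mod_cast bigH_mul_gcd h k
  have hK : (bigK k : ℂ) ≠ 0 := by exact_mod_cast (bigK_pos hk).ne'
  rw [frequency, ← h2]
  field_simp
  rw [← h2] at h1
  linear_combination 6 * h1 - 2 * h3

lemma latticePoint_add (h : ℤ) (k : ℕ) (s t : ℤ) :
    latticePoint h k (s + t) = latticePoint h k s + Nat.gcd k 6 * t := by
  rw [latticePoint, latticePoint]; ring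

lemma latticePoint_injective (h : ℤ) (k : ℕ) : Function.Injective (latticePoint h k) := by
  intro s t hst
  have hg : (Nat.gcd k 6 : ℤ) ≠ 0 := by exact_mod_cast (gcd_six_pos k).ne'
  rw [latticePoint, latticePoint] at hst
  exact mul_left_cancel₀ hg (by linarith)

/-- The shift by μ + 3K centres the 6K points: doubled, they are 2gi + g + 2ϱ - 7k with 0 ≤ gi ≤ 6k
- g and ϱ < g ≤ k. -/
lemma abs_latticePoint_le {h μ : ℤ} {k ϱ : ℕ} (hk : 0 < k) (hh : h = (Nat.gcd k 6 : ℤ) * μ + ϱ)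
    (hϱ : ϱ < Nat.gcd k 6) {i : ℕ} (hi : i < 6 * bigK k) :
    2 * |latticePoint h k (i - μ - 3 * bigK k)| ≤ 7 * k := by
  have h1 := two_mul_latticePoint h k (i - μ - 3 * bigK k)
  have h2 : (bigK k : ℤ) * Nat.gcd k 6 = k := by exact_mod_cast bigK_mul_gcd k
  have hg : (0 : ℤ) < Nat.gcd k 6 := by exact_mod_cast gcd_six_pos k
  have hgk : (Nat.gcd k 6 : ℤ) ≤ k := by exact_mod_cast Nat.gcd_le_left 6 hk
  have hϱ' : (ϱ : ℤ) + 1 ≤ Nat.gcd k 6 := by exact_mod_cast hϱ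
  have hϱ0 : (0 : ℤ) ≤ ϱ := by positivity
  have hi' : (i : ℤ) + 1 ≤ 6 * bigK k := by exact_mod_cast hi
  have hi0 : (0 : ℤ) ≤ i := by positivity
  generalize (Nat.gcd k 6 : ℤ) = g at *
  have h3 : 2 * latticePoint h k (i - μ - 3 * bigK k) = 2 * (g * i) + g + 2 * ϱ - 7 * k := by
    rw [h1, hh, ← h2]; ring
  have h4 : g * i ≤ 6 * k - g := by nlinarith
  have h5 : 0 ≤ g * i := by positivity
  rcases abs_cases (latticePoint h k (i - μ - 3 * bigK k)) with ⟨e, -⟩ | ⟨e, -⟩ <;> rw [e] <;> linarith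

lemma fourierCoefficient_sub {h : ℤ} {k : ℕ} (hk : 0 < k) (hhk : Int.gcd h k = 1) (s : ℤ) :
    fourierCoefficient h k (s - 3 * bigK k) = fourierCoefficient h k s := by
  have h3 : cexp (2 * Real.pi * I / 3) * (cexp (2 * Real.pi * I / 3) * cexp (2 * Real.pi * I / 3)) = 1 := by
    rw [← Complex.exp_add, ← Complex.exp_add, ← Complex.exp_two_pi_mul_I]; congr 1; ring
  have e : s = s - 3 * bigK k + bigK k + bigK k + bigK k := by ring
  conv_rhs => rw [e, fourierCoefficient_add hk hhk, fourierCoefficient_add hk hhk, fourierCoefficient_add hk hhk]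
  linear_combination -fourierCoefficient h k (s - 3 * bigK k) * h3

lemma fourierCoefficient_add_mul {h : ℤ} {k : ℕ} (hk : 0 < k) (hhk : Int.gcd h k = 1) (s : ℤ) (r : ℕ) :
    fourierCoefficient h k (s + bigK k * r) = cexp (2 * Real.pi * I / 3) ^ r * fourierCoefficient h k s := by
  induction r with
  | zero => simp
  | succ r ih =>
    rw [show s + (bigK k : ℤ) * (r + 1 : ℕ) = s + bigK k * r + bigK k by push_cast; ring,
      fourierCoefficient_add hk hhk, ih, pow_succ]
    ring

/-- The kernel depends on β and w through βw and βw². Scaling by k moves the points from frequencies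
to integers and the parameter to π/(6kZ). -/
lemma errKernel_scale (k β w : ℂ) (hk : k ≠ 0) :
    errKernel (k ^ 2 * β) (w / k) = k * errKernel β w := by
  rw [errKernel, errKernel, show k ^ 2 * β * (w / k) ^ 2 = β * w ^ 2 by field_simp]
  field_simp

/-- The sum of `errKernel` over a lattice translate, in symmetric order. -/
noncomputable def latticeKernel (β : ℂ) (k : ℕ) (w : ℂ) : ℂ := errKernel β w + latticeTail β k w

/-- The K frequencies and the six residue classes modulo 6 combine to one index i = ν + Kr running
over 6K values. -/
lemma CuspRange.signedGaussSum_eq {k : ℕ} {Z : ℂ} (hr : CuspRange k Z) {h μ : ℤ} (hhk : Int.gcd h k = 1) (z : ℂ) :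
    signedGaussSum (-(6 * I * ((h : ℂ) / k + I * Z / k))) (3 * z)
      = I * k / Real.pi * ∑ i ∈ Finset.range (6 * bigK k),
          fourierCoefficient h k (i - μ - 3 * bigK k)
            * latticeKernel (cuspBeta k Z) k (3 * k * z - latticePoint h k (i - μ - 3 * bigK k)) := by
  have hk := hr.pos
  have hk0 := hr.cast_ne_zero
  have hZ := hr.ne_zero
  have ha : 0 < (6 * Z / k).re := by
    rw [show 6 * Z / k = ((6 / k : ℝ) : ℂ) * Z by push_cast; ring, re_ofReal_mul]
    have : (0 : ℝ) < k := by exact_mod_cast hk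
    exact mul_pos (by positivity) hr.re_pos
  have hb : (Real.pi : ℂ) / (6 * Z / k) = (k : ℂ) ^ 2 * cuspBeta k Z := by
    rw [cuspBeta]; field_simp
  have h3 : cexp (2 * Real.pi * I / 3) * (cexp (2 * Real.pi * I / 3) * cexp (2 * Real.pi * I / 3)) = 1 := by
    rw [← Complex.exp_add, ← Complex.exp_add, ← Complex.exp_two_pi_mul_I]; congr 1; ring
  have hshift : ∀ a y : ℂ, signedGaussSum a (y + 3) = signedGaussSum a y := by
    intro a y
    rw [← signedGaussSum_sub_one a (y + 3), ← signedGaussSum_sub_one a (y + 3 - 1),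
      ← signedGaussSum_sub_one a (y + 3 - 1 - 1), show y + 3 - 1 - 1 - 1 = y by ring]
    linear_combination signedGaussSum a y * h3
  have hsc : ∀ w : ℂ, errKernel ((k : ℂ) ^ 2 * cuspBeta k Z) w = k * errKernel (cuspBeta k Z) (k * w) := by
    intro w
    rw [← errKernel_scale _ _ _ hk0, mul_div_cancel_left₀ _ hk0]
  rw [signedGaussSum_cusp hk hhk μ hr.re_pos, sum_range_mul_eq, Finset.sum_comm, Finset.mul_sum]
  refine Finset.sum_congr rfl fun ν _ => ?_
  -- Since e^{2πi/3} has order 3, y may be replaced by y + 3; this recentres the range of lattice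
  -- points around 0.
  rw [← hshift, _root_.signedGaussSum_eq ha, hb, Finset.mul_sum, Finset.mul_sum, Finset.mul_sum]
  refine Finset.sum_congr rfl fun r _ => ?_
  have e1 : ((ν + bigK k * r : ℕ) : ℤ) - μ - 3 * bigK k = (ν - μ + bigK k * r) - 3 * bigK k := by push_cast; ring
  have e2 : (k : ℂ) * (3 * z - frequency h k (ν - μ) + 3 - r)
      = 3 * k * z - latticePoint h k (ν - μ + bigK k * r - 3 * bigK k) := by
    have h2 : (bigK k : ℂ) * Nat.gcd k 6 = k := by exact_mod_cast bigK_mul_gcd k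
    rw [sub_eq_add_neg _ (3 * (bigK k : ℤ)), latticePoint_add, latticePoint_add]
    push_cast
    rw [latticePoint_eq_mul_frequency hk]
    linear_combination -(3 - r : ℂ) * h2
  rw [e1, fourierCoefficient_sub hk hhk, fourierCoefficient_add_mul hk hhk]
  rw [hsc, e2, latticeKernel, latticeTail]
  generalize latticePoint h k (ν - μ + bigK k * r - 3 * bigK k) = p at *
  have e3 : ∑' n : ℕ, (errKernel ((k : ℂ) ^ 2 * cuspBeta k Z) (3 * z - frequency h k (ν - μ) + 3 - r - 6 * (n + 1))
      + errKernel ((k : ℂ) ^ 2 * cuspBeta k Z) (3 * z - frequency h k (ν - μ) + 3 - r + 6 * (n + 1)))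
      = k * ∑' n : ℕ, (errKernel (cuspBeta k Z) (3 * k * z - p - 6 * k * (n + 1))
        + errKernel (cuspBeta k Z) (3 * k * z - p + 6 * k * (n + 1))) := by
    rw [← tsum_mul_left]
    refine tsum_congr fun n => ?_
    rw [hsc, hsc,
      show (k : ℂ) * (3 * z - frequency h k (ν - μ) + 3 - r - 6 * (n + 1)) = 3 * k * z - p - 6 * k * (n + 1) by
        linear_combination e2,
      show (k : ℂ) * (3 * z - frequency h k (ν - μ) + 3 - r + 6 * (n + 1)) = 3 * k * z - p + 6 * k * (n + 1) by
        linear_combination e2]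
    ring
  rw [e3]
  ring

/-! ### The main term and the error bound. -/

lemma sum_one_div_max_le (N : ℕ) :
    ∑ n ∈ Finset.range (N + 1), 1 / max 1 (n : ℝ) ≤ 2 + Real.log N := by
  rw [Finset.sum_range_succ']
  have h1 := harmonic_le_one_add_log N
  rw [harmonic] at h1
  push_cast at h1
  have h2 : ∑ n ∈ Finset.range N, 1 / max 1 (((n + 1 : ℕ) : ℝ)) = ∑ n ∈ Finset.range N, ((n : ℝ) + 1)⁻¹ := by
    refine Finset.sum_congr rfl fun n _ => ?_
    push_cast
    rw [max_eq_right (by linarith [(Nat.cast_nonneg n : (0 : ℝ) ≤ n)]), one_div]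
  rw [h2]
  simp
  linarith

/-- The integers are distinct, so each absolute value occurs at most once with either sign, and
twice a harmonic sum is an upper bound. -/
lemma sum_one_div_max_abs_le {ι : Type*} (s : Finset ι) (p : ι → ℤ) (hp : Set.InjOn p s) {N : ℕ}
    (hb : ∀ i ∈ s, |p i| ≤ N) :
    ∑ i ∈ s, 1 / max 1 |(p i : ℝ)| ≤ 2 * (2 + Real.log N) := by
  classical
  have key : ∀ t ⊆ s, Set.InjOn (fun i => (p i).natAbs) t →
      ∑ i ∈ t, 1 / max 1 |(p i : ℝ)| ≤ 2 + Real.log N := by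
    intro t ht hinj
    refine le_trans ?_ (sum_one_div_max_le N)
    have h1 : ∑ i ∈ t, 1 / max 1 |(p i : ℝ)| = ∑ n ∈ t.image fun i => (p i).natAbs, 1 / max 1 (n : ℝ) := by
      rw [Finset.sum_image hinj]
      refine Finset.sum_congr rfl fun i _ => ?_
      rw [Nat.cast_natAbs, Int.cast_abs]
    rw [h1]
    refine Finset.sum_le_sum_of_subset_of_nonneg (fun n hn => ?_) fun _ _ _ => by positivity
    obtain ⟨i, hi, rfl⟩ := Finset.mem_image.mp hn
    have := hb i (ht hi)
    rw [Int.abs_eq_natAbs] at this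
    rw [Finset.mem_range]
    omega
  rw [← Finset.sum_filter_add_sum_filter_not s (fun i => 0 ≤ p i)]
  have h1 := key _ (Finset.filter_subset (fun i => 0 ≤ p i) s) fun i hi j hj hij => by
    simp only [Finset.coe_filter, Set.mem_ofPred_eq] at hi hj
    exact hp hi.1 hj.1 (by simp only at hij; omega)
  have h2 := key _ (Finset.filter_subset (fun i => ¬ 0 ≤ p i) s) fun i hi j hj hij => by
    simp only [Finset.coe_filter, Set.mem_ofPred_eq] at hi hj
    exact hp hi.1 hj.1 (by simp only at hij; omega)
  linarith

/-- The function of `z` agreeing with `calV1 z (h / k + iZ / k)` near the origin. -/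
noncomputable def cuspFun (h : ℤ) (k : ℕ) (Z z : ℂ) : ℂ :=
  cexp (-(2 * Real.pi * I * ((h : ℂ) / k + I * Z / k) / 12)) / crankDenom z ((h : ℂ) / k + I * Z / k)
    * signedGaussSum (-(6 * I * ((h : ℂ) / k + I * Z / k))) (3 * z)

/-- The constant factor of the main term. -/
noncomputable def cuspConst (h : ℤ) (k : ℕ) (Z : ℂ) : ℂ :=
  I * etaMultiplierAt h k ^ 2 * cexp (-(Real.pi * I * negInv h k / (6 * k))) * (I * k / Real.pi)
    / (Real.pi / cuspBeta k Z) ^ (1 / 2 : ℂ)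

/-- The main term of the expansion of `cuspFun`. -/
noncomputable def mainFun (h : ℤ) (k : ℕ) (μ : ℤ) (Z z : ℂ) : ℂ :=
  cuspConst h k Z * (cuspFactor k Z z * ∑ i ∈ Finset.range (6 * bigK k),
    fourierCoefficient h k (i - μ - 3 * bigK k)
      * nearKernel (cuspBeta k Z) k (latticePoint h k (i - μ - 3 * bigK k)) (3 * k * z))

lemma CuspRange.norm_cuspConst {k : ℕ} {Z : ℂ} (hr : CuspRange k Z) {h : ℤ} (hhk : Int.gcd h k = 1) :
    ‖cuspConst h k Z‖ = k / Real.pi / Real.sqrt (6 * k * ‖Z‖) := by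
  have hph : ‖cexp (-(Real.pi * I * negInv h k / (6 * k)))‖ = 1 := by
    rw [show -(Real.pi * I * negInv h k / (6 * k) : ℂ) = ((-(Real.pi * negInv h k / (6 * k)) : ℝ) : ℂ) * I by
      push_cast; ring, Complex.norm_exp_ofReal_mul_I]
  have hb : Real.pi / ‖cuspBeta k Z‖ = 6 * k * ‖Z‖ := by
    have := hr.norm_pos
    have := hr.one_le
    rw [cuspBeta, norm_div, norm_mul, norm_mul, norm_ofNat, Complex.norm_natCast, norm_real,
      Real.norm_of_nonneg Real.pi_pos.le]
    field_simp
  rw [cuspConst, norm_div, norm_mul, norm_mul, norm_mul, norm_pow, norm_etaMultiplierAt hr.pos hhk, hph,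
    norm_gaussConst, hb, norm_div, norm_mul, norm_I, Complex.norm_natCast, norm_real,
    Real.norm_of_nonneg Real.pi_pos.le]
  ring

/-- The constant is of size k/√(k|Z|), the elementary factor O(|Z|), and the Fourier coefficients
are K^{-1/2}; as k ≤ 6K, the powers of k cancel. -/
lemma CuspRange.norm_cuspConst_mul_le {k : ℕ} {Z z : ℂ} (hr : CuspRange k Z) {h : ℤ} (hhk : Int.gcd h k = 1)
    (hz : ‖z‖ ≤ ‖Z‖ / 100) :
    ‖cuspConst h k Z * cuspFactor k Z z‖ * (1 / Real.sqrt (bigK k)) ≤ 8 * Real.sqrt ‖Z‖ := by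
  have hk := hr.one_le
  have hZ := hr.norm_pos
  have hK : (0 : ℝ) < bigK k := by exact_mod_cast bigK_pos hr.pos
  have h6K : (k : ℝ) ≤ 6 * bigK k := by
    have h1 := bigK_mul_gcd k
    have h2 := Nat.le_of_dvd (by norm_num) (Nat.gcd_dvd_right k 6)
    have : k ≤ 6 * bigK k := by nlinarith
    exact_mod_cast this
  have h1 : k * Real.sqrt ‖Z‖ ≤ Real.sqrt (6 * k * ‖Z‖) * Real.sqrt (bigK k) := by
    rw [← Real.sqrt_mul (by positivity)]
    refine Real.le_sqrt_of_sq_le ?_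
    rw [mul_pow, Real.sq_sqrt hZ.le]
    nlinarith [mul_pos (lt_of_lt_of_le one_pos hk) hZ]
  have h2 : 0 < Real.sqrt (6 * k * ‖Z‖) := Real.sqrt_pos.mpr (by positivity)
  have h3 : 0 < Real.sqrt (bigK k) := Real.sqrt_pos.mpr hK
  rw [norm_mul, hr.norm_cuspConst hhk]
  calc _ ≤ k / Real.pi / Real.sqrt (6 * k * ‖Z‖) * (8 * ‖Z‖) * (1 / Real.sqrt (bigK k)) := by
        gcongr
        exact hr.norm_cuspFactor_le hz
    _ = 8 * Real.sqrt ‖Z‖ * (k * Real.sqrt ‖Z‖ / (Real.pi * (Real.sqrt (6 * k * ‖Z‖) * Real.sqrt (bigK k)))) := by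
        nth_rewrite 2 [← Real.sq_sqrt hZ.le]
        field_simp
    _ ≤ 8 * Real.sqrt ‖Z‖ * 1 := by
        gcongr
        rw [div_le_one (by positivity)]
        have := Real.pi_gt_three
        nlinarith [mul_pos h2 h3]
    _ = _ := mul_one _

/-- Let P be the inverse of the transformed crank denominator. The difference is a prefactor times P
Σ c(V - N) + (P - 1) Σ cN, where V are the normalised lattice kernels and N the near kernels. The
first sum is small by `exists_nearKernel_bounds`; in the second, P - 1 = O(e^{-12 Re β}) beats |N| =
O(e^{Re β}). -/
theorem exists_norm_cuspFun_sub_mainFun_le : ∃ C : ℝ, 0 ≤ C ∧ ∀ (k : ℕ) (h μ : ℤ) (ϱ : ℕ) (Z : ℂ),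
    CuspRange k Z → Int.gcd h k = 1 → h = (Nat.gcd k 6 : ℤ) * μ + ϱ → ϱ < Nat.gcd k 6 →
    ∀ z : ℂ, z ≠ 0 → ‖z‖ ≤ ‖Z‖ / 100 →
    ‖cuspFun h k Z z - mainFun h k μ Z z‖ ≤ C * (Real.log (k + 1) * Real.sqrt ‖Z‖) := by
  obtain ⟨C, hC, hnear⟩ := exists_nearKernel_bounds
  refine ⟨8 * (C * 14 * 16), by positivity, fun k h μ ϱ Z hr hhk hh hϱ z hz0 hz => ?_⟩
  have hk := hr.pos
  have hk1 := hr.one_le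
  obtain ⟨-, -, hP, hpref⟩ := crankDenom_cusp hr hhk hz
  have hpref := hpref hz0
  have hE := hr.norm_cuspConst_mul_le hhk hz
  have hnr := hr.isNear hz
  have hβ := hr.pi_div_le_beta_re
  have hexp := hr.exp_neg_le
  set β := cuspBeta k Z with hβdef
  set P := (crankDenom (z / (I * Z)) (negInv h k / k + I / (k * Z)))⁻¹ with hPdef
  set c : ℕ → ℂ := fun i => fourierCoefficient h k (i - μ - 3 * bigK k) with hc
  set p : ℕ → ℤ := fun i => latticePoint h k (i - μ - 3 * bigK k) with hp
  set V : ℕ → ℂ := fun i => latticeKernel β k (3 * k * z - p i) with hV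
  set N : ℕ → ℂ := fun i => nearKernel β k (p i) (3 * k * z) with hN
  set NN := (Real.pi / β : ℂ) ^ (1 / 2 : ℂ) with hNN
  have hNN0 : NN ≠ 0 := cpow_half_ne_zero (div_ne_zero (by exact_mod_cast Real.pi_ne_zero) hr.beta_ne_zero)
  have hb : ∀ i ∈ Finset.range (6 * bigK k), ‖cexp β * NN * V i - N i‖ ≤ C / max 1 |(p i : ℝ)|
      ∧ ‖N i‖ ≤ C * Real.exp β.re / max 1 |(p i : ℝ)| := fun i hi =>
    hnear β (3 * k * z) hnr k hk (p i) (abs_latticePoint_le hk hh hϱ (Finset.mem_range.mp hi))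
  set T := ∑ i ∈ Finset.range (6 * bigK k), 1 / max 1 |(p i : ℝ)| with hT
  have hT0 : 0 ≤ T := Finset.sum_nonneg fun _ _ => by positivity
  -- Additive constants are absorbed because log(k + 1) ≥ log 2 for every k ≥ 1.
  have hTle : T ≤ 16 * Real.log (k + 1) := by
    have h1 := sum_one_div_max_abs_le (Finset.range (6 * bigK k)) p
      (fun i _ j _ hij => by
        have := latticePoint_injective h k hij
        exact_mod_cast (by linarith : (i : ℤ) = j)) (N := 4 * k) (fun i hi => by
        have := abs_latticePoint_le hk hh hϱ (Finset.mem_range.mp hi)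
        push_cast
        change |latticePoint h k (i - μ - 3 * bigK k)| ≤ _
        linarith)
    push_cast at h1
    rw [Real.log_mul (by norm_num) (by linarith)] at h1
    have h2 : Real.log 4 = 2 * Real.log 2 := by
      rw [show (4 : ℝ) = 2 ^ 2 by norm_num, Real.log_pow]; norm_num
    have h3 : Real.log 2 ≤ Real.log (k + 1) := Real.log_le_log (by norm_num) (by linarith)
    have h4 : Real.log k ≤ Real.log (k + 1) := Real.log_le_log (by linarith) (by linarith)
    have h5 := Real.log_two_gt_d9
    linarith
  have hcn : ∀ i, ‖c i‖ = 1 / Real.sqrt (bigK k) := fun i => norm_fourierCoefficient hk hhk _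
  have hS1 : ‖∑ i ∈ Finset.range (6 * bigK k), c i * (cexp β * NN * V i - N i)‖
      ≤ 1 / Real.sqrt (bigK k) * (C * T) := by
    rw [hT, Finset.mul_sum, Finset.mul_sum]
    refine norm_sum_le_of_le _ fun i hi => ?_
    rw [norm_mul, hcn, mul_one_div C]
    exact mul_le_mul_of_nonneg_left (hb i hi).1 (by positivity)
  have hS2 : ‖∑ i ∈ Finset.range (6 * bigK k), c i * N i‖
      ≤ 1 / Real.sqrt (bigK k) * (C * Real.exp β.re * T) := by
    rw [hT, Finset.mul_sum, Finset.mul_sum]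
    refine norm_sum_le_of_le _ fun i hi => ?_
    rw [norm_mul, hcn, mul_one_div (C * _)]
    exact mul_le_mul_of_nonneg_left (hb i hi).2 (by positivity)
  have hkey : cuspFun h k Z z - mainFun h k μ Z z = cuspConst h k Z * cuspFactor k Z z *
      (P * ∑ i ∈ Finset.range (6 * bigK k), c i * (cexp β * NN * V i - N i)
        + (P - 1) * ∑ i ∈ Finset.range (6 * bigK k), c i * N i) := by
    have e1 : ∑ i ∈ Finset.range (6 * bigK k), c i * (cexp β * NN * V i - N i)
        = cexp β * NN * ∑ i ∈ Finset.range (6 * bigK k), c i * V i - ∑ i ∈ Finset.range (6 * bigK k), c i * N i := by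
      rw [Finset.mul_sum, ← Finset.sum_sub_distrib]
      exact Finset.sum_congr rfl fun i _ => by ring
    rw [e1, cuspFun, mainFun, hpref, hr.signedGaussSum_eq hhk (μ := μ), cuspConst, ← hβdef, ← hNN]
    change _ * (_ * ∑ i ∈ Finset.range (6 * bigK k), c i * V i)
      - _ * (_ * ∑ i ∈ Finset.range (6 * bigK k), c i * N i) = _
    generalize ∑ i ∈ Finset.range (6 * bigK k), c i * V i = A
    generalize ∑ i ∈ Finset.range (6 * bigK k), c i * N i = B
    field_simp
    ring
  have hP2 : ‖P‖ ≤ 2 := by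
    have := norm_sub_norm_le P 1
    rw [norm_one] at this
    linarith
  have hPe : ‖P - 1‖ * Real.exp β.re ≤ 12 := by
    calc ‖P - 1‖ * Real.exp β.re ≤ 12 * Real.exp (-12 * β.re) * Real.exp β.re := by gcongr
      _ = 12 * Real.exp (-11 * β.re) := by rw [mul_assoc, ← Real.exp_add]; congr 2; ring
      _ ≤ 12 * 1 := by
          gcongr
          rw [Real.exp_le_one_iff]
          have := Real.pi_pos
          linarith
      _ = 12 := mul_one _
  rw [hkey, norm_mul]
  clear hkey hb hcn hpref
  clear_value P c V N T
  generalize ∑ i ∈ Finset.range (6 * bigK k), c i * (cexp β * NN * V i - N i) = S1 at *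
  generalize ∑ i ∈ Finset.range (6 * bigK k), c i * N i = S2 at *
  generalize cuspConst h k Z * cuspFactor k Z z = E at *
  have hL : 0 ≤ Real.log ((k : ℝ) + 1) := Real.log_nonneg (by linarith)
  calc _ ≤ ‖E‖ * (2 * (1 / Real.sqrt (bigK k) * (C * T))
        + ‖P - 1‖ * (1 / Real.sqrt (bigK k) * (C * Real.exp β.re * T))) := by
        gcongr
        refine (norm_add_le _ _).trans (add_le_add ?_ ?_)
        · rw [norm_mul]; gcongr
        · rw [norm_mul]; gcongr
    _ = ‖E‖ * (1 / Real.sqrt (bigK k))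
        * (C * T * (2 + ‖P - 1‖ * Real.exp β.re)) := by ring
    _ ≤ 8 * Real.sqrt ‖Z‖ * (C * (16 * Real.log (k + 1)) * (2 + 12)) := by
        refine mul_le_mul hE ?_ (by positivity) (by positivity)
        exact mul_le_mul (mul_le_mul_of_nonneg_left hTle hC) (by linarith) (by positivity) (by positivity)
    _ = _ := by ring

/-! ### Holomorphy of both sides and Cauchy's estimate. -/

lemma hasDerivAt_integral_mul_comp_add {g : ℝ → ℂ} (hg : Continuous g) {Ψ : ℂ → ℂ} {U V : Set ℂ}
    (hU : IsOpen U) (hΨ : DifferentiableOn ℂ Ψ U) (hV : IsOpen V) {c : ℂ} {a b : ℝ}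
    (hVU : ∀ z ∈ V, ∀ x ∈ Set.uIcc a b, (x : ℂ) + c * z ∈ U) {z : ℂ} (hz : z ∈ V) :
    HasDerivAt (fun z => ∫ x in a..b, g x * Ψ (x + c * z))
      (∫ x in a..b, g x * (c * deriv Ψ (x + c * z))) z := by
  obtain ⟨r, hr, hball⟩ := Metric.nhds_basis_closedBall.mem_iff.mp (hV.mem_nhds hz)
  refine hasDerivAt_intervalIntegral_of_continuousOn (F := fun z x => g x * Ψ (x + c * z))
    (F' := fun z x => g x * (c * deriv Ψ (x + c * z)))
    (isCompact_closedBall z r) (Metric.closedBall_mem_nhds z hr) (fun w hw => ?_) ?_ (fun w hw x hx => ?_)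
  · exact hg.continuousOn.mul (hΨ.continuousOn.comp (by fun_prop) fun x hx => hVU w (hball hw) x hx)
  · have h1 : ContinuousOn (fun q : ℂ × ℝ => deriv Ψ (q.2 + c * q.1)) (Metric.closedBall z r ×ˢ Set.uIcc a b) :=
      (hΨ.deriv hU).continuousOn.comp (by fun_prop) fun q hq => hVU q.1 (hball hq.1) q.2 hq.2
    unfold Function.uncurry
    have h2 : Continuous fun q : ℂ × ℝ => g q.2 := by fun_prop
    exact h2.continuousOn.mul (continuousOn_const.mul h1)
  · have h1 : HasDerivAt Ψ (deriv Ψ (x + c * w)) (x + c * w) :=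
      (hΨ.differentiableAt (hU.mem_nhds (hVU w (hball hw) x hx))).hasDerivAt
    have h2 : HasDerivAt (fun w => (x : ℂ) + c * w) c w := by
      simpa using ((hasDerivAt_id w).const_mul c).const_add (x : ℂ)
    exact ((h1.comp w h2).const_mul (g x)).congr_deriv (by ring)

lemma iteratedDeriv_integral_mul_comp_add {g : ℝ → ℂ} (hg : Continuous g) {U V : Set ℂ}
    (hU : IsOpen U) (hV : IsOpen V) {c : ℂ} {a b : ℝ}
    (hVU : ∀ z ∈ V, ∀ x ∈ Set.uIcc a b, (x : ℂ) + c * z ∈ U) (n : ℕ) :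
    ∀ {Ψ : ℂ → ℂ}, DifferentiableOn ℂ Ψ U → ∀ {z : ℂ}, z ∈ V →
    iteratedDeriv n (fun z => ∫ x in a..b, g x * Ψ (x + c * z)) z
      = ∫ x in a..b, g x * (c ^ n * iteratedDeriv n Ψ (x + c * z)) := by
  induction n with
  | zero => intro Ψ _ z _; simp
  | succ n ih =>
    intro Ψ hΨ z hz
    rw [iteratedDeriv_succ']
    have h1 : deriv (fun z => ∫ x in a..b, g x * Ψ (x + c * z))
        =ᶠ[nhds z] fun z => c * ∫ x in a..b, g x * deriv Ψ (x + c * z) := by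
      filter_upwards [hV.mem_nhds hz] with w hw
      rw [(hasDerivAt_integral_mul_comp_add hg hU hΨ hV hVU hw).deriv, ← intervalIntegral.integral_const_mul]
      exact intervalIntegral.integral_congr fun x _ => by ring
    rw [h1.iteratedDeriv_eq, iteratedDeriv_const_mul_field, ih (hΨ.deriv hU) hz,
      ← intervalIntegral.integral_const_mul]
    refine intervalIntegral.integral_congr fun x _ => ?_
    rw [iteratedDeriv_succ']
    ring

/-- The density against which the Gaussian is integrated in `nearKernel`. -/
noncomputable def nearDensity (k : ℕ) (p : ℤ) (w : ℂ) : ℂ :=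
  1 / (6 * k) * if 2 ≤ |p| then Real.pi * Complex.cot (Real.pi * ((w - p) / (6 * k)))
    else cotReg ((w - p) / (6 * k))

/-- A domain of holomorphy of `nearDensity k p`. -/
def nearDomain (k : ℕ) (p : ℤ) : Set ℂ := {w | ‖(w - p) / (6 * k)‖ < 4 / 5 ∧ (2 ≤ |p| → w ≠ p)}

lemma isOpen_nearDomain (k : ℕ) (p : ℤ) : IsOpen (nearDomain k p) := by
  refine IsOpen.and (isOpen_lt (by fun_prop) continuous_const) ?_
  by_cases h : 2 ≤ |p|
  · simp only [h, true_imp_iff]; exact isOpen_ne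
  · simp [h]

lemma differentiableOn_nearDensity (k : ℕ) (p : ℤ) :
    DifferentiableOn ℂ (nearDensity k p) (nearDomain k p) := by
  have hreg : DifferentiableOn ℂ (fun w => cotReg ((w - p) / (6 * k))) (nearDomain k p) :=
    differentiableOn_cotReg.comp (by fun_prop) fun w hw => by simpa using hw.1
  unfold nearDensity
  refine DifferentiableOn.const_mul ?_ _
  by_cases h : 2 ≤ |p|
  · simp only [h, if_true]
    have h1 : DifferentiableOn ℂ (fun w => cotReg ((w - p) / (6 * k)) + 1 / ((w - p) / (6 * k))) (nearDomain k p) := by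
      intro w hw
      refine (hreg w hw).add (DifferentiableAt.differentiableWithinAt ?_)
      rcases Nat.eq_zero_or_pos k with rfl | hk
      · simp
      · exact (differentiableAt_const _).fun_div (by fun_prop)
          (div_ne_zero (sub_ne_zero.mpr (hw.2 h)) (by simp [hk.ne']))
    refine h1.congr fun w hw => ?_
    rw [cotReg_eq hw.1.le]
    ring
  · simp only [h, if_false]
    exact hreg

lemma nearKernel_eq (β : ℂ) (k : ℕ) (p : ℤ) (u : ℂ) :
    nearKernel β k p u
      = (if 2 ≤ |p| then 0 else cexp β * (Real.pi / β : ℂ) ^ (1 / 2 : ℂ) * errKernel β (u - p))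
        + ∫ x in (-1 : ℝ)..1, cexp (β * (1 - (x : ℂ) ^ 2)) * nearDensity k p (x + u) := by
  rw [nearKernel]
  by_cases h : 2 ≤ |p|
  · simp only [h, if_true, nearDensity, zero_add]
  · simp only [h, if_false, nearDensity]

lemma CuspRange.mem_nearDomain {k : ℕ} {Z : ℂ} (hr : CuspRange k Z) {p : ℤ} (hp : 2 * |p| ≤ 7 * k) :
    ∀ z ∈ Metric.ball (0 : ℂ) (‖Z‖ / 100), ∀ x ∈ Set.uIcc (-1 : ℝ) 1, (x : ℂ) + 3 * k * z ∈ nearDomain k p := by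
  intro z hz x hx
  have hz' : ‖z‖ < ‖Z‖ / 100 := by simpa using hz
  have hn := hr.isNear hz'.le
  rw [Set.uIcc_of_le (by norm_num)] at hx
  refine ⟨hn.norm_scaled_le hr.pos hp hx, fun h2 h0 => ?_⟩
  have h1 := hn.norm_add_sub_ge h2 hx
  rw [h0, sub_self, norm_zero] at h1
  have h2' : (2 : ℝ) ≤ |(p : ℝ)| := by exact_mod_cast h2
  linarith

lemma differentiable_errKernel (β : ℂ) : Differentiable ℂ (errKernel β) := by
  intro w
  unfold errKernel
  refine DifferentiableAt.mul (by fun_prop) ?_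
  have h := hasDerivAt_intervalIntegral_of_continuousOn (𝕜 := ℂ) (c := 0) (d := 1) (x₀ := w)
    (F := fun w (s : ℝ) => cexp (-(β * w ^ 2 * ((1 - s ^ 2 : ℝ) : ℂ))))
    (F' := fun w (s : ℝ) => cexp (-(β * w ^ 2 * ((1 - s ^ 2 : ℝ) : ℂ))) * (-(β * (2 * w) * ((1 - s ^ 2 : ℝ) : ℂ))))
    (isCompact_closedBall w 1) (Metric.closedBall_mem_nhds w one_pos) (fun v _ => by fun_prop)
    (Continuous.continuousOn (by unfold Function.uncurry; fun_prop)) (fun v _ s _ => by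
      have h1 : ∀ m : ℂ, HasDerivAt (fun v : ℂ => -(β * v ^ 2 * m)) (-(β * (2 * v) * m)) v := fun m => by
        simpa using (((hasDerivAt_pow 2 v).const_mul β).mul_const m).fun_neg
      exact (h1 _).cexp)
  exact h.differentiableAt

lemma continuous_gauss_weight (β : ℂ) : Continuous fun x : ℝ => cexp (β * (1 - (x : ℂ) ^ 2)) := by
  fun_prop

lemma CuspRange.differentiableOn_nearKernel {k : ℕ} {Z : ℂ} (hr : CuspRange k Z) {p : ℤ}
    (hp : 2 * |p| ≤ 7 * k) :
    DifferentiableOn ℂ (fun z => nearKernel (cuspBeta k Z) k p (3 * k * z)) (Metric.ball 0 (‖Z‖ / 100)) := by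
  simp only [nearKernel_eq]
  refine DifferentiableOn.add (Differentiable.differentiableOn ?_) fun z hz => ?_
  · have := differentiable_errKernel (cuspBeta k Z)
    by_cases h : 2 ≤ |p|
    · simp [h]
    · simp only [h, if_false]
      fun_prop
  · exact (hasDerivAt_integral_mul_comp_add (continuous_gauss_weight _) (isOpen_nearDomain k p)
      (differentiableOn_nearDensity k p) Metric.isOpen_ball (hr.mem_nearDomain hp) hz).differentiableAt.differentiableWithinAt

lemma CuspRange.differentiableOn_mainFun {k : ℕ} {Z : ℂ} (hr : CuspRange k Z) {h μ : ℤ} {ϱ : ℕ}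
    (hh : h = (Nat.gcd k 6 : ℤ) * μ + ϱ) (hϱ : ϱ < Nat.gcd k 6) :
    DifferentiableOn ℂ (mainFun h k μ Z) (Metric.ball 0 (‖Z‖ / 100)) := by
  unfold mainFun
  refine DifferentiableOn.const_mul (hr.differentiableOn_cuspFactor.mul (DifferentiableOn.fun_sum fun i hi => ?_)) _
  exact (hr.differentiableOn_nearKernel (abs_latticePoint_le hr.pos hh hϱ (Finset.mem_range.mp hi))).const_mul _

lemma CuspRange.im_pos {k : ℕ} {Z : ℂ} (hr : CuspRange k Z) (h : ℤ) : 0 < ((h : ℂ) / k + I * Z / k).im := by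
  have hk0 := hr.cast_ne_zero
  rw [show (h : ℂ) / k + I * Z / k = ((h / k : ℝ) : ℂ) + ((1 / k : ℝ) : ℂ) * (I * Z) by
    push_cast; field_simp, add_im, ofReal_im, im_ofReal_mul, I_mul_im, zero_add]
  have := hr.one_le
  exact mul_pos (by positivity) hr.re_pos

lemma CuspRange.differentiableOn_cuspFun {k : ℕ} {Z : ℂ} (hr : CuspRange k Z) {h : ℤ} (hhk : Int.gcd h k = 1) :
    DifferentiableOn ℂ (cuspFun h k Z) (Metric.ball 0 (‖Z‖ / 100)) := by
  intro z hz
  have hz' : ‖z‖ < ‖Z‖ / 100 := by simpa using hz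
  have hτ := hr.im_pos h
  have h1 := differentiable_crankDenom hτ
  have h2 : 0 < (-(6 * I * ((h : ℂ) / k + I * Z / k))).re := by
    rw [show -(6 * I * ((h : ℂ) / k + I * Z / k)) = ((-6 : ℝ) : ℂ) * (I * ((h : ℂ) / k + I * Z / k)) by
      push_cast; ring, re_ofReal_mul, I_mul_re]
    linarith
  have h3 := differentiable_signedGaussSum h2
  refine DifferentiableAt.differentiableWithinAt (DifferentiableAt.mul ?_ (by fun_prop))
  exact (differentiableAt_const _).fun_div (h1 z) (crankDenom_cusp hr hhk hz'.le).1

/-- The bound on the circle |z| = |Z|/200 suffices; Cauchy's estimate contributes ℓ! 200^ℓ |Z|^{-ℓ}.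
The point z = 0, excluded from the bound, does not lie on the circle. -/
theorem exists_norm_iteratedDeriv_sub_le (l : ℕ) : ∃ B : ℝ, ∀ (k : ℕ) (h μ : ℤ) (ϱ : ℕ) (Z : ℂ),
    CuspRange k Z → Int.gcd h k = 1 → h = (Nat.gcd k 6 : ℤ) * μ + ϱ → ϱ < Nat.gcd k 6 →
    ‖iteratedDeriv l (fun z => calV1 z ((h : ℂ) / k + I * Z / k)) 0 - iteratedDeriv l (mainFun h k μ Z) 0‖
      ≤ B * (Real.log (k + 1) * ‖Z‖ ^ ((1 / 2 : ℝ) - l)) := by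
  obtain ⟨C, hC, hbound⟩ := exists_norm_cuspFun_sub_mainFun_le
  refine ⟨l.factorial * C * 200 ^ l, fun k h μ ϱ Z hr hhk hh hϱ => ?_⟩
  have hZ := hr.norm_pos
  have hev : (fun z => calV1 z ((h : ℂ) / k + I * Z / k)) =ᶠ[nhds 0] cuspFun h k Z :=
    calV1_eventuallyEq (hr.im_pos h)
  have hd1 := hr.differentiableOn_cuspFun hhk
  have hd2 := hr.differentiableOn_mainFun hh hϱ
  have h0 : (0 : ℂ) ∈ Metric.ball (0 : ℂ) (‖Z‖ / 100) := Metric.mem_ball_self (by positivity)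
  have hc : ∀ f : ℂ → ℂ, DifferentiableOn ℂ f (Metric.ball 0 (‖Z‖ / 100)) → ContDiffAt ℂ l f 0 := fun f hf =>
    (hf.contDiffOn Metric.isOpen_ball).contDiffAt (Metric.isOpen_ball.mem_nhds h0)
  rw [hev.iteratedDeriv_eq, ← iteratedDeriv_sub (hc _ hd1) (hc _ hd2)]
  have hcauchy := Complex.norm_iteratedDeriv_le_of_forall_mem_sphere_norm_le (n := l) (c := 0) (R := ‖Z‖ / 200)
    (F := ℂ) (f := cuspFun h k Z - mainFun h k μ Z) (C := C * (Real.log (k + 1) * Real.sqrt ‖Z‖)) (by positivity)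
    (by
      refine DifferentiableOn.diffContOnCl ?_
      refine (hd1.sub hd2).mono ?_
      rw [closure_ball _ (by positivity)]
      exact Metric.closedBall_subset_ball (by linarith))
    (fun z hz => by
      have hz' : ‖z‖ = ‖Z‖ / 200 := by simpa using hz
      exact hbound k h μ ϱ Z hr hhk hh hϱ z (norm_pos_iff.mp (by rw [hz']; positivity)) (by linarith))
  refine hcauchy.trans (le_of_eq ?_)
  rw [Real.sqrt_eq_rpow, Real.rpow_sub hZ, Real.rpow_natCast, div_pow]
  field_simp

/-! ### Taylor coefficients of the elementary factor. -/

section taylor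
open PowerSeries

/-- The Taylor series at the origin. -/
noncomputable def taylorPS (f : ℂ → ℂ) : PowerSeries ℂ := .mk fun n => iteratedDeriv n f 0 / n.factorial

lemma iteratedDeriv_eq_coeff_taylorPS (f : ℂ → ℂ) (n : ℕ) :
    iteratedDeriv n f 0 = n.factorial * coeff n (taylorPS f) := by
  have : (n.factorial : ℂ) ≠ 0 := by exact_mod_cast n.factorial_ne_zero
  rw [taylorPS, coeff_mk]
  field_simp

lemma taylorPS_mul {f g : ℂ → ℂ} (hf : AnalyticAt ℂ f 0) (hg : AnalyticAt ℂ g 0) :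
    taylorPS (fun z => f z * g z) = taylorPS f * taylorPS g := by
  ext n
  rw [coeff_mul, Finset.Nat.sum_antidiagonal_eq_sum_range_succ (fun i j => coeff i (taylorPS f) * coeff j (taylorPS g))]
  simp only [taylorPS, coeff_mk]
  rw [iteratedDeriv_fun_mul hf.contDiffAt hg.contDiffAt, Finset.sum_div]
  refine Finset.sum_congr rfl fun i hi => ?_
  have hi' : i ≤ n := Nat.lt_succ_iff.mp (Finset.mem_range.mp hi)
  have h1 : (i.factorial : ℂ) ≠ 0 := by exact_mod_cast i.factorial_ne_zero
  have h2 : ((n - i).factorial : ℂ) ≠ 0 := by exact_mod_cast (n - i).factorial_ne_zero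
  have h3 : (n.factorial : ℂ) ≠ 0 := by exact_mod_cast n.factorial_ne_zero
  rw [Nat.cast_choose ℂ hi']
  field_simp

lemma taylorPS_congr {f g : ℂ → ℂ} (h : f =ᶠ[nhds 0] g) : taylorPS f = taylorPS g := by
  ext n
  rw [taylorPS, taylorPS, coeff_mk, coeff_mk, h.iteratedDeriv_eq]

lemma taylorPS_const_mul (c : ℂ) (f : ℂ → ℂ) : taylorPS (fun z => c * f z) = C c * taylorPS f := by
  ext n
  rw [coeff_C_mul, taylorPS, taylorPS, coeff_mk, coeff_mk, iteratedDeriv_const_mul_field, mul_div_assoc]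

lemma taylorPS_eq_of_hasSum {f : ℂ → ℂ} {a : ℕ → ℂ}
    (h : ∀ᶠ z in nhds 0, HasSum (fun n => a n * z ^ n) (f z)) : taylorPS f = .mk a := by
  have h1 : HasFPowerSeriesAt f (FormalMultilinearSeries.ofScalars ℂ a) 0 := by
    rw [hasFPowerSeriesAt_iff]
    filter_upwards [h] with z hz
    simpa [FormalMultilinearSeries.coeff_ofScalars, mul_comm] using hz
  have h2 := h1.analyticAt.hasFPowerSeriesAt.eq_formalMultilinearSeries h1
  ext n
  have h3 := congrArg (fun p => FormalMultilinearSeries.coeff p n) h2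
  simp only [FormalMultilinearSeries.coeff_ofScalars] at h3
  rw [taylorPS, coeff_mk, coeff_mk, h3]

lemma taylorPS_eq_expand_of_hasSum {f : ℂ → ℂ} {a : ℕ → ℂ}
    (h : ∀ z, HasSum (fun n => a n * z ^ (2 * n)) (f z)) :
    taylorPS f = expand 2 two_ne_zero (.mk a) := by
  have : expand 2 two_ne_zero (.mk a) = .mk fun n => coeff n (expand 2 two_ne_zero (.mk a)) := by
    ext n; rw [coeff_mk]
  rw [this]
  refine taylorPS_eq_of_hasSum (Filter.Eventually.of_forall fun z => ?_)
  refine (Function.Injective.hasSum_iff (mul_right_injective₀ (two_ne_zero : (2 : ℕ) ≠ 0)) fun n hn => ?_).mp ?_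
  · rw [coeff_expand_of_not_dvd _ _ _ fun ⟨m, hm⟩ => hn ⟨m, hm.symm⟩, zero_mul]
  · convert! h z using 2 with n
    simp only [Function.comp_apply]
    rw [coeff_expand_mul, coeff_mk]

lemma taylorPS_cexp (c : ℂ) : taylorPS (fun z => cexp (c * z)) = .mk fun n => c ^ n / n.factorial := by
  ext n
  rw [taylorPS, coeff_mk, coeff_mk, iteratedDeriv_cexp_const_mul]
  simp

lemma taylorPS_gauss (c : ℂ) :
    taylorPS (fun z => cexp (c * z ^ 2)) = expand 2 two_ne_zero (.mk fun n => c ^ n / n.factorial) := by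
  refine taylorPS_eq_expand_of_hasSum fun z => ?_
  have := NormedSpace.expSeries_div_hasSum_exp (c * z ^ 2)
  rw [← Complex.exp_eq_exp_ℂ] at this
  convert! this using 2 with n
  rw [mul_pow, pow_mul]
  ring

lemma taylorPS_sinhc (c : ℂ) : taylorPS (fun z => sinhc (c * z))
    = expand 2 two_ne_zero (.mk fun n => c ^ (2 * n) / (2 * n + 1).factorial) := by
  refine taylorPS_eq_expand_of_hasSum fun z => ?_
  rcases eq_or_ne (c * z) 0 with h0 | h0
  · rw [h0, sinhc_zero]
    have := hasSum_single (f := fun n : ℕ => c ^ (2 * n) / ((2 * n + 1).factorial : ℂ) * z ^ (2 * n)) 0 (fun n hn => by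
      rw [div_mul_eq_mul_div, ← mul_pow, h0, zero_pow (by omega), zero_div])
    simpa using this
  · have h1 := (Complex.hasSum_sinh (c * z)).div_const (c * z)
    rw [← mul_sinhc, mul_div_cancel_left₀ _ h0] at h1
    convert! h1 using 2 with n
    have : c ≠ 0 := left_ne_zero_of_mul h0
    have : z ≠ 0 := right_ne_zero_of_mul h0
    rw [mul_pow, pow_succ, pow_succ]
    field_simp

lemma coeff_mul_mul_mul (A B D : PowerSeries ℂ) (j : ℕ) :
    coeff j (A * B * D) = ∑ t ∈ Finset.Nat.antidiagonalTuple 3 j,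
      coeff (t 0) A * coeff (t 1) B * coeff (t 2) D := by
  rw [mul_assoc, coeff_mul]
  simp only [coeff_mul, Finset.mul_sum]
  rw [Finset.sum_sigma']
  refine Finset.sum_bij' (fun x _ => ![x.1.1, x.2.1, x.2.2]) (fun t _ => ⟨(t 0, t 1 + t 2), (t 1, t 2)⟩) ?_ ?_ ?_ ?_ ?_
  · rintro ⟨⟨x, y⟩, ⟨u, v⟩⟩ h
    simp only [Finset.mem_sigma, Finset.HasAntidiagonal.mem_antidiagonal] at h
    rw [Finset.Nat.mem_antidiagonalTuple, Fin.sum_univ_three]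
    simp
    omega
  · intro t h
    rw [Finset.Nat.mem_antidiagonalTuple, Fin.sum_univ_three] at h
    simp only [Finset.mem_sigma, Finset.HasAntidiagonal.mem_antidiagonal, and_true]
    linarith
  · rintro ⟨⟨x, y⟩, ⟨u, v⟩⟩ h
    simp only [Finset.mem_sigma, Finset.HasAntidiagonal.mem_antidiagonal] at h
    simp [h.2]
  · intro t h
    ext i
    fin_cases i <;> simp
  · rintro ⟨⟨x, y⟩, ⟨u, v⟩⟩ h
    simp [mul_assoc]

lemma rescale_expand_mk (c : ℂ) (a : ℕ → ℂ) :
    rescale c (expand 2 two_ne_zero (.mk a)) = expand 2 two_ne_zero (.mk fun n => a n * c ^ (2 * n)) := by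
  ext n
  rw [coeff_rescale]
  by_cases h : 2 ∣ n
  · obtain ⟨m, rfl⟩ := h
    rw [coeff_expand_mul, coeff_expand_mul, coeff_mk, coeff_mk, mul_comm]
  · rw [coeff_expand_of_not_dvd _ _ _ h, coeff_expand_of_not_dvd _ _ _ h, mul_zero]

/-- `w / sinh w` is the exponential generating function of the Bernoulli polynomials at `1 / 2`. -/
lemma bernoulli_half_mul_sinhc :
    expand 2 two_ne_zero (.mk fun n => (((Polynomial.bernoulli (2 * n)).eval (1 / 2 : ℚ) : ℚ) : ℂ)
        / (2 * n).factorial * 2 ^ (2 * n))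
      * expand 2 two_ne_zero (.mk fun n => (1 : ℂ) / (2 * n + 1).factorial) = 1 := by
  -- At x = 1/2 the generating function is T e^{T/2}/(e^T - 1); with T = 2w it becomes w/sinh w.
  have hgen := congrArg (rescale (2 : ℂ)) (Polynomial.bernoulli_generating_function (1 / 2 : ℂ))
  have hB : rescale (2 : ℂ) (.mk fun n => Polynomial.aeval (1 / 2 : ℂ) ((1 / n.factorial : ℚ) • Polynomial.bernoulli n))
      = expand 2 two_ne_zero (.mk fun n => (((Polynomial.bernoulli (2 * n)).eval (1 / 2 : ℚ) : ℚ) : ℂ)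
        / (2 * n).factorial * 2 ^ (2 * n)) := by
    have hev : ∀ n, Polynomial.aeval (1 / 2 : ℂ) (Polynomial.bernoulli n)
        = (((Polynomial.bernoulli n).eval (1 / 2 : ℚ) : ℚ) : ℂ) := fun n => by
      have := Polynomial.aeval_algebraMap_apply ℂ (1 / 2 : ℚ) (Polynomial.bernoulli n)
      simpa using this
    ext n
    rw [coeff_rescale, coeff_mk, map_smul, hev]
    by_cases h : 2 ∣ n
    · obtain ⟨m, rfl⟩ := h
      rw [coeff_expand_mul, coeff_mk, Rat.smul_def]
      push_cast
      ring
    -- The symmetry B_n(1 - x) = (-1)^n B_n(x) makes the odd Bernoulli polynomials vanish at 1/2.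
    · have h1 := Polynomial.bernoulli_eval_one_sub n (1 / 2)
      rw [Odd.neg_one_pow (Nat.not_even_iff_odd.mp fun he => h he.two_dvd)] at h1
      have h2 : (Polynomial.bernoulli n).eval (1 / 2 : ℚ) = 0 := by
        norm_num at h1 ⊢
        linarith
      rw [coeff_expand_of_not_dvd _ _ _ h, h2]
      simp
  rw [map_mul, map_mul, hB, map_sub, map_one, rescale_X, rescale_rescale] at hgen
  generalize expand 2 two_ne_zero (.mk fun n => (((Polynomial.bernoulli (2 * n)).eval (1 / 2 : ℚ) : ℚ) : ℂ)
        / (2 * n).factorial * 2 ^ (2 * n)) = G at *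
  have hS : C (2 : ℂ) * X * expand 2 two_ne_zero (.mk fun n => (1 : ℂ) / (2 * n + 1).factorial)
      = exp ℂ - rescale (-1 : ℂ) (exp ℂ) := by
    ext n
    rw [mul_assoc, coeff_C_mul, map_sub, coeff_rescale, coeff_exp]
    rcases Nat.even_or_odd' n with ⟨m, rfl | rfl⟩
    · rcases m with _ | m
      · simp
      · rw [show 2 * (m + 1) = (2 * m + 1) + 1 by ring, coeff_succ_X_mul, coeff_expand_of_not_dvd _ _ _ (by omega)]
        rw [show (2 * m + 1 + 1) = 2 * (m + 1) by ring, pow_mul]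
        simp
    · rw [coeff_succ_X_mul, coeff_expand_mul, coeff_mk, pow_succ, pow_mul]
      simp
      ring
  have h1 := exp_mul_exp_eq_exp_add (2 : ℂ) (-1 : ℂ)
  have h2 := exp_mul_exp_eq_exp_add (1 : ℂ) (-1 : ℂ)
  norm_num at h1 h2 hgen
  have hne : C (2 : ℂ) * X ≠ (0 : PowerSeries ℂ) := mul_ne_zero (by simp) X_ne_zero
  apply mul_left_cancel₀ hne
  rw [mul_left_comm, hS]
  linear_combination (rescale (-1 : ℂ)) (PowerSeries.exp ℂ) * hgen - G * h1 + C 2 * X * h2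

lemma taylorPS_inv_sinhc (c : ℂ) : taylorPS (fun z => (sinhc (c * z))⁻¹) = expand 2 two_ne_zero (.mk fun n =>
    (((Polynomial.bernoulli (2 * n)).eval (1 / 2 : ℚ) : ℚ) : ℂ) / (2 * n).factorial * 2 ^ (2 * n) * c ^ (2 * n)) := by
  have han : AnalyticAt ℂ (fun z => sinhc (c * z)) 0 :=
    (differentiable_sinhc.comp (by fun_prop : Differentiable ℂ fun z : ℂ => c * z)).analyticAt 0
  have h0 : sinhc (c * 0) ≠ 0 := by rw [mul_zero, sinhc_zero]; exact one_ne_zero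
  have h1 := taylorPS_mul (han.fun_inv h0) han
  have h2 : taylorPS (fun z => (sinhc (c * z))⁻¹ * sinhc (c * z)) = 1 := by
    have h3 : (fun z => (sinhc (c * z))⁻¹ * sinhc (c * z)) =ᶠ[nhds 0] fun z => cexp (0 * z) := by
      filter_upwards [han.continuousAt.eventually_ne h0] with z hz
      rw [inv_mul_cancel₀ hz, zero_mul, Complex.exp_zero]
    rw [taylorPS_congr h3, taylorPS_cexp]
    ext n
    rw [coeff_mk, coeff_one]
    rcases n with _ | n <;> simp
  have h4 := congrArg (rescale c) bernoulli_half_mul_sinhc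
  rw [map_mul, map_one, rescale_expand_mk, rescale_expand_mk] at h4
  rw [h2, taylorPS_sinhc] at h1
  simp only [one_div_mul_eq_div] at h4
  exact mul_right_cancel₀ (right_ne_zero_of_mul_eq_one h4) (h1.symm.trans h4.symm)

/-- The function `cuspFactor`, with the Gaussian factor raised to the power `θ`. -/
noncomputable def cuspGauss (θ : ℂ) (k : ℕ) (Z z : ℂ) : ℂ :=
  cexp (θ * (Real.pi * k / Z) * z ^ 2) * sinhc (Real.pi * I * z) * (sinhc (Real.pi / Z * z))⁻¹ * Z

lemma cuspFactor_eq_cuspGauss (k : ℕ) (Z : ℂ) : cuspFactor k Z = cuspGauss 1 k Z := by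
  ext z
  rw [cuspFactor, cuspGauss, show Real.pi * k * z ^ 2 / Z = 1 * (Real.pi * k / Z) * z ^ 2 by ring,
    show I * (Real.pi * z) = Real.pi * I * z by ring, show Real.pi * z / Z = Real.pi / Z * z by ring]
  ring

lemma analyticAt_cuspGauss (θ : ℂ) (k : ℕ) (Z : ℂ) : AnalyticAt ℂ (cuspGauss θ k Z) 0 := by
  have h1 : ∀ c : ℂ, AnalyticAt ℂ (fun z => sinhc (c * z)) 0 := fun c =>
    (differentiable_sinhc.comp (by fun_prop : Differentiable ℂ fun z : ℂ => c * z)).analyticAt 0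
  have h2 : AnalyticAt ℂ (fun z : ℂ => cexp (θ * (Real.pi * k / Z) * z ^ 2)) 0 :=
    (by fun_prop : Differentiable ℂ fun z : ℂ => cexp (θ * (Real.pi * k / Z) * z ^ 2)).analyticAt 0
  exact ((h2.mul (h1 _)).mul ((h1 _).fun_inv (by rw [mul_zero, sinhc_zero]; exact one_ne_zero))).mul analyticAt_const

/-- The sum over `a + b + c = j` in the Taylor coefficients of `cuspGauss`. -/
noncomputable def kappaSum (θ : ℂ) (k : ℕ) (Z : ℂ) (j : ℕ) : ℂ :=
  ∑ t ∈ Finset.Nat.antidiagonalTuple 3 j,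
    θ ^ t 0 * (k : ℂ) ^ t 0 * (kappa (t 0) (t 1) (t 2) : ℂ) * Z ^ ((1 : ℤ) - (t 0 : ℤ) - 2 * (t 2 : ℤ))

/-- The three indices of κ belong to the three even factors: a to the Gaussian, b to sin w / w, and
c to w / sinh w through its Bernoulli numbers. -/
lemma taylorPS_cuspGauss (θ : ℂ) (k : ℕ) {Z : ℂ} (hZ : Z ≠ 0) :
    taylorPS (cuspGauss θ k Z)
      = expand 2 two_ne_zero (.mk fun j => (2 * Real.pi * I) ^ (2 * j) / (2 * j).factorial * kappaSum θ k Z j) := by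
  have h1 : ∀ c : ℂ, AnalyticAt ℂ (fun z => sinhc (c * z)) 0 := fun c =>
    (differentiable_sinhc.comp (by fun_prop : Differentiable ℂ fun z : ℂ => c * z)).analyticAt 0
  have h2 : AnalyticAt ℂ (fun z : ℂ => cexp (θ * (Real.pi * k / Z) * z ^ 2)) 0 :=
    (by fun_prop : Differentiable ℂ fun z : ℂ => cexp (θ * (Real.pi * k / Z) * z ^ 2)).analyticAt 0
  have h3 := (h1 (Real.pi / Z)).fun_inv (by rw [mul_zero, sinhc_zero]; exact one_ne_zero)
  have h4 : cuspGauss θ k Z = fun z => Z * (cexp (θ * (Real.pi * k / Z) * z ^ 2) * sinhc (Real.pi * I * z)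
      * (sinhc (Real.pi / Z * z))⁻¹) := by
    ext z; rw [cuspGauss]; ring
  rw [h4, taylorPS_const_mul, taylorPS_mul (h2.fun_mul (h1 _)) h3, taylorPS_mul h2 (h1 _), taylorPS_gauss,
    taylorPS_sinhc, taylorPS_inv_sinhc, ← map_mul, ← map_mul, ← expand_C 2 two_ne_zero, ← map_mul]
  congr 1
  ext j
  rw [coeff_C_mul, coeff_mul_mul_mul, coeff_mk, kappaSum, Finset.mul_sum, Finset.mul_sum]
  refine Finset.sum_congr rfl fun t ht => ?_
  rw [Finset.Nat.mem_antidiagonalTuple, Fin.sum_univ_three] at ht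
  simp only [coeff_mk]
  subst ht
  generalize t 0 = a
  generalize t 1 = b
  generalize t 2 = c
  have e1 : (2 * Real.pi * I) ^ (2 * (a + b + c)) = (-1 : ℂ) ^ (a + b + c) * 4 ^ (a + b + c) * (Real.pi : ℂ) ^ (2 * (a + b + c)) := by
    rw [pow_mul, show (2 * Real.pi * I) ^ 2 = -1 * 4 * (Real.pi : ℂ) ^ 2 by linear_combination 4 * (Real.pi : ℂ) ^ 2 * I_sq,
      mul_pow, mul_pow, pow_mul]
  have e2 : Z ^ ((1 : ℤ) - a - 2 * c) = Z / (Z ^ a * Z ^ (2 * c)) := by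
    rw [zpow_sub₀ hZ, zpow_sub₀ hZ, zpow_one, zpow_natCast, div_div]
    norm_cast
  have hpi : (Real.pi : ℂ) ≠ 0 := by exact_mod_cast Real.pi_ne_zero
  have f1 : (a.factorial : ℂ) ≠ 0 := by exact_mod_cast a.factorial_ne_zero
  have f2 : ((2 * b + 1).factorial : ℂ) ≠ 0 := by exact_mod_cast (2 * b + 1).factorial_ne_zero
  have f3 : ((2 * c).factorial : ℂ) ≠ 0 := by exact_mod_cast (2 * c).factorial_ne_zero
  have f4 : ((2 * (a + b + c)).factorial : ℂ) ≠ 0 := by exact_mod_cast (2 * (a + b + c)).factorial_ne_zero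
  have e3 : (Real.pi * I) ^ (2 * b) = (-1 : ℂ) ^ b * (Real.pi : ℂ) ^ (2 * b) := by
    rw [pow_mul, mul_pow, I_sq, mul_neg_one, neg_pow, ← pow_mul]
  have e4 : (2 : ℂ) ^ (2 * c) = 4 ^ c := by rw [pow_mul]; norm_num
  have e5 : (-1 : ℂ) ^ (a + c) * (-1) ^ (a + b + c) = (-1) ^ b := by
    rw [← pow_add, show a + c + (a + b + c) = 2 * (a + c) + b by ring, pow_add, pow_mul]; simp
  rw [e1, e2, e3, e4, kappa]
  push_cast
  rw [mul_pow, div_pow, div_pow, mul_pow]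
  generalize (((Polynomial.bernoulli (2 * c)).eval (1 / 2 : ℚ) : ℚ) : ℂ) = B
  field_simp
  linear_combination -(θ ^ a * k ^ a * B * 4 ^ (a + b + c) * (Real.pi : ℂ) ^ (2 * (a + b + c))) * e5

lemma sum_range_eq_sum_even {M : Type*} [AddCommMonoid M] {f : ℕ → M} (hf : ∀ i, ¬ 2 ∣ i → f i = 0) (l : ℕ) :
    ∑ i ∈ Finset.range (l + 1), f i = ∑ j ∈ Finset.range (l / 2 + 1), f (2 * j) := by
  rw [← Finset.sum_image (f := f) (g := fun j => 2 * j) (fun i _ j _ h => by simpa using h)]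
  refine (Finset.sum_subset (fun i hi => ?_) fun i hi hi' => hf i fun ⟨m, hm⟩ => hi' ?_).symm
  · obtain ⟨j, hj, rfl⟩ := Finset.mem_image.mp hi
    rw [Finset.mem_range] at hj ⊢
    omega
  · rw [Finset.mem_range] at hi
    exact Finset.mem_image.mpr ⟨m, Finset.mem_range.mpr (by omega), hm.symm⟩

/-- Leibniz' rule; only even orders of the elementary factor survive, since it is even in z. -/
lemma iteratedDeriv_cuspGauss_mul (θ : ℂ) (k : ℕ) {Z : ℂ} (hZ : Z ≠ 0) {f : ℂ → ℂ} (hf : AnalyticAt ℂ f 0) (l : ℕ) :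
    iteratedDeriv l (fun z => cuspGauss θ k Z z * f z) 0 = ∑ j ∈ Finset.range (l / 2 + 1),
      l.choose (2 * j) * ((2 * Real.pi * I) ^ (2 * j) * kappaSum θ k Z j) * iteratedDeriv (l - 2 * j) f 0 := by
  rw [iteratedDeriv_fun_mul (analyticAt_cuspGauss θ k Z).contDiffAt hf.contDiffAt]
  rw [sum_range_eq_sum_even]
  · refine Finset.sum_congr rfl fun j _ => ?_
    have : ((2 * j).factorial : ℂ) ≠ 0 := by exact_mod_cast (2 * j).factorial_ne_zero
    rw [iteratedDeriv_eq_coeff_taylorPS, taylorPS_cuspGauss θ k hZ, coeff_expand_mul, coeff_mk]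
    congr 2
    field_simp
  · intro i hi
    rw [iteratedDeriv_eq_coeff_taylorPS, taylorPS_cuspGauss θ k hZ, coeff_expand_of_not_dvd _ _ _ hi]
    simp

end taylor

/-! ### The lattice points at distance at most one. -/

section pole
open PowerSeries

/-- A primitive of `e^{βw²}`. -/
noncomputable def gaussPrimitive (β w : ℂ) : ℂ := w * ∫ r in (0 : ℝ)..1, cexp (β * w ^ 2 * (r : ℂ) ^ 2)

/-- After differentiation under the integral the integrand is the derivative in r of r e^{βw²r²}. -/
lemma hasDerivAt_gaussPrimitive (β w : ℂ) : HasDerivAt (gaussPrimitive β) (cexp (β * w ^ 2)) w := by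
  have h := hasDerivAt_intervalIntegral_of_continuousOn (𝕜 := ℂ) (c := 0) (d := 1) (x₀ := w)
    (F := fun w (r : ℝ) => cexp (β * w ^ 2 * (r : ℂ) ^ 2))
    (F' := fun w (r : ℝ) => cexp (β * w ^ 2 * (r : ℂ) ^ 2) * (β * (2 * w) * (r : ℂ) ^ 2))
    (isCompact_closedBall w 1) (Metric.closedBall_mem_nhds w one_pos) (fun v _ => by fun_prop)
    (Continuous.continuousOn (by unfold Function.uncurry; fun_prop)) (fun v _ r _ => by
      have h1 : ∀ m : ℂ, HasDerivAt (fun v : ℂ => β * v ^ 2 * m) (β * (2 * v) * m) v := fun m => by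
        simpa using ((hasDerivAt_pow 2 v).const_mul β).mul_const m
      exact (h1 _).cexp)
  refine ((hasDerivAt_id w).fun_mul h).congr_deriv ?_
  simp only [id, one_mul]
  rw [← intervalIntegral.integral_const_mul, ← intervalIntegral.integral_add
    (Continuous.intervalIntegrable (by fun_prop) _ _) (Continuous.intervalIntegrable (by fun_prop) _ _)]
  rw [intervalIntegral.integral_eq_sub_of_hasDerivAt (f := fun r : ℝ => (r : ℂ) * cexp (β * w ^ 2 * (r : ℂ) ^ 2))
    (fun r _ => ?_) (Continuous.intervalIntegrable (by fun_prop) _ _)]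
  · simp
  · have h2 : HasDerivAt (fun r : ℂ => β * w ^ 2 * r ^ 2) (β * w ^ 2 * (2 * r)) (r : ℂ) := by
      simpa using (hasDerivAt_pow 2 (r : ℂ)).const_mul (β * w ^ 2)
    refine ((hasDerivAt_id (r : ℂ)).fun_mul h2.cexp).comp_ofReal.congr_deriv ?_
    simp only [id]
    ring

lemma errKernel_eq_gaussPrimitive (β w : ℂ) :
    errKernel β w = 2 * β * cexp (-(β * w ^ 2)) * gaussPrimitive β w := by
  have h : ∫ r in (0 : ℝ)..1, cexp (-(β * w ^ 2 * ((1 - r ^ 2 : ℝ) : ℂ)))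
      = cexp (-(β * w ^ 2)) * ∫ r in (0 : ℝ)..1, cexp (β * w ^ 2 * (r : ℂ) ^ 2) := by
    rw [← intervalIntegral.integral_const_mul]
    refine intervalIntegral.integral_congr fun r _ => ?_
    rw [← Complex.exp_add]
    congr 1
    push_cast
    ring
  rw [errKernel, gaussPrimitive, h]
  ring

lemma errKernel_neg (β w : ℂ) : errKernel β (-w) = -errKernel β w := by
  rw [errKernel, errKernel, neg_sq]; ring

lemma gaussPrimitive_neg_of_sq_eq_one (β : ℂ) {s : ℂ} (hs : s ^ 2 = 1) :
    gaussPrimitive β (-s) = -(s * gaussPrimitive β 1) := by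
  rw [gaussPrimitive, gaussPrimitive, neg_sq, hs]; ring_nf

/-- The primitive of `3k e^{β(3kz)² - 6βskz}` vanishing at the origin, when `s² = 1`. -/
noncomputable def shiftedPrimitive (β s : ℂ) (k : ℕ) (z : ℂ) : ℂ :=
  cexp (-β) * (gaussPrimitive β (3 * k * z - s) + s * gaussPrimitive β 1)

lemma shiftedPrimitive_zero (β : ℂ) {s : ℂ} (hs : s ^ 2 = 1) (k : ℕ) : shiftedPrimitive β s k 0 = 0 := by
  rw [shiftedPrimitive, mul_zero, zero_sub, gaussPrimitive_neg_of_sq_eq_one β hs, neg_add_cancel, mul_zero]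

lemma hasDerivAt_shiftedPrimitive (β : ℂ) {s : ℂ} (hs : s ^ 2 = 1) (k : ℕ) (z : ℂ) :
    HasDerivAt (shiftedPrimitive β s k) (3 * k * (cexp (9 * k ^ 2 * β * z ^ 2) * cexp (-(6 * k * β * s) * z))) z := by
  have h1 : HasDerivAt (fun z : ℂ => 3 * k * z - s) (3 * k) z := by
    simpa using ((hasDerivAt_id z).const_mul (3 * k : ℂ)).sub_const s
  have h2 := (((hasDerivAt_gaussPrimitive β (3 * k * z - s)).comp z h1).add_const (s * gaussPrimitive β 1)).const_mul
    (cexp (-β))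
  refine h2.congr_deriv ?_
  have h3 : cexp (-β) * cexp (β * (3 * k * z - s) ^ 2) = cexp (9 * k ^ 2 * β * z ^ 2) * cexp (-(6 * k * β * s) * z) := by
    rw [← Complex.exp_add, ← Complex.exp_add]
    congr 1
    linear_combination β * hs
  rw [← h3]
  ring

lemma coeff_taylorPS_shiftedPrimitive (β : ℂ) {s : ℂ} (hs : s ^ 2 = 1) (k : ℕ) (n : ℕ) :
    coeff (n + 1) (taylorPS (shiftedPrimitive β s k)) = 3 * k / (n + 1 : ℕ) *
      ∑ i ∈ Finset.range (n / 2 + 1), (9 * k ^ 2 * β) ^ i / i.factorial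
        * ((-(6 * k * β * s)) ^ (n - 2 * i) / (n - 2 * i).factorial) := by
  have hd : deriv (shiftedPrimitive β s k) = fun z => 3 * k * (cexp (9 * k ^ 2 * β * z ^ 2) * cexp (-(6 * k * β * s) * z)) :=
    funext fun z => (hasDerivAt_shiftedPrimitive β hs k z).deriv
  have h1 : AnalyticAt ℂ (fun z : ℂ => cexp (9 * k ^ 2 * β * z ^ 2)) 0 :=
    (by fun_prop : Differentiable ℂ fun z : ℂ => cexp (9 * k ^ 2 * β * z ^ 2)).analyticAt 0
  have h2 : AnalyticAt ℂ (fun z : ℂ => cexp (-(6 * k * β * s) * z)) 0 :=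
    (by fun_prop : Differentiable ℂ fun z : ℂ => cexp (-(6 * k * β * s) * z)).analyticAt 0
  have h3 : ((n + 1 : ℕ) : ℂ) ≠ 0 := by exact_mod_cast n.succ_ne_zero
  have h4 : (n.factorial : ℂ) ≠ 0 := by exact_mod_cast n.factorial_ne_zero
  rw [taylorPS, coeff_mk, iteratedDeriv_succ', hd, iteratedDeriv_eq_coeff_taylorPS, taylorPS_const_mul, taylorPS_mul h1 h2,
    taylorPS_gauss, taylorPS_cexp, coeff_C_mul, coeff_mul, Nat.factorial_succ,
    Finset.Nat.sum_antidiagonal_eq_sum_range_succ (fun i j => coeff i (expand 2 two_ne_zero _) * coeff j _),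
    sum_range_eq_sum_even]
  · simp only [coeff_expand_mul, coeff_mk]
    push_cast
    push_cast at h3
    field_simp
  · intro i hi
    rw [coeff_expand_of_not_dvd _ _ _ hi, zero_mul]

/-- The contribution to `mainFun` of a lattice point at distance at most one from the origin. -/
noncomputable def poleFun (k : ℕ) (Z : ℂ) (p : ℤ) (z : ℂ) : ℂ :=
  cexp (cuspBeta k Z) * (Real.pi / cuspBeta k Z) ^ (1 / 2 : ℂ) * errKernel (cuspBeta k Z) (3 * k * z - p)

lemma analyticAt_poleFun (k : ℕ) (Z : ℂ) (p : ℤ) : AnalyticAt ℂ (poleFun k Z p) 0 := by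
  have := differentiable_errKernel (cuspBeta k Z)
  exact (by unfold poleFun; fun_prop : Differentiable ℂ (poleFun k Z p)).analyticAt 0

/-- For p = 0 the kernel is odd and the elementary factor even, so every even derivative of the
product vanishes. Hence only p = ±1 reach the error-function part. -/
lemma iteratedDeriv_poleFun_zero {l : ℕ} (hl : Even l) (k : ℕ) {Z : ℂ} (hZ : Z ≠ 0) :
    iteratedDeriv l (fun z => cuspGauss 1 k Z z * poleFun k Z 0 z) 0 = 0 := by
  rw [iteratedDeriv_cuspGauss_mul 1 k hZ (analyticAt_poleFun k Z 0)]
  refine Finset.sum_eq_zero fun j _ => ?_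
  have h1 := iteratedDeriv_comp_neg (l - 2 * j) (poleFun k Z 0) 0
  have h2 : (fun z => poleFun k Z 0 (-z)) = fun z => -poleFun k Z 0 z := by
    ext z
    rw [poleFun, poleFun, Int.cast_zero, sub_zero, sub_zero, mul_neg, errKernel_neg, mul_neg]
  have h3 : Even (l - 2 * j) := by
    obtain ⟨m, rfl⟩ := hl
    exact ⟨m - j, by omega⟩
  rw [h2, iteratedDeriv_fun_neg, h3.neg_one_pow, one_smul, neg_zero] at h1
  rw [self_eq_neg.mp h1.symm, mul_zero]

/-- The Gaussian primitive at 3kz - s is split into its value at -s and an increment vanishing at z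
= 0. The constant gives the integral over [0, 1] that multiplies S₂; the increment, with its factor
e^β, gives S₁. -/
lemma cuspGauss_mul_poleFun {k : ℕ} (hk : 0 < k) {Z : ℂ} (hZ : Z ≠ 0) {s : ℤ} (hs : s ^ 2 = 1) (z : ℂ) :
    cuspGauss 1 k Z z * poleFun k Z s z = 2 * cuspBeta k Z * (Real.pi / cuspBeta k Z) ^ (1 / 2 : ℂ) *
      (-(s * gaussPrimitive (cuspBeta k Z) 1) * (cuspGauss (-1 / 2) k Z z * cexp (s * Real.pi / Z * z))
        + cexp (cuspBeta k Z) * (cuspGauss (-1 / 2) k Z z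
          * (cexp (s * Real.pi / Z * z) * shiftedPrimitive (cuspBeta k Z) s k z))) := by
  have hk0 : (k : ℂ) ≠ 0 := by exact_mod_cast hk.ne'
  have hs' : (s : ℂ) ^ 2 = 1 := by exact_mod_cast hs
  have e1 : cexp (cuspBeta k Z) * cexp (-cuspBeta k Z) = 1 := by rw [← Complex.exp_add, add_neg_cancel, Complex.exp_zero]
  -- Since β(3kz)² = (3/2)πkz²/Z, the coefficient 1 of the Gaussian becomes 1 - 3/2 = -1/2, the
  -- value of θ in what follows. The cross term gives e^{sπz/Z}.
  have e2 : cexp (1 * (Real.pi * k / Z) * z ^ 2) * (cexp (cuspBeta k Z) * cexp (-(cuspBeta k Z * (3 * k * z - s) ^ 2)))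
      = cexp (-1 / 2 * (Real.pi * k / Z) * z ^ 2) * cexp (s * Real.pi / Z * z) := by
    rw [← Complex.exp_add, ← Complex.exp_add, ← Complex.exp_add, cuspBeta]
    congr 1
    field_simp
    linear_combination -2 * hs'
  rw [cuspGauss, cuspGauss, poleFun, shiftedPrimitive, errKernel_eq_gaussPrimitive]
  generalize cexp (1 * (Real.pi * k / Z) * z ^ 2) = E1 at *
  generalize cexp (-1 / 2 * (Real.pi * k / Z) * z ^ 2) = E2 at *
  generalize cexp (s * Real.pi / Z * z) = E3 at *
  generalize cexp (-(cuspBeta k Z * (3 * k * z - s) ^ 2)) = E4 at *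
  generalize gaussPrimitive (cuspBeta k Z) (3 * k * z - s) = W at *
  generalize gaussPrimitive (cuspBeta k Z) 1 = J at *
  generalize sinhc (Real.pi * I * z) = S1
  generalize (sinhc (Real.pi / Z * z))⁻¹ = S2
  generalize (Real.pi / cuspBeta k Z) ^ (1 / 2 : ℂ) = NN at *
  generalize cexp (cuspBeta k Z) = eb at *
  generalize cexp (-cuspBeta k Z) = eb' at *
  generalize cuspBeta k Z = β at *
  linear_combination (2 * β * NN * W * S1 * S2 * Z) * e2 - 2 * β * NN * E2 * E3 * S1 * S2 * Z * (W + s * J) * e1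

end pole

/-! ### Matching the sums S₁ and S₂. -/

section erf
open PowerSeries

lemma natCast_rpow_half_add {k : ℕ} (hk : 0 < k) (a : ℕ) :
    (((k : ℝ) ^ ((a : ℝ) + 1 / 2) : ℝ) : ℂ) = (k : ℂ) ^ a * (Real.sqrt k : ℂ) := by
  rw [Real.rpow_add (by exact_mod_cast hk), Real.rpow_natCast, ← Real.sqrt_eq_rpow]
  push_cast
  rfl

lemma natCast_rpow_sub_half {k : ℕ} (hk : 0 < k) (a : ℕ) :
    (((k : ℝ) ^ ((a : ℝ) - 1 / 2) : ℝ) : ℂ) = (k : ℂ) ^ a / (Real.sqrt k : ℂ) := by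
  rw [Real.rpow_sub (by exact_mod_cast hk), Real.rpow_natCast, ← Real.sqrt_eq_rpow]
  push_cast
  rfl

lemma zpow_one_sub_sub {Z : ℂ} (hZ : Z ≠ 0) (a c : ℕ) : Z ^ ((1 : ℤ) - a - 2 * c) = Z / (Z ^ a * Z ^ (2 * c)) := by
  rw [zpow_sub₀ hZ, zpow_sub₀ hZ, zpow_one, zpow_natCast, div_div]
  norm_cast

lemma sqrt_natCast_sq (k : ℕ) : (Real.sqrt k : ℂ) ^ 2 = k := by
  rw [← Complex.ofReal_pow, Real.sq_sqrt (Nat.cast_nonneg k)]; simp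

lemma sqrt_natCast_ne_zero {k : ℕ} (hk : 0 < k) : (Real.sqrt k : ℂ) ≠ 0 := by
  have : (0 : ℝ) < k := by exact_mod_cast hk
  exact_mod_cast (Real.sqrt_pos.mpr this).ne'

/-- S₂ in closed form: j₁ counts derivatives of the elementary factor and j₃ = ℓ - 2j₁ those of the
exponential. -/
lemma iteratedDeriv_cuspGauss_mul_cexp {l k : ℕ} (hl : Even l) (hk : 0 < k) {Z : ℂ} (hZ : Z ≠ 0) (s : ℤ) :
    iteratedDeriv l (fun z => cuspGauss (-1 / 2) k Z z * cexp (s * Real.pi / Z * z)) 0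
      = -(3 * Real.sqrt k * Z * (2 * Real.pi * I) ^ l * erfIntSum s l k Z) := by
  have han : AnalyticAt ℂ (fun z : ℂ => cexp (s * Real.pi / Z * z)) 0 :=
    (by fun_prop : Differentiable ℂ fun z : ℂ => cexp (s * Real.pi / Z * z)).analyticAt 0
  rw [iteratedDeriv_cuspGauss_mul _ _ hZ han, erfIntSum, Finset.mul_sum, ← Finset.sum_neg_distrib]
  refine Finset.sum_congr rfl fun j hj => ?_
  rw [iteratedDeriv_eq_coeff_taylorPS, taylorPS_cexp, coeff_mk, kappaSum, Finset.mul_sum, Finset.mul_sum, Finset.mul_sum,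
    Finset.sum_mul, ← Finset.sum_neg_distrib]
  refine Finset.sum_congr rfl fun t _ => ?_
  generalize t 0 = a
  generalize t 1 = b
  generalize t 2 = c
  obtain ⟨n, rfl⟩ : ∃ n, l = 2 * j + 2 * n := by
    obtain ⟨m, rfl⟩ := hl
    rw [Finset.mem_range] at hj
    exact ⟨m - j, by omega⟩
  rw [Nat.add_sub_cancel_left, natCast_rpow_sub_half hk, zpow_one_sub_sub hZ]
  have e1 : Z ^ (-(a : ℤ) - 2 * c - ((2 * n : ℕ) : ℤ)) = 1 / (Z ^ a * Z ^ (2 * c) * Z ^ (2 * n)) := by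
    rw [show -(a : ℤ) - 2 * c - ((2 * n : ℕ) : ℤ) = -((a + 2 * c + 2 * n : ℕ) : ℤ) by push_cast; ring, zpow_neg, zpow_natCast,
      pow_add, pow_add, one_div]
  have e2 : (2 * Real.pi * I) ^ (2 * n) * ((s : ℂ) * I) ^ (2 * n) = 2 ^ (2 * n) * (s * Real.pi) ^ (2 * n) := by
    rw [← mul_pow, ← mul_pow, pow_mul, pow_mul]
    congr 1
    linear_combination (4 * Real.pi ^ 2 * s ^ 2 * (I ^ 2 - 1) : ℂ) * I_sq
  have hf : (((2 * n).factorial : ℕ) : ℂ) ≠ 0 := by exact_mod_cast (2 * n).factorial_ne_zero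
  have h3 : (Real.sqrt k : ℂ) ≠ 0 := sqrt_natCast_ne_zero hk
  rw [e1, div_pow, div_pow, pow_add (2 * Real.pi * I : ℂ), pow_add (2 : ℂ)]
  generalize (2 * Real.pi * I : ℂ) ^ (2 * j) = P at *
  generalize (2 * Real.pi * I : ℂ) ^ (2 * n) = Q at *
  generalize ((s : ℂ) * I) ^ (2 * n) = R at *
  generalize ((s : ℂ) * Real.pi) ^ (2 * n) = T at *
  generalize (Real.sqrt k : ℂ) = w at *
  field_simp
  linear_combination -(((2 * j + 2 * n).choose (2 * j) : ℂ) * P * k ^ a * (kappa a b c : ℂ) * (-1) ^ a) * e2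

lemma iteratedDeriv_cexp_mul_shiftedPrimitive (β c : ℂ) {s : ℂ} (hs : s ^ 2 = 1) (k n : ℕ) :
    iteratedDeriv n (fun z => cexp (c * z) * shiftedPrimitive β s k z) 0
      = ∑ p ∈ (Finset.HasAntidiagonal.antidiagonal n).filter (fun p => 1 ≤ p.1), n.factorial * (c ^ p.2 / p.2.factorial) *
        (3 * k / p.1 * ∑ i ∈ Finset.range ((p.1 - 1) / 2 + 1), (9 * k ^ 2 * β) ^ i / i.factorial
          * ((-(6 * k * β * s)) ^ (p.1 - 1 - 2 * i) / (p.1 - 1 - 2 * i).factorial)) := by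
  have h1 : AnalyticAt ℂ (fun z : ℂ => cexp (c * z)) 0 := (by fun_prop : Differentiable ℂ fun z : ℂ => cexp (c * z)).analyticAt 0
  have h2 : AnalyticAt ℂ (shiftedPrimitive β s k) 0 :=
    (show Differentiable ℂ (shiftedPrimitive β s k) from fun z => (hasDerivAt_shiftedPrimitive β hs k z).differentiableAt).analyticAt 0
  rw [iteratedDeriv_eq_coeff_taylorPS, taylorPS_mul h1 h2, mul_comm (taylorPS _), coeff_mul, Finset.mul_sum, Finset.sum_filter]
  refine Finset.sum_congr rfl fun p _ => ?_
  rcases p with ⟨m, q⟩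
  rcases m with _ | m
  · rw [if_neg (by simp), taylorPS, coeff_mk, iteratedDeriv_zero, shiftedPrimitive_zero β hs]
    simp
  · rw [if_pos (by simp), coeff_taylorPS_shiftedPrimitive β hs, taylorPS_cexp, coeff_mk]
    simp only [Nat.add_sub_cancel]
    ring

-- The comparison of single terms: p = (m + 1, q) is (j₂, j₃) and i is j₄. With m = 2i + r, the
-- signs and powers of i reduce by s² = 1, and √k enters through its square.
set_option maxHeartbeats 1000000 in
lemma erfExpSum_term {k : ℕ} (hk : 0 < k) {Z : ℂ} (hZ : Z ≠ 0) {s : ℤ} (hs : s ^ 2 = 1) (j m q a b c i : ℕ) (hi : i ≤ m / 2) :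
    ((2 * j + (m + 1 + q)).choose (2 * j) : ℂ) * ((2 * Real.pi * I) ^ (2 * j)
        * ((-1 / 2) ^ a * (k : ℂ) ^ a * (kappa a b c : ℂ) * Z ^ ((1 : ℤ) - (a : ℤ) - 2 * (c : ℤ))))
        * ((m + 1 + q).factorial * ((s * Real.pi / Z) ^ q / q.factorial) * (3 * k / (m + 1 : ℕ) *
          ((9 * k ^ 2 * cuspBeta k Z) ^ i / i.factorial
            * ((-(6 * k * cuspBeta k Z * s)) ^ (m - 2 * i) / (m - 2 * i).factorial))))
      = 3 * I * Real.sqrt k * Z * (2 * Real.pi * I) ^ (2 * j + (m + 1 + q)) *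
        (((2 * j + (m + 1 + q)).factorial : ℂ) * 3 ^ i * (((k : ℝ) ^ ((a : ℝ) + 1 / 2 + (i : ℝ)) : ℝ) : ℂ)
            / (((2 * j).factorial : ℂ) * ((m + 1 : ℕ) : ℂ) * (q.factorial : ℂ) * (i.factorial : ℂ)
              * ((m - 2 * i).factorial : ℂ)
              * (2 : ℂ) ^ (((2 * j + (m + 1 + q) : ℕ) : ℤ) + (a : ℤ) - 2 * (j : ℤ) + (i : ℤ))
              * (Real.pi : ℂ) ^ (i + 1))
          * (kappa a b c : ℂ) * (-1) ^ a
          * ((s : ℂ) * I) ^ (m + 1 + 1) * (-(s : ℂ) * I) ^ q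
          * Z ^ ((1 : ℤ) - (a : ℤ) - 2 * (c : ℤ) - ((m + 1 : ℕ) : ℤ) - (q : ℤ) + (i : ℤ))) := by
  obtain ⟨r, rfl⟩ : ∃ r, m = 2 * i + r := ⟨m - 2 * i, by omega⟩
  have hs' : (s : ℂ) ^ 2 = 1 := by exact_mod_cast hs
  have hk0 : (k : ℂ) ≠ 0 := by exact_mod_cast hk.ne'
  have hpi : (Real.pi : ℂ) ≠ 0 := by exact_mod_cast Real.pi_ne_zero
  have h3 : (Real.sqrt k : ℂ) ≠ 0 := sqrt_natCast_ne_zero hk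
  have h4 := sqrt_natCast_sq k
  have e1 : Z ^ ((1 : ℤ) - (a : ℤ) - 2 * (c : ℤ) - ((2 * i + r + 1 : ℕ) : ℤ) - (q : ℤ) + (i : ℤ))
      = 1 / (Z ^ a * Z ^ (2 * c) * Z ^ i * Z ^ r * Z ^ q) := by
    rw [show (1 : ℤ) - (a : ℤ) - 2 * (c : ℤ) - ((2 * i + r + 1 : ℕ) : ℤ) - (q : ℤ) + (i : ℤ)
      = -((a + 2 * c + i + r + q : ℕ) : ℤ) by push_cast; ring, zpow_neg, zpow_natCast,
      pow_add, pow_add, pow_add, pow_add, one_div]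
  have e2 : (2 : ℂ) ^ (((2 * j + (2 * i + r + 1 + q) : ℕ) : ℤ) + (a : ℤ) - 2 * (j : ℤ) + (i : ℤ))
      = 2 ^ (2 * i + r + 1 + q) * 2 ^ a * 2 ^ i := by
    rw [show ((2 * j + (2 * i + r + 1 + q) : ℕ) : ℤ) + (a : ℤ) - 2 * (j : ℤ) + (i : ℤ)
      = ((2 * i + r + 1 + q + a + i : ℕ) : ℤ) by push_cast; ring, zpow_natCast, pow_add, pow_add]
  have e3 : (((k : ℝ) ^ ((a : ℝ) + 1 / 2 + (i : ℝ)) : ℝ) : ℂ) = (k : ℂ) ^ a * k ^ i * Real.sqrt k := by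
    rw [show (a : ℝ) + 1 / 2 + (i : ℝ) = ((a + i : ℕ) : ℝ) + 1 / 2 by push_cast; ring, natCast_rpow_half_add hk, pow_add]
  have e4 : (2 * Real.pi * I) ^ (2 * i + r + 1 + q) * I * ((s : ℂ) * I) ^ (2 * i + r + 1 + 1) * (-(s : ℂ) * I) ^ q
      = 2 ^ (2 * i + r + 1 + q) * (Real.pi ^ i * Real.pi ^ (i + 1) * Real.pi ^ r * Real.pi ^ q) * ((-s) ^ r * s ^ q) := by
    have f1 : I ^ (2 * i + r + 1) * I * ((s : ℂ) * I) ^ (2 * i + r + 1 + 1) = (-s) ^ r := by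
      rw [← pow_succ, ← mul_pow, show I * ((s : ℂ) * I) = -s by linear_combination (s : ℂ) * I_sq,
        show 2 * i + r + 1 + 1 = 2 * (i + 1) + r by ring, pow_add, pow_mul, neg_sq, hs', one_pow, one_mul]
    have f2 : I ^ q * (-(s : ℂ) * I) ^ q = s ^ q := by
      rw [← mul_pow]
      congr 1
      linear_combination -(s : ℂ) * I_sq
    rw [← f1, ← f2, mul_pow, mul_pow, show (2 * i + r + 1 + q) = (2 * i + r + 1) + q by ring, pow_add I]
    ring
  have e5 : ((2 * j + (2 * i + r + 1 + q)).choose (2 * j) : ℂ) * ((2 * j).factorial * (2 * i + r + 1 + q).factorial)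
      = (2 * j + (2 * i + r + 1 + q)).factorial := by
    have := Nat.add_choose_mul_factorial_mul_factorial (2 * j) (2 * i + r + 1 + q)
    rw [mul_assoc, ← Nat.choose_symm_add] at this
    exact_mod_cast this
  have e6 : 9 * k ^ 2 * cuspBeta k Z = 3 * Real.pi * k / (2 * Z) := by
    rw [cuspBeta]
    field_simp
    ring
  have e7 : -(6 * k * cuspBeta k Z * s) = -s * Real.pi / Z := by
    rw [cuspBeta]
    field_simp
  rw [zpow_one_sub_sub hZ, e1, e2, e3, e6, e7, ← e5, Nat.add_sub_cancel_left, pow_add (2 * Real.pi * I : ℂ) (2 * j)]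
  simp only [div_pow, mul_pow (3 * (Real.pi : ℂ)), mul_pow (3 : ℂ), mul_pow (2 : ℂ) Z, mul_pow (-s : ℂ) (Real.pi : ℂ),
    mul_pow (s : ℂ) (Real.pi : ℂ)]
  have g1 : ((2 * j).factorial : ℂ) ≠ 0 := by exact_mod_cast (2 * j).factorial_ne_zero
  have g2 : (q.factorial : ℂ) ≠ 0 := by exact_mod_cast q.factorial_ne_zero
  have g3 : (i.factorial : ℂ) ≠ 0 := by exact_mod_cast i.factorial_ne_zero
  have g4 : (r.factorial : ℂ) ≠ 0 := by exact_mod_cast r.factorial_ne_zero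
  have g5 : ((2 * i + r + 1 : ℕ) : ℂ) ≠ 0 := by exact_mod_cast (2 * i + r).succ_ne_zero
  generalize ((2 * j + (2 * i + r + 1 + q)).choose (2 * j) : ℂ) = ch
  generalize ((2 * i + r + 1 + q).factorial : ℂ) = F
  generalize ((2 * j).factorial : ℂ) = F1 at *
  generalize (q.factorial : ℂ) = F2 at *
  generalize (i.factorial : ℂ) = F3 at *
  generalize (r.factorial : ℂ) = F4 at *
  generalize ((2 * i + r + 1 : ℕ) : ℂ) = F5 at *
  generalize (kappa a b c : ℂ) = κ
  generalize (2 * Real.pi * I : ℂ) ^ (2 * j) = P at *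
  have g6 : (2 : ℂ) ^ (2 * i + r + 1 + q) ≠ 0 := pow_ne_zero _ two_ne_zero
  generalize (2 * Real.pi * I : ℂ) ^ (2 * i + r + 1 + q) = Q at *
  generalize ((s : ℂ) * I) ^ (2 * i + r + 1 + 1) = R at *
  generalize (-(s : ℂ) * I) ^ q = T at *
  generalize (2 : ℂ) ^ (2 * i + r + 1 + q) = W at *
  generalize (-(s : ℂ)) ^ r = U at *
  generalize (s : ℂ) ^ q = V at *
  have g7 : (Real.pi : ℂ) ^ (i + 1) ≠ 0 := pow_ne_zero _ hpi
  generalize (Real.pi : ℂ) ^ (i + 1) = p1 at *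
  generalize (Real.pi : ℂ) ^ i = p2 at *
  generalize (Real.pi : ℂ) ^ r = p3 at *
  generalize (Real.pi : ℂ) ^ q = p4 at *
  generalize (Real.sqrt k : ℂ) = w at *
  have e8 : 3 * I * w * Z * (P * Q) * (ch * (F1 * F) * 3 ^ i * ((k : ℂ) ^ a * k ^ i * w)
      / (F1 * F5 * F2 * F3 * F4 * (W * 2 ^ a * 2 ^ i) * p1) * κ * (-1) ^ a * R * T
      * (1 / (Z ^ a * Z ^ (2 * c) * Z ^ i * Z ^ r * Z ^ q)))
      = (Q * I * R * T) * (3 * (w ^ 2) * Z * P * (ch * (F1 * F) * 3 ^ i * ((k : ℂ) ^ a * k ^ i)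
      / (F1 * F5 * F2 * F3 * F4 * (W * 2 ^ a * 2 ^ i) * p1) * κ * (-1) ^ a
      * (1 / (Z ^ a * Z ^ (2 * c) * Z ^ i * Z ^ r * Z ^ q)))) := by ring
  rw [e8, e4, h4]
  field_simp

/-- The condition j₂ ≥ 1 reflects the vanishing of the shifted primitive at 0; j₂ - 1 derivatives
fall on its Gaussian density, of which 2j₄ on the quadratic part. -/
lemma iteratedDeriv_cuspGauss_mul_shiftedPrimitive {l k : ℕ} (hk : 0 < k) {Z : ℂ} (hZ : Z ≠ 0) {s : ℤ} (hs : s ^ 2 = 1) :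
    iteratedDeriv l (fun z => cuspGauss (-1 / 2) k Z z * (cexp (s * Real.pi / Z * z) * shiftedPrimitive (cuspBeta k Z) s k z)) 0
      = 3 * I * Real.sqrt k * Z * (2 * Real.pi * I) ^ l * erfExpSum s l k Z := by
  have hs' : (s : ℂ) ^ 2 = 1 := by exact_mod_cast hs
  have h1 : Differentiable ℂ (fun z : ℂ => cexp (s * Real.pi / Z * z)) := by fun_prop
  have h2 : Differentiable ℂ (shiftedPrimitive (cuspBeta k Z) s k) :=
    fun z => (hasDerivAt_shiftedPrimitive _ hs' k z).differentiableAt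
  have han : AnalyticAt ℂ (fun z : ℂ => cexp (s * Real.pi / Z * z) * shiftedPrimitive (cuspBeta k Z) s k z) 0 :=
    (h1.fun_mul h2).analyticAt 0
  rw [iteratedDeriv_cuspGauss_mul _ _ hZ han, erfExpSum, Finset.mul_sum]
  refine Finset.sum_congr rfl fun j hj => ?_
  rw [iteratedDeriv_cexp_mul_shiftedPrimitive _ _ hs', Finset.mul_sum, Finset.mul_sum]
  refine Finset.sum_congr rfl fun p hp => ?_
  rw [Finset.mem_filter, Finset.HasAntidiagonal.mem_antidiagonal] at hp
  rw [kappaSum]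
  simp only [Finset.mul_sum, Finset.sum_mul]
  rw [Finset.sum_comm]
  refine Finset.sum_congr rfl fun t _ => Finset.sum_congr rfl fun i hi => ?_
  obtain ⟨p1, q⟩ := p
  obtain ⟨m, rfl⟩ : ∃ m, p1 = m + 1 := ⟨p1 - 1, by omega⟩
  rw [Finset.mem_range] at hj hi
  obtain ⟨n, rfl⟩ : ∃ n, l = 2 * j + n := ⟨l - 2 * j, by omega⟩
  rw [Nat.add_sub_cancel_left] at hp ⊢
  obtain rfl : m + 1 + q = n := hp.1
  simp only [Nat.add_sub_cancel] at hi ⊢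
  exact erfExpSum_term hk hZ hs j m q (t 0) (t 1) (t 2) i (by omega)

/-- Both pieces share the factor 2β · 3√k Z = π/√k. -/
lemma iteratedDeriv_cuspGauss_mul_poleFun {l k : ℕ} (hl : Even l) (hk : 0 < k) {Z : ℂ} (hZ : Z ≠ 0) {s : ℤ} (hs : s ^ 2 = 1) :
    iteratedDeriv l (fun z => cuspGauss 1 k Z z * poleFun k Z s z) 0
      = Real.pi / Real.sqrt k * (Real.pi / cuspBeta k Z) ^ (1 / 2 : ℂ) * I * (2 * Real.pi * I) ^ l *
        (cexp (cuspBeta k Z) * erfExpSum s l k Z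
          - s * I * (∫ x in (0 : ℝ)..1, cexp (Real.pi * (x : ℂ) ^ 2 / (6 * k * Z))) * erfIntSum s l k Z) := by
  have hs' : (s : ℂ) ^ 2 = 1 := by exact_mod_cast hs
  have hk0 : (k : ℂ) ≠ 0 := by exact_mod_cast hk.ne'
  have h1 : Differentiable ℂ (fun z : ℂ => cexp (s * Real.pi / Z * z)) := by fun_prop
  have h2 : Differentiable ℂ (shiftedPrimitive (cuspBeta k Z) s k) :=
    fun z => (hasDerivAt_shiftedPrimitive _ hs' k z).differentiableAt
  have c1 := ((analyticAt_cuspGauss (-1 / 2) k Z).fun_mul (h1.analyticAt 0)).contDiffAt (n := l)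
  have c2 := ((analyticAt_cuspGauss (-1 / 2) k Z).fun_mul ((h1.fun_mul h2).analyticAt 0)).contDiffAt (n := l)
  have hJ : ∫ x in (0 : ℝ)..1, cexp (Real.pi * (x : ℂ) ^ 2 / (6 * k * Z)) = gaussPrimitive (cuspBeta k Z) 1 := by
    rw [gaussPrimitive, one_mul]
    refine intervalIntegral.integral_congr fun x _ => ?_
    rw [cuspBeta]
    congr 1
    ring
  rw [funext fun z => cuspGauss_mul_poleFun hk hZ hs z, iteratedDeriv_const_mul_field,
    iteratedDeriv_fun_add (contDiffAt_const.mul c1) (contDiffAt_const.mul c2),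
    iteratedDeriv_const_mul_field, iteratedDeriv_const_mul_field, iteratedDeriv_cuspGauss_mul_cexp hl hk hZ,
    iteratedDeriv_cuspGauss_mul_shiftedPrimitive hk hZ hs, hJ]
  have h3 : (Real.sqrt k : ℂ) ≠ 0 := sqrt_natCast_ne_zero hk
  have h4 := sqrt_natCast_sq k
  generalize (Real.pi / cuspBeta k Z) ^ (1 / 2 : ℂ) = NN
  generalize cexp (cuspBeta k Z) = eb
  generalize gaussPrimitive (cuspBeta k Z) 1 = J
  generalize erfIntSum s l k Z = S
  generalize erfExpSum s l k Z = T
  generalize (2 * Real.pi * I : ℂ) ^ l = P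
  rw [cuspBeta, ← h4]
  generalize (Real.sqrt k : ℂ) = w at *
  field_simp
  linear_combination (6 * NN * P * s * J * S) * I_sq
end erf

/-! ### The error-function part of the main term. -/

/-- The equation is g(2i + 1 - 7K) + 2ϱ = 2s, whose solvability is decided by k modulo 12 together
with ϱ and s. If 4 divides k, then K is even and ϱ odd, so every lattice point is even and ±1 is
never reached. -/
lemma exists_latticePoint_eq_iff {k : ℕ} (hk : 0 < k) {h μ : ℤ} {ϱ : ℕ} (hhk : Int.gcd h k = 1)
    (hh : h = (Nat.gcd k 6 : ℤ) * μ + ϱ) (hϱ : ϱ < Nat.gcd k 6) {s : ℤ} (hs : s = 1 ∨ s = -1) :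
    (∃ i : ℤ, (0 ≤ i ∧ i < 6 * bigK k) ∧ latticePoint h k (i - μ - 3 * bigK k) = s) ↔
      ((ϱ : ℤ) ≡ s [ZMOD (Nat.gcd k 3 : ℤ)] ∧ Nat.gcd k 12 ∈ ({1, 2, 3, 6} : Finset ℕ)) := by
  have hK := bigK_pos hk
  have h1 : ∀ i : ℤ, latticePoint h k (i - μ - 3 * bigK k) = s ↔ (Nat.gcd k 6 : ℤ) * (2 * i + 1 - 7 * bigK k) + 2 * ϱ = 2 * s := by
    intro i
    have h2 := two_mul_latticePoint h k (i - μ - 3 * bigK k)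
    have h3 : ((bigK k : ℕ) : ℤ) * Nat.gcd k 6 = k := by exact_mod_cast bigK_mul_gcd k
    rw [← h3] at h2
    have h4 : 2 * latticePoint h k (i - μ - 3 * bigK k) = (Nat.gcd k 6 : ℤ) * (2 * i + 1 - 7 * bigK k) + 2 * ϱ := by
      rw [h2]
      linear_combination 2 * hh
    omega
  simp only [h1]
  -- Coprimality enters here: for even k both h and ϱ are odd.
  have hodd : k % 2 = 0 → (Nat.gcd k 6 : ℤ) % 2 = 0 → ϱ % 2 = 1 := by
    intro h2 h3
    by_contra h4
    have h5 : (2 : ℤ) ∣ h := by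
      rw [hh]
      exact dvd_add (dvd_mul_of_dvd_left (Int.dvd_of_emod_eq_zero h3) _) (by omega)
    have h6 : (2 : ℤ) ∣ (Int.gcd h k : ℤ) := Int.dvd_coe_gcd h5 (by omega)
    rw [hhk] at h6
    omega
  have e6 : Nat.gcd k 6 = Nat.gcd (k % 12 % 6) 6 := by
    rw [Nat.gcd_comm, Nat.gcd_rec, Nat.mod_mod_of_dvd k (by norm_num)]
  have e3 : Nat.gcd k 3 = Nat.gcd (k % 12 % 3) 3 := by
    rw [Nat.gcd_comm, Nat.gcd_rec, Nat.mod_mod_of_dvd k (by norm_num)]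
  have e12 : Nat.gcd k 12 = Nat.gcd (k % 12) 12 := by rw [Nat.gcd_comm, Nat.gcd_rec]
  have hKg := bigK_mul_gcd k
  have hr : k % 12 < 12 := Nat.mod_lt _ (by norm_num)
  rw [Int.modEq_iff_dvd]
  -- The witness is the solution i of the linear equation; its range and exact divisibility are
  -- checked in each residue class.
  have hex : ∀ {g K : ℤ} {C : Prop}, ((∃ i : ℤ, (0 ≤ i ∧ i < 6 * K) ∧ g * (2 * i + 1 - 7 * K) + 2 * ϱ = 2 * s) → C) →
      (C → (0 ≤ (2 * (s - ϱ) / g + 7 * K - 1) / 2 ∧ (2 * (s - ϱ) / g + 7 * K - 1) / 2 < 6 * K)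
        ∧ g * (2 * ((2 * (s - ϱ) / g + 7 * K - 1) / 2) + 1 - 7 * K) + 2 * ϱ = 2 * s) →
      ((∃ i : ℤ, (0 ≤ i ∧ i < 6 * K) ∧ g * (2 * i + 1 - 7 * K) + 2 * ϱ = 2 * s) ↔ C) :=
    fun ha hb => ⟨ha, fun hc => ⟨_, hb hc⟩⟩
  refine hex ?_ ?_
  · rintro ⟨i, hi, h2⟩
    generalize bigK k = K at *
    generalize hr' : k % 12 = r at *
    rw [e6] at hodd h2 hKg hϱ
    rw [e3, e12]
    clear hh h1 hex e6 e3 e12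
    interval_cases r <;> norm_num at hodd h2 hKg hϱ ⊢ <;> omega
  · intro h2
    generalize bigK k = K at *
    generalize hr' : k % 12 = r at *
    rw [e6] at hodd hKg hϱ ⊢
    rw [e3, e12] at h2
    clear hh h1 hex e6 e3 e12
    interval_cases r <;> simp at h2 <;> norm_num at hodd hKg hϱ ⊢ <;> omega

lemma cpow_half_natCast {n : ℕ} (hn : 0 < n) : (n : ℂ) ^ (1 / 2 : ℂ) = Real.sqrt n := by
  have := cpow_half_ofReal_mul (r := n) (by exact_mod_cast hn) one_ne_zero
  simpa using this

lemma sqrt_bigK_mul_sqrt_gcd (k : ℕ) : (Real.sqrt (bigK k) : ℂ) * Real.sqrt (Nat.gcd k 6) = Real.sqrt k := by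
  rw [← Complex.ofReal_mul, ← Real.sqrt_mul (Nat.cast_nonneg _), ← Nat.cast_mul, bigK_mul_gcd]

/-- The factor in `erfPart` depending on the sign `s`, without the sums. -/
noncomputable def polePhase (h : ℤ) (k : ℕ) (s : ℤ) : ℂ :=
  (-1 : ℂ) ^ ((alphaHK h k : ℂ) + (s : ℂ) / Nat.gcd k 6 + 1 / 2)
      * cexp (Real.pi * I * (-(negInv h k : ℂ) / (6 * k)
          + (negInv (bigH h k) (bigK k) : ℂ) / bigK k
              * ((alphaHK h k : ℂ) + (s : ℂ) / Nat.gcd k 6) ^ 2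
          + (bigH h k : ℂ) / (36 * bigK k) - (s : ℂ) / (3 * Nat.gcd k 6 * bigK k)))
      * (Real.sqrt (Nat.gcd k 6) : ℂ) * chiHK h k

lemma cuspConst_mul_fourierCoefficient_pole {k : ℕ} {Z : ℂ} (hr : CuspRange k Z) {h : ℤ} (hhk : Int.gcd h k = 1) {s σ : ℤ}
    (hσ : latticePoint h k σ = s) :
    cuspConst h k Z * fourierCoefficient h k σ * (Real.pi / Real.sqrt k * (Real.pi / cuspBeta k Z) ^ (1 / 2 : ℂ) * I)
      = I ^ (-(1 / 2) : ℂ) * polePhase h k s := by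
  have hk := hr.pos
  have hk0 := hr.cast_ne_zero
  have hK0 : (bigK k : ℂ) ≠ 0 := by exact_mod_cast (bigK_pos hk).ne'
  have hg0 : (Nat.gcd k 6 : ℂ) ≠ 0 := by exact_mod_cast (gcd_six_pos k).ne'
  have hpi : (Real.pi : ℂ) ≠ 0 := by exact_mod_cast Real.pi_ne_zero
  have hKg : (bigK k : ℂ) * Nat.gcd k 6 = k := by exact_mod_cast bigK_mul_gcd k
  have hHg : (bigH h k : ℂ) * Nat.gcd k 6 = 6 * h := by exact_mod_cast bigH_mul_gcd h k
  have h1 : (2 : ℂ) * s = Nat.gcd k 6 * (2 * σ + 1) + 2 * h - k := by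
    rw [← hσ]
    exact_mod_cast two_mul_latticePoint h k σ
  -- When a lattice point equals s, the number α + s/g is its half-integral index σ + 1/2, so the
  -- power of -1 in the statement has an integral exponent.
  have h2 : (alphaHK h k : ℂ) + (s : ℂ) / Nat.gcd k 6 = σ + 1 / 2 := by
    rw [alphaHK]
    push_cast
    field_simp
    linear_combination 6 * h1 + 6 * hKg - 2 * hHg
  have h3 : frequency h k σ = s / k := by
    rw [← hσ, latticePoint_eq_mul_frequency hk, mul_div_cancel_left₀ _ hk0]
  have h4 : (-1 : ℂ) ^ ((σ : ℂ) + 1 / 2 + 1 / 2) = -(-1) ^ σ := by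
    rw [show (σ : ℂ) + 1 / 2 + 1 / 2 = ((σ + 1 : ℤ) : ℂ) by push_cast; ring, Complex.cpow_intCast,
      zpow_add_one₀ (by norm_num)]
    ring
  have h5 : cexp (Real.pi * I * (-(negInv h k : ℂ) / (6 * k) + (negInv (bigH h k) (bigK k) : ℂ) / bigK k * (σ + 1 / 2) ^ 2
          + (bigH h k : ℂ) / (36 * bigK k) - (s : ℂ) / (3 * Nat.gcd k 6 * bigK k)))
      = cexp (-(Real.pi * I * negInv h k / (6 * k))) * cexp (Real.pi * I * (negInv (bigH h k) (bigK k) / bigK k) * (σ + 1 / 2) ^ 2)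
        * cexp (Real.pi * I * bigH h k / (36 * bigK k)) * cexp (-(Real.pi * I * (s / k) / 3)) := by
    rw [← Complex.exp_add, ← Complex.exp_add, ← Complex.exp_add, mul_assoc 3, mul_comm (Nat.gcd k 6 : ℂ), hKg]
    congr 1
    field_simp
    ring
  have h6 : I ^ (-(1 / 2) : ℂ) = (I ^ (1 / 2 : ℂ))⁻¹ := Complex.cpow_neg _ _
  have h7 : (Real.pi / cuspBeta k Z) ^ (1 / 2 : ℂ) ≠ 0 := cpow_half_ne_zero (div_ne_zero hpi hr.beta_ne_zero)
  have h8 : I ^ (1 / 2 : ℂ) ≠ 0 := cpow_half_ne_zero I_ne_zero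
  have h9 := sqrt_bigK_mul_sqrt_gcd k
  have h10 := sqrt_natCast_ne_zero (bigK_pos hk)
  have h11 := sqrt_natCast_ne_zero (gcd_six_pos k)
  have h12 := etaMultiplierAt_ne_zero (bigK_pos hk) (gcd_bigH_bigK (h := h) (k := k) hhk)
  have h13 := sqrt_natCast_sq k
  have h14 := sqrt_natCast_ne_zero hk
  rw [polePhase, h2, h4, h5, chiHK, cuspConst, fourierCoefficient, h3, h6, cpow_half_natCast (bigK_pos hk)]
  generalize (Real.pi / cuspBeta k Z) ^ (1 / 2 : ℂ) = NN at *
  generalize etaMultiplierAt (bigH h k) (bigK k) = x1 at *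
  generalize etaMultiplierAt h k = x2 at *
  generalize cexp (-(Real.pi * I * negInv h k / (6 * k))) = E1
  generalize cexp (Real.pi * I * (negInv (bigH h k) (bigK k) / bigK k) * (σ + 1 / 2) ^ 2) = E2
  generalize cexp (Real.pi * I * bigH h k / (36 * bigK k)) = E3
  generalize cexp (-(Real.pi * I * (s / k) / 3)) = E4
  generalize (-1 : ℂ) ^ σ = sg
  generalize I ^ (1 / 2 : ℂ) = ih at *
  generalize (Real.sqrt (bigK k) : ℂ) = w1 at *
  generalize (Real.sqrt (Nat.gcd k 6) : ℂ) = w2 at *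
  generalize (Real.sqrt k : ℂ) = w at *
  rw [← h13, ← h9]
  field_simp
  have hI4 : I ^ 4 = 1 := I_pow_four
  linear_combination -(x2 ^ 2 * E1 * sg * E2 * E3 * E4) * hI4

/-- By injectivity each of ±1 is hit by at most one index, and ε records whether it is; the index
with lattice point 0 contributes nothing. -/
lemma sum_pole {k : ℕ} {Z : ℂ} (hr : CuspRange k Z) {h μ : ℤ} {ϱ : ℕ} (hhk : Int.gcd h k = 1)
    (hh : h = (Nat.gcd k 6 : ℤ) * μ + ϱ) (hϱ : ϱ < Nat.gcd k 6) {l : ℕ} (hl : Even l) :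
    cuspConst h k Z * ∑ i ∈ Finset.range (6 * bigK k), fourierCoefficient h k (i - μ - 3 * bigK k)
        * (if 2 ≤ |latticePoint h k (i - μ - 3 * bigK k)| then 0 else
          iteratedDeriv l (fun z => cuspGauss 1 k Z z * poleFun k Z (latticePoint h k (i - μ - 3 * bigK k)) z) 0)
      = erfPart l k h ϱ Z := by
  have hZ := hr.ne_zero
  set p : ℕ → ℤ := fun i => latticePoint h k (i - μ - 3 * bigK k) with hp
  set D : ℤ → ℂ := fun s => iteratedDeriv l (fun z => cuspGauss 1 k Z z * poleFun k Z s z) 0 with hD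
  have hD0 : D 0 = 0 := by
    have := iteratedDeriv_poleFun_zero hl k hZ
    simpa [hD] using this
  have h1 : ∀ i : ℕ, (if 2 ≤ |p i| then 0 else D (p i)) = ∑ s ∈ ({1, -1} : Finset ℤ), if p i = s then D s else 0 := by
    intro i
    rw [Finset.sum_pair (by norm_num)]
    by_cases h2 : 2 ≤ |p i|
    · rw [if_pos h2, if_neg, if_neg, add_zero] <;> intro h3 <;> rw [h3] at h2 <;> norm_num at h2
    · rw [if_neg h2]
      have h3 : |p i| ≤ 1 := by omega
      rw [abs_le] at h3
      have h4 : p i = 1 ∨ p i = 0 ∨ p i = -1 := by omega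
      rcases h4 with h4 | h4 | h4 <;> rw [h4] <;> simp [hD0]
  have h2 : ∀ s ∈ ({1, -1} : Finset ℤ), cuspConst h k Z * ∑ i ∈ Finset.range (6 * bigK k),
      (fourierCoefficient h k (i - μ - 3 * bigK k) * if p i = s then D s else 0)
      = (2 * Real.pi * I) ^ l * I ^ (-(1 / 2) : ℂ) * ((epsInd s k ϱ : ℂ) * polePhase h k s
      * (cexp (cuspBeta k Z) * erfExpSum s l k Z
          - s * I * (∫ x in (0 : ℝ)..1, cexp (Real.pi * (x : ℂ) ^ 2 / (6 * k * Z))) * erfIntSum s l k Z)) := by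
    intro s hs
    have hs1 : s = 1 ∨ s = -1 := by simpa using hs
    have hs2 : s ^ 2 = 1 := by rcases hs1 with rfl | rfl <;> norm_num
    have hiff := exists_latticePoint_eq_iff hr.pos hhk hh hϱ hs1
    by_cases hex : ∃ i : ℤ, (0 ≤ i ∧ i < 6 * bigK k) ∧ latticePoint h k (i - μ - 3 * bigK k) = s
    · rw [epsInd, if_pos (hiff.mp hex)]
      obtain ⟨i, ⟨hi0, hi1⟩, hi⟩ := hex
      lift i to ℕ using hi0
      rw [Finset.sum_eq_single i]
      · rw [if_pos hi, hD]
        simp only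
        rw [iteratedDeriv_cuspGauss_mul_poleFun hl hr.pos hZ hs2]
        have := cuspConst_mul_fourierCoefficient_pole hr hhk hi
        linear_combination ((2 * Real.pi * I) ^ l * (cexp (cuspBeta k Z) * erfExpSum s l k Z
          - s * I * (∫ x in (0 : ℝ)..1, cexp (Real.pi * (x : ℂ) ^ 2 / (6 * k * Z))) * erfIntSum s l k Z)) * this
      · intro m _ hm
        rw [if_neg, mul_zero]
        intro h3
        have := latticePoint_injective h k (h3.trans hi.symm)
        omega
      · intro h3
        rw [Finset.mem_range] at h3
        omega
    · rw [epsInd, if_neg fun h3 => hex (hiff.mpr h3), Finset.sum_eq_zero]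
      · simp
      · intro i hi
        rw [Finset.mem_range] at hi
        rw [if_neg fun h3 => hex ⟨i, ⟨by omega, by omega⟩, h3⟩, mul_zero]
  have h3 : ∀ i ∈ Finset.range (6 * bigK k), fourierCoefficient h k (i - μ - 3 * bigK k)
        * (if 2 ≤ |p i| then 0 else D (p i))
      = ∑ s ∈ ({1, -1} : Finset ℤ), fourierCoefficient h k (i - μ - 3 * bigK k) * if p i = s then D s else 0 :=
    fun i _ => by rw [h1, Finset.mul_sum]
  rw [Finset.sum_congr rfl h3, Finset.sum_comm, Finset.mul_sum, Finset.sum_congr rfl h2, ← Finset.mul_sum, erfPart]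
  congr 1
  refine Finset.sum_congr rfl fun s _ => ?_
  rw [polePhase, cuspBeta]
  ring

/-! ### The cotangent part of the main term. -/

lemma iteratedDeriv_comp_mul_sub (f : ℂ → ℂ) (a b : ℂ) (n : ℕ) :
    iteratedDeriv n (fun w => f (a * (w - b))) = fun w => a ^ n * iteratedDeriv n f (a * (w - b)) := by
  induction n with
  | zero => simp
  | succ n ih =>
    ext w
    rw [iteratedDeriv_succ, ih, deriv_const_mul_field, deriv_comp_sub_const (fun w => iteratedDeriv n f (a * w)) b w,
      deriv_comp_mul_left, iteratedDeriv_succ, smul_eq_mul, pow_succ, mul_assoc]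

lemma iteratedDeriv_inv_of_even {n : ℕ} (hn : Even n) (v : ℂ) :
    iteratedDeriv n (fun v : ℂ => v⁻¹) v = n.factorial / v ^ (n + 1) := by
  have h := iter_deriv_inv n v
  rw [iteratedDeriv_eq_iterate, show (fun v : ℂ => v⁻¹) = Inv.inv from rfl, h, hn.neg_one_pow, one_mul,
    show (-1 : ℤ) - n = -((n + 1 : ℕ) : ℤ) by push_cast; ring, zpow_neg, zpow_natCast, div_eq_mul_inv]

lemma iteratedDeriv_cotReg {v : ℂ} (hv : ‖v‖ < 4 / 5) (hv0 : v ≠ 0) {n : ℕ} (hn : Even n) :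
    iteratedDeriv n cotReg v
      = iteratedDeriv n (fun v => Real.pi * Complex.cot (Real.pi * v)) v - n.factorial / v ^ (n + 1) := by
  have hb : Metric.ball (0 : ℂ) (4 / 5) ∈ nhds v := Metric.isOpen_ball.mem_nhds (by simpa using hv)
  have h1 : (fun v : ℂ => Real.pi * Complex.cot (Real.pi * v)) =ᶠ[nhds v] fun v => cotReg v + v⁻¹ := by
    filter_upwards [hb] with w hw
    rw [cotReg_eq (by simpa using (le_of_lt (by simpa using hw : ‖w‖ < 4 / 5)))]
    ring
  have h2 : ContDiffAt ℂ n cotReg v := (differentiableOn_cotReg.analyticAt hb).contDiffAt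
  rw [h1.iteratedDeriv_eq, iteratedDeriv_fun_add h2 (contDiffAt_inv ℂ hv0), iteratedDeriv_inv_of_even hn]
  ring

lemma iteratedDeriv_pi_mul_cot (n : ℕ) (v : ℂ) :
    iteratedDeriv n (fun v => Real.pi * Complex.cot (Real.pi * v)) v = Real.pi * (2 * Real.pi * I) ^ n * cotC n v := by
  have hpi : (Real.pi : ℂ) ≠ 0 := by exact_mod_cast Real.pi_ne_zero
  rw [iteratedDeriv_const_mul_field, cotC, div_pow, one_pow]
  field_simp

/-- For |p| ≤ 1 the density lacks its pole 1/(w - p), whose even derivatives n!/(w - p)^{n+1} are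
the correction term. -/
lemma iteratedDeriv_nearDensity {k : ℕ} (hk : 0 < k) {p : ℤ} {w : ℂ} (hw : w ∈ nearDomain k p) (hwp : w ≠ p) {n : ℕ}
    (hn : Even n) :
    iteratedDeriv n (nearDensity k p) w = Real.pi / (6 * k) * (2 * Real.pi * I / (6 * k)) ^ n * (cotC n ((w - p) / (6 * k))
      - (if |p| ≤ 1 then 1 else 0) * (-1) ^ (n / 2) * 2 * n.factorial * (3 * k / (Real.pi * (w - p))) ^ (n + 1)) := by
  have hk0 : (k : ℂ) ≠ 0 := by exact_mod_cast hk.ne'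
  have hpi : (Real.pi : ℂ) ≠ 0 := by exact_mod_cast Real.pi_ne_zero
  have hwp' : w - p ≠ 0 := sub_ne_zero.mpr hwp
  have h1 : ∀ f : ℂ → ℂ, iteratedDeriv n (fun w => 1 / (6 * k) * f ((w - p) / (6 * k))) w
      = 1 / (6 * k) * (1 / (6 * k) ^ n * iteratedDeriv n f ((w - p) / (6 * k))) := by
    intro f
    have := congrFun (iteratedDeriv_comp_mul_sub f (6 * k)⁻¹ p n) w
    simp only [inv_mul_eq_div] at this
    rw [iteratedDeriv_const_mul_field, this, inv_pow, one_div ((6 * (k : ℂ)) ^ n)]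
  by_cases hp : 2 ≤ |p|
  · have h2 : nearDensity k p = fun w => 1 / (6 * k) * (fun v => Real.pi * Complex.cot (Real.pi * v)) ((w - p) / (6 * k)) := by
      ext w
      rw [nearDensity, if_pos hp]
    rw [h2, h1 fun v => Real.pi * Complex.cot (Real.pi * v), iteratedDeriv_pi_mul_cot, if_neg (by omega), div_pow]
    ring
  · have h2 : nearDensity k p = fun w => 1 / (6 * k) * cotReg ((w - p) / (6 * k)) := by
      ext w
      rw [nearDensity, if_neg hp]
    have h3 : (w - p) / (6 * k) ≠ 0 := div_ne_zero hwp' (by simp [hk0])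
    rw [h2, h1, iteratedDeriv_cotReg hw.1 h3 hn, iteratedDeriv_pi_mul_cot, if_pos (by omega)]
    -- For even n the factor (-1)^{n/2} cancels i^n, so the correction is written with the real
    -- number π/(3k).
    have h4 : (2 * Real.pi * I / (6 * k)) ^ n * (-1) ^ (n / 2) = (Real.pi / (3 * k) : ℂ) ^ n := by
      obtain ⟨m, rfl⟩ := hn
      rw [show (m + m) / 2 = m by omega, ← two_mul, pow_mul, pow_mul, ← mul_pow]
      congr 1
      field_simp
      linear_combination -(36 : ℂ) * I_sq
    have h5 : 1 / (6 * k) * (1 / (6 * k) ^ n * (n.factorial / ((w - p) / (6 * k)) ^ (n + 1)))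
        = Real.pi / (6 * k) * ((Real.pi / (3 * k) : ℂ) ^ n * (2 * n.factorial * (3 * k / (Real.pi * (w - p))) ^ (n + 1))) := by
      simp only [div_pow, mul_pow, pow_succ]
      have hw6 : (6 : ℂ) ^ n ≠ 0 := pow_ne_zero _ (by norm_num)
      field_simp
      ring
    rw [mul_sub, mul_sub, h5, ← h4, div_pow]
    ring

lemma cotC_sub_one (n : ℕ) (v : ℂ) : cotC n (v - 1) = cotC n v := by
  have h1 : (fun u : ℂ => Complex.cot (Real.pi * (u - 1))) = fun u => Complex.cot (Real.pi * u) := by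
    ext u
    rw [Complex.cot, Complex.cot, mul_sub, mul_one, Complex.cos_sub_pi, Complex.sin_sub_pi, neg_div_neg_eq]
  have h2 := congrFun (iteratedDeriv_comp_sub_const n (fun u : ℂ => Complex.cot (Real.pi * u)) 1) v
  rw [h1] at h2
  rw [cotC, cotC, h2]

/-- The `n`-th derivative of the cotangent without its pole nearest to `x`, at a lattice point `p` modulo `6k`. -/
noncomputable def cotDensity (n k : ℕ) (p : ℤ) (x : ℂ) : ℂ :=
  cotC n ((x - p) / (6 * k)) - (if |Int.bmod p (6 * k)| ≤ 1 then 1 else 0) * (-1) ^ (n / 2) * 2 * n.factorial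
    * (3 * k / (Real.pi * (x - Int.bmod p (6 * k)))) ^ (n + 1)

lemma cotDensity_add {k : ℕ} (hk : 0 < k) (n : ℕ) (p : ℤ) (x : ℂ) : cotDensity n k (p + 6 * k) x = cotDensity n k p x := by
  have hk0 : (k : ℂ) ≠ 0 := by exact_mod_cast hk.ne'
  have h1 : Int.bmod (p + 6 * k) (6 * k) = Int.bmod p (6 * k) := by
    have := Int.add_bmod_right p (6 * k)
    exact_mod_cast this
  rw [cotDensity, cotDensity, h1, ← cotC_sub_one n ((x - p) / (6 * k))]
  congr 2
  push_cast
  field_simp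
  ring

/-- For |p| ≤ 7k/2 a translate p ± 6k has modulus at least 5k/2 > 1, so being small modulo 6k means
being small. -/
lemma bmod_eq_or_of_abs_le {k : ℕ} (hk : 0 < k) {p : ℤ} (hp : 2 * |p| ≤ 7 * k) :
    (|p| ≤ 1 ↔ |Int.bmod p (6 * k)| ≤ 1) ∧ (|p| ≤ 1 → Int.bmod p (6 * k) = p) := by
  have h1 : |p| ≤ 1 → Int.bmod p (6 * k) = p := fun h => by
    rw [abs_le] at h
    exact Int.bmod_eq_of_le_mul_two (by push_cast; omega) (by push_cast; omega)
  refine ⟨⟨fun h => by rwa [h1 h], fun h => ?_⟩, h1⟩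
  have h2 := Int.bmod_add_bdiv p (6 * k)
  rw [abs_le] at h
  have h3 : 2 * p ≤ 7 * k ∧ -(7 * k) ≤ 2 * p := by
    constructor <;> [skip; skip] <;> cases abs_cases p <;> omega
  have h4 : Int.bdiv p (6 * k) = 0 := by
    generalize Int.bdiv p (6 * k) = t at h2
    push_cast at h2
    by_contra h0
    rcases lt_or_gt_of_ne h0 with h5 | h5
    · nlinarith
    · nlinarith
  rw [h4, mul_zero, add_zero] at h2
  rw [← h2, abs_le]
  exact h

lemma CuspRange.iteratedDeriv_integral_nearDensity {k : ℕ} {Z : ℂ} (hr : CuspRange k Z) {p : ℤ} (hp : 2 * |p| ≤ 7 * k)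
    {n : ℕ} (hn : Even n) :
    iteratedDeriv n (fun z => ∫ x in (-1 : ℝ)..1, cexp (cuspBeta k Z * (1 - (x : ℂ) ^ 2)) * nearDensity k p (x + 3 * k * z)) 0
      = Real.pi / (6 * k) * (2 * Real.pi * I) ^ n / 2 ^ n
        * ∫ x in (-1 : ℝ)..1, cexp (cuspBeta k Z * (1 - (x : ℂ) ^ 2)) * cotDensity n k p x := by
  have hk0 := hr.cast_ne_zero
  have hz : (0 : ℂ) ∈ Metric.ball (0 : ℂ) (‖Z‖ / 100) := Metric.mem_ball_self (div_pos hr.norm_pos (by norm_num))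
  rw [iteratedDeriv_integral_mul_comp_add (continuous_gauss_weight _) (isOpen_nearDomain k p) Metric.isOpen_ball
    (hr.mem_nearDomain hp) n (differentiableOn_nearDensity k p) hz, ← intervalIntegral.integral_const_mul]
  refine intervalIntegral.integral_congr_ae ?_
  -- At x = p the explicit formula has division by zero where the density has a removable
  -- singularity; a single point does not affect the integral.
  have h0 : ∀ᵐ x : ℝ, x ≠ p := MeasureTheory.Measure.ae_ne _ _
  filter_upwards [h0] with x hx hx'
  have hmem := hr.mem_nearDomain hp 0 hz x (Set.uIoc_subset_uIcc hx')
  rw [mul_zero, add_zero] at hmem ⊢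
  rw [iteratedDeriv_nearDensity hr.pos hmem (by exact_mod_cast hx) hn, cotDensity]
  have h2 := bmod_eq_or_of_abs_le hr.pos hp
  have h3 : (3 * k : ℂ) ^ n * (2 * Real.pi * I / (6 * k)) ^ n = (2 * Real.pi * I) ^ n / 2 ^ n := by
    rw [← mul_pow, ← div_pow]
    congr 1
    field_simp
    norm_num
  by_cases h4 : |p| ≤ 1
  · rw [if_pos h4, if_pos (h2.1.mp h4), h2.2 h4, mul_div_assoc (Real.pi / (6 * k) : ℂ) ((2 * Real.pi * I) ^ n), ← h3]
    ring
  · rw [if_neg h4, if_neg (fun h => h4 (h2.1.mpr h)), mul_div_assoc (Real.pi / (6 * k) : ℂ) ((2 * Real.pi * I) ^ n), ← h3]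
    ring

/-- The derivatives at the origin of a summand of `mainFun` without its pole. -/
noncomputable def cotSum (l k : ℕ) (Z : ℂ) (p : ℤ) : ℂ :=
  ∑ j ∈ Finset.range (l / 2 + 1), (l.choose (2 * j) : ℂ) * (kappaSum 1 k Z j / 2 ^ (l - 2 * j)
    * ∫ x in (-1 : ℝ)..1, cexp (cuspBeta k Z * (1 - (x : ℂ) ^ 2)) * cotDensity (l - 2 * j) k p x)

lemma cotSum_add {k : ℕ} (hk : 0 < k) (l : ℕ) (Z : ℂ) (p : ℤ) : cotSum l k Z (p + 6 * k) = cotSum l k Z p := by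
  simp only [cotSum, cotDensity_add hk]

lemma CuspRange.analyticAt_integral_nearDensity {k : ℕ} {Z : ℂ} (hr : CuspRange k Z) {p : ℤ} (hp : 2 * |p| ≤ 7 * k) :
    AnalyticAt ℂ (fun z => ∫ x in (-1 : ℝ)..1, cexp (cuspBeta k Z * (1 - (x : ℂ) ^ 2)) * nearDensity k p (x + 3 * k * z)) 0 := by
  have hz : Metric.ball (0 : ℂ) (‖Z‖ / 100) ∈ nhds 0 := Metric.ball_mem_nhds _ (div_pos hr.norm_pos (by norm_num))
  refine DifferentiableOn.analyticAt (fun z hz => ?_) hz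
  exact (hasDerivAt_integral_mul_comp_add (continuous_gauss_weight _) (isOpen_nearDomain k p)
      (differentiableOn_nearDensity k p) Metric.isOpen_ball (hr.mem_nearDomain hp) hz).differentiableAt.differentiableWithinAt

/-- The near kernel is an isolated pole term plus a Gaussian integral of a holomorphic density;
Leibniz' rule on the second gives the cotangent sums. -/
lemma CuspRange.iteratedDeriv_cuspGauss_mul_nearKernel {k : ℕ} {Z : ℂ} (hr : CuspRange k Z) {p : ℤ} (hp : 2 * |p| ≤ 7 * k)
    {l : ℕ} (hl : Even l) :
    iteratedDeriv l (fun z => cuspGauss 1 k Z z * nearKernel (cuspBeta k Z) k p (3 * k * z)) 0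
      = (if 2 ≤ |p| then 0 else iteratedDeriv l (fun z => cuspGauss 1 k Z z * poleFun k Z p z) 0)
        + Real.pi / (6 * k) * (2 * Real.pi * I) ^ l * cotSum l k Z p := by
  have hI := hr.analyticAt_integral_nearDensity hp
  have hG := analyticAt_cuspGauss 1 k Z
  have h1 : iteratedDeriv l (fun z => cuspGauss 1 k Z z * ∫ x in (-1 : ℝ)..1,
      cexp (cuspBeta k Z * (1 - (x : ℂ) ^ 2)) * nearDensity k p (x + 3 * k * z)) 0
      = Real.pi / (6 * k) * (2 * Real.pi * I) ^ l * cotSum l k Z p := by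
    rw [iteratedDeriv_cuspGauss_mul 1 k hr.ne_zero hI, cotSum, Finset.mul_sum]
    refine Finset.sum_congr rfl fun j hj => ?_
    obtain ⟨n, rfl⟩ : ∃ n, l = 2 * j + 2 * n := by
      obtain ⟨m, rfl⟩ := hl
      rw [Finset.mem_range] at hj
      exact ⟨m - j, by omega⟩
    rw [Nat.add_sub_cancel_left, hr.iteratedDeriv_integral_nearDensity hp (even_two_mul n), pow_add _ (2 * j)]
    ring
  simp only [nearKernel_eq, mul_add]
  by_cases hp2 : 2 ≤ |p|
  · simp only [if_pos hp2, mul_zero, zero_add]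
    exact h1
  · simp only [if_neg hp2]
    refine (iteratedDeriv_fun_add ((hG.fun_mul (analyticAt_poleFun k Z p)).contDiffAt)
      ((hG.fun_mul hI).contDiffAt)).trans ?_
    rw [h1]

lemma latticePoint_sub_eq {k : ℕ} {h μ : ℤ} {ϱ : ℕ} (hh : h = (Nat.gcd k 6 : ℤ) * μ + ϱ) (ν : ℕ) :
    (latticePoint h k (ν - μ) : ℚ) = (Nat.gcd k 6 : ℚ) * (ν + 1 / 2) - (k : ℚ) / 2 + ϱ := by
  have h1 : (2 : ℚ) * latticePoint h k (ν - μ) = Nat.gcd k 6 * (2 * ((ν - μ : ℤ) : ℚ) + 1) + 2 * h - k := by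
    exact_mod_cast two_mul_latticePoint h k (ν - μ)
  have h2 : (h : ℚ) = (Nat.gcd k 6 : ℚ) * μ + ϱ := by exact_mod_cast hh
  push_cast at h1
  linear_combination h1 / 2 + h2

lemma bmod_eq_of_abs_add_le {k : ℕ} (hk : 0 < k) {p r : ℤ} (h : |6 * k * r + p| ≤ 1) :
    Int.bmod p (6 * k) = 6 * k * r + p := by
  rw [abs_le] at h
  have h1 : Int.bmod (p + (6 * k : ℕ) * r) (6 * k) = Int.bmod p (6 * k) := Int.add_mul_bmod_self_left p (6 * k) r
  rw [← h1, Int.bmod_eq_of_le_mul_two (by push_cast; linarith) (by push_cast; linarith)]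
  push_cast
  ring

lemma deltaInd_eq {k : ℕ} (hk : 0 < k) {h μ : ℤ} {ϱ : ℕ} (hh : h = (Nat.gcd k 6 : ℤ) * μ + ϱ) (ν : ℕ) :
    deltaInd k ϱ ν = if |Int.bmod (latticePoint h k (ν - μ)) (6 * k)| ≤ 1 then 1 else 0 := by
  have h1 := latticePoint_sub_eq hh ν
  generalize latticePoint h k (ν - μ) = p at *
  have h2 : ∀ r : ℤ, |6 * (k : ℚ) * r + (Nat.gcd k 6 : ℚ) * (ν + 1 / 2) - (k : ℚ) / 2 + ϱ| ≤ 1 ↔ |6 * (k : ℤ) * r + p| ≤ 1 := by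
    intro r
    rw [show 6 * (k : ℚ) * r + (Nat.gcd k 6 : ℚ) * (ν + 1 / 2) - (k : ℚ) / 2 + ϱ = ((6 * (k : ℤ) * r + p : ℤ) : ℚ) by
      push_cast
      linear_combination -h1]
    exact_mod_cast Iff.rfl
  have h4 : (∃ r : ℤ, |6 * (k : ℚ) * r + (Nat.gcd k 6 : ℚ) * (ν + 1 / 2) - (k : ℚ) / 2 + ϱ| ≤ 1)
      ↔ |Int.bmod p (6 * k)| ≤ 1 := by
    simp only [h2]
    refine ⟨fun ⟨r, hr⟩ => by rwa [bmod_eq_of_abs_add_le hk hr], fun h => ⟨-Int.bdiv p (6 * k), ?_⟩⟩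
    have h3 := Int.bmod_add_bdiv p (6 * k)
    push_cast at h3
    rwa [show 6 * (k : ℤ) * -Int.bdiv p (6 * k) + p = Int.bmod p (6 * k) by linear_combination -h3]
  rw [deltaInd]
  by_cases h5 : |Int.bmod p (6 * k)| ≤ 1
  · rw [if_pos h5, if_pos (h4.mpr h5)]
  · rw [if_neg h5, if_neg fun h => h5 (h4.mp h)]

/-- The numbers g(ν + 1/2) - k/2 + ϱ are the lattice points themselves, so γ is minus the
representative of least absolute value modulo 6k. -/
lemma gammaInd_eq {k : ℕ} (hk : 0 < k) {h μ : ℤ} {ϱ : ℕ} (hh : h = (Nat.gcd k 6 : ℤ) * μ + ϱ) (ν : ℕ)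
    (hp : |Int.bmod (latticePoint h k (ν - μ)) (6 * k)| ≤ 1) :
    gammaInd k ϱ ν = -Int.bmod (latticePoint h k (ν - μ)) (6 * k) := by
  have h1 := latticePoint_sub_eq hh ν
  generalize latticePoint h k (ν - μ) = p at *
  have h2 : ∀ c : ℤ, |c| ≤ 1 → (((Nat.gcd k 6 : ℚ) * (ν + 1 / 2)) ≡ (k : ℚ) / 2 - ϱ - c [PMOD (6 * k : ℚ)]
      ↔ Int.bmod p (6 * k) = -c) := by
    intro c hc
    rw [AddCommGroup.modEq_iff_zsmul]
    constructor
    · rintro ⟨r, hr⟩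
      have h3 : 6 * (k : ℤ) * r + p = -c := by
        rw [zsmul_eq_mul] at hr
        have : (6 * (k : ℚ) * r + p : ℚ) = -c := by linear_combination hr + h1
        exact_mod_cast this
      rw [bmod_eq_of_abs_add_le hk (by rw [h3, abs_neg]; exact hc), h3]
    · intro h3
      refine ⟨-Int.bdiv p (6 * k), ?_⟩
      have h4 := Int.bmod_add_bdiv p (6 * k)
      rw [h3] at h4
      have h5 : (-c + (6 * k : ℚ) * (Int.bdiv p (6 * k)) : ℚ) = p := by exact_mod_cast h4
      rw [zsmul_eq_mul]
      push_cast
      linear_combination -h5 - h1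
  have e1 := h2 1 (by norm_num)
  have e2 := h2 (-1) (by norm_num)
  push_cast at e1 e2
  rw [sub_neg_eq_add] at e2
  rw [gammaInd]
  simp only [e1, e2]
  rw [abs_le] at hp
  split_ifs <;> omega

lemma cotSum_eq {l k : ℕ} (hl : Even l) (hk : 0 < k) {Z : ℂ} (hZ : Z ≠ 0) {h μ : ℤ} {ϱ : ℕ}
    (hh : h = (Nat.gcd k 6 : ℤ) * μ + ϱ) (ν : ℕ) :
    ∑ j ∈ Finset.range (l / 2 + 1), (l.choose (2 * j) : ℂ)
          * ∑ t ∈ Finset.Nat.antidiagonalTuple 3 j,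
              (k : ℂ) ^ (t 0) * (kappa (t 0) (t 1) (t 2) : ℂ)
              * Z ^ ((1 / 2 : ℂ) - (t 0 : ℂ) - 2 * (t 2 : ℂ))
              * (2 : ℂ) ^ (2 * (j : ℤ) - (l : ℤ))
              * ∫ x in (-1 : ℝ)..1,
                  cexp (Real.pi / (6 * k * Z) * (1 - (x : ℂ) ^ 2))
                  * (cotC (l - 2 * j) (1 / (6 * (k : ℂ))
                        * ((x : ℂ) - (Nat.gcd k 6 : ℂ) * ((ν : ℂ) + 1 / 2) + (k : ℂ) / 2 - ϱ))
                      - (deltaInd k ϱ ν : ℂ) * (-1) ^ (l / 2 + j) * 2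
                        * ((l - 2 * j).factorial : ℂ)
                        * (3 * k / (Real.pi * ((x : ℂ) + gammaInd k ϱ ν))) ^ (l - 2 * j + 1))
      = (Z ^ (1 / 2 : ℂ))⁻¹ * cotSum l k Z (latticePoint h k (ν - μ)) := by
  have h1 : (latticePoint h k (ν - μ) : ℂ) = (Nat.gcd k 6 : ℂ) * (ν + 1 / 2) - (k : ℂ) / 2 + ϱ := by
    have := congrArg (Rat.cast (K := ℂ)) (latticePoint_sub_eq hh ν)
    push_cast at this
    exact this
  rw [cotSum, Finset.mul_sum]
  refine Finset.sum_congr rfl fun j hj => ?_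
  obtain ⟨n, rfl⟩ : ∃ n, l = 2 * j + 2 * n := by
    obtain ⟨m, rfl⟩ := hl
    rw [Finset.mem_range] at hj
    exact ⟨m - j, by omega⟩
  have hint : ∫ x in (-1 : ℝ)..1, cexp (Real.pi / (6 * k * Z) * (1 - (x : ℂ) ^ 2))
        * (cotC (2 * j + 2 * n - 2 * j) (1 / (6 * (k : ℂ))
              * ((x : ℂ) - (Nat.gcd k 6 : ℂ) * ((ν : ℂ) + 1 / 2) + (k : ℂ) / 2 - ϱ))
            - (deltaInd k ϱ ν : ℂ) * (-1) ^ ((2 * j + 2 * n) / 2 + j) * 2 * ((2 * j + 2 * n - 2 * j).factorial : ℂ)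
              * (3 * k / (Real.pi * ((x : ℂ) + gammaInd k ϱ ν))) ^ (2 * j + 2 * n - 2 * j + 1))
      = ∫ x in (-1 : ℝ)..1, cexp (cuspBeta k Z * (1 - (x : ℂ) ^ 2))
        * cotDensity (2 * j + 2 * n - 2 * j) k (latticePoint h k (ν - μ)) x := by
    refine intervalIntegral.integral_congr fun x _ => ?_
    rw [cotDensity, cuspBeta, Nat.add_sub_cancel_left, deltaInd_eq hk hh, h1]
    congr 2
    · congr 1
      ring
    · rw [show (2 * j + 2 * n) / 2 + j = 2 * j + n by omega, pow_add, pow_mul, show 2 * n / 2 = n by omega]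
      by_cases hp : |Int.bmod (latticePoint h k (ν - μ)) (6 * k)| ≤ 1
      · rw [gammaInd_eq hk hh ν hp]
        simp only [if_pos hp]
        push_cast
        ring
      · simp [hp]
  rw [hint, Nat.add_sub_cancel_left]
  generalize ∫ x in (-1 : ℝ)..1, cexp (cuspBeta k Z * (1 - (x : ℂ) ^ 2)) * cotDensity (2 * n) k (latticePoint h k (ν - μ)) x = J
  have h2 : (2 : ℂ) ^ (2 * (j : ℤ) - ((2 * j + 2 * n : ℕ) : ℤ)) = 1 / 2 ^ (2 * n) := by
    rw [show 2 * (j : ℤ) - ((2 * j + 2 * n : ℕ) : ℤ) = -((2 * n : ℕ) : ℤ) by push_cast; ring, zpow_neg, zpow_natCast, one_div]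
  rw [h2, kappaSum, mul_left_comm, Finset.sum_div, Finset.sum_mul]
  congr 1
  rw [Finset.mul_sum]
  refine Finset.sum_congr rfl fun t _ => ?_
  -- The complex power splits into an integral power from the Taylor coefficients and Z^{-1/2} from
  -- the normalisation √(π/β).
  have h3 : Z ^ ((1 / 2 : ℂ) - (t 0 : ℂ) - 2 * (t 2 : ℂ)) = (Z ^ (1 / 2 : ℂ))⁻¹ * Z ^ ((1 : ℤ) - (t 0 : ℤ) - 2 * (t 2 : ℤ)) := by
    rw [show (1 / 2 : ℂ) - (t 0 : ℂ) - 2 * (t 2 : ℂ) = -(1 / 2) + (((1 : ℤ) - (t 0 : ℤ) - 2 * (t 2 : ℤ) : ℤ) : ℂ) by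
      push_cast; ring, Complex.cpow_add _ _ hZ, Complex.cpow_neg, Complex.cpow_intCast]
  rw [h3]
  ring

lemma cuspConst_mul_fourierCoefficient_cot {k : ℕ} {Z : ℂ} (hr : CuspRange k Z) {h : ℤ} (hhk : Int.gcd h k = 1)
    (μ : ℤ) (ν : ℕ) :
    cuspConst h k Z * fourierCoefficient h k (ν - μ) * (Real.pi / (6 * k))
      = (I ^ (1 / 2 : ℂ) * cexp (Real.pi * I / (6 * k) * ((k : ℂ) - h - negInv h k - Nat.gcd k 6))
        * (Real.sqrt (Nat.gcd k 6) : ℂ) / (6 * (Real.sqrt 6 : ℂ) * k)) * chiHK h k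
        * ((-1 : ℂ) ^ ((ν : ℤ) + μ) * cexp (Real.pi * I * (((μ : ℂ) - ν) / (3 * bigK k)
            + (negInv (bigH h k) (bigK k) : ℂ) / bigK k * ((ν : ℂ) - μ + 1 / 2) ^ 2))) * (Z ^ (1 / 2 : ℂ))⁻¹ := by
  have hk := hr.pos
  have hZ := hr.ne_zero
  have hk0 := hr.cast_ne_zero
  have hkR : (0 : ℝ) < k := by exact_mod_cast hk
  have hK0 : (bigK k : ℂ) ≠ 0 := by exact_mod_cast (bigK_pos hk).ne'
  have hg0 : (Nat.gcd k 6 : ℂ) ≠ 0 := by exact_mod_cast (gcd_six_pos k).ne'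
  have hpi : (Real.pi : ℂ) ≠ 0 := by exact_mod_cast Real.pi_ne_zero
  have hKg : (bigK k : ℂ) * Nat.gcd k 6 = k := by exact_mod_cast bigK_mul_gcd k
  have hHg : (bigH h k : ℂ) * Nat.gcd k 6 = 6 * h := by exact_mod_cast bigH_mul_gcd h k
  -- As π/β = 6kZ with 6k > 0, the principal root factors without a branch correction.
  have hN : (Real.pi / cuspBeta k Z) ^ (1 / 2 : ℂ) = Real.sqrt 6 * Real.sqrt k * Z ^ (1 / 2 : ℂ) := by
    rw [show Real.pi / cuspBeta k Z = ((6 * k : ℝ) : ℂ) * Z by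
      rw [cuspBeta]; push_cast; field_simp, cpow_half_ofReal_mul (by positivity) hZ, Real.sqrt_mul (by norm_num)]
    push_cast
    rfl
  have h4 : (-1 : ℂ) ^ ((ν : ℤ) - μ) = (-1) ^ ((ν : ℤ) + μ) := by
    rw [zpow_sub₀ (by norm_num), zpow_add₀ (by norm_num), div_eq_mul_inv, ← inv_zpow, inv_neg_one]
  have h5 : cexp (-(Real.pi * I * negInv h k / (6 * k)))
        * cexp (Real.pi * I * (negInv (bigH h k) (bigK k) / bigK k) * (((ν - μ : ℤ) : ℂ) + 1 / 2) ^ 2)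
        * cexp (Real.pi * I * bigH h k / (36 * bigK k)) * cexp (-(Real.pi * I * frequency h k (ν - μ) / 3))
      = cexp (Real.pi * I / (6 * k) * ((k : ℂ) - h - negInv h k - Nat.gcd k 6))
        * cexp (Real.pi * I * (((μ : ℂ) - ν) / (3 * bigK k)
            + (negInv (bigH h k) (bigK k) : ℂ) / bigK k * ((ν : ℂ) - μ + 1 / 2) ^ 2)) := by
    rw [← Complex.exp_add, ← Complex.exp_add, ← Complex.exp_add, ← Complex.exp_add, frequency]
    congr 1
    have hHg' : (h : ℂ) = bigH h k * Nat.gcd k 6 / 6 := by rw [hHg]; field_simp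
    rw [hHg', ← hKg]
    push_cast
    field_simp
    ring
  have h8 : I ^ (1 / 2 : ℂ) ≠ 0 := cpow_half_ne_zero I_ne_zero
  have h8' := cpow_half_sq I_ne_zero
  have h9 := sqrt_bigK_mul_sqrt_gcd k
  have h10 := sqrt_natCast_ne_zero (bigK_pos hk)
  have h11 := sqrt_natCast_ne_zero (gcd_six_pos k)
  have h12 := etaMultiplierAt_ne_zero (bigK_pos hk) (gcd_bigH_bigK (h := h) (k := k) hhk)
  have h13 := sqrt_natCast_sq k
  have h14 := sqrt_natCast_ne_zero hk
  have h15 : (Real.sqrt 6 : ℂ) ≠ 0 := by exact_mod_cast (Real.sqrt_pos.mpr (by norm_num : (0 : ℝ) < 6)).ne'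
  have h16 : Z ^ (1 / 2 : ℂ) ≠ 0 := cpow_half_ne_zero hZ
  rw [cuspConst, fourierCoefficient, hN, chiHK, cpow_half_natCast (bigK_pos hk), h4]
  generalize cexp (Real.pi * I / (6 * k) * ((k : ℂ) - h - negInv h k - Nat.gcd k 6)) = E5 at *
  generalize cexp (Real.pi * I * (((μ : ℂ) - ν) / (3 * bigK k)
            + (negInv (bigH h k) (bigK k) : ℂ) / bigK k * ((ν : ℂ) - μ + 1 / 2) ^ 2)) = E6 at *
  generalize etaMultiplierAt (bigH h k) (bigK k) = x1 at *
  generalize etaMultiplierAt h k = x2 at *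
  generalize cexp (-(Real.pi * I * negInv h k / (6 * k))) = E1 at *
  generalize cexp (Real.pi * I * (negInv (bigH h k) (bigK k) / bigK k) * (((ν - μ : ℤ) : ℂ) + 1 / 2) ^ 2) = E2 at *
  generalize cexp (Real.pi * I * bigH h k / (36 * bigK k)) = E3 at *
  generalize cexp (-(Real.pi * I * frequency h k (ν - μ) / 3)) = E4 at *
  generalize (-1 : ℂ) ^ ((ν : ℤ) + μ) = sg
  generalize I ^ (1 / 2 : ℂ) = ih at *
  generalize Z ^ (1 / 2 : ℂ) = zh at *
  generalize (Real.sqrt 6 : ℂ) = w6 at *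
  generalize (Real.sqrt (bigK k) : ℂ) = w1 at *
  generalize (Real.sqrt (Nat.gcd k 6) : ℂ) = w2 at *
  generalize (Real.sqrt k : ℂ) = w at *
  have h17 : I * x2 ^ 2 * E1 * (I * k / Real.pi) / (w6 * w * zh) * (-I / (x1 ^ 3 * ih * w1) * (sg * E2) * E3 * E4)
      * (Real.pi / (6 * k)) = (E1 * E2 * E3 * E4) * (I * x2 ^ 2 * (I * k / Real.pi) / (w6 * w * zh) * (-I / (x1 ^ 3 * ih * w1) * sg)
      * (Real.pi / (6 * k))) := by ring
  rw [h17, h5, ← h13, ← h9]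
  field_simp
  linear_combination -(E5 * E6 * x2 ^ 2 * sg) * (I * I_sq + h8')

/-- Coefficients and cotangent terms are periodic in the index with period 6K, so the centred sum
equals the sum over 0 ≤ ν < 6K. -/
lemma sum_cot {l k : ℕ} (hl : Even l) {Z : ℂ} (hr : CuspRange k Z) {h μ : ℤ} {ϱ : ℕ} (hhk : Int.gcd h k = 1)
    (hh : h = (Nat.gcd k 6 : ℤ) * μ + ϱ) :
    cuspConst h k Z * ∑ i ∈ Finset.range (6 * bigK k), fourierCoefficient h k (i - μ - 3 * bigK k)
        * (Real.pi / (6 * k) * (2 * Real.pi * I) ^ l * cotSum l k Z (latticePoint h k (i - μ - 3 * bigK k)))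
      = cotPart l k h μ ϱ Z := by
  have hKg : (bigK k : ℤ) * Nat.gcd k 6 = k := by exact_mod_cast bigK_mul_gcd k
  have hper : ∀ s : ℤ, fourierCoefficient h k (s + (6 * bigK k : ℕ) - μ) * (Real.pi / (6 * k) * (2 * Real.pi * I) ^ l
      * cotSum l k Z (latticePoint h k (s + (6 * bigK k : ℕ) - μ)))
      = fourierCoefficient h k (s - μ) * (Real.pi / (6 * k) * (2 * Real.pi * I) ^ l * cotSum l k Z (latticePoint h k (s - μ))) := by
    intro s
    have e1 := fourierCoefficient_sub hr.pos hhk (s + (6 * bigK k : ℕ) - μ)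
    have e2 := fourierCoefficient_sub hr.pos hhk (s + (6 * bigK k : ℕ) - μ - 3 * bigK k)
    rw [show s + (6 * bigK k : ℕ) - μ - 3 * bigK k - 3 * bigK k = s - μ by push_cast; ring] at e2
    rw [← e1, ← e2, show s + (6 * bigK k : ℕ) - μ = s - μ + 6 * bigK k by push_cast; ring, latticePoint_add,
      show latticePoint h k (s - μ) + Nat.gcd k 6 * (6 * bigK k) = latticePoint h k (s - μ) + 6 * k by linear_combination 6 * hKg,
      cotSum_add hr.pos]
  have hsum := sum_range_int_periodic (F := fun s => fourierCoefficient h k (s - μ) * (Real.pi / (6 * k) * (2 * Real.pi * I) ^ l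
      * cotSum l k Z (latticePoint h k (s - μ)))) hper (3 * bigK k)
  simp only [sub_right_comm] at hsum ⊢
  rw [hsum, cotPart, Finset.mul_sum, Finset.mul_sum]
  refine Finset.sum_congr rfl fun ν _ => ?_
  rw [cotSum_eq hl hr.pos hr.ne_zero hh]
  have := cuspConst_mul_fourierCoefficient_cot hr hhk μ ν
  linear_combination ((2 * Real.pi * I) ^ l * cotSum l k Z (latticePoint h k (ν - μ))) * this

/-! ### Assembly. -/

lemma CuspRange.iteratedDeriv_mainFun {l k : ℕ} (hl : Even l) {Z : ℂ} (hr : CuspRange k Z) {h μ : ℤ} {ϱ : ℕ}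
    (hhk : Int.gcd h k = 1) (hh : h = (Nat.gcd k 6 : ℤ) * μ + ϱ) (hϱ : ϱ < Nat.gcd k 6) :
    iteratedDeriv l (mainFun h k μ Z) 0 = cotPart l k h μ ϱ Z + erfPart l k h ϱ Z := by
  have hb : Metric.ball (0 : ℂ) (‖Z‖ / 100) ∈ nhds 0 := Metric.ball_mem_nhds _ (div_pos hr.norm_pos (by norm_num))
  have hp : ∀ i ∈ Finset.range (6 * bigK k), 2 * |latticePoint h k (i - μ - 3 * bigK k)| ≤ 7 * k := fun i hi =>
    abs_latticePoint_le hr.pos hh hϱ (Finset.mem_range.mp hi)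
  have h1 : mainFun h k μ Z = fun z => cuspConst h k Z * ∑ i ∈ Finset.range (6 * bigK k),
      fourierCoefficient h k (i - μ - 3 * bigK k) * (cuspGauss 1 k Z z
        * nearKernel (cuspBeta k Z) k (latticePoint h k (i - μ - 3 * bigK k)) (3 * k * z)) := by
    ext z
    rw [mainFun, cuspFactor_eq_cuspGauss, Finset.mul_sum]
    congr 1
    exact Finset.sum_congr rfl fun i _ => by ring
  rw [h1, iteratedDeriv_const_mul_field, iteratedDeriv_fun_sum fun i hi => contDiffAt_const.mul
    ((analyticAt_cuspGauss 1 k Z).fun_mul ((hr.differentiableOn_nearKernel (hp i hi)).analyticAt hb)).contDiffAt,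
    ← sum_cot hl hr hhk hh, ← sum_pole hr hhk hh hϱ hl, ← mul_add, ← Finset.sum_add_distrib]
  congr 1
  refine Finset.sum_congr rfl fun i hi => ?_
  rw [iteratedDeriv_const_mul_field, hr.iteratedDeriv_cuspGauss_mul_nearKernel (hp i hi) hl]
  ring

theorem theorem5p2 (l : ℕ) (hl : Even l) (A : ℝ) (hA : 0 < A) :
    ∃ B : ℝ, ∀ (k : ℕ) (h μ : ℤ) (ϱ : ℕ) (Z : ℂ),
      0 < k → Int.gcd h k = 1 →
      h = (Nat.gcd k 6 : ℤ) * μ + ϱ → ϱ < Nat.gcd k 6 →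
      (k : ℝ) / 2 ≤ (1 / Z).re → ‖Z‖ ≤ A / k →
      ‖iteratedDeriv l (fun z : ℂ => calV1 z ((h : ℂ) / k + I * Z / k)) 0
          - (cotPart l k h μ ϱ Z + erfPart l k h ϱ Z)‖
        ≤ B * (Real.log ((k : ℝ) + 1) * ‖Z‖ ^ ((1 / 2 : ℝ) - (l : ℝ))) := by
  obtain ⟨B, hB⟩ := exists_norm_iteratedDeriv_sub_le l
  refine ⟨B, fun k h μ ϱ Z hk hhk hh hϱ hZ _ => ?_⟩
  have hr : CuspRange k Z := ⟨hk, hZ⟩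
  rw [← hr.iteratedDeriv_mainFun hl hhk hh hϱ]
  exact hB k h μ ϱ Z hr hhk hh hϱ
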